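/- **Definitions.** Let $N\ge 0$ be an integer and let $q,c_0,c_1,c_2,c_3,c_4$ be nonzero complex numbers with $q^{2N+3}c_0c_1c_2c_3c_4=1$. Half-integer powers are taken coherently: fix square roots $q^{1/2}$ and $c_k^{1/2}$ with $(q^{1/2})^{2N+3}c_0^{1/2}c_1^{1/2}c_2^{1/2}c_3^{1/2}c_4^{1/2}=1$ (for positive parameters, the positive roots) and compute every half-integer power of a product or quotient of $q$ and the $c_k$ from them. Write $(a;q)_n=\prod_{l=0}^{n-1}(1-aq^l)$. Put $$\omega_n(c)=(-1)^nc^{n/2}q^{\binom{n+1}{2}},\qquad \xi_n(c,d)=\frac{(qc;q)_n}{(qd;q)_n}\Big(\frac dc\Big)^{n/2}.$$ For $0\le n,x\le L$ let $$\mathfrak p_n(x;a,b,c;L)=\Omega(n;a,b,c;L)\sum_{k=0}^{n}\frac{(q^{-n};q)_k(bcq^{n+1};q)_k(q^{-x};q)_k(abq^{x+1};q)_k}{(qb;q)_k(abcq^{L+2};q)_k(q^{-L};q)_k(q;q)_k}\,q^k,$$ $$\Omega(n;a,b,c;L)=\frac{(q;q)_L}{(q;q)_n(q;q)_{L-n}}\,\frac{(1-bcq^{2n+1})(qb;q)_n(abcq^{L+2};q)_n(qa;q)_{L-n}}{(qb)^{n-L/2}(bcq^{n+1};q)_{L+1}(qc;q)_n},$$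 where $1-bcq^{2n+1}$ is cancelled against the equal factor of $(bcq^{n+1};q)_{L+1}$; and let $\mathfrak p_n(x;a,b,c;L)=0$ if $n>L$ or $x>L$. For nonnegative integers $i,j,x,y$ with $i+j\le N$, the Griffiths polynomial of $q$-Racah type is $$\mathcal G_{i,j}(x,y;c_1,c_2,c_3,c_4;N)=\sum_{a=0}^{\min(N-j,N-y)}\omega_a\Big(\frac{c_1c_2c_3}{c_4}\Big)\,\mathfrak p_i(a;c_1,c_2,c_3;N-j)\,\mathfrak p_j(y;c_3,c_0,c_4;N-a)\,\mathfrak p_a(x;c_4,c_2,c_1;N-y),$$ with $c_0$ determined by $q^{2N+3}c_0c_1c_2c_3c_4=1$ (and its square root by the corresponding relation between the square roots). It vanishes when $x+y>N$. The notation $|_{q\to q^{-1}}$ means that $q$ (and $q^{1/2}$) is replaced by its inverse in all these definitions, the square root of $c_k^{-1}$ being $1/c_k^{1/2}$. **Standing constraints** on the parameters of $\mathcal G_{i,j}(x,y;c_1,c_2,c_3,c_4;N)$: $q^m\ne1$ for $1\le m\le N$; none of $c_1c_2,\ c_2c_3,\ c_0c_3,\ c_0c_4,\ c_2c_4,\ qc_1c_2c_3,\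 qc_0c_3c_4,\ qc_1c_2c_4$ lies in $\{q^{-2},\dots,q^{-2N}\}$; none of $c_0,\dots,c_4$ lies in $\{q^{-1},\dots,q^{-N}\}$. **Statement.** Suppose these constraints hold. Let $i,j,x,y$ be nonnegative integers with $i+j\le N$. (1) If the parameters of the Griffiths polynomial on the right-hand side satisfy the constraints too (that is, if moreover $c_1c_3\notin\{q^{-2},\dots,q^{-2N}\}$), then $$\mathcal G_{i,j}(x,y;c_1,c_2,c_3,c_4;N)=\Big(\frac{c_0}{c_1}\Big)^{\frac i2}\Big(\frac{c_3}{c_1}\Big)^{\frac j2}\Big(\frac{c_1}{c_0}\Big)^{\frac x2}\Big(\frac{c_1}{c_4}\Big)^{\frac y2}\frac{\xi_i(c_2,c_3)\xi_j(c_0,c_4)}{\xi_x(c_2,c_4)\xi_y(c_0,c_3)}\,\frac{\omega_j(c_0c_2c_4/c_1)}{\omega_i(c_3c_0c_2/c_1)}\,\omega_N(qc_1c_2c_3)\;\mathcal G_{i,j}(y,x;c_1^{-1},c_3^{-1},c_2^{-1},c_0^{-1};N)\Big|_{q\to q^{-1}}.$$ (2) If the parameters of the Griffiths polynomial on the right-hand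 side satisfy the constraints too (that is, if moreover $c_1c_4\notin\{q^{-2},\dots,q^{-2N}\}$), then $$\mathcal G_{i,j}(x,y;c_1,c_2,c_3,c_4;N)=\Big(\frac{c_0}{c_1}\Big)^{\frac i2}\Big(\frac{c_3}{c_1}\Big)^{\frac j2}\Big(\frac{c_1}{c_0}\Big)^{\frac x2}\Big(\frac{c_1}{c_4}\Big)^{\frac y2}\frac{\xi_i(c_2,c_3)\xi_j(c_0,c_4)}{\xi_x(c_2,c_4)\xi_y(c_0,c_3)}\,\frac{\omega_y(c_1c_3c_0/c_2)}{\omega_x(c_2c_4c_1/c_0)}\,\omega_N(qc_1c_2c_4)\;\mathcal G_{j,i}(x,y;c_1^{-1},c_4^{-1},c_0^{-1},c_2^{-1};N)\Big|_{q\to q^{-1}}.$$ (When $x+y>N$ the Griffiths polynomials on both sides vanish and the relations are read as $0=0$.) -/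

import Mathlib

open scoped BigOperators

/-! Half-integer powers. All functions below take, instead of the base `q` and the parameters
`cᵢ`, square roots of them: `r` stands for `q^{1/2}` and `sᵢ` for `cᵢ^{1/2}`, so `q = r ^ 2` and
`cᵢ = sᵢ ^ 2`. In this way `cᵢ^{n/2}` means `sᵢ ^ n`, coherently in all formulas. The replacement
`q → q⁻¹`, `cᵢ → cᵢ⁻¹` is then `r → r⁻¹`, `sᵢ → sᵢ⁻¹`. -/

noncomputable section

namespace QRacah

/-- The `q`-Pochhammer symbol `(a;q)_n = ∏_{l<n} (1 - a q^l)`. -/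
def qPoch (a q : ℂ) (n : ℕ) : ℂ := ∏ l ∈ Finset.range n, (1 - a * q ^ l)

/-- The `q`-binomial coefficient, which vanishes for `n > N`. -/
def qBinom (q : ℂ) (N n : ℕ) : ℂ :=
  if n ≤ N then qPoch q q N / (qPoch q q n * qPoch q q (N - n)) else 0

/-- The terminating series `₄φ₃(q^{-n}, a₂, a₃, a₄; b₁, b₂, b₃; q; z)`, a sum over `0 ≤ k ≤ n`. -/
def phi43 (n : ℕ) (a₂ a₃ a₄ b₁ b₂ b₃ q z : ℂ) : ℂ :=
  ∑ k ∈ Finset.range (n + 1),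
    (qPoch (q ^ (-(n : ℤ))) q k * qPoch a₂ q k * qPoch a₃ q k * qPoch a₄ q k) /
      (qPoch b₁ q k * qPoch b₂ q k * qPoch b₃ q k) * (z ^ k / qPoch q q k)

/-- For `n ≤ N`, the quotient `(c q^{n+1};q)_{N+1} / (1 - c q^{2n+1})`, where the denominator is
one of the factors of the numerator and has been cancelled. -/
def qPochOmit (c q : ℂ) (N n : ℕ) : ℂ :=
  ∏ l ∈ (Finset.range (N + 1)).erase n, (1 - c * q ^ (n + 1 + l))

/-- The normalization `Ω(n;c₁,c₂,c₃;N)`, with `cᵢ = sᵢ ^ 2` and `q = r ^ 2`: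
`[N, n]_q (1 - c₂c₃q^{2n+1}) (qc₂;q)_n (c₁c₂c₃q^{N+2};q)_n (qc₁;q)_{N-n}`
`/ ((qc₂)^{n-N/2} (c₂c₃q^{n+1};q)_{N+1} (qc₃;q)_n)`.
The factor `1 - c₂c₃q^{2n+1}` is cancelled against the same factor of the denominator (see
`Omega_eq`), which removes the apparent poles at `c₂c₃ = q^{-2n-1}`. -/
def Omega (r s₁ s₂ s₃ : ℂ) (N n : ℕ) : ℂ :=
  qBinom (r ^ 2) N n *
    (qPoch (r ^ 2 * s₂ ^ 2) (r ^ 2) n *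
      qPoch (s₁ ^ 2 * s₂ ^ 2 * s₃ ^ 2 * (r ^ 2) ^ (N + 2)) (r ^ 2) n *
      qPoch (r ^ 2 * s₁ ^ 2) (r ^ 2) (N - n)) /
    ((r * s₂) ^ (2 * (n : ℤ) - (N : ℤ)) * qPochOmit (s₂ ^ 2 * s₃ ^ 2) (r ^ 2) N n *
      qPoch (r ^ 2 * s₃ ^ 2) (r ^ 2) n)

theorem qPoch_eq_mul_qPochOmit (c q : ℂ) {N n : ℕ} (h : n ≤ N) :
    qPoch (c * q ^ (n + 1)) q (N + 1) = (1 - c * q ^ (2 * n + 1)) * qPochOmit c q N n := by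
  unfold qPoch qPochOmit
  have h1 : ∀ l, 1 - c * q ^ (n + 1) * q ^ l = 1 - c * q ^ (n + 1 + l) := by
    intro l; ring
  simp_rw [h1]
  rw [← Finset.mul_prod_erase (Finset.range (N + 1)) _
    (Finset.mem_range.mpr (Nat.lt_succ_of_le h))]
  congr 3
  ring

theorem Omega_eq (r s₁ s₂ s₃ : ℂ) {N n : ℕ} (h : n ≤ N)
    (hne : 1 - s₂ ^ 2 * s₃ ^ 2 * (r ^ 2) ^ (2 * n + 1) ≠ 0) :
    Omega r s₁ s₂ s₃ N n =
      qBinom (r ^ 2) N n *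
        ((1 - s₂ ^ 2 * s₃ ^ 2 * (r ^ 2) ^ (2 * n + 1)) * qPoch (r ^ 2 * s₂ ^ 2) (r ^ 2) n *
          qPoch (s₁ ^ 2 * s₂ ^ 2 * s₃ ^ 2 * (r ^ 2) ^ (N + 2)) (r ^ 2) n *
          qPoch (r ^ 2 * s₁ ^ 2) (r ^ 2) (N - n)) /
        ((r * s₂) ^ (2 * (n : ℤ) - (N : ℤ)) *
          qPoch (s₂ ^ 2 * s₃ ^ 2 * (r ^ 2) ^ (n + 1)) (r ^ 2) (N + 1) *
          qPoch (r ^ 2 * s₃ ^ 2) (r ^ 2) n) := by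
  rw [qPoch_eq_mul_qPochOmit _ _ h]
  unfold Omega
  rw [← mul_div_mul_left _ _ hne]
  congr 1 <;> ring

/-- The normalized `q`-Racah polynomial `p_n(x;c₁,c₂,c₃;N)`, with the convention that it vanishes
for `n > N` or `x > N`. -/
def racah (r s₁ s₂ s₃ : ℂ) (N n x : ℕ) : ℂ :=
  if n ≤ N ∧ x ≤ N then
    Omega r s₁ s₂ s₃ N n *
      phi43 n (s₂ ^ 2 * s₃ ^ 2 * (r ^ 2) ^ (n + 1)) ((r ^ 2) ^ (-(x : ℤ)))
        (s₁ ^ 2 * s₂ ^ 2 * (r ^ 2) ^ (x + 1))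
        (r ^ 2 * s₂ ^ 2) (s₁ ^ 2 * s₂ ^ 2 * s₃ ^ 2 * (r ^ 2) ^ (N + 2)) ((r ^ 2) ^ (-(N : ℤ)))
        (r ^ 2) (r ^ 2)
  else 0

/-- `ξ_n(c,d) = (qc;q)_n / (qd;q)_n (d/c)^{n/2}` for `c = s ^ 2`, `d = t ^ 2`, `q = r ^ 2`. -/
def xi (r s t : ℂ) (n : ℕ) : ℂ :=
  qPoch (r ^ 2 * s ^ 2) (r ^ 2) n / qPoch (r ^ 2 * t ^ 2) (r ^ 2) n * (t / s) ^ n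

/-- `ω_n(c) = (-1)^n c^{n/2} q^{n(n+1)/2}` for `c = t ^ 2`, `q = r ^ 2`. -/
def omega (r t : ℂ) (n : ℕ) : ℂ := (-1) ^ n * t ^ n * (r ^ 2) ^ ((n + 1).choose 2)

/-- The square root of `c₀` determined by `r^{2N+3} s₀ s₁ s₂ s₃ s₄ = 1`; it squares to the
solution `c₀` of `q^{2N+3} c₀ c₁ c₂ c₃ c₄ = 1`. -/
def rootC0 (r s₁ s₂ s₃ s₄ : ℂ) (N : ℕ) : ℂ := (r ^ (2 * N + 3) * (s₁ * s₂ * s₃ * s₄))⁻¹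

/-- The Griffiths polynomial of `q`-Racah type `G_{i,j}(x,y;c₁,c₂,c₃,c₄;N)`, `i + j ≤ N`:
the sum over `0 ≤ a ≤ min (N - j) (N - y)` of
`ω_a(c₁c₂c₃/c₄) p_i(a;c₁,c₂,c₃;N-j) p_j(y;c₃,c₀,c₄;N-a) p_a(x;c₄,c₂,c₁;N-y)`.
If `y > N`, the sum has the single term `a = 0`, which vanishes by the convention of `racah`. -/
def griffiths (r s₁ s₂ s₃ s₄ : ℂ) (N i j x y : ℕ) : ℂ :=
  ∑ a ∈ Finset.range (min (N - j) (N - y) + 1),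
    omega r (s₁ * s₂ * s₃ / s₄) a *
      racah r s₁ s₂ s₃ (N - j) i a *
      racah r s₃ (rootC0 r s₁ s₂ s₃ s₄ N) s₄ (N - a) j y *
      racah r s₄ s₂ s₁ (N - y) a x

/-- `c ∉ {q^{-1}, …, q^{-N}}`. -/
def AvoidsOne (q : ℂ) (N : ℕ) (c : ℂ) : Prop :=
  ∀ m : ℕ, 1 ≤ m → m ≤ N → c ≠ q ^ (-(m : ℤ))

/-- `c ∉ {q^{-2}, q^{-3}, …, q^{-2N}}`. -/
def AvoidsTwo (q : ℂ) (N : ℕ) (c : ℂ) : Prop :=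
  ∀ m : ℕ, 2 ≤ m → m ≤ 2 * N → c ≠ q ^ (-(m : ℤ))

/-- The constraints imposed on the parameters of a Griffiths polynomial
`G_{i,j}(x,y;c₁,c₂,c₃,c₄;N)` with base `q`, where `c₀` is tied to the other parameters by
`q^{2N+3} c₀ c₁ c₂ c₃ c₄ = 1`. -/
structure Admissible (q c₀ c₁ c₂ c₃ c₄ : ℂ) (N : ℕ) : Prop where
  constraint : q ^ (2 * N + 3) * (c₀ * c₁ * c₂ * c₃ * c₄) = 1
  q_ne : q ≠ 0
  c_ne : c₀ ≠ 0 ∧ c₁ ≠ 0 ∧ c₂ ≠ 0 ∧ c₃ ≠ 0 ∧ c₄ ≠ 0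
  q_pow : ∀ m : ℕ, 1 ≤ m → m ≤ N → q ^ m ≠ 1
  pairs : AvoidsTwo q N (c₁ * c₂) ∧ AvoidsTwo q N (c₂ * c₃) ∧ AvoidsTwo q N (c₀ * c₃) ∧
    AvoidsTwo q N (c₀ * c₄) ∧ AvoidsTwo q N (c₂ * c₄)
  triples : AvoidsTwo q N (q * (c₁ * c₂ * c₃)) ∧ AvoidsTwo q N (q * (c₀ * c₃ * c₄)) ∧
    AvoidsTwo q N (q * (c₁ * c₂ * c₄))
  singles : AvoidsOne q N c₀ ∧ AvoidsOne q N c₁ ∧ AvoidsOne q N c₂ ∧ AvoidsOne q N c₃ ∧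
    AvoidsOne q N c₄

end QRacah

end

open scoped BigOperators
noncomputable section
namespace QRacah

theorem qPoch_zero (a q : ℂ) : qPoch a q 0 = 1 := by simp [qPoch]

theorem qPoch_succ (a q : ℂ) (k : ℕ) : qPoch a q (k + 1) = qPoch a q k * (1 - a * q ^ k) := by
  simp [qPoch, Finset.prod_range_succ]

theorem qPoch_succ' (a q : ℂ) (k : ℕ) : qPoch a q (k + 1) = (1 - a) * qPoch (q * a) q k := by
  unfold qPoch
  rw [Finset.prod_range_succ', mul_comm]
  congr 1
  · simp
  · exact Finset.prod_congr rfl fun l _ => by ring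

theorem qPoch_shift (a q : ℂ) (k : ℕ) :
    qPoch a q k * (1 - a * q ^ k) = (1 - a) * qPoch (q * a) q k := by
  rw [← qPoch_succ, qPoch_succ']

theorem qPoch_inv_pow_eq_zero {q : ℂ} (hq : q ≠ 0) {n k : ℕ} (h : n < k) :
    qPoch (q ^ n)⁻¹ q k = 0 := by
  unfold qPoch
  refine Finset.prod_eq_zero (Finset.mem_range.mpr h) ?_
  rw [inv_mul_cancel₀ (pow_ne_zero n hq), sub_self]

theorem qPoch_ne_zero_of_le {a q : ℂ} {k n : ℕ} (h : qPoch a q n ≠ 0) (hk : k ≤ n) :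
    qPoch a q k ≠ 0 := by
  unfold qPoch at *
  rw [Finset.prod_ne_zero_iff] at *
  intro l hl
  exact h l (Finset.mem_range.mpr (lt_of_lt_of_le (Finset.mem_range.mp hl) hk))

theorem one_sub_ne_zero_of_qPoch {a q : ℂ} {k n : ℕ} (h : qPoch a q n ≠ 0) (hk : k < n) :
    1 - a * q ^ k ≠ 0 := by
  unfold qPoch at h
  rw [Finset.prod_ne_zero_iff] at h
  exact h k (Finset.mem_range.mpr hk)

/-- The `k`-th term of the balanced series `hyp`. -/
def hypTerm (q lam mu b₁ b₂ b₃ : ℂ) (n x k : ℕ) : ℂ :=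
  qPoch (q ^ n)⁻¹ q k * qPoch (lam * q ^ n) q k * qPoch (q ^ x)⁻¹ q k * qPoch (mu * q ^ x) q k /
    (qPoch b₁ q k * qPoch b₂ q k * qPoch b₃ q k * qPoch q q k) * q ^ k

/-- The series `₄φ₃(q^{-n}, lam q^n, q^{-x}, mu q^x; b₁, b₂, b₃; q; q)`. -/
def hyp (q lam mu b₁ b₂ b₃ : ℂ) (n x : ℕ) : ℂ :=
  ∑ k ∈ Finset.range (n + 1), hypTerm q lam mu b₁ b₂ b₃ n x k

theorem hyp_eq_sum {q lam mu b₁ b₂ b₃ : ℂ} (hq : q ≠ 0) {n x M : ℕ} (h : n < M ∨ x < M) :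
    hyp q lam mu b₁ b₂ b₃ n x = ∑ k ∈ Finset.range M, hypTerm q lam mu b₁ b₂ b₃ n x k := by
  have key : ∀ M, (n < M ∨ x < M) → ∑ k ∈ Finset.range M, hypTerm q lam mu b₁ b₂ b₃ n x k =
      ∑ k ∈ Finset.range (min n x + 1), hypTerm q lam mu b₁ b₂ b₃ n x k := by
    intro M hM
    symm
    refine Finset.sum_subset (Finset.range_subset_range.mpr (by omega)) fun k _ hk => ?_
    have hk' : n < k ∨ x < k := by
      simp only [Finset.mem_range] at hk; omega
    rcases hk' with hk' | hk' <;> simp [hypTerm, qPoch_inv_pow_eq_zero hq hk']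
  rw [key M h, hyp, key (n + 1) (by omega)]

theorem hyp_comm {q : ℂ} (hq : q ≠ 0) (lam mu b₁ b₂ b₃ : ℂ) (n x : ℕ) :
    hyp q lam mu b₁ b₂ b₃ n x = hyp q mu lam b₁ b₂ b₃ x n := by
  rw [hyp_eq_sum hq (M := x + 1) (by omega), hyp]
  refine Finset.sum_congr rfl fun k _ => ?_
  unfold hypTerm; ring

theorem hyp_swap₁₂ (q lam mu b₁ b₂ b₃ : ℂ) (n x : ℕ) :
    hyp q lam mu b₁ b₂ b₃ n x = hyp q lam mu b₂ b₁ b₃ n x :=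
  Finset.sum_congr rfl fun k _ => by unfold hypTerm; ring

theorem hyp_swap₁₃ (q lam mu b₁ b₂ b₃ : ℂ) (n x : ℕ) :
    hyp q lam mu b₁ b₂ b₃ n x = hyp q lam mu b₃ b₂ b₁ n x :=
  Finset.sum_congr rfl fun k _ => by unfold hypTerm; ring

theorem hyp_zero_left (q lam mu b₁ b₂ b₃ : ℂ) (x : ℕ) : hyp q lam mu b₁ b₂ b₃ 0 x = 1 := by
  simp [hyp, hypTerm, qPoch_zero]

theorem hyp_zero_right {q : ℂ} (hq : q ≠ 0) (lam mu b₁ b₂ b₃ : ℂ) (n : ℕ) :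
    hyp q lam mu b₁ b₂ b₃ n 0 = 1 := by
  rw [hyp_comm hq, hyp_zero_left]

theorem qPoch_inv_pow_pred {q : ℂ} (hq : q ≠ 0) (x k : ℕ) :
    (1 - (q ^ x)⁻¹) * qPoch (q ^ (x - 1))⁻¹ q k = qPoch (q ^ x)⁻¹ q (k + 1) := by
  rcases x with _ | x
  · simp [qPoch_succ']
  · rw [qPoch_succ', show q * (q ^ (x + 1))⁻¹ = (q ^ x)⁻¹ by field_simp; ring]
    rfl

theorem qPoch_mul_pow_succ (q c : ℂ) (x k : ℕ) :
    (1 - c * q ^ x) * qPoch (q * c * q ^ x) q k = qPoch (c * q ^ x) q (k + 1) := by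
  rw [qPoch_succ']; congr 2; ring

theorem mu_pred {q : ℂ} (mu : ℂ) {x : ℕ} (hx : x ≠ 0) :
    q * mu * q ^ (x - 1) = mu * q ^ x := by
  obtain ⟨y, rfl⟩ := Nat.exists_eq_succ_of_ne_zero hx
  simp; ring

theorem hyp_shift_term {b mu X Q A Y Z Y' Z' Z'' B B' C W : ℂ} (hX : X ≠ 0) (n0 : 1 - b ≠ 0)
    (nB : B ≠ 0) (n2 : 1 - b * Q ≠ 0) (e1 : B * (1 - b * Q) = (1 - b) * B')
    (e2 : (1 - mu * X) * Z' = Z * (1 - mu * X * Q)) (e3 : (1 - X⁻¹) * Y' = Y * (1 - X⁻¹ * Q))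
    (e4 : (X - 1) * Z'' = (X - 1) * Z) :
    (1 - b) * (1 - mu * X ^ 2) * (A * Y * Z / (B * C) * W) =
      (1 - b * X) * (1 - mu * X) * (A * Y * Z' / (B' * C) * W) +
        (b - mu * X) * (X - 1) * (A * Y' * Z'' / (B' * C) * W) := by
  have e1' : B' = B * (1 - b * Q) / (1 - b) := by rw [e1]; field_simp
  have e5 : (X - 1) * (Y' * Z'') = (X - Q) * (Y * Z) := by
    have : (X - 1) * Y' = Y * (X - Q) := by
      have : (X - 1) * Y' = X * ((1 - X⁻¹) * Y') := by field_simp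
      rw [this, e3]; field_simp
    linear_combination Y' * e4 + Z * this
  have e6 : (1 - b * X) * (1 - mu * X) * (A * Y * Z' / (B' * C) * W) +
        (b - mu * X) * (X - 1) * (A * Y' * Z'' / (B' * C) * W) =
      ((1 - b * X) * (Y * ((1 - mu * X) * Z')) + (b - mu * X) * ((X - 1) * (Y' * Z''))) *
        (A / (B' * C) * W) := by ring
  rw [e6, e2, e5, e1']
  field_simp
  ring

/-- Shift of `mu` and of one lower parameter. -/
theorem hyp_shift {q : ℂ} (hq : q ≠ 0) (lam mu : ℂ) {b₁ : ℂ} (b₂ b₃ : ℂ) (n x : ℕ)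
    (hb : qPoch b₁ q (n + 1) ≠ 0) :
    (1 - b₁) * (1 - mu * (q ^ x) ^ 2) * hyp q lam mu b₁ b₂ b₃ n x =
      (1 - b₁ * q ^ x) * (1 - mu * q ^ x) * hyp q lam (q * mu) (q * b₁) b₂ b₃ n x +
        (b₁ - mu * q ^ x) * (q ^ x - 1) * hyp q lam (q * mu) (q * b₁) b₂ b₃ n (x - 1) := by
  unfold hyp
  simp only [Finset.mul_sum]
  rw [← Finset.sum_add_distrib]
  refine Finset.sum_congr rfl fun k hk => ?_
  have hk' : k ≤ n := Nat.lt_succ_iff.mp (Finset.mem_range.mp hk)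
  have e2 := qPoch_mul_pow_succ q mu x k
  have e3 := qPoch_inv_pow_pred hq x k
  rw [qPoch_succ] at e2 e3
  have e4 : (q ^ x - 1) * qPoch (q * mu * q ^ (x - 1)) q k =
      (q ^ x - 1) * qPoch (mu * q ^ x) q k := by
    rcases eq_or_ne x 0 with rfl | hx
    · simp
    · rw [mu_pred mu hx]
  have := hyp_shift_term (A := qPoch (q ^ n)⁻¹ q k * qPoch (lam * q ^ n) q k)
    (C := qPoch b₂ q k * qPoch b₃ q k * qPoch q q k) (W := q ^ k) (pow_ne_zero x hq)
    (by simpa using one_sub_ne_zero_of_qPoch hb (Nat.succ_pos n))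
    (qPoch_ne_zero_of_le hb (by omega)) (one_sub_ne_zero_of_qPoch hb (by omega))
    (qPoch_shift b₁ q k) e2 e3 e4
  unfold hypTerm
  simpa only [mul_assoc] using this

theorem qPoch_inv_pow_succ {q : ℂ} (hq : q ≠ 0) (n k : ℕ) :
    qPoch (q ^ (n + 1))⁻¹ q (k + 1) = (1 - (q ^ (n + 1))⁻¹) * qPoch (q ^ n)⁻¹ q k := by
  rw [← qPoch_inv_pow_pred hq]; rfl

/-- The forward shift in `n`. -/
theorem hyp_forward {q : ℂ} (hq : q ≠ 0) (lam mu : ℂ) {b₁ b₂ b₃ : ℂ} (n : ℕ) {x : ℕ} (hx : x ≠ 0)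
    (h₁ : 1 - b₁ ≠ 0) (h₂ : 1 - b₂ ≠ 0) (h₃ : 1 - b₃ ≠ 0) (hn : qPoch q q (n + 1) ≠ 0) :
    (1 - b₁) * (1 - b₂) * (1 - b₃) *
        (hyp q lam mu b₁ b₂ b₃ (n + 1) x - hyp q lam mu b₁ b₂ b₃ n x) =
      q * (lam * q ^ n - (q ^ (n + 1))⁻¹) * (1 - (q ^ x)⁻¹) * (1 - mu * q ^ x) *
        hyp q (q * lam) (q ^ 2 * mu) (q * b₁) (q * b₂) (q * b₃) n (x - 1) := by
  obtain ⟨x, rfl⟩ := Nat.exists_eq_succ_of_ne_zero hx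
  rw [hyp_eq_sum hq (n := n) (M := n + 1 + 1) (by omega), hyp, hyp, ← Finset.sum_sub_distrib,
    Finset.sum_range_succ']
  have h0 : hypTerm q lam mu b₁ b₂ b₃ (n + 1) (x + 1) 0 -
      hypTerm q lam mu b₁ b₂ b₃ n (x + 1) 0 = 0 := by simp [hypTerm, qPoch_zero]
  rw [Nat.succ_eq_add_one, h0, add_zero, Finset.mul_sum, Finset.mul_sum]
  refine Finset.sum_congr rfl fun k hk => ?_
  have hk' : k ≤ n := Nat.lt_succ_iff.mp (Finset.mem_range.mp hk)
  have hc : 1 - q * q ^ k ≠ 0 := one_sub_ne_zero_of_qPoch hn (by omega)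
  unfold hypTerm
  rw [qPoch_inv_pow_succ hq n k, qPoch_inv_pow_succ hq x k, qPoch_succ (lam * q ^ (n + 1)),
    qPoch_succ' (lam * q ^ n), qPoch_succ (q ^ n)⁻¹, qPoch_succ' (mu * _), qPoch_succ' b₁,
    qPoch_succ' b₂, qPoch_succ' b₃, qPoch_succ q, Nat.add_sub_cancel,
    show q * (lam * q ^ n) = lam * q ^ (n + 1) by ring,
    show q * lam * q ^ n = lam * q ^ (n + 1) by ring,
    show q ^ 2 * mu * q ^ x = q * (mu * q ^ (x + 1)) by ring]
  generalize qPoch (q ^ n)⁻¹ q k = U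
  generalize qPoch (lam * q ^ (n + 1)) q k = V
  generalize qPoch (q ^ x)⁻¹ q k = Y
  generalize qPoch (q * (mu * q ^ (x + 1))) q k = Z
  have hI : q ^ n ≠ 0 := pow_ne_zero _ hq
  have e : ∀ B₁ B₂ B₃ C : ℂ, (1 - b₁) * (1 - b₂) * (1 - b₃) *
      ((1 - (q ^ (n + 1))⁻¹) * U * (V * (1 - lam * q ^ (n + 1) * q ^ k)) *
          ((1 - (q ^ (x + 1))⁻¹) * Y) * ((1 - mu * q ^ (x + 1)) * Z) /
          ((1 - b₁) * B₁ * ((1 - b₂) * B₂) * ((1 - b₃) * B₃) * (C * (1 - q * q ^ k))) *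
          q ^ (k + 1) -
        U * (1 - (q ^ n)⁻¹ * q ^ k) * ((1 - lam * q ^ n) * V) *
          ((1 - (q ^ (x + 1))⁻¹) * Y) * ((1 - mu * q ^ (x + 1)) * Z) /
          ((1 - b₁) * B₁ * ((1 - b₂) * B₂) * ((1 - b₃) * B₃) * (C * (1 - q * q ^ k))) *
          q ^ (k + 1)) =
      ((1 - (q ^ (n + 1))⁻¹) * (1 - lam * q ^ (n + 1) * q ^ k) -
        (1 - (q ^ n)⁻¹ * q ^ k) * (1 - lam * q ^ n)) / (1 - q * q ^ k) *
        (U * V * ((1 - (q ^ (x + 1))⁻¹) * Y) * ((1 - mu * q ^ (x + 1)) * Z) /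
          (B₁ * B₂ * B₃ * C) * q ^ (k + 1)) := by
    intro B₁ B₂ B₃ C
    have a1 : (1 - b₁) * (1 - b₁)⁻¹ = 1 := mul_inv_cancel₀ h₁
    have a2 : (1 - b₂) * (1 - b₂)⁻¹ = 1 := mul_inv_cancel₀ h₂
    have a3 : (1 - b₃) * (1 - b₃)⁻¹ = 1 := mul_inv_cancel₀ h₃
    simp only [div_eq_mul_inv, mul_inv]
    generalize (1 - b₁)⁻¹ = i1 at *
    generalize (1 - b₂)⁻¹ = i2 at *
    generalize (1 - b₃)⁻¹ = i3 at *
    generalize 1 - b₁ = d1 at *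
    generalize 1 - b₂ = d2 at *
    generalize 1 - b₃ = d3 at *
    have a4 : d1 * d2 * d3 * (i1 * i2 * i3) = 1 := by
      calc _ = (d1 * i1) * (d2 * i2) * (d3 * i3) := by ring
        _ = 1 := by rw [a1, a2, a3]; ring
    linear_combination (((1 - (q ^ (n + 1))⁻¹) * (1 - lam * q ^ (n + 1) * q ^ k) -
        (1 - (q ^ n)⁻¹ * q ^ k) * (1 - lam * q ^ n)) * (1 - q * q ^ k)⁻¹ *
        (U * V * ((1 - (q ^ (x + 1))⁻¹) * Y) * ((1 - mu * q ^ (x + 1)) * Z) *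
          (B₁⁻¹ * B₂⁻¹ * B₃⁻¹ * C⁻¹) * q ^ (k + 1))) * a4
  rw [e]
  have e' : ((1 - (q ^ (n + 1))⁻¹) * (1 - lam * q ^ (n + 1) * q ^ k) -
        (1 - (q ^ n)⁻¹ * q ^ k) * (1 - lam * q ^ n)) / (1 - q * q ^ k) =
      lam * q ^ n - (q ^ (n + 1))⁻¹ := by
    rw [div_eq_iff hc]
    simp only [pow_succ]
    field_simp
    ring
  rw [e']
  ring

theorem hyp_backward_rat {q lam mu b₁ b₂ b₃ I X Q : ℂ} (hI : I ≠ 0) (hX : X ≠ 0)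
    (hbal : lam * mu * q = b₁ * b₂ * b₃) (h₁ : 1 - b₁ * Q ≠ 0)
    (h₂ : 1 - b₂ * Q ≠ 0) (h₃ : 1 - b₃ * Q ≠ 0) (hQ : 1 - Q ≠ 0) :
    mu * X * (1 - mu * X ^ 2) * ((1 - I⁻¹) * (1 - lam * I)) / (1 - Q) * Q -
      (mu * ((1 - b₁ * X) * (1 - b₂ * X) * (1 - b₃ * X)) * (1 - mu * X * Q) +
        X * ((b₁ - mu * X) * (b₂ - mu * X) * (b₃ - mu * X)) * (1 - X⁻¹ * Q)) *
        ((1 - I⁻¹ * Q) * (1 - lam * I * Q)) /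
        ((1 - b₁ * Q) * (1 - b₂ * Q) * (1 - b₃ * Q) * (1 - Q)) * Q =
      mu * X * (1 - mu * X ^ 2) * ((1 - lam * q * Q) *
        ((1 - I⁻¹ * Q) * (1 - lam * I * Q) * (1 - X⁻¹ * Q) * (1 - mu * X * Q)) /
        ((1 - b₁ * Q) * (1 - b₂ * Q) * (1 - b₃ * Q) * (1 - Q)) - (1 - lam * Q)) := by
  have key : mu * X * (1 - mu * X ^ 2) * ((I - 1) * (1 - lam * I)) * Q *
        ((1 - b₁ * Q) * (1 - b₂ * Q) * (1 - b₃ * Q)) -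
      (mu * ((1 - b₁ * X) * (1 - b₂ * X) * (1 - b₃ * X)) * (1 - mu * X * Q) +
        ((b₁ - mu * X) * (b₂ - mu * X) * (b₃ - mu * X)) * (X - Q)) *
        ((I - Q) * (1 - lam * I * Q)) * Q =
      mu * (1 - mu * X ^ 2) * ((1 - lam * q * Q) *
        ((I - Q) * (1 - lam * I * Q) * (X - Q) * (1 - mu * X * Q))) -
      I * X * mu * (1 - mu * X ^ 2) * ((1 - lam * Q) *
        ((1 - b₁ * Q) * (1 - b₂ * Q) * (1 - b₃ * Q) * (1 - Q))) := by
    linear_combination (-(mu * X * (1 - mu * X ^ 2) * (I - 1) * (1 - lam * I) * Q * (-Q ^ 3) -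
      (-(mu * X ^ 3) * (1 - mu * X * Q) + (X - Q)) * (I - Q) * (1 - lam * I * Q) * Q +
      I * X * mu * (1 - mu * X ^ 2) * (1 - lam * Q) * (1 - Q) * (-Q ^ 3))) * hbal
  have eI : 1 - I⁻¹ * Q = (I - Q) / I := by field_simp
  have eI' : 1 - I⁻¹ = (I - 1) / I := by field_simp
  have eX : 1 - X⁻¹ * Q = (X - Q) / X := by field_simp
  rw [eI, eI', eX]
  generalize 1 - b₁ * Q = d₁ at *
  generalize 1 - b₂ * Q = d₂ at *
  generalize 1 - b₃ * Q = d₃ at *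
  generalize 1 - lam * I * Q = d₄ at *
  generalize 1 - mu * X * Q = d₅ at *
  generalize 1 - mu * X ^ 2 = d₆ at *
  generalize 1 - lam * I = d₇ at *
  generalize (1 - b₁ * X) * (1 - b₂ * X) * (1 - b₃ * X) = d₈ at *
  generalize (b₁ - mu * X) * (b₂ - mu * X) * (b₃ - mu * X) = d₉ at *
  generalize 1 - lam * Q = d₁₀ at *
  generalize 1 - lam * q * Q = d₁₁ at *
  generalize I - Q = d₁₂ at *
  generalize X - Q = d₁₃ at *
  generalize I - 1 = d₁₄ at *
  generalize 1 - Q = d₁₅ at *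
  field_simp
  linear_combination key

theorem mul_pred_term {X Q Y Z Y' Z'' : ℂ} (hX : X ≠ 0)
    (e3 : (1 - X⁻¹) * Y' = Y * (1 - X⁻¹ * Q)) (e4 : (X - 1) * Z'' = (X - 1) * Z) :
    (X - 1) * (Y' * Z'') = (X - Q) * (Y * Z) := by
  have : (X - 1) * Y' = Y * (X - Q) := by
    have : (X - 1) * Y' = X * ((1 - X⁻¹) * Y') := by field_simp
    rw [this, e3]; field_simp
  linear_combination Y' * e4 + Z * this

theorem hyp_backward_step {q lam mu b₁ b₂ b₃ I X Q U V Y Z Y' Z' Z'' B₁ B₂ B₃ C : ℂ}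
    (hI : I ≠ 0) (hX : X ≠ 0) (hbal : lam * mu * q = b₁ * b₂ * b₃)
    (g₁ : 1 - b₁ ≠ 0) (g₂ : 1 - b₂ ≠ 0) (g₃ : 1 - b₃ ≠ 0) (h₁ : 1 - b₁ * Q ≠ 0)
    (h₂ : 1 - b₂ * Q ≠ 0) (h₃ : 1 - b₃ * Q ≠ 0) (hQ : 1 - Q ≠ 0)
    (e2 : (1 - mu * X) * Z' = Z * (1 - mu * X * Q))
    (e5 : (X - 1) * (Y' * Z'') = (X - Q) * (Y * Z)) :
    mu * (1 - b₁) * (1 - b₂) * (1 - b₃) * X * (1 - mu * X ^ 2) *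
      ((1 - I⁻¹) * U * ((1 - lam * I) * V) * Y * Z /
        ((1 - b₁) * B₁ * ((1 - b₂) * B₂) * ((1 - b₃) * B₃) * (C * (1 - Q))) * Q) -
      (mu * (1 - mu * X) * (1 - b₁ * X) * (1 - b₂ * X) * (1 - b₃ * X) *
        (U * (1 - I⁻¹ * Q) * (V * (1 - lam * I * Q)) * Y * Z' /
          (B₁ * (1 - b₁ * Q) * (B₂ * (1 - b₂ * Q)) * (B₃ * (1 - b₃ * Q)) * (C * (1 - Q))) * Q) -
      (1 - X) * (b₁ - mu * X) * (b₂ - mu * X) * (b₃ - mu * X) *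
        (U * (1 - I⁻¹ * Q) * (V * (1 - lam * I * Q)) * Y' * Z'' /
          (B₁ * (1 - b₁ * Q) * (B₂ * (1 - b₂ * Q)) * (B₃ * (1 - b₃ * Q)) * (C * (1 - Q))) * Q)) =
    mu * X * (1 - mu * X ^ 2) * (1 - lam * q * Q) *
      (U * (1 - I⁻¹ * Q) * (V * (1 - lam * I * Q)) * (Y * (1 - X⁻¹ * Q)) * (Z * (1 - mu * X * Q)) /
          (B₁ * (1 - b₁ * Q) * (B₂ * (1 - b₂ * Q)) * (B₃ * (1 - b₃ * Q)) * (C * (1 - Q)))) -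
    mu * X * (1 - mu * X ^ 2) * (1 - lam * Q) * (U * V * Y * Z / (B₁ * B₂ * B₃ * C)) := by
  have key := hyp_backward_rat (q := q) hI hX hbal h₁ h₂ h₃ hQ
  have eX : X * (1 - X⁻¹ * Q) = X - Q := by field_simp
  have a1 : (1 - b₁) * (1 - b₁)⁻¹ = 1 := mul_inv_cancel₀ g₁
  have a2 : (1 - b₂) * (1 - b₂)⁻¹ = 1 := mul_inv_cancel₀ g₂
  have a3 : (1 - b₃) * (1 - b₃)⁻¹ = 1 := mul_inv_cancel₀ g₃
  have a4 : (1 - b₁) * (1 - b₂) * (1 - b₃) * ((1 - b₁)⁻¹ * (1 - b₂)⁻¹ * (1 - b₃)⁻¹) = 1 := by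
    calc _ = ((1 - b₁) * (1 - b₁)⁻¹) * ((1 - b₂) * (1 - b₂)⁻¹) * ((1 - b₃) * (1 - b₃)⁻¹) := by ring
      _ = 1 := by rw [a1, a2, a3]; ring
  have t1 : mu * (1 - b₁) * (1 - b₂) * (1 - b₃) * X * (1 - mu * X ^ 2) *
      ((1 - I⁻¹) * U * ((1 - lam * I) * V) * Y * Z /
        ((1 - b₁) * B₁ * ((1 - b₂) * B₂) * ((1 - b₃) * B₃) * (C * (1 - Q))) * Q) =
      (mu * X * (1 - mu * X ^ 2) * ((1 - I⁻¹) * (1 - lam * I)) / (1 - Q) * Q) *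
        (U * V * Y * Z / (B₁ * B₂ * B₃ * C)) := by
    simp only [div_eq_mul_inv, mul_inv]
    generalize (1 - b₁)⁻¹ = i1 at *
    generalize (1 - b₂)⁻¹ = i2 at *
    generalize (1 - b₃)⁻¹ = i3 at *
    generalize 1 - b₁ = d1 at *
    generalize 1 - b₂ = d2 at *
    generalize 1 - b₃ = d3 at *
    linear_combination ((mu * X * (1 - mu * X ^ 2) * ((1 - I⁻¹) * (1 - lam * I)) * (1 - Q)⁻¹ * Q) *
        (U * V * Y * Z * (B₁⁻¹ * B₂⁻¹ * B₃⁻¹ * C⁻¹))) * a4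
  have t2 : mu * (1 - mu * X) * (1 - b₁ * X) * (1 - b₂ * X) * (1 - b₃ * X) *
        (U * (1 - I⁻¹ * Q) * (V * (1 - lam * I * Q)) * Y * Z' /
          (B₁ * (1 - b₁ * Q) * (B₂ * (1 - b₂ * Q)) * (B₃ * (1 - b₃ * Q)) * (C * (1 - Q))) * Q) -
      (1 - X) * (b₁ - mu * X) * (b₂ - mu * X) * (b₃ - mu * X) *
        (U * (1 - I⁻¹ * Q) * (V * (1 - lam * I * Q)) * Y' * Z'' /
          (B₁ * (1 - b₁ * Q) * (B₂ * (1 - b₂ * Q)) * (B₃ * (1 - b₃ * Q)) * (C * (1 - Q))) * Q) =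
      ((mu * ((1 - b₁ * X) * (1 - b₂ * X) * (1 - b₃ * X)) * (1 - mu * X * Q) +
        X * ((b₁ - mu * X) * (b₂ - mu * X) * (b₃ - mu * X)) * (1 - X⁻¹ * Q)) *
        ((1 - I⁻¹ * Q) * (1 - lam * I * Q)) /
        ((1 - b₁ * Q) * (1 - b₂ * Q) * (1 - b₃ * Q) * (1 - Q)) * Q) *
        (U * V * Y * Z / (B₁ * B₂ * B₃ * C)) := by
    simp only [div_eq_mul_inv, mul_inv]
    generalize (1 - b₁ * Q)⁻¹ = i1 at *
    generalize (1 - b₂ * Q)⁻¹ = i2 at *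
    generalize (1 - b₃ * Q)⁻¹ = i3 at *
    generalize (1 - Q)⁻¹ = i4 at *
    linear_combination (U * (1 - I⁻¹ * Q) * (V * (1 - lam * I * Q)) *
      (B₁⁻¹ * i1 * (B₂⁻¹ * i2) * (B₃⁻¹ * i3) * (C⁻¹ * i4)) * Q) *
      (mu * (1 - b₁ * X) * (1 - b₂ * X) * (1 - b₃ * X) * Y * e2 +
        (b₁ - mu * X) * (b₂ - mu * X) * (b₃ - mu * X) * (e5 - Y * Z * eX))
  rw [t1, t2, ← sub_mul, key]
  simp only [div_eq_mul_inv, mul_inv]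
  ring

theorem hyp_backward_partial {q : ℂ} (hq : q ≠ 0) {lam mu b₁ b₂ b₃ : ℂ} (m x : ℕ)
    (hbal : lam * mu * q = b₁ * b₂ * b₃)
    (h₁ : qPoch b₁ q (m + 1) ≠ 0) (h₂ : qPoch b₂ q (m + 1) ≠ 0) (h₃ : qPoch b₃ q (m + 1) ≠ 0)
    (hn : qPoch q q (m + 1) ≠ 0) (K : ℕ) (hK : K ≤ m) :
    ∑ k ∈ Finset.range (K + 1), (mu * (1 - b₁) * (1 - b₂) * (1 - b₃) * q ^ x *
        (1 - mu * (q ^ x) ^ 2) * hypTerm q lam mu b₁ b₂ b₃ (m + 1) x k -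
      (mu * (1 - mu * q ^ x) * (1 - b₁ * q ^ x) * (1 - b₂ * q ^ x) * (1 - b₃ * q ^ x) *
        hypTerm q (q ^ 2 * lam) (q * mu) (q * b₁) (q * b₂) (q * b₃) m x k -
      (1 - q ^ x) * (b₁ - mu * q ^ x) * (b₂ - mu * q ^ x) * (b₃ - mu * q ^ x) *
        hypTerm q (q ^ 2 * lam) (q * mu) (q * b₁) (q * b₂) (q * b₃) m (x - 1) k)) =
    mu * q ^ x * (1 - mu * (q ^ x) ^ 2) * (1 - lam * q ^ (K + 1)) *
      (qPoch (q ^ m)⁻¹ q K * qPoch (q ^ 2 * lam * q ^ m) q K * qPoch (q ^ x)⁻¹ q (K + 1) *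
        qPoch (mu * q ^ x) q (K + 1) /
      (qPoch (q * b₁) q K * qPoch (q * b₂) q K * qPoch (q * b₃) q K * qPoch q q K)) := by
  have hX : q ^ x ≠ 0 := pow_ne_zero x hq
  induction K with
  | zero =>
    simp [hypTerm, qPoch_zero, qPoch_succ]
    have eX : q ^ x * (1 - (q ^ x)⁻¹) = q ^ x - 1 := by field_simp
    generalize q ^ x = X at *
    linear_combination (-(mu * (1 - mu * X ^ 2) * (1 - lam * q) * (1 - mu * X))) * eX +
      (mu * X * (1 - mu * X ^ 2) - mu * (1 - mu * X) * X ^ 3 + (X - 1)) * hbal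
  | succ K ih =>
    rw [Finset.sum_range_succ, ih (by omega)]
    have e2 := qPoch_mul_pow_succ q mu x (K + 1)
    have e3 := qPoch_inv_pow_pred hq x (K + 1)
    rw [qPoch_succ _ _ (K + 1)] at e2 e3
    have e4 : (q ^ x - 1) * qPoch (q * mu * q ^ (x - 1)) q (K + 1) =
        (q ^ x - 1) * qPoch (mu * q ^ x) q (K + 1) := by
      rcases eq_or_ne x 0 with rfl | hx
      · simp
      · rw [mu_pred mu hx]
    have e5 := mul_pred_term hX e3 e4
    have f : ∀ {b : ℂ}, qPoch b q (m + 1) ≠ 0 → 1 - b * q ^ (K + 1) ≠ 0 :=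
      fun h => one_sub_ne_zero_of_qPoch h (by omega)
    have f0 : ∀ {b : ℂ}, qPoch b q (m + 1) ≠ 0 → 1 - b ≠ 0 :=
      fun h => by simpa using one_sub_ne_zero_of_qPoch h (Nat.succ_pos m)
    have fq : 1 - q ^ (K + 1) ≠ 0 := by
      have := one_sub_ne_zero_of_qPoch hn (show K < m + 1 by omega)
      rwa [← pow_succ'] at this
    have step := hyp_backward_step (q := q) (U := qPoch (q ^ m)⁻¹ q K)
      (V := qPoch (q ^ 2 * lam * q ^ m) q K) (B₁ := qPoch (q * b₁) q K) (B₂ := qPoch (q * b₂) q K)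
      (B₃ := qPoch (q * b₃) q K) (C := qPoch q q K) (pow_ne_zero (m + 1) hq) hX hbal (f0 h₁)
      (f0 h₂) (f0 h₃) (f h₁) (f h₂) (f h₃) fq e2 e5
    have r1 : ∀ b : ℂ, qPoch (q * b) q (K + 1) = qPoch (q * b) q K * (1 - b * q ^ (K + 1)) := by
      intro b; rw [qPoch_succ]; ring
    have r2 : qPoch q q (K + 1) = qPoch q q K * (1 - q ^ (K + 1)) := by
      rw [qPoch_succ]; ring
    have r3 : qPoch (q ^ m)⁻¹ q (K + 1) =
        qPoch (q ^ m)⁻¹ q K * (1 - (q ^ (m + 1))⁻¹ * q ^ (K + 1)) := by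
      rw [qPoch_succ, show (q ^ m)⁻¹ * q ^ K = (q ^ (m + 1))⁻¹ * q ^ (K + 1) by
        rw [pow_succ, pow_succ]; field_simp]
    have r4 : qPoch (q ^ 2 * lam * q ^ m) q (K + 1) =
        qPoch (q ^ 2 * lam * q ^ m) q K * (1 - lam * q ^ (m + 1) * q ^ (K + 1)) := by
      rw [qPoch_succ]; ring
    have r5 : qPoch (lam * q ^ (m + 1)) q (K + 1) =
        (1 - lam * q ^ (m + 1)) * qPoch (q ^ 2 * lam * q ^ m) q K := by
      rw [qPoch_succ']; ring_nf
    have r6 : 1 - lam * q ^ (K + 1 + 1) = 1 - lam * q * q ^ (K + 1) := by ring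
    unfold hypTerm
    rw [r1, r1, r1, r2, r3, r4, r5, r6, qPoch_inv_pow_succ hq m K, qPoch_succ' b₁, qPoch_succ' b₂,
      qPoch_succ' b₃, qPoch_succ (q ^ x)⁻¹ q (K + 1), qPoch_succ (mu * q ^ x) q (K + 1)]
    linear_combination step

/-- The backward shift: `n + 1` is expressed by `n`. -/
theorem hyp_backward {q : ℂ} (hq : q ≠ 0) {lam mu b₁ b₂ b₃ : ℂ} (m x : ℕ)
    (hbal : lam * mu * q = b₁ * b₂ * b₃)
    (h₁ : qPoch b₁ q (m + 1) ≠ 0) (h₂ : qPoch b₂ q (m + 1) ≠ 0) (h₃ : qPoch b₃ q (m + 1) ≠ 0)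
    (hn : qPoch q q (m + 1) ≠ 0) :
    mu * (1 - b₁) * (1 - b₂) * (1 - b₃) * q ^ x * (1 - mu * (q ^ x) ^ 2) *
        hyp q lam mu b₁ b₂ b₃ (m + 1) x =
      mu * (1 - mu * q ^ x) * (1 - b₁ * q ^ x) * (1 - b₂ * q ^ x) * (1 - b₃ * q ^ x) *
        hyp q (q ^ 2 * lam) (q * mu) (q * b₁) (q * b₂) (q * b₃) m x -
      (1 - q ^ x) * (b₁ - mu * q ^ x) * (b₂ - mu * q ^ x) * (b₃ - mu * q ^ x) *
        hyp q (q ^ 2 * lam) (q * mu) (q * b₁) (q * b₂) (q * b₃) m (x - 1) := by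
  have key := hyp_backward_partial hq m x hbal h₁ h₂ h₃ hn m le_rfl
  rw [Finset.sum_sub_distrib, Finset.sum_sub_distrib, ← Finset.mul_sum, ← Finset.mul_sum,
    ← Finset.mul_sum] at key
  unfold hyp
  rw [Finset.sum_range_succ _ (m + 1)]
  have f0 : ∀ {b : ℂ}, qPoch b q (m + 1) ≠ 0 → (1 - b) * (1 - b)⁻¹ = 1 := fun h =>
    mul_inv_cancel₀ (by simpa using one_sub_ne_zero_of_qPoch h (Nat.succ_pos m))
  have hI : q ^ (m + 1) ≠ 0 := pow_ne_zero _ hq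
  have fq : 1 - q ^ (m + 1) ≠ 0 := by
    have := one_sub_ne_zero_of_qPoch hn (show m < m + 1 by omega)
    rwa [← pow_succ'] at this
  have last : mu * (1 - b₁) * (1 - b₂) * (1 - b₃) * q ^ x * (1 - mu * (q ^ x) ^ 2) *
      hypTerm q lam mu b₁ b₂ b₃ (m + 1) x (m + 1) =
    -(mu * q ^ x * (1 - mu * (q ^ x) ^ 2) * (1 - lam * q ^ (m + 1)) *
      (qPoch (q ^ m)⁻¹ q m * qPoch (q ^ 2 * lam * q ^ m) q m * qPoch (q ^ x)⁻¹ q (m + 1) *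
        qPoch (mu * q ^ x) q (m + 1) /
      (qPoch (q * b₁) q m * qPoch (q * b₂) q m * qPoch (q * b₃) q m * qPoch q q m))) := by
    have r2 : qPoch q q (m + 1) = qPoch q q m * (1 - q ^ (m + 1)) := by
      rw [qPoch_succ]; ring
    have r5 : qPoch (lam * q ^ (m + 1)) q (m + 1) =
        (1 - lam * q ^ (m + 1)) * qPoch (q ^ 2 * lam * q ^ m) q m := by
      rw [qPoch_succ']; ring_nf
    have r7 : (1 - (q ^ (m + 1))⁻¹) * q ^ (m + 1) * (1 - q ^ (m + 1))⁻¹ = -1 := by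
      field_simp; ring
    unfold hypTerm
    rw [r2, r5, qPoch_inv_pow_succ hq m m, qPoch_succ' b₁, qPoch_succ' b₂, qPoch_succ' b₃]
    simp only [div_eq_mul_inv, mul_inv]
    calc _ = (mu * q ^ x * (1 - mu * (q ^ x) ^ 2) * (1 - lam * q ^ (m + 1)) *
      (qPoch (q ^ m)⁻¹ q m * qPoch (q ^ 2 * lam * q ^ m) q m * qPoch (q ^ x)⁻¹ q (m + 1) *
        qPoch (mu * q ^ x) q (m + 1) * ((qPoch (q * b₁) q m)⁻¹ * (qPoch (q * b₂) q m)⁻¹ *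
        (qPoch (q * b₃) q m)⁻¹ * (qPoch q q m)⁻¹))) * ((1 - b₁) * (1 - b₁)⁻¹) *
        ((1 - b₂) * (1 - b₂)⁻¹) * ((1 - b₃) * (1 - b₃)⁻¹) *
        ((1 - (q ^ (m + 1))⁻¹) * q ^ (m + 1) * (1 - q ^ (m + 1))⁻¹) := by ring
      _ = _ := by rw [f0 h₁, f0 h₂, f0 h₃, r7]; ring
  rw [mul_add, last]
  linear_combination key

theorem hyp_exchange_rat {q lam mu b₁ b₂ b₃ I X R : ℂ} (hq : q ≠ 0) (hI : I ≠ 0) (hX : X ≠ 0)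
    (h₁ : 1 - b₁ * R ≠ 0) (h₂ : 1 - b₂ * (q * R) ≠ 0) (h₃ : 1 - b₃ * (q * R) ≠ 0)
    (hQ : 1 - q * R ≠ 0) :
    X * (1 - mu * X ^ 2) * ((1 - b₁ * I) * ((1 - (q * I)⁻¹) * (1 - lam * I * (q * R))) +
      I * (b₁ - lam * q * I) * ((1 - I⁻¹ * R) * (1 - lam * I))) * (q * R) /
        ((1 - b₁ * R) * (1 - q * R)) -
    (1 - lam * q * I ^ 2) * ((1 - b₂ * X) * (1 - b₃ * X) * (1 - mu * X * (q * R)) -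
      X * ((mu * X - b₂) * (mu * X - b₃)) * (X * (1 - X⁻¹ * (q * R)))) *
        ((1 - I⁻¹ * R) * (1 - lam * I * (q * R))) * (q * R) /
        ((1 - b₁ * R) * (1 - b₂ * (q * R)) * (1 - b₃ * (q * R)) * (1 - q * R)) =
    (1 - lam * q * I ^ 2) * X * (1 - mu * X ^ 2) *
      ((1 - I⁻¹ * R) * (1 - lam * I * (q * R)) * (1 - X⁻¹ * (q * R)) * (1 - mu * X * (q * R)) /
        ((1 - b₁ * R) * (1 - b₂ * (q * R)) * (1 - b₃ * (q * R)) * (1 - q * R)) - 1) := by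
  have key : X * (1 - mu * X ^ 2) * ((1 - b₁ * I) * ((q * I - 1) * (1 - lam * I * (q * R))) +
      I * (b₁ - lam * q * I) * ((q * I - q * R) * (1 - lam * I))) * (q * R) *
        ((1 - b₂ * (q * R)) * (1 - b₃ * (q * R))) -
    (1 - lam * q * I ^ 2) * ((1 - b₂ * X) * (1 - b₃ * X) * (1 - mu * X * (q * R)) -
      X * ((mu * X - b₂) * (mu * X - b₃)) * (X - q * R)) *
        ((q * I - q * R) * (1 - lam * I * (q * R))) * (q * R) =
    (1 - lam * q * I ^ 2) * (1 - mu * X ^ 2) *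
      ((q * I - q * R) * (1 - lam * I * (q * R)) * (X - q * R) * (1 - mu * X * (q * R))) -
    q * I * (1 - lam * q * I ^ 2) * X * (1 - mu * X ^ 2) *
      ((1 - b₁ * R) * ((1 - b₂ * (q * R)) * (1 - b₃ * (q * R))) * (1 - q * R)) := by
    ring
  have eI : 1 - I⁻¹ * R = (q * I - q * R) / (q * I) := by field_simp
  have eI' : 1 - (q * I)⁻¹ = (q * I - 1) / (q * I) := by field_simp
  have eX : 1 - X⁻¹ * (q * R) = (X - q * R) / X := by field_simp
  rw [eI, eI', eX]
  generalize 1 - b₁ * R = d₁ at *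
  generalize 1 - b₂ * (q * R) = d₂ at *
  generalize 1 - b₃ * (q * R) = d₃ at *
  generalize 1 - lam * I * (q * R) = d₄ at *
  generalize 1 - mu * X * (q * R) = d₅ at *
  generalize 1 - mu * X ^ 2 = d₆ at *
  generalize 1 - lam * I = d₇ at *
  generalize (1 - b₂ * X) * (1 - b₃ * X) = d₈ at *
  generalize (mu * X - b₂) * (mu * X - b₃) = d₉ at *
  generalize 1 - lam * q * I ^ 2 = d₁₀ at *
  generalize q * I - q * R = d₁₂ at *
  generalize X - q * R = d₁₃ at *
  generalize q * I - 1 = d₁₄ at *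
  generalize 1 - q * R = d₁₅ at *
  generalize 1 - b₁ * I = d₁₆ at *
  generalize b₁ - lam * q * I = d₁₇ at *
  field_simp
  linear_combination key

theorem hyp_exchange_step {q lam mu b₁ b₂ b₃ I X R U V Y Z Y' Z' Z'' B₁ B₂ B₃ C : ℂ}
    (hq : q ≠ 0) (hI : I ≠ 0) (hX : X ≠ 0) (g₂ : 1 - b₂ ≠ 0) (g₃ : 1 - b₃ ≠ 0)
    (h₁ : 1 - b₁ * R ≠ 0) (h₂ : 1 - b₂ * (q * R) ≠ 0) (h₃ : 1 - b₃ * (q * R) ≠ 0)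
    (hQ : 1 - q * R ≠ 0) (e2 : (1 - mu * X) * Z' = Z * (1 - mu * X * (q * R)))
    (e5 : (X - 1) * (Y' * Z'') = (X - q * R) * (Y * Z)) :
    (1 - b₂) * (1 - b₃) * X * (1 - mu * X ^ 2) *
      ((1 - b₁ * I) * ((1 - (q * I)⁻¹) * U * (V * (1 - lam * I * (q * R))) * Y * Z /
        (B₁ * (1 - b₁ * R) * ((1 - b₂) * B₂) * ((1 - b₃) * B₃) * (C * (1 - q * R))) * (q * R)) +
      I * (b₁ - lam * q * I) * (U * (1 - I⁻¹ * R) * ((1 - lam * I) * V) * Y * Z /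
        (B₁ * (1 - b₁ * R) * ((1 - b₂) * B₂) * ((1 - b₃) * B₃) * (C * (1 - q * R))) * (q * R))) -
      (1 - lam * q * I ^ 2) * ((1 - mu * X) * (1 - b₂ * X) * (1 - b₃ * X) *
        (U * (1 - I⁻¹ * R) * (V * (1 - lam * I * (q * R))) * Y * Z' /
          (B₁ * (1 - b₁ * R) * (B₂ * (1 - b₂ * (q * R))) * (B₃ * (1 - b₃ * (q * R))) *
            (C * (1 - q * R))) * (q * R)) -
      X * (X - 1) * (mu * X - b₂) * (mu * X - b₃) *
        (U * (1 - I⁻¹ * R) * (V * (1 - lam * I * (q * R))) * Y' * Z'' /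
          (B₁ * (1 - b₁ * R) * (B₂ * (1 - b₂ * (q * R))) * (B₃ * (1 - b₃ * (q * R))) *
            (C * (1 - q * R))) * (q * R))) =
    (1 - lam * q * I ^ 2) * X * (1 - mu * X ^ 2) *
      (U * (1 - I⁻¹ * R) * (V * (1 - lam * I * (q * R))) * (Y * (1 - X⁻¹ * (q * R))) *
        (Z * (1 - mu * X * (q * R))) /
          (B₁ * (1 - b₁ * R) * (B₂ * (1 - b₂ * (q * R))) * (B₃ * (1 - b₃ * (q * R))) *
            (C * (1 - q * R)))) -
    (1 - lam * q * I ^ 2) * X * (1 - mu * X ^ 2) * (U * V * Y * Z / (B₁ * B₂ * B₃ * C)) := by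
  have key := hyp_exchange_rat (lam := lam) (mu := mu) hq hI hX h₁ h₂ h₃ hQ
  have eX : X * (1 - X⁻¹ * (q * R)) = X - q * R := by field_simp
  have a2 : (1 - b₂) * (1 - b₂)⁻¹ = 1 := mul_inv_cancel₀ g₂
  have a3 : (1 - b₃) * (1 - b₃)⁻¹ = 1 := mul_inv_cancel₀ g₃
  have t1 : (1 - b₂) * (1 - b₃) * X * (1 - mu * X ^ 2) *
      ((1 - b₁ * I) * ((1 - (q * I)⁻¹) * U * (V * (1 - lam * I * (q * R))) * Y * Z /
        (B₁ * (1 - b₁ * R) * ((1 - b₂) * B₂) * ((1 - b₃) * B₃) * (C * (1 - q * R))) * (q * R)) +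
      I * (b₁ - lam * q * I) * (U * (1 - I⁻¹ * R) * ((1 - lam * I) * V) * Y * Z /
        (B₁ * (1 - b₁ * R) * ((1 - b₂) * B₂) * ((1 - b₃) * B₃) * (C * (1 - q * R))) * (q * R))) =
      (X * (1 - mu * X ^ 2) * ((1 - b₁ * I) * ((1 - (q * I)⁻¹) * (1 - lam * I * (q * R))) +
      I * (b₁ - lam * q * I) * ((1 - I⁻¹ * R) * (1 - lam * I))) * (q * R) /
        ((1 - b₁ * R) * (1 - q * R))) * (U * V * Y * Z / (B₁ * B₂ * B₃ * C)) := by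
    generalize (q * I)⁻¹ = J
    simp only [div_eq_mul_inv, mul_inv]
    generalize (1 - b₂)⁻¹ = i2 at *
    generalize (1 - b₃)⁻¹ = i3 at *
    generalize 1 - b₂ = d2 at *
    generalize 1 - b₃ = d3 at *
    have a4 : d2 * d3 * (i2 * i3) = 1 := by
      calc _ = (d2 * i2) * (d3 * i3) := by ring
        _ = 1 := by rw [a2, a3]; ring
    generalize (1 - b₁ * I) = d4
    generalize (1 - lam * I * (q * R)) = d5
    generalize b₁ - lam * q * I = d6
    generalize (1 - b₁ * R)⁻¹ = d7
    generalize (1 - q * R)⁻¹ = d8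
    linear_combination ((X * (1 - mu * X ^ 2) * (d4 * ((1 - J) * d5) +
      I * d6 * ((1 - I⁻¹ * R) * (1 - lam * I))) * (q * R) * (d7 * d8)) *
        (U * V * Y * Z * (B₁⁻¹ * B₂⁻¹ * B₃⁻¹ * C⁻¹))) * a4
  have t2 : (1 - mu * X) * (1 - b₂ * X) * (1 - b₃ * X) *
        (U * (1 - I⁻¹ * R) * (V * (1 - lam * I * (q * R))) * Y * Z' /
          (B₁ * (1 - b₁ * R) * (B₂ * (1 - b₂ * (q * R))) * (B₃ * (1 - b₃ * (q * R))) *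
            (C * (1 - q * R))) * (q * R)) -
      X * (X - 1) * (mu * X - b₂) * (mu * X - b₃) *
        (U * (1 - I⁻¹ * R) * (V * (1 - lam * I * (q * R))) * Y' * Z'' /
          (B₁ * (1 - b₁ * R) * (B₂ * (1 - b₂ * (q * R))) * (B₃ * (1 - b₃ * (q * R))) *
            (C * (1 - q * R))) * (q * R)) =
      (((1 - b₂ * X) * (1 - b₃ * X) * (1 - mu * X * (q * R)) -
      X * ((mu * X - b₂) * (mu * X - b₃)) * (X * (1 - X⁻¹ * (q * R)))) *
        ((1 - I⁻¹ * R) * (1 - lam * I * (q * R))) * (q * R) /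
        ((1 - b₁ * R) * (1 - b₂ * (q * R)) * (1 - b₃ * (q * R)) * (1 - q * R))) *
        (U * V * Y * Z / (B₁ * B₂ * B₃ * C)) := by
    rw [eX]
    simp only [div_eq_mul_inv, mul_inv]
    generalize (1 - b₁ * R)⁻¹ = i1
    generalize (1 - b₂ * (q * R))⁻¹ = i2
    generalize (1 - b₃ * (q * R))⁻¹ = i3
    generalize (1 - q * R)⁻¹ = i4
    generalize (1 - I⁻¹ * R) = d1
    generalize (1 - lam * I * (q * R)) = d2
    linear_combination (U * d1 * (V * d2) *
      (B₁⁻¹ * i1 * (B₂⁻¹ * i2) * (B₃⁻¹ * i3) * (C⁻¹ * i4)) * (q * R)) *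
      ((1 - b₂ * X) * (1 - b₃ * X) * Y * e2 - X * (mu * X - b₂) * (mu * X - b₃) * e5)
  rw [t1, t2]
  clear t1 t2 eX
  generalize (q * I)⁻¹ = J at *
  simp only [div_eq_mul_inv, mul_inv] at key ⊢
  generalize X⁻¹ = Xi at *
  generalize I⁻¹ = Ii at *
  generalize (1 - b₁ * R)⁻¹ = i1 at *
  generalize (1 - b₂ * (q * R))⁻¹ = i2 at *
  generalize (1 - b₃ * (q * R))⁻¹ = i3 at *
  generalize (1 - q * R)⁻¹ = i4 at *
  linear_combination (U * V * Y * Z * (B₁⁻¹ * B₂⁻¹ * B₃⁻¹ * C⁻¹)) * key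

theorem hyp_exchange_partial {q : ℂ} (hq : q ≠ 0) {lam mu b₁ b₂ b₃ : ℂ} (i x : ℕ)
    (h₁ : qPoch b₁ q (i + 1) ≠ 0) (h₂ : qPoch b₂ q (i + 1) ≠ 0) (h₃ : qPoch b₃ q (i + 1) ≠ 0)
    (hn : qPoch q q (i + 1) ≠ 0) (K : ℕ) (hK : K ≤ i) :
    ∑ k ∈ Finset.range (K + 1), ((1 - b₂) * (1 - b₃) * q ^ x * (1 - mu * (q ^ x) ^ 2) *
        ((1 - b₁ * q ^ i) * hypTerm q lam mu b₁ b₂ b₃ (i + 1) x k +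
          q ^ i * (b₁ - lam * q * q ^ i) * hypTerm q lam mu b₁ b₂ b₃ i x k) -
      (1 - lam * q * (q ^ i) ^ 2) *
        ((1 - mu * q ^ x) * (1 - b₂ * q ^ x) * (1 - b₃ * q ^ x) *
            hypTerm q (q * lam) (q * mu) b₁ (q * b₂) (q * b₃) i x k -
          q ^ x * (q ^ x - 1) * (mu * q ^ x - b₂) * (mu * q ^ x - b₃) *
            hypTerm q (q * lam) (q * mu) b₁ (q * b₂) (q * b₃) i (x - 1) k)) =
    (1 - lam * q * (q ^ i) ^ 2) * q ^ x * (1 - mu * (q ^ x) ^ 2) *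
      (qPoch (q ^ i)⁻¹ q K * qPoch (q * lam * q ^ i) q K * qPoch (q ^ x)⁻¹ q (K + 1) *
        qPoch (mu * q ^ x) q (K + 1) /
      (qPoch b₁ q K * qPoch (q * b₂) q K * qPoch (q * b₃) q K * qPoch q q K)) := by
  have hX : q ^ x ≠ 0 := pow_ne_zero x hq
  induction K with
  | zero =>
    simp [hypTerm, qPoch_zero, qPoch_succ]
    have eX : q ^ x * (1 - (q ^ x)⁻¹) = q ^ x - 1 := by field_simp
    generalize q ^ x = X at *
    generalize q ^ i = I at *
    linear_combination (-((1 - mu * X ^ 2) * (1 - lam * q * I ^ 2) * (1 - mu * X))) * eX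
  | succ K ih =>
    rw [Finset.sum_range_succ, ih (by omega)]
    have e2 := qPoch_mul_pow_succ q mu x (K + 1)
    have e3 := qPoch_inv_pow_pred hq x (K + 1)
    rw [qPoch_succ _ _ (K + 1)] at e2 e3
    have e4 : (q ^ x - 1) * qPoch (q * mu * q ^ (x - 1)) q (K + 1) =
        (q ^ x - 1) * qPoch (mu * q ^ x) q (K + 1) := by
      rcases eq_or_ne x 0 with rfl | hx
      · simp
      · rw [mu_pred mu hx]
    have e5 := mul_pred_term hX e3 e4
    rw [pow_succ' q K] at e2 e5
    have f : ∀ {b : ℂ}, qPoch b q (i + 1) ≠ 0 → 1 - b * (q * q ^ K) ≠ 0 := fun h => by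
      rw [← pow_succ']; exact one_sub_ne_zero_of_qPoch h (by omega)
    have f0 : ∀ {b : ℂ}, qPoch b q (i + 1) ≠ 0 → 1 - b ≠ 0 :=
      fun h => by simpa using one_sub_ne_zero_of_qPoch h (Nat.succ_pos i)
    have step := hyp_exchange_step (lam := lam) (U := qPoch (q ^ i)⁻¹ q K)
      (V := qPoch (q * lam * q ^ i) q K) (B₁ := qPoch b₁ q K) (B₂ := qPoch (q * b₂) q K)
      (B₃ := qPoch (q * b₃) q K) (C := qPoch q q K) hq (pow_ne_zero i hq) hX (f0 h₂) (f0 h₃)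
      (one_sub_ne_zero_of_qPoch h₁ (show K < i + 1 by omega)) (f h₂) (f h₃)
      (one_sub_ne_zero_of_qPoch hn (show K < i + 1 by omega)) e2 e5
    have r1 : ∀ b : ℂ, qPoch (q * b) q (K + 1) = qPoch (q * b) q K * (1 - b * (q * q ^ K)) := by
      intro b; rw [qPoch_succ]; ring
    have r4 : qPoch (q * lam * q ^ i) q (K + 1) =
        qPoch (q * lam * q ^ i) q K * (1 - lam * q ^ i * (q * q ^ K)) := by
      rw [qPoch_succ]; ring
    have r4' : qPoch (lam * q ^ (i + 1)) q (K + 1) =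
        qPoch (q * lam * q ^ i) q K * (1 - lam * q ^ i * (q * q ^ K)) := by
      rw [← r4]; ring_nf
    have r5 : qPoch (lam * q ^ i) q (K + 1) =
        (1 - lam * q ^ i) * qPoch (q * lam * q ^ i) q K := by
      rw [qPoch_succ']; ring_nf
    unfold hypTerm
    rw [qPoch_inv_pow_succ hq i K, qPoch_succ' b₂, qPoch_succ' b₃, r1, r1, r4', r4, r5,
      qPoch_succ (q ^ i)⁻¹, qPoch_succ b₁, qPoch_succ q, qPoch_succ (q ^ x)⁻¹ q (K + 1),
      qPoch_succ (mu * q ^ x) q (K + 1), pow_succ' q K, pow_succ' q i]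
    linear_combination step

/-- A four-term relation with a shift of `lam`, `mu` and two lower parameters. -/
theorem hyp_exchange {q : ℂ} (hq : q ≠ 0) {lam mu b₁ b₂ b₃ : ℂ} (i x : ℕ)
    (h₁ : qPoch b₁ q (i + 1) ≠ 0) (h₂ : qPoch b₂ q (i + 1) ≠ 0) (h₃ : qPoch b₃ q (i + 1) ≠ 0)
    (hn : qPoch q q (i + 1) ≠ 0) :
    (1 - b₂) * (1 - b₃) * q ^ x * (1 - mu * (q ^ x) ^ 2) *
        ((1 - b₁ * q ^ i) * hyp q lam mu b₁ b₂ b₃ (i + 1) x +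
          q ^ i * (b₁ - lam * q * q ^ i) * hyp q lam mu b₁ b₂ b₃ i x) =
      (1 - lam * q * (q ^ i) ^ 2) *
        ((1 - mu * q ^ x) * (1 - b₂ * q ^ x) * (1 - b₃ * q ^ x) *
            hyp q (q * lam) (q * mu) b₁ (q * b₂) (q * b₃) i x -
          q ^ x * (q ^ x - 1) * (mu * q ^ x - b₂) * (mu * q ^ x - b₃) *
            hyp q (q * lam) (q * mu) b₁ (q * b₂) (q * b₃) i (x - 1)) := by
  have key := hyp_exchange_partial (lam := lam) (mu := mu) hq i x h₁ h₂ h₃ hn i le_rfl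
  simp only [Finset.sum_sub_distrib, Finset.sum_add_distrib, ← Finset.mul_sum] at key
  unfold hyp
  rw [Finset.sum_range_succ _ (i + 1)]
  have f0 : ∀ {b : ℂ}, qPoch b q (i + 1) ≠ 0 → (1 - b) * (1 - b)⁻¹ = 1 := fun h =>
    mul_inv_cancel₀ (by simpa using one_sub_ne_zero_of_qPoch h (Nat.succ_pos i))
  have hI : q ^ i ≠ 0 := pow_ne_zero _ hq
  have fq : 1 - q * q ^ i ≠ 0 := one_sub_ne_zero_of_qPoch hn (show i < i + 1 by omega)
  have fb : 1 - b₁ * q ^ i ≠ 0 := one_sub_ne_zero_of_qPoch h₁ (show i < i + 1 by omega)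
  have last : (1 - b₂) * (1 - b₃) * q ^ x * (1 - mu * (q ^ x) ^ 2) * ((1 - b₁ * q ^ i) *
      hypTerm q lam mu b₁ b₂ b₃ (i + 1) x (i + 1)) =
    -((1 - lam * q * (q ^ i) ^ 2) * q ^ x * (1 - mu * (q ^ x) ^ 2) *
      (qPoch (q ^ i)⁻¹ q i * qPoch (q * lam * q ^ i) q i * qPoch (q ^ x)⁻¹ q (i + 1) *
        qPoch (mu * q ^ x) q (i + 1) /
      (qPoch b₁ q i * qPoch (q * b₂) q i * qPoch (q * b₃) q i * qPoch q q i))) := by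
    have r4' : qPoch (lam * q ^ (i + 1)) q (i + 1) =
        qPoch (q * lam * q ^ i) q i * (1 - lam * q * (q ^ i) ^ 2) := by
      rw [qPoch_succ]; ring_nf
    have r7 : (1 - (q * q ^ i)⁻¹) * (q * q ^ i) * (1 - q * q ^ i)⁻¹ = -1 := by
      field_simp; ring
    have r8 : (1 - b₁ * q ^ i) * (1 - b₁ * q ^ i)⁻¹ = 1 := mul_inv_cancel₀ fb
    unfold hypTerm
    rw [r4', qPoch_inv_pow_succ hq i i, qPoch_succ b₁, qPoch_succ q, qPoch_succ' b₂,
      qPoch_succ' b₃, pow_succ' q i]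
    generalize (q * q ^ i)⁻¹ = J at *
    simp only [div_eq_mul_inv, mul_inv]
    calc _ = ((1 - lam * q * (q ^ i) ^ 2) * q ^ x * (1 - mu * (q ^ x) ^ 2) *
      (qPoch (q ^ i)⁻¹ q i * qPoch (q * lam * q ^ i) q i * qPoch (q ^ x)⁻¹ q (i + 1) *
        qPoch (mu * q ^ x) q (i + 1) * ((qPoch b₁ q i)⁻¹ * (qPoch (q * b₂) q i)⁻¹ *
        (qPoch (q * b₃) q i)⁻¹ * (qPoch q q i)⁻¹))) * ((1 - b₁ * q ^ i) * (1 - b₁ * q ^ i)⁻¹) *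
        ((1 - b₂) * (1 - b₂)⁻¹) * ((1 - b₃) * (1 - b₃)⁻¹) *
        ((1 - J) * (q * q ^ i) * (1 - q * q ^ i)⁻¹) := by ring
      _ = _ := by rw [f0 h₂, f0 h₃, r7, r8]; ring
  linear_combination key + last

theorem sum_forward_backward {q : ℂ} (hq : q ≠ 0) {l al b₁ b₂ b₃ mu d₁ d₂ d₃ rho : ℂ}
    (w w' : ℕ → ℂ) (M b x : ℕ)
    (hw : ∀ m ≤ M, w (m + 1) * ((1 - (q ^ (m + 1))⁻¹) * (1 - al * q ^ (m + 1))) = rho * w' m)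
    (h₁ : 1 - b₁ ≠ 0) (h₂ : 1 - b₂ ≠ 0) (h₃ : 1 - b₃ ≠ 0) (hb : qPoch q q (b + 1) ≠ 0)
    (hbal : al * mu * q = d₁ * d₂ * d₃)
    (e₁ : qPoch d₁ q (M + 1) ≠ 0) (e₂ : qPoch d₂ q (M + 1) ≠ 0) (e₃ : qPoch d₃ q (M + 1) ≠ 0)
    (hM : qPoch q q (M + 1) ≠ 0) :
    (1 - b₁) * (1 - b₂) * (1 - b₃) *
      (mu * (1 - d₁) * (1 - d₂) * (1 - d₃) * q ^ x * (1 - mu * (q ^ x) ^ 2)) *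
      (∑ a ∈ Finset.range (M + 2), w a * hyp q l al b₁ b₂ b₃ (b + 1) a * hyp q al mu d₁ d₂ d₃ a x -
        ∑ a ∈ Finset.range (M + 2), w a * hyp q l al b₁ b₂ b₃ b a * hyp q al mu d₁ d₂ d₃ a x) =
    q * (l * q ^ b - (q ^ (b + 1))⁻¹) * rho *
      (mu * (1 - mu * q ^ x) * (1 - d₁ * q ^ x) * (1 - d₂ * q ^ x) * (1 - d₃ * q ^ x) *
        (∑ a ∈ Finset.range (M + 1), w' a *
          hyp q (q * l) (q ^ 2 * al) (q * b₁) (q * b₂) (q * b₃) b a *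
          hyp q (q ^ 2 * al) (q * mu) (q * d₁) (q * d₂) (q * d₃) a x) -
      (1 - q ^ x) * (d₁ - mu * q ^ x) * (d₂ - mu * q ^ x) * (d₃ - mu * q ^ x) *
        (∑ a ∈ Finset.range (M + 1), w' a *
          hyp q (q * l) (q ^ 2 * al) (q * b₁) (q * b₂) (q * b₃) b a *
          hyp q (q ^ 2 * al) (q * mu) (q * d₁) (q * d₂) (q * d₃) a (x - 1))) := by
  rw [← Finset.sum_sub_distrib, Finset.sum_range_succ', hyp_zero_right hq, hyp_zero_right hq,
    sub_self, add_zero]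
  simp only [Finset.mul_sum, ← Finset.sum_sub_distrib]
  refine Finset.sum_congr rfl fun m hm => ?_
  have hm' : m ≤ M := Nat.lt_succ_iff.mp (Finset.mem_range.mp hm)
  have f := hyp_forward hq l al b (Nat.succ_ne_zero m) h₁ h₂ h₃ hb
  have g := hyp_backward hq m x hbal (qPoch_ne_zero_of_le e₁ (by omega))
    (qPoch_ne_zero_of_le e₂ (by omega)) (qPoch_ne_zero_of_le e₃ (by omega))
    (qPoch_ne_zero_of_le hM (by omega))
  rw [Nat.succ_eq_add_one, Nat.add_sub_cancel] at f
  have h := hw m hm'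
  generalize hyp q (q * l) (q ^ 2 * al) (q * b₁) (q * b₂) (q * b₃) b m = H1 at *
  generalize hyp q (q ^ 2 * al) (q * mu) (q * d₁) (q * d₂) (q * d₃) m x = H2 at *
  generalize hyp q (q ^ 2 * al) (q * mu) (q * d₁) (q * d₂) (q * d₃) m (x - 1) = H3 at *
  generalize hyp q al mu d₁ d₂ d₃ (m + 1) x = H4 at *
  generalize (q ^ (b + 1))⁻¹ = J at *
  generalize (q ^ (m + 1))⁻¹ = J' at *
  generalize hR : mu * (1 - mu * q ^ x) * (1 - d₁ * q ^ x) * (1 - d₂ * q ^ x) * (1 - d₃ * q ^ x) =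
    R at *
  generalize hR' : (1 - q ^ x) * (d₁ - mu * q ^ x) * (d₂ - mu * q ^ x) * (d₃ - mu * q ^ x) =
    R' at *
  calc _ = w (m + 1) * ((1 - b₁) * (1 - b₂) * (1 - b₃) *
        (hyp q l al b₁ b₂ b₃ (b + 1) (m + 1) - hyp q l al b₁ b₂ b₃ b (m + 1))) *
        (mu * (1 - d₁) * (1 - d₂) * (1 - d₃) * q ^ x * (1 - mu * (q ^ x) ^ 2) * H4) := by ring
    _ = _ := by
      rw [f, g]
      linear_combination (q * (l * q ^ b - J) * H1 * (R * H2 - R' * H3)) * h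

theorem sum_forward {q : ℂ} (hq : q ≠ 0) {al mu d₁ d₂ d₃ rho : ℂ}
    (w w' : ℕ → ℂ) (M x : ℕ)
    (hw : ∀ m ≤ M, w (m + 1) * ((1 - (q ^ (m + 1))⁻¹) * (1 - al * q ^ (m + 1))) = rho * w' m)
    (h₁ : 1 - d₁ ≠ 0) (h₂ : 1 - d₂ ≠ 0) (h₃ : 1 - d₃ ≠ 0) (hx : qPoch q q (x + 1) ≠ 0) :
    (1 - d₁) * (1 - d₂) * (1 - d₃) *
      (∑ a ∈ Finset.range (M + 2), w a * hyp q al mu d₁ d₂ d₃ a (x + 1) -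
        ∑ a ∈ Finset.range (M + 2), w a * hyp q al mu d₁ d₂ d₃ a x) =
    q * (mu * q ^ x - (q ^ (x + 1))⁻¹) * rho *
      (∑ a ∈ Finset.range (M + 1), w' a *
          hyp q (q ^ 2 * al) (q * mu) (q * d₁) (q * d₂) (q * d₃) a x) := by
  rw [← Finset.sum_sub_distrib, Finset.sum_range_succ', hyp_zero_left, hyp_zero_left,
    sub_self, add_zero]
  simp only [Finset.mul_sum]
  refine Finset.sum_congr rfl fun m hm => ?_
  have hm' : m ≤ M := Nat.lt_succ_iff.mp (Finset.mem_range.mp hm)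
  have f := hyp_forward hq mu al x (Nat.succ_ne_zero m) h₁ h₂ h₃ hx
  rw [Nat.succ_eq_add_one, Nat.add_sub_cancel] at f
  rw [hyp_comm hq al mu, hyp_comm hq al mu, hyp_comm hq (q ^ 2 * al) (q * mu)]
  linear_combination w (m + 1) * f +
    q * (mu * q ^ x - (q ^ (x + 1))⁻¹) *
      hyp q (q * mu) (q ^ 2 * al) (q * d₁) (q * d₂) (q * d₃) x m * hw m hm'

/-- No integral power of `q` times `c` equals one. -/
def Generic (q c : ℂ) : Prop := ∀ m : ℤ, c * q ^ m ≠ 1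

theorem Generic.mul_pow {q c : ℂ} (hq : q ≠ 0) (h : Generic q c) (n : ℕ) :
    Generic q (c * q ^ n) := by
  intro m
  have := h (n + m)
  rwa [zpow_add₀ hq, zpow_natCast, ← mul_assoc] at this

theorem Generic.mul {q c : ℂ} (hq : q ≠ 0) (h : Generic q c) : Generic q (q * c) := by
  simpa [mul_comm] using h.mul_pow hq 1

theorem Generic.inv {q c : ℂ} (h : Generic q c) : Generic q c⁻¹ := by
  intro m hm
  apply h (-m)
  rw [zpow_neg]
  rw [← inv_inj, mul_inv, inv_inv, inv_one] at hm
  exact hm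

theorem Generic.mul_inv_pow {q c : ℂ} (hq : q ≠ 0) (h : Generic q c) (n : ℕ) :
    Generic q (c * (q ^ n)⁻¹) := by
  have := (h.inv.mul_pow hq n).inv
  rwa [mul_inv, inv_inv] at this

theorem Generic.sub_ne_zero {q c : ℂ} (h : Generic q c) : 1 - c ≠ 0 := by
  have := h 0
  rw [zpow_zero, mul_one] at this
  exact _root_.sub_ne_zero.mpr this.symm

theorem Generic.sub_pow_ne_zero {q c : ℂ} (h : Generic q c) (n : ℕ) : 1 - c * q ^ n ≠ 0 := by
  have := h n
  rw [zpow_natCast] at this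
  exact _root_.sub_ne_zero.mpr this.symm

theorem Generic.qPoch {q c : ℂ} (h : Generic q c) (n : ℕ) : qPoch c q n ≠ 0 := by
  unfold QRacah.qPoch
  exact Finset.prod_ne_zero_iff.mpr fun l _ => h.sub_pow_ne_zero l

/-- `q` is neither zero nor a root of unity. -/
structure NonRoot (q : ℂ) : Prop where
  ne : q ≠ 0
  pow : ∀ m : ℕ, 1 ≤ m → q ^ m ≠ 1

theorem NonRoot.sub {q : ℂ} (h : NonRoot q) {m : ℕ} (hm : 1 ≤ m) : 1 - q ^ m ≠ 0 :=
  sub_ne_zero.mpr (h.pow m hm).symm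

theorem NonRoot.qPoch {q : ℂ} (h : NonRoot q) (n : ℕ) : qPoch q q n ≠ 0 := by
  unfold QRacah.qPoch
  refine Finset.prod_ne_zero_iff.mpr fun l _ => ?_
  rw [← pow_succ']
  exact h.sub (by omega)

theorem NonRoot.qPoch_inv_pow {q : ℂ} (h : NonRoot q) {k n : ℕ} (hk : k ≤ n) :
    QRacah.qPoch (q ^ n)⁻¹ q k ≠ 0 := by
  unfold QRacah.qPoch
  refine Finset.prod_ne_zero_iff.mpr fun l hl => ?_
  have hl' : l < k := Finset.mem_range.mp hl
  intro h0
  have h1 : (q ^ n)⁻¹ * q ^ l = 1 := (sub_eq_zero.mp h0).symm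
  have h2 : q ^ n = q ^ l * q ^ (n - l) := by rw [← pow_add]; congr 1; omega
  have h3 := pow_ne_zero l h.ne
  have h4 := pow_ne_zero (n - l) h.ne
  rw [h2] at h1
  apply h.pow (n - l) (by omega)
  field_simp at h1
  exact h1.symm

/-- The factor of the very-well-poised weights that depends on `al` only. -/
def vwp (q al : ℂ) (a : ℕ) : ℂ :=
  qPoch al q a * (1 - al * (q ^ a) ^ 2) / (qPoch q q a * (1 - al))

theorem vwp_zero {q al : ℂ} (h : 1 - al ≠ 0) : vwp q al 0 = 1 := by
  simp [vwp, qPoch_zero, h]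

theorem vwp_succ {q al : ℂ} (hq : NonRoot q) (h : Generic q al) (a : ℕ) :
    vwp q al (a + 1) * (1 - al * q ^ (a + 1)) * (1 - q ^ (a + 1)) =
      (1 - al * q) * (1 - al * q ^ 2) * vwp q (q ^ 2 * al) a := by
  have e : qPoch al q (a + 1) * (1 - al * q ^ (a + 1)) =
      (1 - al) * (1 - al * q) * qPoch (q ^ 2 * al) q a := by
    rw [← qPoch_succ, qPoch_succ', qPoch_succ']; ring_nf
  have h0 := h.sub_ne_zero
  have h2 : 1 - q ^ 2 * al ≠ 0 := by
    rw [mul_comm]; exact h.sub_pow_ne_zero 2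
  have h3 : 1 - q ^ (a + 1) ≠ 0 := hq.sub (by omega)
  have h4 := hq.qPoch a
  unfold vwp
  rw [qPoch_succ q, ← pow_succ']
  have e2 : 1 - q ^ 2 * al * (q ^ a) ^ 2 = 1 - al * (q ^ (a + 1)) ^ 2 := by ring
  rw [e2]
  generalize qPoch (q ^ 2 * al) q a = V at *
  generalize qPoch al q (a + 1) = U at *
  have e3 : 1 - q ^ 2 * al = 1 - al * q ^ 2 := by ring
  rw [e3] at h2 ⊢
  generalize 1 - al * q ^ (a + 1) = d1 at *
  generalize 1 - q ^ (a + 1) = d2 at *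
  generalize 1 - al * q ^ 2 = d3 at *
  generalize 1 - al * (q ^ (a + 1)) ^ 2 = d4 at *
  generalize 1 - al = d5 at *
  field_simp
  linear_combination d4 * e

theorem qPoch_div_shift {c q : ℂ} (hc : Generic q c) (n : ℕ) :
    qPoch (q * c) q n = qPoch c q n * (1 - c * q ^ n) / (1 - c) := by
  rw [qPoch_shift, mul_div_cancel_left₀ _ hc.sub_ne_zero]

/-- The terms of a terminating very-well-poised `₆φ₅`. -/
def vwpTerm (q al B C : ℂ) (N a : ℕ) : ℂ :=
  vwp q al a * (qPoch B q a * qPoch C q a * qPoch (q ^ N)⁻¹ q a /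
    (qPoch (al * q / B) q a * qPoch (al * q / C) q a * qPoch (al * q ^ (N + 1)) q a)) *
    (al * q ^ (N + 1) / (B * C)) ^ a

/-- The limit of `vwpTerm` as `C` tends to infinity. -/
def vwpTermLim (q al B : ℂ) (N a : ℕ) : ℂ :=
  vwp q al a * (qPoch B q a * qPoch (q ^ N)⁻¹ q a /
    (qPoch (al * q / B) q a * qPoch (al * q ^ (N + 1)) q a)) *
    ((-(al * q ^ (N + 1) / B)) ^ a * q ^ a.choose 2)

theorem neg_inv_mul {q : ℂ} (hq : q ≠ 0) (n : ℕ) :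
    1 - (q ^ n)⁻¹ = -((q ^ n)⁻¹ * (1 - q ^ n)) := by
  have := pow_ne_zero n hq
  field_simp; ring

theorem vwpTerm_succ {q al B C : ℂ} (hq : NonRoot q) (h : Generic q al) (hB : B ≠ 0) (hC : C ≠ 0)
    (N a : ℕ) :
    vwpTerm q al B C (N + 1) (a + 1) * ((1 - (q ^ (a + 1))⁻¹) * (1 - al * q ^ (a + 1))) =
      (-((1 - al * q) * (1 - al * q ^ 2) * (1 - B) * (1 - C) * (1 - (q ^ (N + 1))⁻¹) /
        ((1 - al * q / B) * (1 - al * q / C) * (1 - al * q ^ (N + 2))) *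
        (al * q ^ (N + 1) / (B * C)))) * vwpTerm q (q ^ 2 * al) (q * B) (q * C) N a := by
  have hv := vwp_succ hq h a
  have hz : (al * q ^ (N + 1 + 1) / (B * C)) ^ (a + 1) * (q ^ (a + 1))⁻¹ =
      (al * q ^ (N + 1) / (B * C)) ^ a * (al * q ^ (N + 1) / (B * C)) := by
    rw [← pow_succ, ← inv_pow, ← mul_pow]
    congr 1
    have := hq.ne
    field_simp
    ring
  have hz' : q ^ 2 * al * q ^ (N + 1) / (q * B * (q * C)) = al * q ^ (N + 1) / (B * C) := by
    have := hq.ne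
    field_simp
  unfold vwpTerm
  rw [neg_inv_mul hq.ne, hz', qPoch_succ' B, qPoch_succ' C, qPoch_inv_pow_succ hq.ne,
    qPoch_succ' (al * q / B), qPoch_succ' (al * q / C), qPoch_succ' (al * _),
    show q * (al * q / B) = q ^ 2 * al * q / (q * B) by have := hq.ne; field_simp,
    show q * (al * q / C) = q ^ 2 * al * q / (q * C) by have := hq.ne; field_simp,
    show q * (al * q ^ (N + 1 + 1)) = q ^ 2 * al * q ^ (N + 1) by ring]
  generalize (al * q ^ (N + 1 + 1) / (B * C)) ^ (a + 1) = Z at *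
  generalize vwp q (q ^ 2 * al) a = v at *
  generalize vwp q al (a + 1) = v' at *
  generalize 1 - (q ^ (N + 1))⁻¹ = d1 at *
  generalize (q ^ (a + 1))⁻¹ = d2 at *
  generalize (al * q ^ (N + 1) / (B * C)) ^ a = Z' at *
  generalize al * q ^ (N + 1) / (B * C) = z at *
  generalize 1 - al * q / B = d3
  generalize 1 - al * q / C = d4
  rw [show N + 1 + 1 = N + 2 from rfl]
  generalize 1 - al * q ^ (N + 2) = d5
  simp only [div_eq_mul_inv, mul_inv]
  calc _ = -(v' * (1 - al * q ^ (a + 1)) * (1 - q ^ (a + 1))) * (Z * d2) *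
      ((1 - B) * qPoch (q * B) q a * ((1 - C) * qPoch (q * C) q a) *
        (d1 * qPoch (q ^ N)⁻¹ q a) *
        (d3⁻¹ * (qPoch (q ^ 2 * al * q * (q⁻¹ * B⁻¹)) q a)⁻¹ *
          (d4⁻¹ * (qPoch (q ^ 2 * al * q * (q⁻¹ * C⁻¹)) q a)⁻¹) *
          (d5⁻¹ * (qPoch (q ^ 2 * al * q ^ (N + 1)) q a)⁻¹))) := by ring
    _ = _ := by rw [hv, hz]; ring

theorem vwpTermLim_succ {q al B : ℂ} (hq : NonRoot q) (h : Generic q al) (hB : B ≠ 0) (N a : ℕ) :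
    vwpTermLim q al B (N + 1) (a + 1) * ((1 - (q ^ (a + 1))⁻¹) * (1 - al * q ^ (a + 1))) =
      ((1 - al * q) * (1 - al * q ^ 2) * (1 - B) * (1 - (q ^ (N + 1))⁻¹) /
        ((1 - al * q / B) * (1 - al * q ^ (N + 2))) *
        (al * q ^ (N + 1) / B)) * vwpTermLim q (q ^ 2 * al) (q * B) N a := by
  have hv := vwp_succ hq h a
  have hz : (-(al * q ^ (N + 1 + 1) / B)) ^ (a + 1) * q ^ (a + 1).choose 2 * (q ^ (a + 1))⁻¹ =
      -((-(al * q ^ (N + 1 + 1) / B)) ^ a * q ^ a.choose 2 * (al * q ^ (N + 1) / B)) := by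
    have := hq.ne
    rw [Nat.choose_succ_succ' a 1, Nat.choose_one_right, pow_succ _ a, pow_add]
    field_simp
    ring
  have hz' : q ^ 2 * al * q ^ (N + 1) / (q * B) = al * q ^ (N + 1 + 1) / B := by
    have := hq.ne
    field_simp
    ring
  unfold vwpTermLim
  rw [neg_inv_mul hq.ne, hz', qPoch_succ' B, qPoch_inv_pow_succ hq.ne,
    qPoch_succ' (al * q / B), qPoch_succ' (al * _),
    show q * (al * q / B) = q ^ 2 * al * q / (q * B) by have := hq.ne; field_simp,
    show q * (al * q ^ (N + 1 + 1)) = q ^ 2 * al * q ^ (N + 1) by ring]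
  generalize (-(al * q ^ (N + 1 + 1) / B)) ^ (a + 1) * q ^ (a + 1).choose 2 = Z at *
  generalize (-(al * q ^ (N + 1 + 1) / B)) ^ a * q ^ a.choose 2 = Z' at *
  generalize vwp q (q ^ 2 * al) a = v at *
  generalize vwp q al (a + 1) = v' at *
  generalize 1 - (q ^ (N + 1))⁻¹ = d1 at *
  generalize (q ^ (a + 1))⁻¹ = d2 at *
  generalize al * q ^ (N + 1) / B = z at *
  generalize 1 - al * q / B = d3
  rw [show N + 1 + 1 = N + 2 from rfl]
  generalize 1 - al * q ^ (N + 2) = d5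
  simp only [div_eq_mul_inv, mul_inv]
  calc _ = -(v' * (1 - al * q ^ (a + 1)) * (1 - q ^ (a + 1))) * (Z * d2) *
      ((1 - B) * qPoch (q * B) q a *
        (d1 * qPoch (q ^ N)⁻¹ q a) *
        (d3⁻¹ * (qPoch (q ^ 2 * al * q * (q⁻¹ * B⁻¹)) q a)⁻¹ *
          (d5⁻¹ * (qPoch (q ^ 2 * al * q ^ (N + 1)) q a)⁻¹))) := by ring
    _ = _ := by rw [hv, hz]; ring

theorem qPoch_pair_diff {q al : ℂ} (hq : NonRoot q) (h : Generic q al) (N a : ℕ) :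
    qPoch (q ^ (N + 1))⁻¹ q (a + 1) / qPoch (al * q ^ (N + 1 + 1)) q (a + 1) * q ^ (a + 1) -
      qPoch (q ^ N)⁻¹ q (a + 1) / qPoch (al * q ^ (N + 1)) q (a + 1) =
    -((1 - q ^ (a + 1)) * (1 - al * q ^ (a + 1)) /
      ((1 - al * q ^ (N + 1)) * (1 - al * q ^ (N + 2))) *
      (qPoch (q ^ N)⁻¹ q a / qPoch (q ^ 2 * al * q ^ (N + 1)) q a)) := by
  have g := fun n => h.mul_pow hq.ne n
  have h1 : qPoch (q ^ 2 * al * q ^ (N + 1)) q a =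
      qPoch (al * q ^ (N + 2)) q a * (1 - al * q ^ (N + 2) * q ^ a) / (1 - al * q ^ (N + 2)) := by
    rw [← qPoch_div_shift (g (N + 2))]; ring_nf
  rw [h1, qPoch_inv_pow_succ hq.ne, qPoch_succ (q ^ N)⁻¹, qPoch_succ (al * q ^ (N + 1 + 1)),
    qPoch_succ' (al * q ^ (N + 1)), show q * (al * q ^ (N + 1)) = al * q ^ (N + 2) by ring]
  have n1 := (g (N + 2)).qPoch a
  have n2 := (g (N + 2)).sub_pow_ne_zero a
  have n3 := (g (N + 2)).sub_ne_zero
  have n4 := (g (N + 1)).sub_ne_zero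
  have n5 := pow_ne_zero N hq.ne
  have n6 := hq.ne
  rw [show N + 1 + 1 = N + 2 from rfl]
  have key : (1 - (q ^ (N + 1))⁻¹) * q ^ (a + 1) * (1 - al * q ^ (N + 1)) -
      (1 - (q ^ N)⁻¹ * q ^ a) * (1 - al * q ^ (N + 2) * q ^ a) =
      -((1 - q ^ (a + 1)) * (1 - al * q ^ (a + 1))) := by
    simp only [pow_succ]
    field_simp
    ring
  generalize (1 - (q ^ (N + 1))⁻¹) = d1 at *
  generalize (1 - (q ^ N)⁻¹ * q ^ a) = d2 at *
  generalize 1 - al * q ^ (N + 2) * q ^ a = d3 at *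
  generalize 1 - al * q ^ (N + 2) = d4 at *
  generalize 1 - al * q ^ (N + 1) = d5 at *
  generalize 1 - al * q ^ (a + 1) = d6 at *
  generalize 1 - q ^ (a + 1) = d7 at *
  generalize qPoch (q ^ N)⁻¹ q a = p at *
  field_simp
  linear_combination p * key

theorem sum_vwpTerm {q : ℂ} (hq : NonRoot q) (N : ℕ) : ∀ {al B C : ℂ}, Generic q al →
    B ≠ 0 → C ≠ 0 → Generic q (al / B) → Generic q (al / C) →
    ∑ a ∈ Finset.range (N + 1), vwpTerm q al B C N a =
      qPoch (al * q) q N * qPoch (al * q / (B * C)) q N /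
        (qPoch (al * q / B) q N * qPoch (al * q / C) q N) := by
  induction N with
  | zero =>
    intro al B C h _ _ _ _
    simp [vwpTerm, vwp_zero h.sub_ne_zero, qPoch_zero]
  | succ N ih =>
    intro al B C h hB hC gB gC
    have hq0 := hq.ne
    have gB' : Generic q (al * q / B) := by
      rw [show al * q / B = al / B * q ^ 1 by ring]; exact gB.mul_pow hq0 1
    have gC' : Generic q (al * q / C) := by
      rw [show al * q / C = al / C * q ^ 1 by ring]; exact gC.mul_pow hq0 1
    have up := @ih (q ^ 2 * al) (q * B) (q * C)
      (by rw [mul_comm]; exact h.mul_pow hq0 2) (mul_ne_zero hq0 hB) (mul_ne_zero hq0 hC)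
      (by rw [show q ^ 2 * al / (q * B) = al * q / B by field_simp]; exact gB')
      (by rw [show q ^ 2 * al / (q * C) = al * q / C by field_simp]; exact gC')
    have low := ih h hB hC gB gC
    have diff : ∀ a, vwpTerm q al B C (N + 1) (a + 1) - vwpTerm q al B C N (a + 1) =
        -(al * q ^ (N + 1) / (B * C) * ((1 - al * q) * (1 - al * q ^ 2) * (1 - B) * (1 - C)) /
          ((1 - al * q / B) * (1 - al * q / C) * (1 - al * q ^ (N + 1)) * (1 - al * q ^ (N + 2)))) *
          vwpTerm q (q ^ 2 * al) (q * B) (q * C) N a := by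
      intro a
      have hd := qPoch_pair_diff hq h N a
      have hv := vwp_succ hq h a
      unfold vwpTerm
      have hz : (al * q ^ (N + 1 + 1) / (B * C)) ^ (a + 1) =
          (al * q ^ (N + 1) / (B * C)) ^ (a + 1) * q ^ (a + 1) := by
        rw [← mul_pow]; congr 1; ring
      have hz' : q ^ 2 * al * q ^ (N + 1) / (q * B * (q * C)) = al * q ^ (N + 1) / (B * C) := by
        field_simp
      rw [hz, hz', qPoch_succ' B, qPoch_succ' C, qPoch_succ' (al * q / B),
        qPoch_succ' (al * q / C),
        show q * (al * q / B) = q ^ 2 * al * q / (q * B) by field_simp,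
        show q * (al * q / C) = q ^ 2 * al * q / (q * C) by field_simp]
      generalize vwp q (q ^ 2 * al) a = v at *
      generalize vwp q al (a + 1) = v' at *
      rw [pow_succ (al * q ^ (N + 1) / (B * C)) a]
      generalize (al * q ^ (N + 1) / (B * C)) ^ a = Z' at *
      generalize al * q ^ (N + 1) / (B * C) = z at *
      generalize 1 - al * q / B = d3
      generalize 1 - al * q / C = d4
      simp only [div_eq_mul_inv, mul_inv] at hd ⊢
      generalize qPoch (q ^ (N + 1))⁻¹ q (a + 1) = p1 at *
      generalize (qPoch (al * q ^ (N + 1 + 1)) q (a + 1))⁻¹ = p2 at *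
      generalize qPoch (q ^ N)⁻¹ q (a + 1) = p3 at *
      generalize (qPoch (al * q ^ (N + 1)) q (a + 1))⁻¹ = p4 at *
      generalize (1 - al * q ^ (N + 1))⁻¹ = p5 at *
      generalize (1 - al * q ^ (N + 2))⁻¹ = p6 at *
      generalize (qPoch (q ^ 2 * al * q ^ (N + 1)) q a)⁻¹ = p7 at *
      generalize qPoch (q ^ N)⁻¹ q a = p8 at *
      generalize (qPoch (q ^ 2 * al * q * (q⁻¹ * B⁻¹)) q a)⁻¹ = p9 at *
      generalize (qPoch (q ^ 2 * al * q * (q⁻¹ * C⁻¹)) q a)⁻¹ = p10 at *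
      generalize 1 - al * q = p11 at *
      generalize 1 - al * q ^ 2 = p12 at *
      generalize 1 - al * q ^ (a + 1) = p13 at *
      generalize 1 - q ^ (a + 1) = p14 at *
      generalize 1 - B = p15 at *
      generalize 1 - C = p16 at *
      linear_combination v' * Z' * z * (p15 * qPoch (q * B) q a * (p16 * qPoch (q * C) q a)) *
          (d3⁻¹ * p9 * (d4⁻¹ * p10)) * hd -
        Z' * z * (p15 * qPoch (q * B) q a * (p16 * qPoch (q * C) q a)) *
          (d3⁻¹ * p9 * (d4⁻¹ * p10)) * p5 * p6 * p7 * p8 * hv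
    have e0 : ∑ a ∈ Finset.range (N + 1), vwpTerm q al B C N a =
        ∑ a ∈ Finset.range (N + 2), vwpTerm q al B C N a := by
      rw [Finset.sum_range_succ _ (N + 1)]
      simp [vwpTerm, qPoch_inv_pow_eq_zero hq0 (Nat.lt_succ_self N)]
    have e1 : ∑ a ∈ Finset.range (N + 2), vwpTerm q al B C (N + 1) a -
        ∑ a ∈ Finset.range (N + 2), vwpTerm q al B C N a =
        -(al * q ^ (N + 1) / (B * C) * ((1 - al * q) * (1 - al * q ^ 2) * (1 - B) * (1 - C)) /
          ((1 - al * q / B) * (1 - al * q / C) * (1 - al * q ^ (N + 1)) * (1 - al * q ^ (N + 2)))) *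
          ∑ a ∈ Finset.range (N + 1), vwpTerm q (q ^ 2 * al) (q * B) (q * C) N a := by
      rw [← Finset.sum_sub_distrib, Finset.sum_range_succ', Finset.mul_sum]
      have : vwpTerm q al B C (N + 1) 0 - vwpTerm q al B C N 0 = 0 := by
        simp [vwpTerm, qPoch_zero]
      rw [this, add_zero]
      exact Finset.sum_congr rfl fun a _ => diff a
    rw [sub_eq_iff_eq_add.mp e1, ← e0, low, up]
    have r1 : qPoch (q ^ 2 * al * q) q N = qPoch (al * q) q N * (1 - al * q ^ (N + 1)) *
        (1 - al * q ^ (N + 2)) / ((1 - al * q) * (1 - al * q ^ 2)) := by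
      have g1 : Generic q (al * q) := by simpa using h.mul_pow hq0 1
      have := qPoch_div_shift (g1.mul hq0) N
      rw [qPoch_div_shift g1] at this
      rw [show q ^ 2 * al * q = q * (q * (al * q)) by ring, this]
      have n1 := g1.sub_ne_zero
      have n2 := (g1.mul hq0).sub_ne_zero
      rw [show al * q ^ (N + 1) = al * q * q ^ N by ring,
        show al * q ^ (N + 2) = q * (al * q) * q ^ N by ring,
        show al * q ^ 2 = q * (al * q) by ring]
      field_simp
    have r2 : ∀ X : ℂ, Generic q (al * q / X) → qPoch (q ^ 2 * al * q / (q * X)) q N =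
        qPoch (al * q / X) q N * (1 - al * q / X * q ^ N) / (1 - al * q / X) := by
      intro X hX
      rw [← qPoch_div_shift hX]; congr 1; field_simp
    have r3 : q ^ 2 * al * q / (q * B * (q * C)) = al * q / (B * C) := by field_simp
    rw [r1, r2 B gB', r2 C gC', r3, qPoch_succ, qPoch_succ, qPoch_succ, qPoch_succ]
    have n1 := gB'.sub_ne_zero
    have n2 := gC'.sub_ne_zero
    have n3 := gB'.sub_pow_ne_zero N
    have n4 := gC'.sub_pow_ne_zero N
    have n5 := (h.mul_pow hq0 1).sub_ne_zero
    have n6 := (h.mul_pow hq0 2).sub_ne_zero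
    have n7 := (h.mul_pow hq0 (N + 1)).sub_ne_zero
    have n8 := (h.mul_pow hq0 (N + 2)).sub_ne_zero
    have n9 := gB'.qPoch N
    have n10 := gC'.qPoch N
    rw [pow_one] at n5
    have key : (1 - al * q * q ^ N) * (1 - al * q / (B * C) * q ^ N) =
        (1 - al * q / B * q ^ N) * (1 - al * q / C * q ^ N) -
          al * q ^ (N + 1) / (B * C) * ((1 - B) * (1 - C)) := by
      field_simp; ring
    rw [show qPoch (al * q) q N * (1 - al * q * q ^ N) *
      (qPoch (al * q / (B * C)) q N * (1 - al * q / (B * C) * q ^ N)) =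
      qPoch (al * q) q N * qPoch (al * q / (B * C)) q N *
      ((1 - al * q * q ^ N) * (1 - al * q / (B * C) * q ^ N)) by ring, key]
    generalize qPoch (al * q / B) q N = x1 at *
    generalize qPoch (al * q / C) q N = x2 at *
    generalize qPoch (al * q / (B * C)) q N = x3 at *
    generalize 1 - al * q / B * q ^ N = x4 at *
    generalize 1 - al * q / C * q ^ N = x5 at *
    generalize 1 - al * q / B = x6 at *
    generalize 1 - al * q / C = x7 at *
    generalize 1 - al * q ^ (N + 1) = x8 at *
    generalize 1 - al * q ^ (N + 2) = x9 at *
    generalize 1 - al * q ^ 2 = x10 at *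
    generalize qPoch (al * q) q N = x11 at *
    generalize 1 - al * q = x12 at *
    generalize al * q ^ (N + 1) / (B * C) = x13 at *
    generalize 1 - B = x14 at *
    generalize 1 - C = x15 at *
    field_simp
    ring

theorem sum_vwpTermLim {q : ℂ} (hq : NonRoot q) (N : ℕ) : ∀ {al B : ℂ}, Generic q al →
    B ≠ 0 → Generic q (al / B) →
    ∑ a ∈ Finset.range (N + 1), vwpTermLim q al B N a =
      qPoch (al * q) q N / qPoch (al * q / B) q N := by
  induction N with
  | zero =>
    intro al B h _ _
    simp [vwpTermLim, vwp_zero h.sub_ne_zero, qPoch_zero]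
  | succ N ih =>
    intro al B h hB gB
    have hq0 := hq.ne
    have gB' : Generic q (al * q / B) := by
      rw [show al * q / B = al / B * q ^ 1 by ring]; exact gB.mul_pow hq0 1
    have up := @ih (q ^ 2 * al) (q * B)
      (by rw [mul_comm]; exact h.mul_pow hq0 2) (mul_ne_zero hq0 hB)
      (by rw [show q ^ 2 * al / (q * B) = al * q / B by field_simp]; exact gB')
    have low := ih h hB gB
    have diff : ∀ a, vwpTermLim q al B (N + 1) (a + 1) - vwpTermLim q al B N (a + 1) =
        (al * q ^ (N + 1) / B * ((1 - al * q) * (1 - al * q ^ 2) * (1 - B)) /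
          ((1 - al * q / B) * (1 - al * q ^ (N + 1)) * (1 - al * q ^ (N + 2)))) *
          vwpTermLim q (q ^ 2 * al) (q * B) N a := by
      intro a
      have hd := qPoch_pair_diff hq h N a
      have hv := vwp_succ hq h a
      unfold vwpTermLim
      have hz2 : (-(al * q ^ (N + 1) / B)) ^ (a + 1) * q ^ (a + 1).choose 2 =
          -((-(al * q ^ (N + 1) / B)) ^ a * q ^ a * q ^ a.choose 2 * (al * q ^ (N + 1) / B)) := by
        rw [Nat.choose_succ_succ' a 1, Nat.choose_one_right, pow_add q a]
        ring
      have hz3 : (-(al * q ^ (N + 1 + 1) / B)) ^ (a + 1) * q ^ (a + 1).choose 2 =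
          -((-(al * q ^ (N + 1) / B)) ^ a * q ^ a * q ^ a.choose 2 * (al * q ^ (N + 1) / B)) *
            q ^ (a + 1) := by
        rw [← hz2, show -(al * q ^ (N + 1 + 1) / B) = -(al * q ^ (N + 1) / B) * q by ring, mul_pow]
        ring
      have hz' : (-(q ^ 2 * al * q ^ (N + 1) / (q * B))) ^ a * q ^ a.choose 2 =
          (-(al * q ^ (N + 1) / B)) ^ a * q ^ a * q ^ a.choose 2 := by
        rw [← mul_pow]; congr 2; field_simp
      rw [hz3, hz2, hz', qPoch_succ' B, qPoch_succ' (al * q / B),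
        show q * (al * q / B) = q ^ 2 * al * q / (q * B) by field_simp]
      clear hz2 hz3 hz'
      generalize vwp q (q ^ 2 * al) a = v at *
      generalize vwp q al (a + 1) = v' at *
      generalize (-(al * q ^ (N + 1) / B)) ^ a * q ^ a * q ^ a.choose 2 = Z' at *
      generalize al * q ^ (N + 1) / B = z at *
      generalize 1 - al * q / B = d3
      simp only [div_eq_mul_inv, mul_inv] at hd ⊢
      generalize qPoch (q ^ (N + 1))⁻¹ q (a + 1) = p1 at *
      generalize (qPoch (al * q ^ (N + 1 + 1)) q (a + 1))⁻¹ = p2 at *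
      generalize qPoch (q ^ N)⁻¹ q (a + 1) = p3 at *
      generalize (qPoch (al * q ^ (N + 1)) q (a + 1))⁻¹ = p4 at *
      generalize (1 - al * q ^ (N + 1))⁻¹ = p5 at *
      generalize (1 - al * q ^ (N + 2))⁻¹ = p6 at *
      generalize (qPoch (q ^ 2 * al * q ^ (N + 1)) q a)⁻¹ = p7 at *
      generalize qPoch (q ^ N)⁻¹ q a = p8 at *
      generalize (qPoch (q ^ 2 * al * q * (q⁻¹ * B⁻¹)) q a)⁻¹ = p9 at *
      generalize 1 - al * q = p11 at *
      generalize 1 - al * q ^ 2 = p12 at *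
      generalize 1 - al * q ^ (a + 1) = p13 at *
      generalize 1 - q ^ (a + 1) = p14 at *
      generalize 1 - B = p15 at *
      linear_combination -v' * Z' * z * (p15 * qPoch (q * B) q a) * (d3⁻¹ * p9) * hd +
        Z' * z * (p15 * qPoch (q * B) q a) * (d3⁻¹ * p9) * p5 * p6 * p7 * p8 * hv
    have e0 : ∑ a ∈ Finset.range (N + 1), vwpTermLim q al B N a =
        ∑ a ∈ Finset.range (N + 2), vwpTermLim q al B N a := by
      rw [Finset.sum_range_succ _ (N + 1)]
      simp [vwpTermLim, qPoch_inv_pow_eq_zero hq0 (Nat.lt_succ_self N)]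
    have e1 : ∑ a ∈ Finset.range (N + 2), vwpTermLim q al B (N + 1) a -
        ∑ a ∈ Finset.range (N + 2), vwpTermLim q al B N a =
        (al * q ^ (N + 1) / B * ((1 - al * q) * (1 - al * q ^ 2) * (1 - B)) /
          ((1 - al * q / B) * (1 - al * q ^ (N + 1)) * (1 - al * q ^ (N + 2)))) *
          ∑ a ∈ Finset.range (N + 1), vwpTermLim q (q ^ 2 * al) (q * B) N a := by
      rw [← Finset.sum_sub_distrib, Finset.sum_range_succ', Finset.mul_sum]
      have : vwpTermLim q al B (N + 1) 0 - vwpTermLim q al B N 0 = 0 := by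
        simp [vwpTermLim, qPoch_zero]
      rw [this, add_zero]
      exact Finset.sum_congr rfl fun a _ => diff a
    rw [sub_eq_iff_eq_add.mp e1, ← e0, low, up]
    have r1 : qPoch (q ^ 2 * al * q) q N = qPoch (al * q) q N * (1 - al * q ^ (N + 1)) *
        (1 - al * q ^ (N + 2)) / ((1 - al * q) * (1 - al * q ^ 2)) := by
      have g1 : Generic q (al * q) := by simpa using h.mul_pow hq0 1
      have := qPoch_div_shift (g1.mul hq0) N
      rw [qPoch_div_shift g1] at this
      rw [show q ^ 2 * al * q = q * (q * (al * q)) by ring, this]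
      have n1 := g1.sub_ne_zero
      have n2 := (g1.mul hq0).sub_ne_zero
      rw [show al * q ^ (N + 1) = al * q * q ^ N by ring,
        show al * q ^ (N + 2) = q * (al * q) * q ^ N by ring,
        show al * q ^ 2 = q * (al * q) by ring]
      field_simp
    have r2 : qPoch (q ^ 2 * al * q / (q * B)) q N =
        qPoch (al * q / B) q N * (1 - al * q / B * q ^ N) / (1 - al * q / B) := by
      rw [← qPoch_div_shift gB']; congr 1; field_simp
    rw [r1, r2, qPoch_succ, qPoch_succ]
    have n1 := gB'.sub_ne_zero
    have n3 := gB'.sub_pow_ne_zero N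
    have n5 := (h.mul_pow hq0 1).sub_ne_zero
    have n6 := (h.mul_pow hq0 2).sub_ne_zero
    have n7 := (h.mul_pow hq0 (N + 1)).sub_ne_zero
    have n8 := (h.mul_pow hq0 (N + 2)).sub_ne_zero
    have n9 := gB'.qPoch N
    rw [pow_one] at n5
    have key : 1 - al * q * q ^ N = (1 - al * q / B * q ^ N) +
          al * q ^ (N + 1) / B * (1 - B) := by
      field_simp; ring
    rw [key]
    generalize qPoch (al * q / B) q N = x1 at *
    generalize 1 - al * q / B * q ^ N = x4 at *
    generalize 1 - al * q / B = x6 at *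
    generalize 1 - al * q ^ (N + 1) = x8 at *
    generalize 1 - al * q ^ (N + 2) = x9 at *
    generalize 1 - al * q ^ 2 = x10 at *
    generalize qPoch (al * q) q N = x11 at *
    generalize 1 - al * q = x12 at *
    generalize al * q ^ (N + 1) / B = x13 at *
    generalize 1 - B = x14 at *
    field_simp
    ring

/-- The series part of the `q`-Racah polynomial `p_n(x;a,b,c;L)`. -/
def racahHyp (q a b c : ℂ) (L n x : ℕ) : ℂ :=
  hyp q (b * c * q) (a * b * q) (q * b) (a * b * c * q ^ (L + 2)) (q ^ L)⁻¹ n x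

theorem mul_inv_pow_succ {q : ℂ} (hq : q ≠ 0) (L : ℕ) : q * (q ^ (L + 1))⁻¹ = (q ^ L)⁻¹ := by
  have := pow_ne_zero L hq
  field_simp
  ring

/-- Nonzero parameters of which no product is an integral power of `q`. -/
structure GenericTriple (q a b c : ℂ) : Prop where
  ne_a : a ≠ 0
  ne_b : b ≠ 0
  ne_c : c ≠ 0
  ga : Generic q a
  gb : Generic q b
  gc : Generic q c
  gab : Generic q (a * b)
  gac : Generic q (a * c)
  gbc : Generic q (b * c)
  gabc : Generic q (a * b * c)

theorem GenericTriple.shift {q a b c : ℂ} (hq : q ≠ 0) (h : GenericTriple q a b c) :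
    GenericTriple q (q * a) (q * b) c where
  ne_a := mul_ne_zero hq h.ne_a
  ne_b := mul_ne_zero hq h.ne_b
  ne_c := h.ne_c
  ga := h.ga.mul hq
  gb := h.gb.mul hq
  gc := h.gc
  gab := by rw [show q * a * (q * b) = a * b * q ^ 2 by ring]; exact h.gab.mul_pow hq 2
  gac := by rw [mul_assoc]; exact h.gac.mul hq
  gbc := by rw [mul_assoc]; exact h.gbc.mul hq
  gabc := by
    rw [show q * a * (q * b) * c = a * b * c * q ^ 2 by ring]; exact h.gabc.mul_pow hq 2

/-- `∏_{l=1}^n (1 - (s q^l)⁻¹) / (1 - t q^l)`. -/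
def ratioProd (q s t : ℂ) (n : ℕ) : ℂ :=
  ∏ l ∈ Finset.range n, (1 - (s * q ^ (l + 1))⁻¹) / (1 - t * q ^ (l + 1))

theorem ratioProd_zero (q s t : ℂ) : ratioProd q s t 0 = 1 := by simp [ratioProd]

theorem ratioProd_succ (q s t : ℂ) (n : ℕ) : ratioProd q s t (n + 1) =
    ratioProd q s t n * ((1 - (s * q ^ (n + 1))⁻¹) / (1 - t * q ^ (n + 1))) := by
  rw [ratioProd, Finset.prod_range_succ, ratioProd]

theorem ratioProd_shift {q t : ℂ} (s : ℂ) (ht : Generic q t) (n : ℕ) :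
    ratioProd q s (q * t) n * (1 - t * q ^ (n + 1)) = ratioProd q s t n * (1 - q * t) := by
  induction n with
  | zero => simp [ratioProd_zero, mul_comm]
  | succ n ih =>
    have h1 := ht.sub_pow_ne_zero (n + 1)
    have h2 := ht.sub_pow_ne_zero (n + 1 + 1)
    rw [ratioProd_succ, ratioProd_succ, show q * t * q ^ (n + 1) = t * q ^ (n + 1 + 1) by ring]
    generalize 1 - t * q ^ (n + 1 + 1) = d at *
    generalize 1 - t * q ^ (n + 1) = d' at *
    generalize 1 - (s * q ^ (n + 1))⁻¹ = e
    field_simp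
    linear_combination e * ih

theorem ratioProd_pred {q s t : ℂ} (hq : q ≠ 0) (hs : s ≠ 0) (ht : Generic q t)
    {n : ℕ} (hn : n ≠ 0) : ratioProd q s (q * t) (n - 1) * (1 - s * q ^ n) =
      -(ratioProd q s t n * (1 - q * t) * (s * q ^ n)) := by
  obtain ⟨n, rfl⟩ := Nat.exists_eq_succ_of_ne_zero hn
  rw [Nat.succ_eq_add_one, Nat.add_sub_cancel, ratioProd_succ]
  have h1 := ht.sub_pow_ne_zero (n + 1)
  have h2 := ratioProd_shift s ht n
  have h3 : 1 - s * q ^ (n + 1) = -(s * q ^ (n + 1) * (1 - (s * q ^ (n + 1))⁻¹)) := by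
    have := pow_ne_zero (n + 1) hq
    field_simp; ring
  rw [h3]
  generalize 1 - t * q ^ (n + 1) = d' at *
  generalize 1 - (s * q ^ (n + 1))⁻¹ = e
  rw [show ratioProd q s t n * (e / d') * (1 - q * t) * (s * q ^ (n + 1)) =
    ratioProd q s t n * (1 - q * t) * (e / d') * (s * q ^ (n + 1)) by ring, ← h2]
  field_simp

/-- The value at `i = b = 0` of the sum in `sum_racahHyp`. -/
def sumConst (q a b c : ℂ) (L : ℕ) : ℂ :=
  qPoch (a * b * q ^ 2) q L / qPoch ((c * q ^ L)⁻¹) q L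

theorem sumConst_succ {q a b c : ℂ} (hq : q ≠ 0) (h : GenericTriple q a b c) (L : ℕ) :
    sumConst q a b c (L + 1) * ((1 - (c * q ^ (L + 1))⁻¹) * (1 - a * b * q ^ (L + 3))) =
      sumConst q (q * a) (q * b) c L * ((1 - a * b * q ^ 2) * (1 - a * b * q ^ 3)) := by
  unfold sumConst
  have e1 : qPoch (a * b * q ^ 2) q (L + 1) * (1 - a * b * q ^ (L + 3)) =
      (1 - a * b * q ^ 2) * (1 - a * b * q ^ 3) * qPoch (q * a * (q * b) * q ^ 2) q L := by
    rw [show a * b * q ^ (L + 3) = a * b * q ^ 2 * q ^ (L + 1) by ring, ← qPoch_succ,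
      qPoch_succ', qPoch_succ']
    ring_nf
  have e2 : qPoch ((c * q ^ (L + 1))⁻¹) q (L + 1) =
      (1 - (c * q ^ (L + 1))⁻¹) * qPoch ((c * q ^ L)⁻¹) q L := by
    rw [qPoch_succ', mul_inv, mul_left_comm, mul_inv_pow_succ hq, mul_inv]
  have n1 : 1 - (c * q ^ (L + 1))⁻¹ ≠ 0 := (h.gc.mul_pow hq (L + 1)).inv.sub_ne_zero
  have n2 : qPoch ((c * q ^ L)⁻¹) q L ≠ 0 := (h.gc.mul_pow hq L).inv.qPoch L
  rw [e2]
  generalize 1 - (c * q ^ (L + 1))⁻¹ = d at *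
  generalize qPoch (c * q ^ L)⁻¹ q L = p at *
  generalize qPoch (a * b * q ^ 2) q (L + 1) = p' at *
  generalize qPoch (q * a * (q * b) * q ^ 2) q L = p'' at *
  field_simp
  linear_combination e1

theorem racahHyp_shift₁₂ {q : ℂ} (hq : q ≠ 0) (a b c : ℂ) (L n x : ℕ) :
    hyp q (q * (b * c * q)) (q ^ 2 * (a * b * q)) (q * (q * b))
      (q * (a * b * c * q ^ (L + 1 + 2))) (q * (q ^ (L + 1))⁻¹) n x =
    racahHyp q (q * a) (q * b) c L n x := by
  unfold racahHyp
  rw [mul_inv_pow_succ hq]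
  congr 1 <;> ring

theorem racahHyp_shift₂₃ {q : ℂ} (hq : q ≠ 0) (a b c : ℂ) (L n x : ℕ) :
    hyp q (q ^ 2 * (b * c * q)) (q * (a * b * q)) (q * (q * b))
      (q * (a * b * c * q ^ (L + 1 + 2))) (q * (q ^ (L + 1))⁻¹) n x =
    racahHyp q a (q * b) (q * c) L n x := by
  unfold racahHyp
  rw [mul_inv_pow_succ hq]
  congr 1 <;> ring

theorem racahHyp_shift₁₃ {q : ℂ} (hq : q ≠ 0) (a b c : ℂ) (L n x : ℕ) :
    hyp q (q * (b * c * q)) (q * (a * b * q)) (q * b)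
      (q * (a * b * c * q ^ (L + 1 + 2))) (q * (q ^ (L + 1))⁻¹) n x =
    racahHyp q (q * a) b (q * c) L n x := by
  unfold racahHyp
  rw [mul_inv_pow_succ hq]
  congr 1 <;> ring

/-- The weight in `sum_racahHyp`. -/
def sumWeight (q a b c : ℂ) (L n : ℕ) : ℂ :=
  vwpTermLim q (a * b * q) (a * b * c * q ^ (L + 2)) L n

theorem sumWeight_succ {q a b c : ℂ} (hq : NonRoot q) (h : GenericTriple q a b c) (L m : ℕ) :
    sumWeight q a b c (L + 1) (m + 1) * ((1 - (q ^ (m + 1))⁻¹) * (1 - a * b * q * q ^ (m + 1))) =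
      ((1 - a * b * q ^ 2) * (1 - a * b * q ^ 3) * (1 - a * b * c * q ^ (L + 1 + 2)) *
        (1 - (q ^ (L + 1))⁻¹) / ((1 - (c * q ^ (L + 1))⁻¹) * (1 - a * b * q ^ (L + 3)) *
          (q * c))) * sumWeight q (q * a) (q * b) c L m := by
  have hq0 := hq.ne
  have ha := h.ne_a
  have hb := h.ne_b
  have hc := h.ne_c
  have key := vwpTermLim_succ (B := a * b * c * q ^ (L + 1 + 2)) hq
    (by simpa using h.gab.mul_pow hq0 1 : Generic q (a * b * q))
    (by have := pow_ne_zero (L + 1 + 2) hq0; simp_all) L m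
  unfold sumWeight
  rw [key]
  have e1 : a * b * q * q / (a * b * c * q ^ (L + 1 + 2)) = (c * q ^ (L + 1))⁻¹ := by
    field_simp; ring
  have e2 : a * b * q * q ^ (L + 1) / (a * b * c * q ^ (L + 1 + 2)) = (q * c)⁻¹ := by
    field_simp; ring
  rw [e1, e2, show q * a * (q * b) * q = q ^ 2 * (a * b * q) by ring,
    show q * a * (q * b) * c * q ^ (L + 2) = q * (a * b * c * q ^ (L + 1 + 2)) by ring,
    show a * b * q * q = a * b * q ^ 2 by ring, show a * b * q * q ^ 2 = a * b * q ^ 3 by ring,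
    show a * b * q * q ^ (L + 2) = a * b * q ^ (L + 3) by ring]
  congr 1
  rw [← div_eq_mul_inv, div_div]

theorem NonRoot.one_sub_inv_ne_zero {q : ℂ} (hq : NonRoot q) (L : ℕ) :
    1 - (q ^ (L + 1))⁻¹ ≠ 0 := by
  simpa [QRacah.qPoch] using hq.qPoch_inv_pow (show 1 ≤ L + 1 by omega)

theorem Generic.one_sub_mul_sq_ne_zero {q c : ℂ} (h : Generic q c) (n : ℕ) :
    1 - c * (q ^ n) ^ 2 ≠ 0 := by
  rw [← pow_mul]; exact h.sub_pow_ne_zero _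

theorem sum_racahHyp_step_aux {A A' D D0 D1 E E' P0 P1 H0 H1 S0 S1 T0 T1 rho q c mu I J X n m g1 gB
    g3 f1 eps l B d3 d1 : ℂ}
    (sfb : g1 * gB * g3 * (mu * f1 * gB * g3 * X * n) * (S1 - S0) =
      q * (l * I - J) * rho * (mu * m * (1 - d1 * X) * (1 - B * X) * (1 - d3 * X) * T0 -
        (1 - X) * (d1 - mu * X) * (B - mu * X) * (d3 - mu * X) * T1))
    (hT0 : (1 - d3 * X) * T0 = (1 - d3 * X) * (A' * E' * D0 * H0))
    (hT1 : T1 = A' * E' * D1 * H1)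
    (F0 : D0 * (1 - d1 * X) = D * f1)
    (F1 : (1 - X) * (d1 - mu * X) * D1 = -((1 - X) * D * f1 * mu * X))
    (hE : E' * eps = E * g1)
    (R7 : gB * g3 * X * n * ((1 - q * c * I) * P1 + I * (q * c - l * q * I) * P0) =
      (1 - l * q * I ^ 2) * (m * (1 - B * X) * (1 - d3 * X) * H0 -
        X * (X - 1) * (mu * X - B) * (mu * X - d3) * H1))
    (hJ : J * (q * I) = 1) (hA : rho * A' * (q * c) = A * gB * g3)
    (heps : q * c - l * q * I = q * c * eps)
    (n1 : g1 ≠ 0) (n2 : gB ≠ 0) (n3 : g3 ≠ 0) (n4 : mu ≠ 0) (n5 : f1 ≠ 0) (n6 : X ≠ 0)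
    (n7 : n ≠ 0) (n8 : eps ≠ 0) (n9 : c ≠ 0) :
    S1 - S0 = A * (E * ((1 - c⁻¹ * J) / eps)) * D * P1 - A * E * D * P0 := by
  have s1 : g1 * gB * g3 * (mu * f1 * gB * g3 * X * n) * (S1 - S0) =
      -(q * J * (rho * A') * mu * f1 * D * E' *
        (gB * g3 * X * n * ((1 - q * c * I) * P1 + I * (q * c - l * q * I) * P0))) := by
    rw [sfb, R7, hT1]
    have hlJ : l * I - J = -((1 - l * q * I ^ 2) * J) := by linear_combination (-l * I) * hJ
    rw [hlJ]
    linear_combination (q * (-((1 - l * q * I ^ 2) * J)) * rho) *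
      (mu * m * (1 - d1 * X) * (1 - B * X) * hT0 +
        mu * m * (1 - B * X) * ((1 - d3 * X) * (A' * E' * H0)) * F0 -
        (B - mu * X) * (d3 - mu * X) * (A' * E' * H1) * F1)
  have s2 : (gB * g3 * gB * g3 * mu * f1 * X * n) * (g1 * c * (S1 - S0)) =
      (gB * g3 * gB * g3 * mu * f1 * X * n) *
        (-(J * A * D * E' * ((1 - q * c * I) * P1 + I * (q * c - l * q * I) * P0))) := by
    linear_combination c * s1 - (J * mu * f1 * D * E' *
        (gB * g3 * X * n * ((1 - q * c * I) * P1 + I * (q * c - l * q * I) * P0))) * hA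
  have s3 := mul_left_cancel₀ (by positivity) s2
  have s4 : g1 * c * eps * (S1 - S0) = g1 * c * eps *
      (A * (E * ((1 - c⁻¹ * J) / eps)) * D * P1 - A * E * D * P0) := by
    have e1 : c * eps * ((1 - c⁻¹ * J) / eps) = c - J := by field_simp
    rw [heps] at s3
    linear_combination eps * s3 -
      (J * A * D * ((1 - q * c * I) * P1 + I * (q * c * eps) * P0)) * hE -
      (g1 * A * E * D * P1) * e1 + (g1 * A * E * D * P1 * c - g1 * A * E * D * c * eps * P0) * hJ
  exact mul_left_cancel₀ (by positivity) s4

/-- The sum in `sum_racahHyp_mul`. -/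
def racahSum (q a b c : ℂ) (L i x : ℕ) : ℂ :=
  ∑ m ∈ Finset.range (L + 1), sumWeight q a b c L m * racahHyp q a b c L i m *
    racahHyp q c a b L m x

/-- The factor in `sum_racahHyp_mul`. -/
def racahSumFactor (q a b c : ℂ) (L i x : ℕ) : ℂ :=
  sumConst q a b c L * ratioProd q c b i * ratioProd q c a x

theorem racahSum_succ_sub {q a b c : ℂ} (hq : NonRoot q) (h : GenericTriple q a b c) (L i x : ℕ)
    (hi : i ≤ L) (hx : x ≤ L + 1)
    (ih : ∀ y, y ≤ L → racahSum q (q * a) (q * b) c L i y =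
      racahSumFactor q (q * a) (q * b) c L i y * racahHyp q (q * a) c (q * b) L i y) :
    racahSum q a b c (L + 1) (i + 1) x - racahSum q a b c (L + 1) i x =
      racahSumFactor q a b c (L + 1) (i + 1) x * racahHyp q a c b (L + 1) (i + 1) x -
      racahSumFactor q a b c (L + 1) i x * racahHyp q a c b (L + 1) i x := by
  have hq0 := hq.ne
  have gB : Generic q (a * b * c * q ^ (L + 1 + 2)) := h.gabc.mul_pow hq0 _
  have g3 : ∀ k ≤ L + 1, qPoch (q ^ (L + 1))⁻¹ q k ≠ 0 := fun k hk => hq.qPoch_inv_pow hk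
  have g31 := hq.one_sub_inv_ne_zero L
  have hX := pow_ne_zero x hq0
  have ha := h.ne_a
  have hb := h.ne_b
  have hc := h.ne_c
  have gmu : Generic q (c * a * q) := by
    rw [mul_comm c]; simpa using h.gac.mul_pow hq0 1
  have sfb := sum_forward_backward (l := b * c * q) (al := a * b * q) (b₁ := q * b)
    (b₂ := a * b * c * q ^ (L + 1 + 2)) (b₃ := (q ^ (L + 1))⁻¹) (mu := c * a * q) (d₁ := q * a)
    (d₂ := a * b * c * q ^ (L + 1 + 2)) (d₃ := (q ^ (L + 1))⁻¹) hq0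
    (sumWeight q a b c (L + 1)) (sumWeight q (q * a) (q * b) c L) L i x
    (fun m _ => sumWeight_succ hq h L m) (h.gb.mul hq0).sub_ne_zero gB.sub_ne_zero g31
    (hq.qPoch _) (by field_simp; ring) ((h.ga.mul hq0).qPoch _) (gB.qPoch _) (g3 _ le_rfl)
    (hq.qPoch _)
  have ex := hyp_exchange (lam := b * c * q) (mu := c * a * q) (b₁ := q * c)
    (b₂ := a * b * c * q ^ (L + 1 + 2)) (b₃ := (q ^ (L + 1))⁻¹) hq0 i x
    ((h.gc.mul hq0).qPoch _) (gB.qPoch _) (g3 _ (by omega)) (hq.qPoch _)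
  have r1 : ∀ i m, hyp q (b * c * q) (a * b * q) (q * b) (a * b * c * q ^ (L + 1 + 2))
      (q ^ (L + 1))⁻¹ i m = racahHyp q a b c (L + 1) i m := fun i m => rfl
  have r2 : ∀ i m, hyp q (a * b * q) (c * a * q) (q * a) (a * b * c * q ^ (L + 1 + 2))
      (q ^ (L + 1))⁻¹ i m = racahHyp q c a b (L + 1) i m := fun i m => by
    unfold racahHyp; congr 1; ring
  have r3 : ∀ i m, hyp q (b * c * q) (c * a * q) (q * c) (a * b * c * q ^ (L + 1 + 2))
      (q ^ (L + 1))⁻¹ i m = racahHyp q a c b (L + 1) i m := fun i m => by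
    unfold racahHyp; congr 1 <;> ring
  have r4 : ∀ i m, hyp q (q ^ 2 * (a * b * q)) (q * (c * a * q)) (q * (q * a))
      (q * (a * b * c * q ^ (L + 1 + 2))) (q * (q ^ (L + 1))⁻¹) i m =
      racahHyp q c (q * a) (q * b) L i m := fun i m => by
    rw [← racahHyp_shift₂₃ hq0]; congr 1; ring
  have r5 : ∀ i m, hyp q (q * (b * c * q)) (q * (c * a * q)) (q * c)
      (q * (a * b * c * q ^ (L + 1 + 2))) (q * (q ^ (L + 1))⁻¹) i m =
      racahHyp q (q * a) c (q * b) L i m := fun i m => by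
    rw [← racahHyp_shift₁₃ hq0]; congr 1 <;> ring
  simp only [r1, r2, r4, racahHyp_shift₁₂ hq0] at sfb
  simp only [r3, r5] at ex
  have hrho : ((1 - a * b * q ^ 2) * (1 - a * b * q ^ 3) * (1 - a * b * c * q ^ (L + 1 + 2)) *
        (1 - (q ^ (L + 1))⁻¹) / ((1 - (c * q ^ (L + 1))⁻¹) * (1 - a * b * q ^ (L + 3)) *
          (q * c))) * sumConst q (q * a) (q * b) c L * (q * c) =
      sumConst q a b c (L + 1) * (1 - a * b * c * q ^ (L + 1 + 2)) * (1 - (q ^ (L + 1))⁻¹) := by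
    have e := sumConst_succ hq0 h L
    have n1 : 1 - (c * q ^ (L + 1))⁻¹ ≠ 0 := (h.gc.mul_pow hq0 (L + 1)).inv.sub_ne_zero
    have n2 := h.gab.sub_pow_ne_zero (L + 3)
    generalize 1 - (c * q ^ (L + 1))⁻¹ = d1 at *
    generalize 1 - a * b * q ^ (L + 3) = d2 at *
    generalize 1 - (q ^ (L + 1))⁻¹ = d3
    generalize 1 - a * b * c * q ^ (L + 1 + 2) = d4
    generalize 1 - a * b * q ^ 2 = d5 at *
    generalize 1 - a * b * q ^ 3 = d6 at *
    field_simp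
    linear_combination (-d3 * d4) * e
  have key := sum_racahHyp_step_aux (A := sumConst q a b c (L + 1))
    (A' := sumConst q (q * a) (q * b) c L)
    (D := ratioProd q c a x) (D0 := ratioProd q c (q * a) x) (D1 := ratioProd q c (q * a) (x - 1))
    (E := ratioProd q c b i) (E' := ratioProd q c (q * b) i)
    (T0 := racahSum q (q * a) (q * b) c L i x)
    (T1 := racahSum q (q * a) (q * b) c L i (x - 1))
    (eps := 1 - b * q ^ (i + 1)) sfb ?_ (ih _ (by omega)) ?_ ?_ (ratioProd_shift c h.gb i)
    ex ?_ hrho ?_ (h.gb.mul hq0).sub_ne_zero gB.sub_ne_zero g31 (by positivity)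
    (h.ga.mul hq0).sub_ne_zero hX (gmu.one_sub_mul_sq_ne_zero x)
    (h.gb.sub_pow_ne_zero _) hc
  · unfold racahSumFactor
    rw [ratioProd_succ, mul_inv]
    exact key
  · rcases Nat.lt_or_ge L x with hx' | hx'
    · obtain rfl : x = L + 1 := by omega
      rw [inv_mul_cancel₀ (pow_ne_zero _ hq0)]; simp
    · rw [ih x hx']; rfl
  · rw [← ratioProd_shift c h.ga x]; ring
  · rcases eq_or_ne x 0 with rfl | hx0
    · simp
    · linear_combination ((1 - q ^ x) * q * a) * ratioProd_pred hq0 hc h.ga hx0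
  · rw [pow_succ']; exact inv_mul_cancel₀ (mul_ne_zero hq0 (pow_ne_zero i hq0))
  · ring

theorem racahSum_zero_succ_sub {q a b c : ℂ} (hq : NonRoot q) (h : GenericTriple q a b c)
    (L x : ℕ) (ih : racahSum q (q * a) (q * b) c L 0 x =
      racahSumFactor q (q * a) (q * b) c L 0 x) :
    racahSum q a b c (L + 1) 0 (x + 1) - racahSum q a b c (L + 1) 0 x =
      racahSumFactor q a b c (L + 1) 0 (x + 1) - racahSumFactor q a b c (L + 1) 0 x := by
  have hq0 := hq.ne
  have gB : Generic q (a * b * c * q ^ (L + 1 + 2)) := h.gabc.mul_pow hq0 _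
  have g31 := hq.one_sub_inv_ne_zero L
  have hX := pow_ne_zero x hq0
  have ha := h.ne_a
  have hb := h.ne_b
  have hc := h.ne_c
  have sf := sum_forward (al := a * b * q) (mu := c * a * q) (d₁ := q * a)
    (d₂ := a * b * c * q ^ (L + 1 + 2)) (d₃ := (q ^ (L + 1))⁻¹) hq0
    (sumWeight q a b c (L + 1)) (sumWeight q (q * a) (q * b) c L) L x
    (fun m _ => sumWeight_succ hq h L m) (h.ga.mul hq0).sub_ne_zero gB.sub_ne_zero g31
    (hq.qPoch _)
  have r2 : ∀ i m, hyp q (a * b * q) (c * a * q) (q * a) (a * b * c * q ^ (L + 1 + 2))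
      (q ^ (L + 1))⁻¹ i m = racahHyp q c a b (L + 1) i m := fun i m => by
    unfold racahHyp; congr 1; ring
  have r4 : ∀ i m, hyp q (q ^ 2 * (a * b * q)) (q * (c * a * q)) (q * (q * a))
      (q * (a * b * c * q ^ (L + 1 + 2))) (q * (q ^ (L + 1))⁻¹) i m =
      racahHyp q c (q * a) (q * b) L i m := fun i m => by
    rw [← racahHyp_shift₂₃ hq0]; congr 1; ring
  have r0 : ∀ (a b : ℂ) L x, racahSum q a b c L 0 x = ∑ m ∈ Finset.range (L + 1),
      sumWeight q a b c L m * racahHyp q c a b L m x := fun a b L x =>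
    Finset.sum_congr rfl fun m _ => by rw [racahHyp, hyp_zero_left, mul_one]
  simp only [r2, r4] at sf
  rw [← r0, ← r0, ← r0, ih] at sf
  have hD := ratioProd_shift c h.ga x
  have n1 : 1 - (c * q ^ (L + 1))⁻¹ ≠ 0 := (h.gc.mul_pow hq0 (L + 1)).inv.sub_ne_zero
  have n2 := h.gab.sub_pow_ne_zero (L + 3)
  have n3 := h.ga.sub_pow_ne_zero (x + 1)
  have n4 := gB.sub_ne_zero
  have n5 := (h.ga.mul hq0).sub_ne_zero
  have e := sumConst_succ hq0 h L
  unfold racahSumFactor at *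
  rw [ratioProd_succ]
  rw [ratioProd_zero] at *
  have hJ : (c * a * q * q ^ x - (q ^ (x + 1))⁻¹) * q =
      -(c * q) * ((1 - a * q ^ (x + 1)) - (1 - (c * q ^ (x + 1))⁻¹)) := by
    field_simp; ring
  generalize c * a * q * q ^ x - (q ^ (x + 1))⁻¹ = k0 at *
  generalize 1 - (c * q ^ (L + 1))⁻¹ = d1 at *
  generalize 1 - a * b * q ^ (L + 3) = d2 at *
  generalize 1 - (q ^ (L + 1))⁻¹ = d3 at *
  generalize 1 - a * b * c * q ^ (L + 1 + 2) = d4 at *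
  generalize 1 - a * b * q ^ 2 = d5 at *
  generalize 1 - a * b * q ^ 3 = d6 at *
  generalize 1 - a * q ^ (x + 1) = d7 at *
  generalize 1 - q * a = d8 at *
  generalize 1 - (c * q ^ (x + 1))⁻¹ = d9 at *
  generalize racahSum q a b c (L + 1) 0 (x + 1) - racahSum q a b c (L + 1) 0 x = S at *
  generalize sumConst q a b c (L + 1) = A at *
  generalize sumConst q (q * a) (q * b) c L = A' at *
  generalize ratioProd q c a x = D at *
  generalize ratioProd q c (q * a) x = D' at *
  have s1 : d8 * d4 * d3 * (d1 * d2 * c) * S = k0 * d5 * d6 * d4 * d3 * A' * D' := by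
    field_simp at sf
    linear_combination (d4 * d3) * sf
  have s2 : d8 * d4 * d3 * (d1 * d2 * c * d7 * q) * S =
      d8 * d4 * d3 * (d1 * d2 * c * d7 * q) * (A * 1 * (D * (d9 / d7)) - A * 1 * D) := by
    have e1 : d7 * (d9 / d7) = d9 := by field_simp
    linear_combination d7 * q * s1 + (k0 * d5 * d6 * d4 * d3 * A' * q) * hD +
      (d5 * d6 * d4 * d3 * A' * D * d8) * hJ + (c * q) * (d7 - d9) * (d4 * d3 * d8 * D) * e -
      d8 * d4 * d3 * (d1 * d2 * c * q) * A * D * e1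
  exact mul_left_cancel₀ (by positivity) s2

theorem racahSum_eq {q : ℂ} (hq : NonRoot q) (L : ℕ) : ∀ {a b c : ℂ}, GenericTriple q a b c →
    ∀ i x, i ≤ L → x ≤ L →
    racahSum q a b c L i x = racahSumFactor q a b c L i x * racahHyp q a c b L i x := by
  induction L with
  | zero =>
    intro a b c h i x hi hx
    obtain rfl : i = 0 := by omega
    obtain rfl : x = 0 := by omega
    have h0 : 1 - a * b * q ≠ 0 := by simpa using h.gab.sub_pow_ne_zero 1
    simp [racahSum, racahSumFactor, racahHyp, hyp_zero_left, sumWeight, vwpTermLim, vwp_zero h0,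
      sumConst, ratioProd_zero, qPoch_zero]
  | succ L ih =>
    intro a b c h i
    have hq0 := hq.ne
    induction i with
    | zero =>
      intro x _ hx
      have r : ∀ x, racahHyp q a c b (L + 1) 0 x = 1 := fun x => hyp_zero_left ..
      rw [r, mul_one]
      induction x with
      | zero =>
        have hB : a * b * c * q ^ (L + 1 + 2) ≠ 0 := by
          have := pow_ne_zero (L + 1 + 2) hq0
          have := h.ne_a
          have := h.ne_b
          have := h.ne_c
          positivity
        have ha := h.ne_a
        have hb := h.ne_b
        have hc := h.ne_c
        have e := sum_vwpTermLim hq (L + 1) (by simpa using h.gab.mul_pow hq0 1 :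
          Generic q (a * b * q)) hB (by
            have := (h.gc.mul_pow hq0 (L + 2)).inv
            rw [show a * b * q / (a * b * c * q ^ (L + 1 + 2)) = (c * q ^ (L + 2))⁻¹ by
              field_simp; ring]
            exact this)
        rw [racahSumFactor, ratioProd_zero, ratioProd_zero, mul_one, mul_one, sumConst]
        rw [show a * b * q ^ 2 = a * b * q * q by ring,
          show (c * q ^ (L + 1))⁻¹ = a * b * q * q / (a * b * c * q ^ (L + 1 + 2)) by
            field_simp; ring, ← e]
        refine Finset.sum_congr rfl fun m _ => ?_
        rw [racahHyp, racahHyp, hyp_zero_left, hyp_zero_right hq0, mul_one, mul_one]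
        rfl
      | succ x ihx =>
        have s := racahSum_zero_succ_sub hq h L x (by
          rw [ih (h.shift hq0) 0 x (by omega) (by omega), racahHyp, hyp_zero_left, mul_one])
        linear_combination s + ihx (by omega)
    | succ i ihi =>
      intro x hi hx
      have s := racahSum_succ_sub hq h L i x (by omega) hx
        fun y hy => ih (h.shift hq0) i y (by omega) hy
      linear_combination s + ihi x (by omega) hx

/-- Five nonzero parameters in general position whose product is `q^{-2N-3}`. -/
structure GenericFive (q c₀ c₁ c₂ c₃ c₄ : ℂ) (N : ℕ) : Prop where
  hq : NonRoot q
  bal : q ^ (2 * N + 3) * (c₀ * c₁ * c₂ * c₃ * c₄) = 1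
  n0 : c₀ ≠ 0
  n1 : c₁ ≠ 0
  n2 : c₂ ≠ 0
  n3 : c₃ ≠ 0
  n4 : c₄ ≠ 0
  g0 : Generic q c₀
  g1 : Generic q c₁
  g2 : Generic q c₂
  g3 : Generic q c₃
  g4 : Generic q c₄
  g01 : Generic q (c₀ * c₁)
  g02 : Generic q (c₀ * c₂)
  g03 : Generic q (c₀ * c₃)
  g04 : Generic q (c₀ * c₄)
  g12 : Generic q (c₁ * c₂)
  g13 : Generic q (c₁ * c₃)
  g14 : Generic q (c₁ * c₄)
  g23 : Generic q (c₂ * c₃)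
  g24 : Generic q (c₂ * c₄)
  g34 : Generic q (c₃ * c₄)

theorem Generic.comm {q a b : ℂ} (h : Generic q (a * b)) : Generic q (b * a) := by
  rwa [mul_comm]

theorem Generic.shift_left {q a b : ℂ} (hq : q ≠ 0) (h : Generic q (a * b)) :
    Generic q (q * a * b) := by
  rw [mul_assoc]; exact h.mul hq

theorem Generic.shift_right {q a b : ℂ} (hq : q ≠ 0) (h : Generic q (a * b)) :
    Generic q (a * (q * b)) := by
  rw [mul_left_comm]; exact h.mul hq

theorem Generic.shift_both {q a b : ℂ} (hq : q ≠ 0) (h : Generic q (a * b)) :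
    Generic q (q * a * (q * b)) :=
  (h.shift_right hq).shift_left hq

namespace GenericFive

variable {q c₀ c₁ c₂ c₃ c₄ : ℂ} {N : ℕ}

theorem mirror (h : GenericFive q c₀ c₁ c₂ c₃ c₄ N) : GenericFive q c₀ c₂ c₁ c₄ c₃ N where
  hq := h.hq
  bal := by rw [← h.bal]; ring
  n0 := h.n0
  n1 := h.n2
  n2 := h.n1
  n3 := h.n4
  n4 := h.n3
  g0 := h.g0
  g1 := h.g2
  g2 := h.g1
  g3 := h.g4
  g4 := h.g3
  g01 := h.g02
  g02 := h.g01
  g03 := h.g04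
  g04 := h.g03
  g12 := h.g12.comm
  g13 := h.g24
  g14 := h.g23
  g23 := h.g14
  g24 := h.g13
  g34 := h.g34.comm

/-- Exchange of `c₂` with `c₃` and of `c₀` with `c₄`. -/
theorem exchange (h : GenericFive q c₀ c₁ c₂ c₃ c₄ N) : GenericFive q c₄ c₁ c₃ c₂ c₀ N where
  hq := h.hq
  bal := by rw [← h.bal]; ring
  n0 := h.n4
  n1 := h.n1
  n2 := h.n3
  n3 := h.n2
  n4 := h.n0
  g0 := h.g4
  g1 := h.g1
  g2 := h.g3
  g3 := h.g2
  g4 := h.g0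
  g01 := h.g14.comm
  g02 := h.g34.comm
  g03 := h.g24.comm
  g04 := h.g04.comm
  g12 := h.g13
  g13 := h.g12
  g14 := h.g01.comm
  g23 := h.g23.comm
  g24 := h.g03.comm
  g34 := h.g02.comm

theorem shift₁₂ (h : GenericFive q c₀ c₁ c₂ c₃ c₄ (N + 1)) :
    GenericFive q c₀ (q * c₁) (q * c₂) c₃ c₄ N where
  hq := h.hq
  bal := by rw [← h.bal]; ring
  n0 := h.n0
  n1 := mul_ne_zero h.hq.ne h.n1
  n2 := mul_ne_zero h.hq.ne h.n2
  n3 := h.n3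
  n4 := h.n4
  g0 := h.g0
  g1 := h.g1.mul h.hq.ne
  g2 := h.g2.mul h.hq.ne
  g3 := h.g3
  g4 := h.g4
  g01 := h.g01.shift_right h.hq.ne
  g02 := h.g02.shift_right h.hq.ne
  g03 := h.g03
  g04 := h.g04
  g12 := h.g12.shift_both h.hq.ne
  g13 := h.g13.shift_left h.hq.ne
  g14 := h.g14.shift_left h.hq.ne
  g23 := h.g23.shift_left h.hq.ne
  g24 := h.g24.shift_left h.hq.ne
  g34 := h.g34

theorem shift₀₄ (h : GenericFive q c₀ c₁ c₂ c₃ c₄ (N + 1)) :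
    GenericFive q (q * c₀) c₁ c₂ c₃ (q * c₄) N where
  hq := h.hq
  bal := by rw [← h.bal]; ring
  n0 := mul_ne_zero h.hq.ne h.n0
  n1 := h.n1
  n2 := h.n2
  n3 := h.n3
  n4 := mul_ne_zero h.hq.ne h.n4
  g0 := h.g0.mul h.hq.ne
  g1 := h.g1
  g2 := h.g2
  g3 := h.g3
  g4 := h.g4.mul h.hq.ne
  g01 := h.g01.shift_left h.hq.ne
  g02 := h.g02.shift_left h.hq.ne
  g03 := h.g03.shift_left h.hq.ne
  g04 := h.g04.shift_both h.hq.ne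
  g12 := h.g12
  g13 := h.g13
  g14 := h.g14.shift_right h.hq.ne
  g23 := h.g23
  g24 := h.g24.shift_right h.hq.ne
  g34 := h.g34.shift_right h.hq.ne

theorem triple_aux {a b x y z : ℂ} (hq : q ≠ 0) (g : Generic q (x * y))
    (h : q ^ (2 * N + 3) * (a * b * z * (x * y)) = 1) : Generic q (a * b * z) := by
  have e : a * b * z = (x * y * q ^ (2 * N + 3))⁻¹ := by
    refine eq_inv_of_mul_eq_one_left ?_
    rw [← h]; ring
  rw [e]
  exact (g.mul_pow hq _).inv

theorem g123 (h : GenericFive q c₀ c₁ c₂ c₃ c₄ N) : Generic q (c₁ * c₂ * c₃) :=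
  triple_aux (N := N) h.hq.ne h.g04 (by rw [← h.bal]; ring)

theorem g124 (h : GenericFive q c₀ c₁ c₂ c₃ c₄ N) : Generic q (c₁ * c₂ * c₄) :=
  triple_aux (N := N) h.hq.ne h.g03 (by rw [← h.bal]; ring)

theorem g013 (h : GenericFive q c₀ c₁ c₂ c₃ c₄ N) : Generic q (c₀ * c₁ * c₃) :=
  triple_aux (N := N) h.hq.ne h.g24 (by rw [← h.bal]; ring)

theorem g024 (h : GenericFive q c₀ c₁ c₂ c₃ c₄ N) : Generic q (c₀ * c₂ * c₄) :=
  triple_aux (N := N) h.hq.ne h.g13 (by rw [← h.bal]; ring)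

theorem g034 (h : GenericFive q c₀ c₁ c₂ c₃ c₄ N) : Generic q (c₀ * c₃ * c₄) :=
  triple_aux (N := N) h.hq.ne h.g12 (by rw [← h.bal]; ring)

end GenericFive

theorem qPoch_mul_eq {z q : ℂ} (hz : 1 - z ≠ 0) (n : ℕ) :
    qPoch (q * z) q n = qPoch z q n * ((1 - z * q ^ n) / (1 - z)) := by
  rw [← mul_div_assoc, qPoch_shift, mul_div_cancel_left₀ _ hz]

/-- The value of the sum in `sum_vwpTerm_mul_hyp_mul_hyp`. -/
def twoHypConst (q c₀ c₁ c₂ c₃ c₄ : ℂ) (N b x : ℕ) : ℂ :=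
  qPoch (c₁ * c₂ * q ^ 2) q N * qPoch (q * c₀) q N /
      (qPoch (c₃ * q ^ N)⁻¹ q N * qPoch (c₄ * q ^ N)⁻¹ q N) *
    (qPoch (q * c₃) q b / qPoch (q * c₁) q b *
      (qPoch ((q ^ N)⁻¹ * q ^ x) q b * qPoch (c₁ * c₃ * q ^ (N + 2)) q b *
          qPoch (c₀ * c₁ * c₃ * q ^ (N + 2) * (q ^ x)⁻¹) q b /
        (qPoch (c₁ * c₃ * q ^ (N + 2) * (q ^ x)⁻¹) q b * qPoch (q ^ N)⁻¹ q b *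
          qPoch ((c₀ * q ^ N)⁻¹ * q ^ x) q b)) * ((c₀ * c₃ * q ^ (N + 1))⁻¹) ^ b) *
    (qPoch (q * c₄) q x / qPoch (q * c₂) q x *
      (qPoch (c₀ * c₂ * c₄ * q ^ (N + 2)) q x / qPoch (c₀ * q ^ N)⁻¹ q x) *
        ((c₀ * c₄ * q ^ (N + 1))⁻¹) ^ x)

theorem twoHypConst_succ_left {q c₀ c₁ c₂ c₃ c₄ : ℂ} {N : ℕ} (b x : ℕ) :
    twoHypConst q c₀ c₁ c₂ c₃ c₄ N (b + 1) x = twoHypConst q c₀ c₁ c₂ c₃ c₄ N b x *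
      ((1 - q * c₃ * q ^ b) * (1 - (q ^ N)⁻¹ * q ^ x * q ^ b) *
        (1 - c₁ * c₃ * q ^ (N + 2) * q ^ b) * (1 - c₀ * c₁ * c₃ * q ^ (N + 2) * (q ^ x)⁻¹ * q ^ b) /
      ((1 - q * c₁ * q ^ b) * (1 - c₁ * c₃ * q ^ (N + 2) * (q ^ x)⁻¹ * q ^ b) *
        (1 - (q ^ N)⁻¹ * q ^ b) * (1 - (c₀ * q ^ N)⁻¹ * q ^ x * q ^ b)) *
        (c₀ * c₃ * q ^ (N + 1))⁻¹) := by
  unfold twoHypConst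
  simp only [qPoch_succ, pow_succ _ b]
  simp only [div_eq_mul_inv, mul_inv]
  ring

theorem twoHypConst_aux {q c₀ c₁ c₂ c₃ c₄ : ℂ} {N : ℕ}
    (h : GenericFive q c₀ c₁ c₂ c₃ c₄ (N + 1)) :
    qPoch (q * c₁ * (q * c₂) * q ^ 2) q N * qPoch (q * c₀) q N /
      (qPoch (c₃ * q ^ N)⁻¹ q N * qPoch (c₄ * q ^ N)⁻¹ q N) =
    qPoch (c₁ * c₂ * q ^ 2) q (N + 1) * qPoch (q * c₀) q (N + 1) /
      (qPoch (c₃ * q ^ (N + 1))⁻¹ q (N + 1) * qPoch (c₄ * q ^ (N + 1))⁻¹ q (N + 1)) *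
    ((1 - c₁ * c₂ * q ^ (N + 3)) * (1 - (c₃ * q ^ (N + 1))⁻¹) * (1 - (c₄ * q ^ (N + 1))⁻¹) /
      ((1 - c₁ * c₂ * q ^ 2) * (1 - c₁ * c₂ * q ^ 3) * (1 - c₀ * q ^ (N + 1)))) := by
  have hq0 := h.hq.ne
  have e1 : qPoch (c₁ * c₂ * q ^ 2) q (N + 1) * (1 - c₁ * c₂ * q ^ (N + 3)) =
      (1 - c₁ * c₂ * q ^ 2) * (1 - c₁ * c₂ * q ^ 3) *
        qPoch (q * c₁ * (q * c₂) * q ^ 2) q N := by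
    rw [show c₁ * c₂ * q ^ (N + 3) = c₁ * c₂ * q ^ 2 * q ^ (N + 1) by ring, ← qPoch_succ,
      qPoch_succ', qPoch_succ']
    ring_nf
  have e2 : ∀ c : ℂ, qPoch ((c * q ^ (N + 1))⁻¹) q (N + 1) =
      (1 - (c * q ^ (N + 1))⁻¹) * qPoch ((c * q ^ N)⁻¹) q N := by
    intro c
    rw [qPoch_succ', mul_inv, mul_left_comm, mul_inv_pow_succ hq0, mul_inv]
  have e3 : qPoch (q * c₀) q (N + 1) = qPoch (q * c₀) q N * (1 - c₀ * q ^ (N + 1)) := by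
    rw [qPoch_succ]; ring
  have m1 := (h.g3.mul_pow hq0 (N + 1)).inv.sub_ne_zero
  have m2 := (h.g4.mul_pow hq0 (N + 1)).inv.sub_ne_zero
  have m3 := (h.g3.mul_pow hq0 N).inv.qPoch N
  have m4 := (h.g4.mul_pow hq0 N).inv.qPoch N
  have m5 := h.g12.sub_pow_ne_zero 2
  have m6 := h.g12.sub_pow_ne_zero 3
  have m7 := h.g0.sub_pow_ne_zero (N + 1)
  rw [e2, e2, e3]
  clear e2 e3
  generalize 1 - (c₃ * q ^ (N + 1))⁻¹ = d1 at *
  generalize 1 - (c₄ * q ^ (N + 1))⁻¹ = d2 at *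
  generalize qPoch (c₃ * q ^ N)⁻¹ q N = p1 at *
  generalize qPoch (c₄ * q ^ N)⁻¹ q N = p2 at *
  generalize qPoch (c₁ * c₂ * q ^ 2) q (N + 1) = p3 at *
  generalize qPoch (q * c₁ * (q * c₂) * q ^ 2) q N = p4 at *
  generalize qPoch (q * c₀) q N = p5 at *
  generalize 1 - c₁ * c₂ * q ^ (N + 3) = d3 at *
  generalize 1 - c₁ * c₂ * q ^ 2 = d4 at *
  generalize 1 - c₁ * c₂ * q ^ 3 = d5 at *
  generalize 1 - c₀ * q ^ (N + 1) = d6 at *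
  field_simp
  linear_combination (-p5) * e1

theorem qPoch_inv_pow_eq {q : ℂ} (hq : NonRoot q) (N : ℕ) {b : ℕ} :
    qPoch (q ^ N)⁻¹ q b =
      qPoch (q ^ (N + 1))⁻¹ q b * ((1 - (q ^ (N + 1))⁻¹ * q ^ b) / (1 - (q ^ (N + 1))⁻¹)) := by
  rw [← mul_inv_pow_succ hq.ne, qPoch_mul_eq (hq.one_sub_inv_ne_zero N)]

theorem qPoch_inv_mul_pow_eq {q c : ℂ} (hq : q ≠ 0) (N x : ℕ)
    (h : 1 - (c * q ^ (N + 1))⁻¹ * q ^ x ≠ 0) (b : ℕ) :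
    qPoch ((c * q ^ N)⁻¹ * q ^ x) q b = qPoch ((c * q ^ (N + 1))⁻¹ * q ^ x) q b *
      ((1 - (c * q ^ (N + 1))⁻¹ * q ^ x * q ^ b) / (1 - (c * q ^ (N + 1))⁻¹ * q ^ x)) := by
  rw [← qPoch_mul_eq h]
  congr 1
  rw [mul_inv, mul_inv, ← mul_inv_pow_succ hq]
  ring

theorem mul_mul_mul_mul_comm_three (a r b s c t : ℂ) :
    a * r * (b * s) * (c * t) = a * b * c * (r * s * t) := by ring

/-- The change of `twoHypConst` under a shift of `c₁`, `c₂`. -/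
theorem twoHypConst_shift {q c₀ c₁ c₂ c₃ c₄ : ℂ} {N : ℕ}
    (h : GenericFive q c₀ c₁ c₂ c₃ c₄ (N + 1)) {b x : ℕ} (hx : x ≤ N) :
    twoHypConst q c₀ (q * c₁) (q * c₂) c₃ c₄ N b x = twoHypConst q c₀ c₁ c₂ c₃ c₄ (N + 1) b x *
      ((1 - c₁ * c₂ * q ^ (N + 3)) * (1 - (c₃ * q ^ (N + 1))⁻¹) * (1 - (c₄ * q ^ (N + 1))⁻¹) /
        ((1 - c₁ * c₂ * q ^ 2) * (1 - c₁ * c₂ * q ^ 3) * (1 - c₀ * q ^ (N + 1))) *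
      ((1 - q * c₁) * (1 - (q ^ (N + 1))⁻¹ * q ^ x * q ^ b) * (1 - (q ^ (N + 1))⁻¹) *
        (1 - q * c₂) * (1 - (c₀ * q ^ (N + 1))⁻¹) * q ^ b * q ^ x /
      ((1 - q * c₁ * q ^ b) * (1 - (q ^ (N + 1))⁻¹ * q ^ x) * (1 - (q ^ (N + 1))⁻¹ * q ^ b) *
        (1 - (c₀ * q ^ (N + 1))⁻¹ * q ^ x * q ^ b) * (1 - q * c₂ * q ^ x)))) := by
  have hq := h.hq
  have hq0 := hq.ne
  have m1 : 1 - (q ^ (N + 1))⁻¹ * q ^ x ≠ 0 := by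
    have := one_sub_ne_zero_of_qPoch (hq.qPoch_inv_pow (le_refl (N + 1)))
      (show x < N + 1 by omega)
    exact this
  have m1' : 1 - (1 * q ^ (N + 1))⁻¹ * q ^ x ≠ 0 := by rwa [one_mul]
  have m2 := ((h.g0.mul_pow hq0 (N + 1)).inv.mul_pow hq0 x).sub_ne_zero
  have m2' := (h.g0.mul_pow hq0 (N + 1)).inv.sub_ne_zero
  have m3 := (h.g1.mul hq0).sub_ne_zero
  have m4 := (h.g2.mul hq0).sub_ne_zero
  have e1 := qPoch_inv_mul_pow_eq hq0 N x m1' b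
  have e2 := qPoch_inv_mul_pow_eq hq0 N x m2 b
  have e3 := qPoch_inv_mul_pow_eq (c := c₀) hq0 N 0 (by simpa using m2') x
  rw [one_mul, one_mul] at e1
  rw [pow_zero, mul_one, mul_one] at e3
  have z1 : ((c₀ * c₃ * q ^ (N + 1))⁻¹) ^ b =
      ((c₀ * c₃ * q ^ (N + 1 + 1))⁻¹) ^ b * q ^ b := by
    rw [← mul_pow]; congr 1; field_simp; ring
  have z2 : ((c₀ * c₄ * q ^ (N + 1))⁻¹) ^ x =
      ((c₀ * c₄ * q ^ (N + 1 + 1))⁻¹) ^ x * q ^ x := by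
    rw [← mul_pow]; congr 1; field_simp; ring
  have eB : qPoch (q * c₃) q b / qPoch (q * (q * c₁)) q b *
      (qPoch ((q ^ N)⁻¹ * q ^ x) q b * qPoch (q * c₁ * c₃ * q ^ (N + 2)) q b *
          qPoch (c₀ * (q * c₁) * c₃ * q ^ (N + 2) * (q ^ x)⁻¹) q b /
        (qPoch (q * c₁ * c₃ * q ^ (N + 2) * (q ^ x)⁻¹) q b * qPoch (q ^ N)⁻¹ q b *
          qPoch ((c₀ * q ^ N)⁻¹ * q ^ x) q b)) * ((c₀ * c₃ * q ^ (N + 1))⁻¹) ^ b =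
      qPoch (q * c₃) q b / qPoch (q * c₁) q b *
      (qPoch ((q ^ (N + 1))⁻¹ * q ^ x) q b * qPoch (c₁ * c₃ * q ^ (N + 1 + 2)) q b *
          qPoch (c₀ * c₁ * c₃ * q ^ (N + 1 + 2) * (q ^ x)⁻¹) q b /
        (qPoch (c₁ * c₃ * q ^ (N + 1 + 2) * (q ^ x)⁻¹) q b * qPoch (q ^ (N + 1))⁻¹ q b *
          qPoch ((c₀ * q ^ (N + 1))⁻¹ * q ^ x) q b)) * ((c₀ * c₃ * q ^ (N + 1 + 1))⁻¹) ^ b *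
      ((1 - q * c₁) * (1 - (q ^ (N + 1))⁻¹ * q ^ x * q ^ b) * (1 - (q ^ (N + 1))⁻¹) *
        (1 - (c₀ * q ^ (N + 1))⁻¹ * q ^ x) * q ^ b /
      ((1 - q * c₁ * q ^ b) * (1 - (q ^ (N + 1))⁻¹ * q ^ x) * (1 - (q ^ (N + 1))⁻¹ * q ^ b) *
        (1 - (c₀ * q ^ (N + 1))⁻¹ * q ^ x * q ^ b))) := by
    rw [e1, e2, qPoch_inv_pow_eq hq N (b := b), qPoch_mul_eq m3, z1,
      show q * c₁ * c₃ * q ^ (N + 2) = c₁ * c₃ * q ^ (N + 1 + 2) by ring,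
      show c₀ * (q * c₁) * c₃ * q ^ (N + 2) = c₀ * c₁ * c₃ * q ^ (N + 1 + 2) by ring]
    generalize 1 - (q ^ (N + 1))⁻¹ * q ^ x * q ^ b = y0
    generalize 1 - (q ^ (N + 1))⁻¹ * q ^ x = y1
    generalize 1 - (q ^ (N + 1))⁻¹ * q ^ b = y2
    generalize 1 - (q ^ (N + 1))⁻¹ = y3
    generalize 1 - (c₀ * q ^ (N + 1))⁻¹ * q ^ x * q ^ b = y4
    generalize 1 - (c₀ * q ^ (N + 1))⁻¹ * q ^ x = y5
    generalize 1 - q * c₁ * q ^ b = y6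
    generalize 1 - q * c₁ = y7
    generalize qPoch ((q ^ (N + 1))⁻¹ * q ^ x) q b = y8
    generalize qPoch (q ^ (N + 1))⁻¹ q b = y9
    generalize qPoch ((c₀ * q ^ (N + 1))⁻¹ * q ^ x) q b = y10
    generalize qPoch (c₁ * c₃ * q ^ (N + 1 + 2) * (q ^ x)⁻¹) q b = y11
    generalize ((c₀ * c₃ * q ^ (N + 1 + 1))⁻¹) ^ b = y12
    simp only [div_eq_mul_inv, mul_inv, inv_inv]
    ring
  have eC : qPoch (q * c₄) q x / qPoch (q * (q * c₂)) q x *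
      (qPoch (c₀ * (q * c₂) * c₄ * q ^ (N + 2)) q x / qPoch (c₀ * q ^ N)⁻¹ q x) *
        ((c₀ * c₄ * q ^ (N + 1))⁻¹) ^ x =
      qPoch (q * c₄) q x / qPoch (q * c₂) q x *
      (qPoch (c₀ * c₂ * c₄ * q ^ (N + 1 + 2)) q x / qPoch (c₀ * q ^ (N + 1))⁻¹ q x) *
        ((c₀ * c₄ * q ^ (N + 1 + 1))⁻¹) ^ x *
      ((1 - q * c₂) * (1 - (c₀ * q ^ (N + 1))⁻¹) * q ^ x /
      ((1 - (c₀ * q ^ (N + 1))⁻¹ * q ^ x) * (1 - q * c₂ * q ^ x))) := by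
    rw [e3, qPoch_mul_eq m4, z2,
      show c₀ * (q * c₂) * c₄ * q ^ (N + 2) = c₀ * c₂ * c₄ * q ^ (N + 1 + 2) by ring]
    generalize 1 - (c₀ * q ^ (N + 1))⁻¹ * q ^ x = y13
    generalize 1 - (c₀ * q ^ (N + 1))⁻¹ = y14
    generalize 1 - q * c₂ * q ^ x = y15
    generalize 1 - q * c₂ = y16
    generalize qPoch (c₀ * q ^ (N + 1))⁻¹ q x = y17
    generalize ((c₀ * c₄ * q ^ (N + 1 + 1))⁻¹) ^ x = y18
    simp only [div_eq_mul_inv, mul_inv, inv_inv]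
    ring
  unfold twoHypConst
  rw [twoHypConst_aux h, eB, eC, mul_mul_mul_mul_comm_three]
  congr 1
  rw [mul_assoc]
  congr 1
  clear e1 e2 e3 z1 z2 eB eC
  generalize 1 - (c₀ * q ^ (N + 1))⁻¹ * q ^ x * q ^ b = y19 at *
  generalize 1 - (c₀ * q ^ (N + 1))⁻¹ * q ^ x = y20 at *
  generalize 1 - (q ^ (N + 1))⁻¹ * q ^ x * q ^ b = y21
  generalize 1 - (q ^ (N + 1))⁻¹ * q ^ x = y22
  generalize 1 - (q ^ (N + 1))⁻¹ * q ^ b = y23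
  generalize 1 - (q ^ (N + 1))⁻¹ = y24
  generalize 1 - (c₀ * q ^ (N + 1))⁻¹ = y25
  generalize 1 - q * c₁ * q ^ b = y26
  generalize 1 - q * c₂ * q ^ x = y27
  field_simp

/-- The change of `twoHypConst` under a shift of `c₁`, `c₂` and of the last argument. -/
theorem twoHypConst_shift_pred {q c₀ c₁ c₂ c₃ c₄ : ℂ} {N : ℕ}
    (h : GenericFive q c₀ c₁ c₂ c₃ c₄ (N + 1)) {b x : ℕ} :
    twoHypConst q c₀ (q * c₁) (q * c₂) c₃ c₄ N b x =
      twoHypConst q c₀ c₁ c₂ c₃ c₄ (N + 1) b (x + 1) *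
      ((1 - c₁ * c₂ * q ^ (N + 3)) * (1 - (c₃ * q ^ (N + 1))⁻¹) * (1 - (c₄ * q ^ (N + 1))⁻¹) /
        ((1 - c₁ * c₂ * q ^ 2) * (1 - c₁ * c₂ * q ^ 3) * (1 - c₀ * q ^ (N + 1))) *
      ((1 - q * c₁) * (1 - c₀ * c₁ * c₃ * q ^ (N + 1 + 2) * (q ^ (x + 1))⁻¹ * q ^ b) *
        (1 - c₁ * c₃ * q ^ (N + 1 + 2) * (q ^ (x + 1))⁻¹) * (1 - (q ^ (N + 1))⁻¹) *
        (1 - q * c₂) * (1 - (c₀ * q ^ (N + 1))⁻¹) * q ^ b * q ^ x * (c₀ * c₄ * q ^ (N + 2)) /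
      ((1 - q * c₁ * q ^ b) * (1 - c₀ * c₁ * c₃ * q ^ (N + 1 + 2) * (q ^ (x + 1))⁻¹) *
        (1 - c₁ * c₃ * q ^ (N + 1 + 2) * (q ^ (x + 1))⁻¹ * q ^ b) *
        (1 - (q ^ (N + 1))⁻¹ * q ^ b) * (1 - c₄ * q ^ (x + 1)) *
        (1 - c₀ * c₂ * c₄ * q ^ (N + 1 + 2) * q ^ x)))) := by
  have hq := h.hq
  have hq0 := hq.ne
  have m1 : 1 - c₀ * c₁ * c₃ * q ^ (N + 1 + 2) * (q ^ (x + 1))⁻¹ ≠ 0 :=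
    ((h.g013.mul_pow hq0 _).mul_inv_pow hq0 _).sub_ne_zero
  have m2 : 1 - c₁ * c₃ * q ^ (N + 1 + 2) * (q ^ (x + 1))⁻¹ ≠ 0 :=
    ((h.g13.mul_pow hq0 _).mul_inv_pow hq0 _).sub_ne_zero
  have m3 := (h.g1.mul hq0).sub_ne_zero
  have m4 := (h.g2.mul hq0).sub_ne_zero
  have m5 := (h.g0.mul_pow hq0 (N + 1)).inv.sub_ne_zero
  have m6 := h.g4.sub_pow_ne_zero (x + 1)
  have m7 := (h.g024.mul_pow hq0 (N + 1 + 2)).sub_pow_ne_zero x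
  have z1 : ((c₀ * c₃ * q ^ (N + 1))⁻¹) ^ b =
      ((c₀ * c₃ * q ^ (N + 1 + 1))⁻¹) ^ b * q ^ b := by
    rw [← mul_pow]; congr 1; field_simp; ring
  have z2 : ((c₀ * c₄ * q ^ (N + 1))⁻¹) ^ x =
      ((c₀ * c₄ * q ^ (N + 1 + 1))⁻¹) ^ (x + 1) * (q ^ x * (c₀ * c₄ * q ^ (N + 2))) := by
    have := h.n0
    have := h.n4
    have e : (c₀ * c₄ * q ^ (N + 1))⁻¹ = (c₀ * c₄ * q ^ (N + 1 + 1))⁻¹ * q := by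
      field_simp; ring
    have e2 : (c₀ * c₄ * q ^ (N + 1 + 1))⁻¹ * (c₀ * c₄ * q ^ (N + 2)) = 1 :=
      inv_mul_cancel₀ (by positivity)
    rw [e, mul_pow, pow_succ]
    linear_combination (-((c₀ * c₄ * q ^ (N + 1 + 1))⁻¹ ^ x * q ^ x)) * e2
  have r1 : (q ^ (N + 1))⁻¹ * q ^ (x + 1) = (q ^ N)⁻¹ * q ^ x := by
    field_simp; ring
  have r2 : (c₀ * q ^ (N + 1))⁻¹ * q ^ (x + 1) = (c₀ * q ^ N)⁻¹ * q ^ x := by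
    rw [mul_inv, mul_inv, mul_assoc, r1, mul_assoc]
  have s1 : q * c₁ * c₃ * q ^ (N + 2) * (q ^ x)⁻¹ =
      q * (c₁ * c₃ * q ^ (N + 1 + 2) * (q ^ (x + 1))⁻¹) := by
    field_simp; ring
  have s2 : c₀ * (q * c₁) * c₃ * q ^ (N + 2) * (q ^ x)⁻¹ =
      q * (c₀ * c₁ * c₃ * q ^ (N + 1 + 2) * (q ^ (x + 1))⁻¹) := by
    field_simp; ring
  have s3 : q * (c₀ * q ^ (N + 1))⁻¹ = (c₀ * q ^ N)⁻¹ := by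
    rw [mul_inv, mul_left_comm, mul_inv_pow_succ hq0, mul_inv]
  have eB : qPoch (q * c₃) q b / qPoch (q * (q * c₁)) q b *
      (qPoch ((q ^ N)⁻¹ * q ^ x) q b * qPoch (q * c₁ * c₃ * q ^ (N + 2)) q b *
          qPoch (c₀ * (q * c₁) * c₃ * q ^ (N + 2) * (q ^ x)⁻¹) q b /
        (qPoch (q * c₁ * c₃ * q ^ (N + 2) * (q ^ x)⁻¹) q b * qPoch (q ^ N)⁻¹ q b *
          qPoch ((c₀ * q ^ N)⁻¹ * q ^ x) q b)) * ((c₀ * c₃ * q ^ (N + 1))⁻¹) ^ b =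
      qPoch (q * c₃) q b / qPoch (q * c₁) q b *
      (qPoch ((q ^ (N + 1))⁻¹ * q ^ (x + 1)) q b * qPoch (c₁ * c₃ * q ^ (N + 1 + 2)) q b *
          qPoch (c₀ * c₁ * c₃ * q ^ (N + 1 + 2) * (q ^ (x + 1))⁻¹) q b /
        (qPoch (c₁ * c₃ * q ^ (N + 1 + 2) * (q ^ (x + 1))⁻¹) q b * qPoch (q ^ (N + 1))⁻¹ q b *
          qPoch ((c₀ * q ^ (N + 1))⁻¹ * q ^ (x + 1)) q b)) * ((c₀ * c₃ * q ^ (N + 1 + 1))⁻¹) ^ b *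
      ((1 - q * c₁) * (1 - c₀ * c₁ * c₃ * q ^ (N + 1 + 2) * (q ^ (x + 1))⁻¹ * q ^ b) *
        (1 - c₁ * c₃ * q ^ (N + 1 + 2) * (q ^ (x + 1))⁻¹) * (1 - (q ^ (N + 1))⁻¹) * q ^ b /
      ((1 - q * c₁ * q ^ b) * (1 - c₀ * c₁ * c₃ * q ^ (N + 1 + 2) * (q ^ (x + 1))⁻¹) *
        (1 - c₁ * c₃ * q ^ (N + 1 + 2) * (q ^ (x + 1))⁻¹ * q ^ b) *
        (1 - (q ^ (N + 1))⁻¹ * q ^ b))) := by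
    rw [r1, r2, s1, s2, qPoch_inv_pow_eq hq N (b := b), qPoch_mul_eq m3, qPoch_mul_eq m1,
      qPoch_mul_eq m2, z1,
      show q * c₁ * c₃ * q ^ (N + 2) = c₁ * c₃ * q ^ (N + 1 + 2) by ring]
    generalize qPoch ((q ^ N)⁻¹ * q ^ x) q b = y0
    generalize qPoch ((c₀ * q ^ N)⁻¹ * q ^ x) q b = y1
    generalize 1 - c₀ * c₁ * c₃ * q ^ (N + 1 + 2) * (q ^ (x + 1))⁻¹ * q ^ b = y2
    generalize 1 - c₀ * c₁ * c₃ * q ^ (N + 1 + 2) * (q ^ (x + 1))⁻¹ = y3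
    generalize 1 - c₁ * c₃ * q ^ (N + 1 + 2) * (q ^ (x + 1))⁻¹ * q ^ b = y4
    generalize 1 - c₁ * c₃ * q ^ (N + 1 + 2) * (q ^ (x + 1))⁻¹ = y5
    generalize qPoch (c₀ * c₁ * c₃ * q ^ (N + 1 + 2) * (q ^ (x + 1))⁻¹) q b = y6
    generalize qPoch (c₁ * c₃ * q ^ (N + 1 + 2) * (q ^ (x + 1))⁻¹) q b = y7
    generalize 1 - (q ^ (N + 1))⁻¹ * q ^ b = y8
    generalize 1 - (q ^ (N + 1))⁻¹ = y9
    generalize 1 - q * c₁ * q ^ b = y10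
    generalize 1 - q * c₁ = y11
    generalize qPoch (q ^ (N + 1))⁻¹ q b = y12
    generalize ((c₀ * c₃ * q ^ (N + 1 + 1))⁻¹) ^ b = y13
    simp only [div_eq_mul_inv, mul_inv, inv_inv]
    ring
  have eC : qPoch (q * c₄) q x / qPoch (q * (q * c₂)) q x *
      (qPoch (c₀ * (q * c₂) * c₄ * q ^ (N + 2)) q x / qPoch (c₀ * q ^ N)⁻¹ q x) *
        ((c₀ * c₄ * q ^ (N + 1))⁻¹) ^ x =
      qPoch (q * c₄) q (x + 1) / qPoch (q * c₂) q (x + 1) *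
      (qPoch (c₀ * c₂ * c₄ * q ^ (N + 1 + 2)) q (x + 1) / qPoch (c₀ * q ^ (N + 1))⁻¹ q (x + 1)) *
        ((c₀ * c₄ * q ^ (N + 1 + 1))⁻¹) ^ (x + 1) *
      ((1 - q * c₂) * (1 - (c₀ * q ^ (N + 1))⁻¹) * q ^ x * (c₀ * c₄ * q ^ (N + 2)) /
      ((1 - c₄ * q ^ (x + 1)) * (1 - c₀ * c₂ * c₄ * q ^ (N + 1 + 2) * q ^ x))) := by
    rw [z2, qPoch_succ' (q * c₂), qPoch_succ' (c₀ * q ^ (N + 1))⁻¹, qPoch_succ (q * c₄),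
      qPoch_succ (c₀ * c₂ * c₄ * q ^ (N + 1 + 2)), s3,
      show q * c₄ * q ^ x = c₄ * q ^ (x + 1) by ring,
      show c₀ * (q * c₂) * c₄ * q ^ (N + 2) = c₀ * c₂ * c₄ * q ^ (N + 1 + 2) by ring]
    clear z1 z2 r1 r2 s1 s2 s3 eB m1 m2 m3
    generalize 1 - (c₀ * q ^ (N + 1))⁻¹ = y14 at *
    generalize 1 - c₄ * q ^ (x + 1) = y15 at *
    generalize 1 - c₀ * c₂ * c₄ * q ^ (N + 1 + 2) * q ^ x = y16 at *
    generalize 1 - q * c₂ = y17 at *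
    generalize qPoch (c₀ * q ^ N)⁻¹ q x = y18
    generalize ((c₀ * c₄ * q ^ (N + 1 + 1))⁻¹) ^ (x + 1) = y19
    generalize qPoch (q * c₄) q x = y20
    generalize qPoch (q * (q * c₂)) q x = y21
    generalize qPoch (c₀ * c₂ * c₄ * q ^ (N + 1 + 2)) q x = y22
    field_simp
  unfold twoHypConst
  rw [twoHypConst_aux h, eB, eC, mul_mul_mul_mul_comm_three]
  congr 1
  rw [mul_assoc]
  congr 1
  rw [div_mul_div_comm]
  congr 1 <;> ring

theorem twoHyp_rat {q I X Q c₀ c₁ g c₃ : ℂ} (hq : q ≠ 0) (hI : I ≠ 0) (hX : X ≠ 0) (hQ : Q ≠ 0)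
    (h0 : c₀ ≠ 0) (h1 : c₁ ≠ 0) (hg : g ≠ 0) (hbal : q ^ 3 * Q ^ 2 * (c₀ * c₁ * c₃ * g) = 1)
    (n1 : 1 - q * c₁ * I ≠ 0) (n2 : 1 - Q⁻¹ * I ≠ 0) (n3 : 1 - (c₀ * Q)⁻¹ * X * I ≠ 0)
    (n4 : 1 - c₁ * c₃ * (Q * q ^ 2) * X⁻¹ * I ≠ 0) :
    X * (1 - g * q * X ^ 2) * ((1 - q * c₃ * I) * (1 - Q⁻¹ * X * I) *
        (1 - c₁ * c₃ * (Q * q ^ 2) * I) * (1 - c₀ * c₁ * c₃ * (Q * q ^ 2) * X⁻¹ * I) /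
      ((1 - q * c₁ * I) * (1 - c₁ * c₃ * (Q * q ^ 2) * X⁻¹ * I) *
        (1 - Q⁻¹ * I) * (1 - (c₀ * Q)⁻¹ * X * I)) * (c₀ * c₃ * (Q * q))⁻¹ - 1) =
    q * (c₁ * c₃ * q * I - (q * I)⁻¹) * (I * X / ((1 - q * c₁ * I) * (1 - Q⁻¹ * I))) *
      ((1 - g * q * X) * (1 - c₁ * g * (Q * q ^ 2) * X) * (1 - Q⁻¹ * X * I) /
          (1 - (c₀ * Q)⁻¹ * X * I) +
        (1 - X) * g * q * (X - c₁ * Q * q) * (1 - c₀ * c₁ * c₃ * (Q * q ^ 2) * X⁻¹ * I) /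
          (1 - c₁ * c₃ * (Q * q ^ 2) * X⁻¹ * I)) := by
  have e3 : c₃ = 1 / (q ^ 3 * Q ^ 2 * c₀ * c₁ * g) := by
    field_simp; linear_combination hbal
  subst e3
  have a1 : 1 - Q⁻¹ * I = (Q - I) / Q := by field_simp
  have a2 : 1 - (c₀ * Q)⁻¹ * X * I = (c₀ * Q - X * I) / (c₀ * Q) := by field_simp
  have a3 : 1 - c₁ * (1 / (q ^ 3 * Q ^ 2 * c₀ * c₁ * g)) * (Q * q ^ 2) * X⁻¹ * I =
      (q * Q * c₀ * g * X - I) / (q * Q * c₀ * g * X) := by field_simp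
  have a4 : 1 - Q⁻¹ * X * I = (Q - X * I) / Q := by field_simp
  have a5 : 1 - c₀ * c₁ * (1 / (q ^ 3 * Q ^ 2 * c₀ * c₁ * g)) * (Q * q ^ 2) * X⁻¹ * I =
      (q * Q * g * X - I) / (q * Q * g * X) := by field_simp
  rw [a1] at n2
  rw [a2] at n3
  rw [a3] at n4
  rw [a1, a2, a3, a4, a5]
  have m2 : Q - I ≠ 0 := fun h => n2 (by rw [h, zero_div])
  have m3 : c₀ * Q - X * I ≠ 0 := fun h => n3 (by rw [h, zero_div])
  have m4 : q * Q * c₀ * g * X - I ≠ 0 := fun h => n4 (by rw [h, zero_div])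
  clear n2 n3 n4 a1 a2 a3 a4 a5
  clear hbal
  generalize hD1 : 1 - q * c₁ * I = D1 at *
  generalize hD2 : Q - I = D2 at *
  generalize hD3 : c₀ * Q - X * I = D3 at *
  generalize hD4 : q * Q * c₀ * g * X - I = D4 at *
  field_simp
  subst hD1 hD2 hD3 hD4
  ring

/-- The weight in `twoHypSum`. -/
def twoHypWeight (q c₁ c₂ c₃ c₄ : ℂ) (N a : ℕ) : ℂ :=
  vwpTerm q (c₁ * c₂ * q) (c₁ * c₂ * c₃ * q ^ (N + 2)) (c₁ * c₂ * c₄ * q ^ (N + 2)) N a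

theorem twoHypWeight_succ {q c₀ c₁ c₂ c₃ c₄ : ℂ} {N : ℕ}
    (h : GenericFive q c₀ c₁ c₂ c₃ c₄ (N + 1)) (m : ℕ) :
    twoHypWeight q c₁ c₂ c₃ c₄ (N + 1) (m + 1) *
        ((1 - (q ^ (m + 1))⁻¹) * (1 - c₁ * c₂ * q * q ^ (m + 1))) =
      (-((1 - c₁ * c₂ * q ^ 2) * (1 - c₁ * c₂ * q ^ 3) * (1 - c₁ * c₂ * c₃ * q ^ (N + 1 + 2)) *
        (1 - c₁ * c₂ * c₄ * q ^ (N + 1 + 2)) * (1 - (q ^ (N + 1))⁻¹) /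
        ((1 - (c₃ * q ^ (N + 1))⁻¹) * (1 - (c₄ * q ^ (N + 1))⁻¹) * (1 - c₁ * c₂ * q ^ (N + 3))) *
          (c₀ * q ^ (N + 1)))) * twoHypWeight q (q * c₁) (q * c₂) c₃ c₄ N m := by
  have hq0 := h.hq.ne
  have n1 := h.n1
  have n2 := h.n2
  have n3 := h.n3
  have n4 := h.n4
  have key := vwpTerm_succ (B := c₁ * c₂ * c₃ * q ^ (N + 1 + 2))
    (C := c₁ * c₂ * c₄ * q ^ (N + 1 + 2)) h.hq
    (by simpa using h.g12.mul_pow hq0 1 : Generic q (c₁ * c₂ * q)) (by positivity) (by positivity)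
    N m
  have e1 : c₁ * c₂ * q * q / (c₁ * c₂ * c₃ * q ^ (N + 1 + 2)) = (c₃ * q ^ (N + 1))⁻¹ := by
    field_simp; ring
  have e1' : c₁ * c₂ * q * q / (c₁ * c₂ * c₄ * q ^ (N + 1 + 2)) = (c₄ * q ^ (N + 1))⁻¹ := by
    field_simp; ring
  have e2 : c₁ * c₂ * q * q ^ (N + 1) /
      (c₁ * c₂ * c₃ * q ^ (N + 1 + 2) * (c₁ * c₂ * c₄ * q ^ (N + 1 + 2))) = c₀ * q ^ (N + 1) := by
    rw [div_eq_iff (by positivity)]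
    linear_combination (-(c₁ * c₂ * q ^ (N + 2))) * h.bal
  unfold twoHypWeight
  rw [key, e1, e1', e2, show q * c₁ * (q * c₂) * q = q ^ 2 * (c₁ * c₂ * q) by ring,
    show q * c₁ * (q * c₂) * c₃ * q ^ (N + 2) = q * (c₁ * c₂ * c₃ * q ^ (N + 1 + 2)) by ring,
    show q * c₁ * (q * c₂) * c₄ * q ^ (N + 2) = q * (c₁ * c₂ * c₄ * q ^ (N + 1 + 2)) by ring,
    show c₁ * c₂ * q * q = c₁ * c₂ * q ^ 2 by ring,
    show c₁ * c₂ * q * q ^ 2 = c₁ * c₂ * q ^ 3 by ring,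
    show c₁ * c₂ * q * q ^ (N + 2) = c₁ * c₂ * q ^ (N + 3) by ring]

/-- The sum of products of two series with the weights `twoHypWeight`. -/
def twoHypSum (q c₁ c₂ c₃ c₄ : ℂ) (N b x : ℕ) : ℂ :=
  ∑ a ∈ Finset.range (N + 1), twoHypWeight q c₁ c₂ c₃ c₄ N a * racahHyp q c₂ c₁ c₃ N b a *
    racahHyp q c₄ c₂ c₁ N a x

theorem twoHyp_step_aux {q mu X n l I J f1 f2 gB gC g3 e1 e2 rho U V k R S0 S1 T0 T1 s0 s1 : ℂ}
    (sfb : f1 * gB * g3 * (mu * f2 * gC * g3 * X * n) * (S1 - S0) =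
      q * (l * I - J) * rho * (U * T0 - V * T1))
    (h0 : rho * (U * T0) = gB * gC * g3 ^ 2 * f1 * f2 * mu * (k * (I * X / (e1 * e2)) * s0))
    (h1 : rho * (V * T1) = -(gB * gC * g3 ^ 2 * f1 * f2 * mu * (k * (I * X / (e1 * e2)) * s1)))
    (hR : X * n * (R - 1) = q * (l * I - J) * (I * X / (e1 * e2)) * (s0 + s1))
    (a1 : f1 ≠ 0) (a2 : f2 ≠ 0) (a3 : gB ≠ 0) (a4 : gC ≠ 0) (a5 : g3 ≠ 0) (a6 : mu ≠ 0)
    (a7 : X ≠ 0) (a8 : n ≠ 0) : S1 - S0 = k * R - k := by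
  have : (gB * gC * g3 ^ 2 * f1 * f2 * mu * X * n) * (S1 - S0) =
      (gB * gC * g3 ^ 2 * f1 * f2 * mu * X * n) * (k * R - k) := by
    linear_combination sfb + q * (l * I - J) * (h0 - h1) -
      (gB * gC * g3 ^ 2 * f1 * f2 * mu * k) * hR
  exact mul_left_cancel₀ (by positivity) this

theorem twoHyp_shift_rat {X I f1 f2 gB gC g3 e1 e2 t1 rho k K' mu m cX c0i c0x u x0 y :
    ℂ} (hK : K' = k * (t1 * (f1 * u * g3 * f2 * c0i * I * X / (e1 * x0 * e2 * c0x * y))))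
    (hr : rho * t1 * c0i = gB * gC * g3) (n1 : x0 ≠ 0) (n2 : y ≠ 0) :
    rho * (mu * m * y * cX * x0 * K') =
      gB * gC * g3 ^ 2 * f1 * f2 * mu * (k * (I * X / (e1 * e2)) * (m * cX * u / c0x)) := by
  have e : f1 * u * g3 * f2 * c0i * I * X / (e1 * x0 * e2 * c0x * y) * (x0 * y) =
      f1 * u * g3 * f2 * c0i * (I * X / (e1 * e2)) * c0x⁻¹ := by
    field_simp
  rw [hK]
  rw [div_eq_mul_inv _ c0x]
  linear_combination (rho * mu * m * cX * k * t1) * e +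
    (mu * m * cX * k * (f1 * u * g3 * f2 * (I * X / (e1 * e2)) * c0x⁻¹)) * hr

theorem twoHyp_shift_pred_rat {q X Xi Xp I Q Qi f1 f2 gB gC g3 e1 e2 e3 t1 rho k g c13 c04 c₁ c₂
    u u1 f4 y w v1 v2 c0i Qq : ℂ} (hr : rho * t1 * c0i = gB * gC * g3) (n1 : u1 ≠ 0) (n2 : f4 ≠ 0)
    (n3 : y ≠ 0) (bal : q ^ 3 * Q ^ 2 * (c₂ * c13 * c04) = 1) (hv1 : v1 = q * c₂ * f4)
    (hv2 : v2 = -(g * q * (X - c₁ * Q * q))) (hu1 : Qi - g * q * X = -(g * q * X * u1))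
    (hw : w = -(c13 * (Q * q ^ 2) * Xi * y)) (hX : X * Xi = 1) (hXp : Xp * q * Qq = X * (Q * q)) :
    rho * ((1 - X) * v1 * v2 * (Qi - g * q * X) * (k * (t1 *
      (f1 * u * w * g3 * f2 * c0i * I * Xp * (c04 * Qq) / (e1 * u1 * e3 * e2 * f4 * y))))) =
    -(gB * gC * g3 ^ 2 * f1 * f2 * (g * q) * (k * (I * X / (e1 * e2)) *
      ((1 - X) * g * q * (X - c₁ * Q * q) * u / e3))) := by
  have p : q * c₂ * (g * q) ^ 2 * X * (c13 * (Q * q ^ 2) * Xi) * Xp * (c04 * Qq) =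
      (g * q) ^ 2 * X := by
    linear_combination (c₂ * (g * q) ^ 2 * X * c13 * Q * q ^ 2 * Xi * c04) * hXp +
      (c₂ * c04 * c13 * (g * q) ^ 2 * Q ^ 2 * q ^ 3 * X) * hX + (g * q) ^ 2 * X * bal
  have i1 : u1 * u1⁻¹ * (f4 * f4⁻¹) * (y * y⁻¹) = 1 := by
    rw [mul_inv_cancel₀ n1, mul_inv_cancel₀ n2, mul_inv_cancel₀ n3]; ring
  rw [hv1, hv2, hu1, hw]
  simp only [div_eq_mul_inv, mul_inv]
  generalize u1⁻¹ = j1 at *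
  generalize f4⁻¹ = i2 at *
  generalize y⁻¹ = i3 at *
  generalize e1⁻¹ = i4 at *
  generalize e2⁻¹ = i5 at *
  generalize e3⁻¹ = i6 at *
  generalize X - c₁ * Q * q = v
  calc _ = -(rho * t1 * c0i) * (u1 * j1 * (f4 * i2) * (y * i3)) *
        (q * c₂ * (g * q) ^ 2 * X * (c13 * (Q * q ^ 2) * Xi) * Xp * (c04 * Qq)) *
        ((1 - X) * v * k * f1 * u * g3 * f2 * I * i4 * i5 * i6) := by ring
    _ = _ := by rw [hr, i1, p]; ring

theorem twoHypConst_factor_aux {q c₀ c₁ c₂ c₃ c₄ : ℂ} {N : ℕ}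
    (h : GenericFive q c₀ c₁ c₂ c₃ c₄ (N + 1)) (gB gC g3 : ℂ) :
    (-((1 - c₁ * c₂ * q ^ 2) * (1 - c₁ * c₂ * q ^ 3) * gB * gC * g3 /
        ((1 - (c₃ * q ^ (N + 1))⁻¹) * (1 - (c₄ * q ^ (N + 1))⁻¹) * (1 - c₁ * c₂ * q ^ (N + 3))) *
          (c₀ * q ^ (N + 1)))) *
      ((1 - c₁ * c₂ * q ^ (N + 3)) * (1 - (c₃ * q ^ (N + 1))⁻¹) * (1 - (c₄ * q ^ (N + 1))⁻¹) /
        ((1 - c₁ * c₂ * q ^ 2) * (1 - c₁ * c₂ * q ^ 3) * (1 - c₀ * q ^ (N + 1)))) *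
      (1 - (c₀ * q ^ (N + 1))⁻¹) = gB * gC * g3 := by
  have hq0 := h.hq.ne
  have m1 := (h.g3.mul_pow hq0 (N + 1)).inv.sub_ne_zero
  have m2 := (h.g4.mul_pow hq0 (N + 1)).inv.sub_ne_zero
  have m3 := h.g12.sub_pow_ne_zero 2
  have m4 := h.g12.sub_pow_ne_zero 3
  have m5 := h.g12.sub_pow_ne_zero (N + 3)
  have m6 := h.g0.sub_pow_ne_zero (N + 1)
  have n0 := h.n0
  have e : c₀ * q ^ (N + 1) * (1 - (c₀ * q ^ (N + 1))⁻¹) = -(1 - c₀ * q ^ (N + 1)) := by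
    field_simp; ring
  generalize 1 - (c₃ * q ^ (N + 1))⁻¹ = y0 at *
  generalize 1 - (c₄ * q ^ (N + 1))⁻¹ = y1 at *
  generalize 1 - c₁ * c₂ * q ^ (N + 3) = y2 at *
  generalize 1 - c₁ * c₂ * q ^ 2 = y3 at *
  generalize 1 - c₁ * c₂ * q ^ 3 = y4 at *
  generalize 1 - c₀ * q ^ (N + 1) = y5 at *
  generalize 1 - (c₀ * q ^ (N + 1))⁻¹ = y6 at *
  generalize c₀ * q ^ (N + 1) = y7 at *
  field_simp
  linear_combination (-(gB * gC * g3)) * e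

theorem twoHypSum_succ_sub {q c₀ c₁ c₂ c₃ c₄ : ℂ} {N : ℕ}
    (h : GenericFive q c₀ c₁ c₂ c₃ c₄ (N + 1)) {b x : ℕ} (hb : b ≤ N) (hx : x ≤ N + 1)
    (ih : ∀ y, y ≤ N → twoHypSum q (q * c₁) (q * c₂) c₃ c₄ N b y =
      twoHypConst q c₀ (q * c₁) (q * c₂) c₃ c₄ N b y) :
    twoHypSum q c₁ c₂ c₃ c₄ (N + 1) (b + 1) x - twoHypSum q c₁ c₂ c₃ c₄ (N + 1) b x =
      twoHypConst q c₀ c₁ c₂ c₃ c₄ (N + 1) (b + 1) x -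
        twoHypConst q c₀ c₁ c₂ c₃ c₄ (N + 1) b x := by
  have hq := h.hq
  have hq0 := hq.ne
  have gB : Generic q (c₁ * c₂ * c₃ * q ^ (N + 1 + 2)) := h.g123.mul_pow hq0 _
  have gC : Generic q (c₁ * c₂ * c₄ * q ^ (N + 1 + 2)) := h.g124.mul_pow hq0 _
  have g3 : ∀ k ≤ N + 1, qPoch (q ^ (N + 1))⁻¹ q k ≠ 0 := fun k hk => hq.qPoch_inv_pow hk
  have g31 := hq.one_sub_inv_ne_zero N
  have hX := pow_ne_zero x hq0
  have n0 := h.n0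
  have n1 := h.n1
  have n2 := h.n2
  have n3 := h.n3
  have n4 := h.n4
  have gmu : Generic q (c₂ * c₄ * q) := by simpa using h.g24.mul_pow hq0 1
  have sfb := sum_forward_backward (l := c₁ * c₃ * q) (al := c₁ * c₂ * q) (b₁ := q * c₁)
    (b₂ := c₁ * c₂ * c₃ * q ^ (N + 1 + 2)) (b₃ := (q ^ (N + 1))⁻¹) (mu := c₂ * c₄ * q)
    (d₁ := q * c₂) (d₂ := c₁ * c₂ * c₄ * q ^ (N + 1 + 2)) (d₃ := (q ^ (N + 1))⁻¹) hq0
    (twoHypWeight q c₁ c₂ c₃ c₄ (N + 1)) (twoHypWeight q (q * c₁) (q * c₂) c₃ c₄ N) N b x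
    (fun m _ => twoHypWeight_succ h m) (h.g1.mul hq0).sub_ne_zero gB.sub_ne_zero g31
    (hq.qPoch _) (by field_simp; ring) ((h.g2.mul hq0).qPoch _) (gC.qPoch _) (g3 _ le_rfl)
    (hq.qPoch _)
  have r1 : ∀ i m, hyp q (c₁ * c₃ * q) (c₁ * c₂ * q) (q * c₁) (c₁ * c₂ * c₃ * q ^ (N + 1 + 2))
      (q ^ (N + 1))⁻¹ i m = racahHyp q c₂ c₁ c₃ (N + 1) i m := fun i m => by
    unfold racahHyp; congr 1 <;> ring
  have r2 : ∀ i m, hyp q (c₁ * c₂ * q) (c₂ * c₄ * q) (q * c₂) (c₁ * c₂ * c₄ * q ^ (N + 1 + 2))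
      (q ^ (N + 1))⁻¹ i m = racahHyp q c₄ c₂ c₁ (N + 1) i m := fun i m => by
    unfold racahHyp; congr 1 <;> ring
  have r3 : ∀ i m, hyp q (q * (c₁ * c₃ * q)) (q ^ 2 * (c₁ * c₂ * q)) (q * (q * c₁))
      (q * (c₁ * c₂ * c₃ * q ^ (N + 1 + 2))) (q * (q ^ (N + 1))⁻¹) i m =
      racahHyp q (q * c₂) (q * c₁) c₃ N i m := fun i m => by
    rw [← racahHyp_shift₁₂ hq0]; congr 1 <;> ring
  have r4 : ∀ i m, hyp q (q ^ 2 * (c₁ * c₂ * q)) (q * (c₂ * c₄ * q)) (q * (q * c₂))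
      (q * (c₁ * c₂ * c₄ * q ^ (N + 1 + 2))) (q * (q ^ (N + 1))⁻¹) i m =
      racahHyp q c₄ (q * c₂) (q * c₁) N i m := fun i m => by
    rw [← racahHyp_shift₂₃ hq0]; congr 1 <;> ring
  simp only [r1, r2, r3, r4] at sfb
  have hb1 := one_sub_ne_zero_of_qPoch (g3 (N + 1) le_rfl) (show b < N + 1 by omega)
  have m4 : 1 - c₁ * c₃ * q ^ (N + 1 + 2) * (q ^ x)⁻¹ * q ^ b ≠ 0 :=
    ((h.g13.mul_pow hq0 _).mul_inv_pow hq0 _).sub_pow_ne_zero _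
  have rat := twoHyp_rat (q := q) (I := q ^ b) (X := q ^ x) (Q := q ^ (N + 1)) (c₀ := c₀)
    (c₁ := c₁) (g := c₂ * c₄) (c₃ := c₃) hq0 (pow_ne_zero b hq0) hX (pow_ne_zero _ hq0) n0 n1
    (mul_ne_zero n2 n4) (by rw [← h.bal]; ring) ((h.g1.mul hq0).sub_pow_ne_zero b) hb1
    (((h.g0.mul_pow hq0 (N + 1)).inv.mul_pow hq0 x).sub_pow_ne_zero b)
    (by rw [← pow_add]; exact m4)
  rw [twoHypConst_succ_left]
  refine twoHyp_step_aux (J := (q ^ (b + 1))⁻¹) (l := c₁ * c₃ * q) (I := q ^ b)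
    (U := c₂ * c₄ * q * (1 - c₂ * c₄ * q * q ^ x) * (1 - q * c₂ * q ^ x) *
      (1 - c₁ * c₂ * c₄ * q ^ (N + 1 + 2) * q ^ x) * (1 - (q ^ (N + 1))⁻¹ * q ^ x))
    (V := (1 - q ^ x) * (q * c₂ - c₂ * c₄ * q * q ^ x) *
      (c₁ * c₂ * c₄ * q ^ (N + 1 + 2) - c₂ * c₄ * q * q ^ x) *
      ((q ^ (N + 1))⁻¹ - c₂ * c₄ * q * q ^ x))
    (T0 := twoHypSum q (q * c₁) (q * c₂) c₃ c₄ N b x)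
    (T1 := twoHypSum q (q * c₁) (q * c₂) c₃ c₄ N b (x - 1))
    (mu := c₂ * c₄ * q) (X := q ^ x) (n := 1 - c₂ * c₄ * q * (q ^ x) ^ 2)
    (f1 := 1 - q * c₁) (f2 := 1 - q * c₂) (e1 := 1 - q * c₁ * q ^ b)
    (e2 := 1 - (q ^ (N + 1))⁻¹ * q ^ b)
    (s0 := (1 - c₂ * c₄ * q * q ^ x) * (1 - c₁ * c₂ * c₄ * q ^ (N + 1 + 2) * q ^ x) *
      (1 - (q ^ (N + 1))⁻¹ * q ^ x * q ^ b) / (1 - (c₀ * q ^ (N + 1))⁻¹ * q ^ x * q ^ b))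
    (s1 := (1 - q ^ x) * (c₂ * c₄) * q * (q ^ x - c₁ * q ^ (N + 1) * q) *
      (1 - c₀ * c₁ * c₃ * q ^ (N + 1 + 2) * (q ^ x)⁻¹ * q ^ b) /
      (1 - c₁ * c₃ * q ^ (N + 1 + 2) * (q ^ x)⁻¹ * q ^ b))
    sfb ?_ ?_ ?_ (h.g1.mul hq0).sub_ne_zero (h.g2.mul hq0).sub_ne_zero gB.sub_ne_zero
    gC.sub_ne_zero g31 (by positivity) hX (gmu.one_sub_mul_sq_ne_zero x)
  · rcases Nat.lt_or_ge N x with hx' | hx'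
    · obtain rfl : x = N + 1 := by omega
      rw [inv_mul_cancel₀ (pow_ne_zero _ hq0)]
      rcases Nat.eq_zero_or_pos b with rfl | hb0
      · simp
      · have : twoHypConst q c₀ c₁ c₂ c₃ c₄ (N + 1) b (N + 1) = 0 := by
          unfold twoHypConst
          rw [inv_mul_cancel₀ (pow_ne_zero _ hq0)]
          obtain ⟨b, rfl⟩ := Nat.exists_eq_succ_of_ne_zero hb0.ne'
          simp [qPoch_succ']
        rw [this]; simp
    · rw [ih x hx']
      have m1 : 1 - (q ^ (N + 1))⁻¹ * q ^ x ≠ 0 :=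
        one_sub_ne_zero_of_qPoch (g3 (N + 1) le_rfl) (show x < N + 1 by omega)
      exact twoHyp_shift_rat (twoHypConst_shift h hx') (twoHypConst_factor_aux h _ _ _) m1
        ((h.g2.mul hq0).sub_pow_ne_zero x)
  · rcases Nat.eq_zero_or_pos x with rfl | hx0
    · simp
    · obtain ⟨x, rfl⟩ := Nat.exists_eq_succ_of_ne_zero hx0.ne'
      rw [Nat.succ_eq_add_one, Nat.add_sub_cancel, ih x (by omega), twoHypConst_shift_pred h]
      refine twoHyp_shift_pred_rat (g := c₂ * c₄) (c13 := c₁ * c₃) (c04 := c₀ * c₄)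
        (Q := q ^ (N + 1)) (X := q ^ (x + 1)) (Xi := (q ^ (x + 1))⁻¹) (c₁ := c₁) (c₂ := c₂) (q := q)
        (twoHypConst_factor_aux h _ _ _) ?_ ?_ ?_ ?_ ?_ ?_ ?_ ?_ ?_ ?_
      · exact ((h.g013.mul_pow hq0 _).mul_inv_pow hq0 _).sub_ne_zero
      · exact h.g4.sub_pow_ne_zero (x + 1)
      · exact (h.g024.mul_pow hq0 (N + 1 + 2)).sub_pow_ne_zero x
      · rw [← h.bal]; ring
      · ring
      · ring
      · have e : c₀ * c₁ * c₃ * (q ^ (N + 1) * q * q * (q * q ^ (N + 1)) * (c₂ * c₄)) = 1 := by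
          rw [← h.bal]; ring
        have hXX : q ^ (x + 1) * (q ^ (x + 1))⁻¹ = 1 := mul_inv_cancel₀ hX
        have hQQ : q ^ (N + 1) * (q ^ (N + 1))⁻¹ = 1 := mul_inv_cancel₀ (pow_ne_zero _ hq0)
        generalize (q ^ (x + 1))⁻¹ = Xi at *
        generalize (q ^ (N + 1))⁻¹ = Qi at *
        linear_combination (-(c₂ * c₄ * q * (c₀ * c₁ * c₃ * q ^ (N + 1 + 2)))) * hXX +
          (-Qi) * e + (q ^ 3 * q ^ (N + 1) * (c₀ * c₁ * c₃) * (c₂ * c₄)) * hQQ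
      · have e : c₀ * c₂ * c₄ * (q ^ (N + 1) * q * q * (q * q ^ (N + 1)) * (c₁ * c₃)) = 1 := by
          rw [← h.bal]; ring
        have hXX : q ^ (x + 1) * (q ^ (x + 1))⁻¹ = 1 := mul_inv_cancel₀ hX
        generalize (q ^ (x + 1))⁻¹ = Xi at *
        linear_combination (-(q * q ^ x * Xi)) * e - hXX
      · exact mul_inv_cancel₀ hX
      · ring
  · rw [show c₁ * c₂ * c₄ * q ^ (N + 1 + 2) = c₁ * (c₂ * c₄) * (q ^ (N + 1) * q ^ 2) by ring]
    convert rat using 2 <;> ring_nf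

theorem twoHypConst_zero_succ (q c₀ c₁ c₂ c₃ c₄ : ℂ) (N x : ℕ) :
    twoHypConst q c₀ c₁ c₂ c₃ c₄ N 0 (x + 1) = twoHypConst q c₀ c₁ c₂ c₃ c₄ N 0 x *
      ((1 - q * c₄ * q ^ x) * (1 - c₀ * c₂ * c₄ * q ^ (N + 2) * q ^ x) /
        ((1 - q * c₂ * q ^ x) * (1 - (c₀ * q ^ N)⁻¹ * q ^ x)) * (c₀ * c₄ * q ^ (N + 1))⁻¹) := by
  unfold twoHypConst
  simp only [qPoch_succ _ _ x, pow_succ _ x, qPoch_zero, pow_zero]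
  simp only [div_eq_mul_inv, mul_inv]
  ring

theorem twoHyp_zero_step_aux {q X Q J c₀ c₂ c₄ c123 f1 f2 gC g3 e1 e2 rho t1 c0i k S0 S1 T u1 Q1 Q2 : ℂ} (sf : f2 * gC * g3 * (S1 - S0) = q * (c₂ * c₄ * q * X - J) * rho * T)
    (hT : T = k * (t1 * (f1 * u1 * g3 * f2 * c0i * X / (f1 * u1 * g3 * e1 * e2))))
    (hr : rho * t1 * c0i = (1 - c123 * Q2) * gC * g3)
    (hbal : q ^ 3 * Q ^ 2 * (c₀ * c₄ * c123) = 1) (he1 : e1 = 1 - (c₀ * Q)⁻¹ * X)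
    (he2 : e2 = 1 - q * c₂ * X) (hQ1 : Q1 = Q * q) (hQ2 : Q2 = Q * q ^ 2) (hJ : J * (q * X) = 1)
    (n1 : f1 ≠ 0) (n2 : f2 ≠ 0) (n3 : gC ≠ 0) (n4 : g3 ≠ 0) (n5 : e1 ≠ 0) (n6 : e2 ≠ 0)
    (n7 : u1 ≠ 0) (n8 : c₀ ≠ 0) (n9 : c₄ ≠ 0) (n10 : q ≠ 0) (n11 : Q ≠ 0) :
    S1 - S0 = k * ((1 - q * c₄ * X) * (1 - c₀ * c₂ * c₄ * Q2 * X) / (e2 * e1) *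
      (c₀ * c₄ * Q1)⁻¹) - k := by
  subst hQ1 hQ2
  have e : f1 * u1 * g3 * f2 * c0i * X / (f1 * u1 * g3 * e1 * e2) * (e1 * e2) =
      f2 * c0i * X := by
    field_simp
  have key : (1 - q * c₄ * X) * (1 - c₀ * c₂ * c₄ * (Q * q ^ 2) * X) * (c₀ * c₄ * (Q * q))⁻¹ -
      e2 * e1 = (q * (c₂ * c₄ * q * X ^ 2) - 1) * (1 - c123 * (Q * q ^ 2)) := by
    have h3 : c123 = 1 / (q ^ 3 * Q ^ 2 * (c₀ * c₄)) := by
      field_simp; linear_combination hbal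
    rw [he1, he2, h3]
    field_simp
    ring
  have s : f2 * gC * g3 * (e1 * e2) * (S1 - S0) = f2 * gC * g3 *
      (k * ((q * (c₂ * c₄ * q * X ^ 2) - 1) * (1 - c123 * (Q * q ^ 2)))) := by
    rw [hT] at sf
    linear_combination (e1 * e2) * sf + (q * (c₂ * c₄ * q * X - J) * rho * k * t1) * e +
      (q * (c₂ * c₄ * q * X - J) * k * f2 * X) * hr -
      (k * f2 * (1 - c123 * (Q * q ^ 2)) * gC * g3) * hJ
  rw [← key] at s
  have s2 : f2 * gC * g3 * (e1 * e2) * (S1 - S0) = f2 * gC * g3 * (e1 * e2) *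
      (k * ((1 - q * c₄ * X) * (1 - c₀ * c₂ * c₄ * (Q * q ^ 2) * X) / (e2 * e1) *
      (c₀ * c₄ * (Q * q))⁻¹) - k) := by
    rw [s]
    generalize (c₀ * c₄ * (Q * q))⁻¹ = z
    generalize (1 - q * c₄ * X) * (1 - c₀ * c₂ * c₄ * (Q * q ^ 2) * X) = z'
    clear key s e hT sf he1 he2 hr
    field_simp
  exact mul_left_cancel₀ (by positivity) s2

theorem twoHypSum_zero_succ_sub {q c₀ c₁ c₂ c₃ c₄ : ℂ} {N : ℕ}
    (h : GenericFive q c₀ c₁ c₂ c₃ c₄ (N + 1)) {x : ℕ} (hx : x ≤ N)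
    (ih : twoHypSum q (q * c₁) (q * c₂) c₃ c₄ N 0 x =
      twoHypConst q c₀ (q * c₁) (q * c₂) c₃ c₄ N 0 x) :
    twoHypSum q c₁ c₂ c₃ c₄ (N + 1) 0 (x + 1) - twoHypSum q c₁ c₂ c₃ c₄ (N + 1) 0 x =
      twoHypConst q c₀ c₁ c₂ c₃ c₄ (N + 1) 0 (x + 1) -
        twoHypConst q c₀ c₁ c₂ c₃ c₄ (N + 1) 0 x := by
  have hq := h.hq
  have hq0 := hq.ne
  have gC : Generic q (c₁ * c₂ * c₄ * q ^ (N + 1 + 2)) := h.g124.mul_pow hq0 _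
  have g31 := hq.one_sub_inv_ne_zero N
  have hX := pow_ne_zero x hq0
  have sf := sum_forward (al := c₁ * c₂ * q) (mu := c₂ * c₄ * q)
    (d₁ := q * c₂) (d₂ := c₁ * c₂ * c₄ * q ^ (N + 1 + 2)) (d₃ := (q ^ (N + 1))⁻¹) hq0
    (twoHypWeight q c₁ c₂ c₃ c₄ (N + 1)) (twoHypWeight q (q * c₁) (q * c₂) c₃ c₄ N) N x
    (fun m _ => twoHypWeight_succ h m) (h.g2.mul hq0).sub_ne_zero gC.sub_ne_zero g31
    (hq.qPoch _)
  have r2 : ∀ i m, hyp q (c₁ * c₂ * q) (c₂ * c₄ * q) (q * c₂) (c₁ * c₂ * c₄ * q ^ (N + 1 + 2))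
      (q ^ (N + 1))⁻¹ i m = racahHyp q c₄ c₂ c₁ (N + 1) i m := fun i m => by
    unfold racahHyp; congr 1 <;> ring
  have r4 : ∀ i m, hyp q (q ^ 2 * (c₁ * c₂ * q)) (q * (c₂ * c₄ * q)) (q * (q * c₂))
      (q * (c₁ * c₂ * c₄ * q ^ (N + 1 + 2))) (q * (q ^ (N + 1))⁻¹) i m =
      racahHyp q c₄ (q * c₂) (q * c₁) N i m := fun i m => by
    rw [← racahHyp_shift₂₃ hq0]; congr 1 <;> ring
  have r0 : ∀ (a b : ℂ) L x, twoHypSum q a b c₃ c₄ L 0 x = ∑ m ∈ Finset.range (L + 1),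
      twoHypWeight q a b c₃ c₄ L m * racahHyp q c₄ b a L m x := fun a b L x =>
    Finset.sum_congr rfl fun m _ => by rw [racahHyp, hyp_zero_left, mul_one]
  simp only [r2, r4] at sf
  rw [← r0, ← r0, ← r0, ih] at sf
  have hT := twoHypConst_shift h (b := 0) hx
  have hr := twoHypConst_factor_aux h (1 - c₁ * c₂ * c₃ * q ^ (N + 1 + 2))
        (1 - c₁ * c₂ * c₄ * q ^ (N + 1 + 2)) (1 - (q ^ (N + 1))⁻¹)
  rw [twoHypConst_zero_succ]
  simp only [pow_zero, mul_one] at hT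
  have m1 : 1 - (q ^ (N + 1))⁻¹ * q ^ x ≠ 0 :=
    one_sub_ne_zero_of_qPoch (hq.qPoch_inv_pow (le_refl (N + 1))) (show x < N + 1 by omega)
  exact twoHyp_zero_step_aux (Q := q ^ (N + 1)) (c123 := c₁ * c₂ * c₃) (J := (q ^ (x + 1))⁻¹)
    sf hT hr (by rw [← h.bal]; ring) rfl rfl
    (pow_succ q (N + 1)) (pow_add q (N + 1) 2)
    (by rw [pow_succ']; exact inv_mul_cancel₀ (mul_ne_zero hq0 hX)) (h.g1.mul hq0).sub_ne_zero
    (h.g2.mul hq0).sub_ne_zero gC.sub_ne_zero g31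
    ((h.g0.mul_pow hq0 (N + 1)).inv.mul_pow hq0 x).sub_ne_zero
    ((h.g2.mul hq0).sub_pow_ne_zero x) m1 h.n0 h.n4 hq0 (pow_ne_zero _ hq0)

theorem twoHypSum_eq {q c₀ c₃ c₄ : ℂ} (N : ℕ) : ∀ {c₁ c₂ : ℂ},
    GenericFive q c₀ c₁ c₂ c₃ c₄ N → ∀ b x, b ≤ N → x ≤ N →
    twoHypSum q c₁ c₂ c₃ c₄ N b x = twoHypConst q c₀ c₁ c₂ c₃ c₄ N b x := by
  induction N with
  | zero =>
    intro c₁ c₂ h b x hb hx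
    obtain rfl : b = 0 := by omega
    obtain rfl : x = 0 := by omega
    have h0 : 1 - c₁ * c₂ * q ≠ 0 := by simpa using h.g12.sub_pow_ne_zero 1
    simp [twoHypSum, twoHypConst, racahHyp, hyp_zero_left, twoHypWeight, vwpTerm, vwp_zero h0,
      qPoch_zero]
  | succ N ih =>
    intro c₁ c₂ h b
    have hq0 := h.hq.ne
    induction b with
    | zero =>
      intro x _ hx
      induction x with
      | zero =>
        have n0 := h.n0
        have n1 := h.n1
        have n2 := h.n2
        have n3 := h.n3
        have n4 := h.n4
        have e1 : ∀ c : ℂ, c ≠ 0 →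
            c₁ * c₂ * q / (c₁ * c₂ * c * q ^ (N + 1 + 2)) = (c * q ^ (N + 2))⁻¹ := by
          intro c hc
          field_simp; ring
        have e2 : ∀ c : ℂ, c ≠ 0 →
            c₁ * c₂ * q * q / (c₁ * c₂ * c * q ^ (N + 1 + 2)) = (c * q ^ (N + 1))⁻¹ := by
          intro c hc
          field_simp; ring
        have e := sum_vwpTerm h.hq (N + 1) (al := c₁ * c₂ * q)
          (B := c₁ * c₂ * c₃ * q ^ (N + 1 + 2)) (C := c₁ * c₂ * c₄ * q ^ (N + 1 + 2))
          (by simpa using h.g12.mul_pow hq0 1) (by positivity) (by positivity)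
          (by rw [e1 _ n3]; exact (h.g3.mul_pow hq0 _).inv)
          (by rw [e1 _ n4]; exact (h.g4.mul_pow hq0 _).inv)
        have e3 : c₁ * c₂ * q * q /
            (c₁ * c₂ * c₃ * q ^ (N + 1 + 2) * (c₁ * c₂ * c₄ * q ^ (N + 1 + 2))) = q * c₀ := by
          rw [div_eq_iff (by positivity)]
          linear_combination (-(c₁ * c₂ * q * q)) * h.bal
        rw [e2 _ n3, e2 _ n4, e3] at e
        have : twoHypConst q c₀ c₁ c₂ c₃ c₄ (N + 1) 0 0 =
            qPoch (c₁ * c₂ * q * q) q (N + 1) * qPoch (q * c₀) q (N + 1) /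
              (qPoch (c₃ * q ^ (N + 1))⁻¹ q (N + 1) * qPoch (c₄ * q ^ (N + 1))⁻¹ q (N + 1)) := by
          unfold twoHypConst
          rw [show c₁ * c₂ * q * q = c₁ * c₂ * q ^ 2 by ring]
          simp [qPoch_zero]
        rw [this, ← e]
        refine Finset.sum_congr rfl fun m _ => ?_
        rw [racahHyp, racahHyp, hyp_zero_left, hyp_zero_right hq0, mul_one, mul_one]
        rfl
      | succ x ihx =>
        have s := twoHypSum_zero_succ_sub h (by omega)
          (ih h.shift₁₂ 0 x (by omega) (by omega))
        linear_combination s + ihx (by omega)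
    | succ b ihb =>
      intro x hb hx
      have s := twoHypSum_succ_sub h (by omega : b ≤ N) hx
        fun y hy => ih h.shift₁₂ b y (by omega) hy
      linear_combination s + ihb x (by omega) hx

/-- The weight in `pentSum`. -/
def pentWeight (q c₀ c₁ c₂ c₃ c₄ : ℂ) (N L M a : ℕ) : ℂ :=
  vwp q (c₁ * c₂ * q) a * (c₀ * q ^ (N + 1)) ^ a *
    (qPoch (q ^ L)⁻¹ q a * qPoch (q ^ M)⁻¹ q a * qPoch (c₁ * c₂ * q ^ (N + 2)) q a *
        qPoch (c₁ * c₂ * c₃ * q ^ (L + 2)) q a * qPoch (c₁ * c₂ * c₄ * q ^ (M + 2)) q a /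
      (qPoch (c₁ * c₂ * q ^ (L + 2)) q a * qPoch (c₁ * c₂ * q ^ (M + 2)) q a *
        qPoch (q ^ N)⁻¹ q a * qPoch (c₃ * q ^ L)⁻¹ q a * qPoch (c₄ * q ^ M)⁻¹ q a))

/-- The sum of products of three series in the pentagon relation `pentSum_eq`. -/
def pentSum (q c₀ c₁ c₂ c₃ c₄ : ℂ) (N b j x y : ℕ) : ℂ :=
  ∑ a ∈ Finset.range (N + 1), pentWeight q c₀ c₁ c₂ c₃ c₄ N (N - j) (N - y) a *
    racahHyp q c₂ c₁ c₃ (N - j) b a * racahHyp q c₄ c₂ c₁ (N - y) a x *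
      racahHyp q c₃ c₀ c₄ (N - a) j y

theorem pentWeight_eq_zero {q : ℂ} (hq : q ≠ 0) (c₀ c₁ c₂ c₃ c₄ : ℂ) (N : ℕ) {L M a : ℕ}
    (h : L < a ∨ M < a) : pentWeight q c₀ c₁ c₂ c₃ c₄ N L M a = 0 := by
  rcases h with h | h <;> simp [pentWeight, qPoch_inv_pow_eq_zero hq h]

theorem mul_inv_mul_pow_succ {q : ℂ} (hq : q ≠ 0) (c : ℂ) (L : ℕ) :
    q * (c * q ^ (L + 1))⁻¹ = (c * q ^ L)⁻¹ := by
  rw [mul_inv, mul_left_comm, mul_inv_pow_succ hq, mul_inv]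

theorem mul_div_mul_ratio {C x₁ x₂ z₁ z₂ x₁' x₂' z₁' z₂' u u' v v' w w' t t' : ℂ}
    (e1 : x₁ * u' = u * x₁') (e2 : x₂' * v' = v * x₂) (e3 : z₁' * w' = w * z₁)
    (e4 : z₂ * t' = t * z₂') (n1 : z₁ ≠ 0) (n2 : z₂ ≠ 0) (n3 : z₁' ≠ 0) (n4 : z₂' ≠ 0) :
    C * (x₁ * x₂ / (z₁ * z₂)) * (v * t) * (u' * w') =
      C * (x₁' * x₂' / (z₁' * z₂')) * (u * w) * (v' * t') := by
  have e : x₁ * x₂ * (v * t) * (u' * w') * (z₁' * z₂') =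
      x₁' * x₂' * (u * w) * (v' * t') * (z₁ * z₂) := by
    calc _ = (x₁ * u') * (v * x₂) * (z₁' * w') * (t * z₂') := by ring
      _ = _ := by rw [e1, ← e2, e3, ← e4]; ring
  field_simp
  linear_combination C * e

theorem pentWeight_shift {q c₀ c₁ c₂ c₃ c₄ : ℂ} {N : ℕ}
    (h : GenericFive q c₀ c₁ c₂ c₃ c₄ (N + 1)) (L M a : ℕ) (ha : a ≤ N) :
    pentWeight q c₀ c₁ c₂ c₃ c₄ (N + 1) L (M + 1) a *
        ((1 - c₁ * c₂ * q ^ (N + 2)) * (1 - (q ^ (N + 1))⁻¹)) *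
        ((1 - (q ^ (M + 1))⁻¹ * q ^ a) * (1 - c₁ * c₂ * q ^ (M + 2) * q ^ a)) =
      pentWeight q (q * c₀) c₁ c₂ c₃ (q * c₄) N L M a *
        ((1 - (q ^ (M + 1))⁻¹) * (1 - c₁ * c₂ * q ^ (M + 2))) *
        ((1 - c₁ * c₂ * q ^ (N + 2) * q ^ a) * (1 - (q ^ (N + 1))⁻¹ * q ^ a)) := by
  have hq := h.hq
  have hq0 := hq.ne
  have e1 := qPoch_shift (q ^ (M + 1))⁻¹ q a
  have e2 := qPoch_shift (c₁ * c₂ * q ^ (N + 2)) q a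
  have e3 := qPoch_shift (c₁ * c₂ * q ^ (M + 2)) q a
  have e4 := qPoch_shift (q ^ (N + 1))⁻¹ q a
  have r2 : q * (c₁ * c₂ * q ^ (N + 2)) = c₁ * c₂ * q ^ (N + 1 + 2) := by ring
  have r3 : q * (c₁ * c₂ * q ^ (M + 2)) = c₁ * c₂ * q ^ (M + 1 + 2) := by ring
  rw [mul_inv_pow_succ hq0] at e1 e4
  rw [r2] at e2
  rw [r3] at e3
  have key := mul_div_mul_ratio (C := vwp q (c₁ * c₂ * q) a * (c₀ * q ^ (N + 1 + 1)) ^ a *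
    (qPoch (q ^ L)⁻¹ q a * qPoch (c₁ * c₂ * c₃ * q ^ (L + 2)) q a *
      qPoch (c₁ * c₂ * c₄ * q ^ (M + 1 + 2)) q a /
    (qPoch (c₁ * c₂ * q ^ (L + 2)) q a * qPoch (c₃ * q ^ L)⁻¹ q a *
      qPoch (c₄ * q ^ (M + 1))⁻¹ q a))) e1 e2 e3 e4 ((h.g12.mul_pow hq0 _).qPoch a)
    (hq.qPoch_inv_pow (by omega)) ((h.g12.mul_pow hq0 _).qPoch a) (hq.qPoch_inv_pow ha)
  unfold pentWeight
  rw [show q * c₀ * q ^ (N + 1) = c₀ * q ^ (N + 1 + 1) by ring,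
    show c₁ * c₂ * (q * c₄) * q ^ (M + 2) = c₁ * c₂ * c₄ * q ^ (M + 1 + 2) by ring,
    show q * c₄ * q ^ M = c₄ * q ^ (M + 1) by ring]
  convert key using 3
  · simp only [div_eq_mul_inv, mul_inv_rev]
    ring
  · simp only [div_eq_mul_inv, mul_inv_rev]
    ring

theorem pentWeight_shift_pred {q c₀ c₁ c₂ c₃ c₄ : ℂ} {N : ℕ}
    (h : GenericFive q c₀ c₁ c₂ c₃ c₄ (N + 1)) (L M a : ℕ) (ha : a ≤ N) :
    pentWeight q c₀ c₁ c₂ c₃ c₄ (N + 1) L M a *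
        ((1 - c₁ * c₂ * q ^ (N + 2)) * (1 - (q ^ (N + 1))⁻¹)) *
        ((1 - c₁ * c₂ * c₄ * q ^ (M + 2) * q ^ a) * (1 - (c₄ * q ^ (M + 1))⁻¹ * q ^ a)) =
      pentWeight q (q * c₀) c₁ c₂ c₃ (q * c₄) N L M a *
        ((1 - c₁ * c₂ * c₄ * q ^ (M + 2)) * (1 - (c₄ * q ^ (M + 1))⁻¹)) *
        ((1 - c₁ * c₂ * q ^ (N + 2) * q ^ a) * (1 - (q ^ (N + 1))⁻¹ * q ^ a)) := by
  have hq := h.hq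
  have hq0 := hq.ne
  have e1 := qPoch_shift (c₁ * c₂ * c₄ * q ^ (M + 2)) q a
  have e2 := qPoch_shift (c₁ * c₂ * q ^ (N + 2)) q a
  have e3 := qPoch_shift (c₄ * q ^ (M + 1))⁻¹ q a
  have e4 := qPoch_shift (q ^ (N + 1))⁻¹ q a
  have r1 : q * (c₁ * c₂ * c₄ * q ^ (M + 2)) = c₁ * c₂ * (q * c₄) * q ^ (M + 2) := by ring
  have r2 : q * (c₁ * c₂ * q ^ (N + 2)) = c₁ * c₂ * q ^ (N + 1 + 2) := by ring
  rw [mul_inv_mul_pow_succ hq0] at e3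
  rw [mul_inv_pow_succ hq0] at e4
  rw [r1] at e1
  rw [r2] at e2
  have key := mul_div_mul_ratio (C := vwp q (c₁ * c₂ * q) a * (c₀ * q ^ (N + 1 + 1)) ^ a *
    (qPoch (q ^ L)⁻¹ q a * qPoch (q ^ M)⁻¹ q a * qPoch (c₁ * c₂ * c₃ * q ^ (L + 2)) q a /
    (qPoch (c₁ * c₂ * q ^ (L + 2)) q a * qPoch (c₁ * c₂ * q ^ (M + 2)) q a *
      qPoch (c₃ * q ^ L)⁻¹ q a))) e1 e2 e3 e4 ((h.g4.mul_pow hq0 _).inv.qPoch a)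
    (hq.qPoch_inv_pow (by omega)) ((h.g4.mul_pow hq0 _).inv.qPoch a) (hq.qPoch_inv_pow ha)
  unfold pentWeight
  rw [show q * c₀ * q ^ (N + 1) = c₀ * q ^ (N + 1 + 1) by ring,
    show q * c₄ * q ^ M = c₄ * q ^ (M + 1) by ring]
  convert key using 3
  · simp only [div_eq_mul_inv, mul_inv_rev]
    ring
  · simp only [div_eq_mul_inv, mul_inv_rev]
    ring

/-- One summand in the recursion for `pentSum`. -/
theorem pent_summand_aux {mu f₀ g₂ g₃ Y n n' H H0 H1 m p v u₂ u₃ v₂ v₃ W W0 W1 k₀ k₁ D Z Z0 Z1 Z2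
    Z3 γ δ e₀ e₁ e₂ e₃ Bh : ℂ}
    (h1 : mu * f₀ * g₂ * g₃ * Y * n * H =
      mu * m * p * u₂ * u₃ * H0 - (1 - Y) * v * v₂ * v₃ * H1)
    (w0 : W * D * (u₂ * u₃) = W0 * (γ * k₀) * Y * (g₂ * g₃))
    (w1 : W * D * (v₂ * v₃) = W1 * (δ * k₁) * (mu * Y) * (g₂ * g₃))
    (p0 : W0 * (γ * n' * Z) = W0 * (e₀ * Z0 + e₁ * Z1))
    (p1 : δ * n' * Z = e₂ * Z2 + e₃ * Z3) (hY : Y ≠ 0) (hg : g₂ ≠ 0) (hg' : g₃ ≠ 0) :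
    mu * f₀ * n * n' * D * (W * Bh * Z * H) =
      mu * m * p * k₀ * (e₀ * (W0 * Bh * Z0 * H0) + e₁ * (W0 * Bh * Z1 * H0)) -
      (1 - Y) * v * mu * k₁ * (e₂ * (W1 * Bh * Z2 * H1) + e₃ * (W1 * Bh * Z3 * H1)) := by
  have : (g₂ * g₃ * Y) * (mu * f₀ * n * n' * D * (W * Bh * Z * H)) = (g₂ * g₃ * Y) *
      (mu * m * p * k₀ * (e₀ * (W0 * Bh * Z0 * H0) + e₁ * (W0 * Bh * Z1 * H0)) -
      (1 - Y) * v * mu * k₁ * (e₂ * (W1 * Bh * Z2 * H1) + e₃ * (W1 * Bh * Z3 * H1))) := by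
    linear_combination (n' * D * W * Bh * Z) * h1 + (n' * Bh * Z * mu * m * p * H0) * w0 -
      (n' * Bh * Z * (1 - Y) * v * H1) * w1 +
      (k₀ * Y * g₂ * g₃ * Bh * mu * m * p * H0) * p0 -
      (W1 * k₁ * mu * Y * g₂ * g₃ * Bh * (1 - Y) * v * H1) * p1
  exact mul_left_cancel₀ (by positivity) this

theorem racahHyp_shift_left {q : ℂ} (hq : NonRoot q) {a : ℂ} (b c : ℂ) {L n : ℕ} (x : ℕ)
    (h : n ≤ L) :
    (1 - (q ^ (L + 1))⁻¹) * (1 - a * b * q * (q ^ x) ^ 2) * racahHyp q a b c (L + 1) n x =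
      (1 - (q ^ (L + 1))⁻¹ * q ^ x) * (1 - a * b * q * q ^ x) * racahHyp q (q * a) b c L n x +
        ((q ^ (L + 1))⁻¹ - a * b * q * q ^ x) * (q ^ x - 1) *
          racahHyp q (q * a) b c L n (x - 1) := by
  have e := hyp_shift hq.ne (b * c * q) (a * b * q) (q * b) (a * b * c * q ^ (L + 1 + 2))
    (b₁ := (q ^ (L + 1))⁻¹) n x (hq.qPoch_inv_pow (by omega))
  have r1 : ∀ y, hyp q (b * c * q) (a * b * q) (q ^ (L + 1))⁻¹ (q * b) (a * b * c * q ^ (L + 1 + 2))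
      n y = racahHyp q a b c (L + 1) n y := fun y => by
    rw [hyp_swap₁₃, hyp_swap₁₂]; rfl
  have r2 : ∀ y, hyp q (b * c * q) (q * (a * b * q)) (q * (q ^ (L + 1))⁻¹) (q * b)
      (a * b * c * q ^ (L + 1 + 2)) n y = racahHyp q (q * a) b c L n y := fun y => by
    rw [hyp_swap₁₃, hyp_swap₁₂, mul_inv_pow_succ hq.ne]
    unfold racahHyp
    congr 1 <;> ring
  rw [r1, r2, r2] at e
  exact e

theorem racahHyp_shift_left' {q : ℂ} (hq : NonRoot q) {a b c : ℂ} (L n x : ℕ)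
    (h : Generic q (a * b * c)) :
    (1 - a * b * c * q ^ (L + 2)) * (1 - a * b * q * (q ^ x) ^ 2) * racahHyp q a b c L n x =
      (1 - a * b * c * q ^ (L + 2) * q ^ x) * (1 - a * b * q * q ^ x) *
          racahHyp q (q * a) b c L n x +
        (a * b * c * q ^ (L + 2) - a * b * q * q ^ x) * (q ^ x - 1) *
          racahHyp q (q * a) b c L n (x - 1) := by
  have e := hyp_shift hq.ne (b * c * q) (a * b * q) (q * b) (q ^ L)⁻¹
    (b₁ := a * b * c * q ^ (L + 2)) n x ((h.mul_pow hq.ne _).qPoch _)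
  have r1 : ∀ y, hyp q (b * c * q) (a * b * q) (a * b * c * q ^ (L + 2)) (q * b) (q ^ L)⁻¹
      n y = racahHyp q a b c L n y := fun y => by
    rw [hyp_swap₁₂]; rfl
  have r2 : ∀ y, hyp q (b * c * q) (q * (a * b * q)) (q * (a * b * c * q ^ (L + 2))) (q * b)
      (q ^ L)⁻¹ n y = racahHyp q (q * a) b c L n y := fun y => by
    rw [hyp_swap₁₂]
    unfold racahHyp
    congr 1 <;> ring
  rw [r1, r2, r2] at e
  exact e

theorem racahHyp_backward {q : ℂ} (hq : NonRoot q) {a b c : ℂ} {L m : ℕ} (x : ℕ) (hm : m ≤ L)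
    (h1 : Generic q b) (h2 : Generic q (a * b * c)) :
    a * b * q * (1 - q * b) * (1 - a * b * c * q ^ (L + 1 + 2)) * (1 - (q ^ (L + 1))⁻¹) * q ^ x *
        (1 - a * b * q * (q ^ x) ^ 2) * racahHyp q a b c (L + 1) (m + 1) x =
      a * b * q * (1 - a * b * q * q ^ x) * (1 - q * b * q ^ x) *
          (1 - a * b * c * q ^ (L + 1 + 2) * q ^ x) * (1 - (q ^ (L + 1))⁻¹ * q ^ x) *
          racahHyp q a (q * b) (q * c) L m x -
        (1 - q ^ x) * (q * b - a * b * q * q ^ x) *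
          (a * b * c * q ^ (L + 1 + 2) - a * b * q * q ^ x) *
          ((q ^ (L + 1))⁻¹ - a * b * q * q ^ x) * racahHyp q a (q * b) (q * c) L m (x - 1) := by
  have e := hyp_backward hq.ne (lam := b * c * q) (mu := a * b * q) (b₁ := q * b)
    (b₂ := a * b * c * q ^ (L + 1 + 2)) (b₃ := (q ^ (L + 1))⁻¹) m x
    (by have := hq.ne; field_simp; ring) ((h1.mul hq.ne).qPoch _) ((h2.mul_pow hq.ne _).qPoch _)
    (hq.qPoch_inv_pow (by omega)) (hq.qPoch _)
  rw [racahHyp_shift₂₃ hq.ne, racahHyp_shift₂₃ hq.ne] at e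
  exact e

section coef
variable {q c₀ c₁ c₂ c₃ c₄ : ℂ} {n a y L : ℕ}

theorem pent_coef₁ (h : GenericFive q c₀ c₁ c₂ c₃ c₄ (n + a + 1)) :
    1 - c₃ * c₀ * c₄ * q ^ (n + 1 + 2) =
      -(c₃ * c₀ * c₄ * q ^ (n + 1 + 2) * (1 - c₁ * c₂ * q ^ (n + a + 2) * q ^ a)) := by
  linear_combination (-1) * h.bal

theorem pent_coef₂ (h : GenericFive q c₀ c₁ c₂ c₃ c₄ (n + a + 1)) (hL : L + y = n + a + 1) :
    1 - c₃ * c₀ * c₄ * q ^ (n + 1 + 2) * q ^ y =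
      -(c₃ * c₀ * c₄ * q ^ (n + 1 + 2) * q ^ y * (1 - c₁ * c₂ * q ^ (L + 1) * q ^ a)) := by
  have e : q ^ L * q ^ y = q ^ (n + a + 1) := by rw [← pow_add, hL]
  linear_combination (-1) * h.bal -
    (c₃ * c₀ * c₄ * q ^ (n + 1 + 2) * c₁ * c₂ * q * q ^ a) * e

theorem pent_coef₃ (h : GenericFive q c₀ c₁ c₂ c₃ c₄ (n + a + 1)) (hL : L + y = n + a + 1) :
    c₃ * c₀ * c₄ * q ^ (n + 1 + 2) - c₃ * c₀ * q * q ^ y =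
      c₃ * c₀ * c₄ * q ^ (n + 1 + 2) * (1 - (c₄ * q ^ (L + 1))⁻¹ * q ^ a) := by
  have e : q ^ L * q ^ y = q ^ (n + a + 1) := by rw [← pow_add, hL]
  have hq := h.hq.ne
  have h4 := h.n4
  field_simp
  linear_combination (-(c₃ * c₀ * q ^ 2)) * e

theorem pent_coef₄ (h : GenericFive q c₀ c₁ c₂ c₃ c₄ (n + a + 1)) (hL : L + y = n + a + 1) :
    (q ^ (n + 1))⁻¹ - c₃ * c₀ * q * q ^ y =
      -(c₃ * c₀ * q * q ^ y * (1 - c₁ * c₂ * c₄ * q ^ (L + 2) * q ^ a)) := by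
  have e : q ^ L * q ^ y = q ^ (n + a + 1) := by rw [← pow_add, hL]
  have hQ : (q ^ (n + 1))⁻¹ * q ^ (n + 1) = 1 := inv_mul_cancel₀ (pow_ne_zero _ h.hq.ne)
  generalize (q ^ (n + 1))⁻¹ = z at *
  linear_combination (-z) * h.bal - (c₃ * c₀ * c₁ * c₂ * c₄ * q ^ 3 * q ^ a) * e +
    (c₃ * c₀ * c₁ * c₂ * c₄ * q ^ (n + a + a + 4)) * hQ

theorem pent_coef₅ (hq : q ≠ 0) : (q ^ (n + 1))⁻¹ = (q ^ (n + a + 1))⁻¹ * q ^ a := by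
  field_simp; ring

theorem pent_coef₆ (hq : q ≠ 0) (hL : L + y = n + a + 1) :
    (q ^ (n + 1))⁻¹ * q ^ y = (q ^ L)⁻¹ * q ^ a := by
  have e : q ^ L * q ^ y = q ^ (n + a + 1) := by rw [← pow_add, hL]
  field_simp
  linear_combination e

theorem pent_summand (h : GenericFive q c₀ c₁ c₂ c₃ c₄ (n + a + 1)) (b x : ℕ) {m : ℕ}
    (hm : m ≤ n) (hL : L + y = n + a) (K : ℕ) :
    c₃ * c₀ * q * (1 - q * c₀) * (1 - c₃ * c₀ * q * (q ^ y) ^ 2) *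
      (1 - c₄ * c₂ * q * (q ^ x) ^ 2) *
      ((1 - c₁ * c₂ * q ^ (n + a + 2)) * (1 - (q ^ (n + a + 1))⁻¹)) *
      (pentWeight q c₀ c₁ c₂ c₃ c₄ (n + a + 1) K (L + 1) a * racahHyp q c₂ c₁ c₃ K b a *
        racahHyp q c₄ c₂ c₁ (L + 1) a x * racahHyp q c₃ c₀ c₄ (n + 1) (m + 1) y) =
    c₃ * c₀ * q * (1 - c₃ * c₀ * q * q ^ y) * (1 - q * c₀ * q ^ y) *
      (1 - c₁ * c₂ * q ^ (L + 2)) *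
      ((1 - (q ^ (L + 1))⁻¹ * q ^ x) * (1 - c₄ * c₂ * q * q ^ x) *
        (pentWeight q (q * c₀) c₁ c₂ c₃ (q * c₄) (n + a) K L a * racahHyp q c₂ c₁ c₃ K b a *
          racahHyp q (q * c₄) c₂ c₁ L a x * racahHyp q c₃ (q * c₀) (q * c₄) n m y) +
      ((q ^ (L + 1))⁻¹ - c₄ * c₂ * q * q ^ x) * (q ^ x - 1) *
        (pentWeight q (q * c₀) c₁ c₂ c₃ (q * c₄) (n + a) K L a * racahHyp q c₂ c₁ c₃ K b a *
          racahHyp q (q * c₄) c₂ c₁ L a (x - 1) * racahHyp q c₃ (q * c₀) (q * c₄) n m y)) -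
    (1 - q ^ y) * (q * c₀ - c₃ * c₀ * q * q ^ y) * (c₃ * c₀ * q) *
      (1 - (c₄ * q ^ (L + 1 + 1))⁻¹) *
      ((1 - c₄ * c₂ * c₁ * q ^ (L + 1 + 2) * q ^ x) * (1 - c₄ * c₂ * q * q ^ x) *
        (pentWeight q (q * c₀) c₁ c₂ c₃ (q * c₄) (n + a) K (L + 1) a *
          racahHyp q c₂ c₁ c₃ K b a * racahHyp q (q * c₄) c₂ c₁ (L + 1) a x *
          racahHyp q c₃ (q * c₀) (q * c₄) n m (y - 1)) +
      (c₄ * c₂ * c₁ * q ^ (L + 1 + 2) - c₄ * c₂ * q * q ^ x) * (q ^ x - 1) *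
        (pentWeight q (q * c₀) c₁ c₂ c₃ (q * c₄) (n + a) K (L + 1) a *
          racahHyp q c₂ c₁ c₃ K b a * racahHyp q (q * c₄) c₂ c₁ (L + 1) a (x - 1) *
          racahHyp q c₃ (q * c₀) (q * c₄) n m (y - 1))) := by
  have hq := h.hq
  have hq0 := hq.ne
  have g304 : Generic q (c₃ * c₀ * c₄) := by
    rw [mul_comm c₃ c₀]; exact h.g034
  have g421 : Generic q (c₄ * c₂ * c₁) := by
    rw [show c₄ * c₂ * c₁ = c₁ * c₂ * c₄ by ring]; exact h.g124
  have R1 := racahHyp_backward hq (L := n) (m := m) y hm h.g0 g304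
  have hL' : L + 1 + y = n + a + 1 := by omega
  have s1 := pentWeight_shift h K L a (by omega)
  have s2 := pentWeight_shift_pred h K (L + 1) a (by omega)
  have e1 := pent_coef₁ h
  have e2 := pent_coef₂ h hL'
  have e3 := pent_coef₃ h hL'
  have e4 := pent_coef₄ h hL'
  have e5 := pent_coef₅ (n := n) (a := a) hq0
  have e6 := pent_coef₆ hq0 hL'
  refine pent_summand_aux (γ := 1 - (q ^ (L + 1))⁻¹) (δ := 1 - c₄ * c₂ * c₁ * q ^ (L + 1 + 2))
    (Y := q ^ y) R1 ?_ ?_ ?_ (racahHyp_shift_left' hq (L + 1) a x g421) (pow_ne_zero _ hq0)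
    (g304.mul_pow hq0 _).sub_ne_zero (hq.one_sub_inv_ne_zero n)
  · rw [e2, e1, e6, e5, show L + 1 + 1 = L + 2 from rfl]
    linear_combination (-(c₃ * c₀ * c₄ * q ^ (n + 1 + 2) * q ^ y)) * s1
  · rw [e3, e4, e1, e5, show c₄ * c₂ * c₁ * q ^ (L + 1 + 2) = c₁ * c₂ * c₄ * q ^ (L + 1 + 2) by ring]
    linear_combination (-(c₃ * c₀ * c₄ * q ^ (n + 1 + 2) * (c₃ * c₀ * q) * q ^ y)) * s2
  · rcases Nat.lt_or_ge L a with ha | ha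
    · rw [pentWeight_eq_zero hq0 _ _ _ _ _ _ (Or.inr ha)]; simp
    · rw [racahHyp_shift_left hq c₂ c₁ x ha]

/-- The last summand lemma at the boundary `y = N + 1`. -/
theorem pent_summand_boundary (h : GenericFive q c₀ c₁ c₂ c₃ c₄ (n + 1)) {m : ℕ}
    (hm : m ≤ n) :
    c₃ * c₀ * q * (1 - q * c₀) * (1 - c₃ * c₀ * q * (q ^ (n + 1)) ^ 2) *
      (1 - c₄ * c₂ * q) *
      ((1 - c₁ * c₂ * q ^ (n + 2)) * (1 - (q ^ (n + 1))⁻¹)) *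
      racahHyp q c₃ c₀ c₄ (n + 1) (m + 1) (n + 1) =
    -((1 - q ^ (n + 1)) * (q * c₀ - c₃ * c₀ * q * q ^ (n + 1)) * (c₃ * c₀ * q) *
      (1 - (c₄ * q)⁻¹) * ((1 - c₄ * c₂ * c₁ * q ^ 2) * (1 - c₄ * c₂ * q) *
        racahHyp q c₃ (q * c₀) (q * c₄) n m n)) := by
  have hq := h.hq
  have hq0 := hq.ne
  have g304 : Generic q (c₃ * c₀ * c₄) := by
    rw [mul_comm c₃ c₀]; exact h.g034
  have R1 := racahHyp_backward hq (L := n) (m := m) (n + 1) hm h.g0 g304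
  have e1 := pent_coef₁ (a := 0) h
  have e3 := pent_coef₃ (a := 0) (L := 0) (y := n + 1) h (by omega)
  have e4 := pent_coef₄ (a := 0) (L := 0) (y := n + 1) h (by omega)
  rw [Nat.add_sub_cancel, e3, e4, e1, inv_mul_cancel₀ (pow_ne_zero _ hq0)] at R1
  simp only [pow_zero, mul_one, zero_add, pow_one, add_zero] at R1
  have n1 := h.n0
  have n3 := h.n3
  have n4 := h.n4
  have : (c₃ * c₀ * c₄ * q ^ (n + 1 + 2) * q ^ (n + 1)) ≠ 0 := by positivity
  refine mul_left_cancel₀ this ?_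
  linear_combination (-(1 - c₄ * c₂ * q)) * R1

end coef

theorem pentWeight_zero {q c₁ c₂ : ℂ} (c₀ c₃ c₄ : ℂ) (N L M : ℕ) (h : Generic q (c₁ * c₂)) :
    pentWeight q c₀ c₁ c₂ c₃ c₄ N L M 0 = 1 := by
  have : 1 - c₁ * c₂ * q ≠ 0 := by simpa using h.sub_pow_ne_zero 1
  simp [pentWeight, vwp, qPoch_zero, this]

section step
variable {q c₀ c₁ c₂ c₃ c₄ : ℂ} {N : ℕ}

theorem pentSum_top {c₀ c₁ c₂ c₃ c₄ : ℂ} (hq : NonRoot q) (h : Generic q (c₁ * c₂)) (b j x : ℕ) :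
    pentSum q c₀ c₁ c₂ c₃ c₄ N b j x N = racahHyp q c₃ c₀ c₄ N j N := by
  unfold pentSum
  rw [Finset.sum_eq_single 0]
  · rw [pentWeight_zero _ _ _ _ _ _ h]
    simp [racahHyp, hyp_zero_left, hyp_zero_right hq.ne]
  · intro a _ ha
    rw [pentWeight_eq_zero hq.ne _ _ _ _ _ _ (Or.inr (by omega))]
    simp
  · simp

theorem pentSum_step (h : GenericFive q c₀ c₁ c₂ c₃ c₄ (N + 1)) (b : ℕ) {m x y M : ℕ}
    (hm : m ≤ N) (hM : M + y = N + 1) (hx : x ≤ M) :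
    c₃ * c₀ * q * (1 - q * c₀) * (1 - c₃ * c₀ * q * (q ^ y) ^ 2) *
      (1 - c₄ * c₂ * q * (q ^ x) ^ 2) *
      ((1 - c₁ * c₂ * q ^ (N + 2)) * (1 - (q ^ (N + 1))⁻¹)) *
      pentSum q c₀ c₁ c₂ c₃ c₄ (N + 1) b (m + 1) x y =
    c₃ * c₀ * q * (1 - c₃ * c₀ * q * q ^ y) * (1 - q * c₀ * q ^ y) *
      (1 - c₁ * c₂ * q ^ (M + 1)) *
      ((1 - (q ^ M)⁻¹ * q ^ x) * (1 - c₄ * c₂ * q * q ^ x) *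
        pentSum q (q * c₀) c₁ c₂ c₃ (q * c₄) N b m x y +
      ((q ^ M)⁻¹ - c₄ * c₂ * q * q ^ x) * (q ^ x - 1) *
        pentSum q (q * c₀) c₁ c₂ c₃ (q * c₄) N b m (x - 1) y) -
    (1 - q ^ y) * (q * c₀ - c₃ * c₀ * q * q ^ y) * (c₃ * c₀ * q) *
      (1 - (c₄ * q ^ (M + 1))⁻¹) *
      ((1 - c₄ * c₂ * c₁ * q ^ (M + 2) * q ^ x) * (1 - c₄ * c₂ * q * q ^ x) *
        pentSum q (q * c₀) c₁ c₂ c₃ (q * c₄) N b m x (y - 1) +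
      (c₄ * c₂ * c₁ * q ^ (M + 2) - c₄ * c₂ * q * q ^ x) * (q ^ x - 1) *
        pentSum q (q * c₀) c₁ c₂ c₃ (q * c₄) N b m (x - 1) (y - 1)) := by
  have hq := h.hq
  have hq0 := hq.ne
  rcases M with _ | L
  · obtain rfl : x = 0 := by omega
    obtain rfl : y = N + 1 := by omega
    rw [Nat.add_sub_cancel, pentSum_top hq h.g12, pentSum_top hq h.g12]
    have := pent_summand_boundary h hm
    simp only [pow_zero, mul_one, zero_add, pow_one, sub_self, inv_one, mul_zero, zero_mul,
      add_zero, one_pow] at this ⊢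
    linear_combination this
  · have hL : L = N - y := by omega
    unfold pentSum
    rw [Finset.sum_range_succ _ (N + 1), pentWeight_eq_zero hq0 _ _ _ _ _ _
      (Or.inl (show N + 1 - (m + 1) < N + 1 by omega)), zero_mul, zero_mul, zero_mul, add_zero]
    have hzero : y ≠ 0 ∨ 1 - q ^ y = 0 := by
      rcases y with _ | y
      · right; simp
      · left; omega
    simp only [Finset.mul_sum, ← Finset.sum_add_distrib, ← Finset.sum_sub_distrib]
    refine Finset.sum_congr rfl fun a ha => ?_
    rcases Nat.lt_or_ge (N - m) a with hlt | hge
    · rw [Nat.add_sub_add_right]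
      repeat rw [pentWeight_eq_zero hq0 _ _ _ _ _ _ (Or.inl hlt)]
      ring
    · obtain ⟨n, rfl⟩ : ∃ n, N = n + a := ⟨N - a, by simp at ha; omega⟩
      have key := pent_summand h b x (m := m) (L := L) (y := y) (by omega) (by omega) (n + a - m)
      rw [Nat.add_sub_add_right, show n + a + 1 - y = L + 1 by omega,
        show n + a + 1 - a = n + 1 by omega, ← hL, Nat.add_sub_cancel]
      rcases hzero with hy | hy
      · rw [show n + a - (y - 1) = L + 1 by omega]
        linear_combination key
      · rw [hy] at key ⊢
        linear_combination key

end step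

/-- A factor of `pentConst`. -/
def pentFactor (q c₀ P c₃ c₄ : ℂ) (N j : ℕ) : ℂ :=
  qPoch (q * c₄) q j / qPoch (q * c₀) q j *
    (qPoch (c₃ * q ^ N)⁻¹ q j / qPoch (P * q ^ (N + 1))⁻¹ q j) * (c₀ * c₃ * q ^ (N + 1)) ^ j

theorem pentFactor_succ {q c₀ P c₃ c₄ : ℂ} {N m : ℕ} (hq : q ≠ 0) (h0 : Generic q c₀)
    (hP : Generic q P) :
    pentFactor q c₀ P c₃ c₄ (N + 1) (m + 1) *
        ((1 - q * c₀) * (1 - (P * q ^ (N + 2))⁻¹)) =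
      pentFactor q (q * c₀) P c₃ (q * c₄) N m *
        ((1 - q * c₄) * (1 - (c₃ * q ^ (N + 1))⁻¹) * (c₀ * c₃ * q ^ (N + 2))) := by
  unfold pentFactor
  have n1 := (((h0.mul hq).mul hq).qPoch m)
  have n2 := ((hP.mul_pow hq (N + 1)).inv.qPoch m)
  have n3 := (h0.mul hq).sub_ne_zero
  have n4 := (hP.mul_pow hq (N + 2)).inv.sub_ne_zero
  rw [qPoch_succ', qPoch_succ', qPoch_succ', qPoch_succ', mul_inv_mul_pow_succ hq,
    mul_inv_mul_pow_succ hq, show N + 1 + 1 = N + 2 from rfl,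
    show q * c₀ * c₃ * q ^ (N + 1) = c₀ * c₃ * q ^ (N + 2) by ring, pow_succ _ m]
  generalize qPoch (q * (q * c₀)) q m = y0 at *
  generalize qPoch (P * q ^ (N + 1))⁻¹ q m = y1 at *
  generalize (P * q ^ (N + 2))⁻¹ = y2 at *
  generalize (c₃ * q ^ (N + 1))⁻¹ = y3 at *
  generalize (c₃ * q ^ N)⁻¹ = y4 at *
  generalize 1 - q * c₀ = y5 at *
  generalize 1 - y2 = y6 at *
  generalize c₀ * c₃ * q ^ (N + 2) = y7 at *
  field_simp

theorem pentFactor_shift {q c₀ P c₃ c₄ : ℂ} {N y : ℕ} (hq : q ≠ 0) (h0 : Generic q c₀)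
    (hP : Generic q P) :
    pentFactor q (q * c₀) P (q * c₄) c₃ N y *
        ((1 - q * c₀ * q ^ y) * (1 - (P * q ^ (N + 2))⁻¹ * q ^ y)) =
      pentFactor q c₀ P c₄ c₃ (N + 1) y *
        ((1 - q * c₀) * (1 - (P * q ^ (N + 2))⁻¹) * q ^ y) := by
  unfold pentFactor
  have n1 := ((h0.mul hq).qPoch y)
  have n2 := ((hP.mul_pow hq (N + 2)).inv.qPoch y)
  have n3 := (h0.mul hq).sub_ne_zero
  have n4 := (hP.mul_pow hq (N + 2)).inv.sub_ne_zero
  have n5 := (h0.mul hq).sub_pow_ne_zero y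
  have n6 := (hP.mul_pow hq (N + 2)).inv.sub_pow_ne_zero y
  have e : (q * c₀ * (q * c₄) * q ^ (N + 1)) ^ y = (c₀ * c₄ * q ^ (N + 1 + 1)) ^ y * q ^ y := by
    rw [← mul_pow]; ring
  rw [← mul_inv_mul_pow_succ hq P (N + 1), show N + 1 + 1 = N + 2 from rfl, qPoch_mul_eq n3,
    qPoch_mul_eq n4, show q * c₄ * q ^ N = c₄ * q ^ (N + 1) by ring, e,
    show N + 1 + 1 = N + 2 from rfl]
  generalize (c₀ * c₄ * q ^ (N + 2)) ^ y = y0 at *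
  generalize (P * q ^ (N + 2))⁻¹ = y1 at *
  generalize (c₄ * q ^ (N + 1))⁻¹ = y2 at *
  generalize 1 - q * c₀ * q ^ y = y3 at *
  generalize 1 - q * c₀ = y4 at *
  generalize 1 - y1 * q ^ y = y5 at *
  generalize 1 - y1 = y6 at *
  generalize qPoch (q * c₀) q y = y7 at *
  generalize qPoch y1 q y = y8 at *
  field_simp

theorem pentFactor_shift_pred {q c₀ P c₃ c₄ : ℂ} {N t : ℕ} (hq : q ≠ 0) (h0 : Generic q c₀)
    (hP : Generic q P) :
    pentFactor q (q * c₀) P (q * c₄) c₃ N t *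
        ((1 - q * c₃ * q ^ t) * (1 - (c₄ * q ^ (N + 1))⁻¹ * q ^ t) * (c₀ * c₄ * q ^ (N + 2))) =
      pentFactor q c₀ P c₄ c₃ (N + 1) (t + 1) *
        ((1 - q * c₀) * (1 - (P * q ^ (N + 2))⁻¹) * q ^ t) := by
  unfold pentFactor
  have n1 := (((h0.mul hq).mul hq).qPoch t)
  have n2 := ((hP.mul_pow hq (N + 1)).inv.qPoch t)
  have n3 := (h0.mul hq).sub_ne_zero
  have n4 := (hP.mul_pow hq (N + 2)).inv.sub_ne_zero
  have e : (q * c₀ * (q * c₄) * q ^ (N + 1)) ^ t = (c₀ * c₄ * q ^ (N + 1 + 1)) ^ t * q ^ t := by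
    rw [← mul_pow]; ring
  rw [qPoch_succ (q * c₃), qPoch_succ (c₄ * q ^ (N + 1))⁻¹, qPoch_succ', qPoch_succ',
    mul_inv_mul_pow_succ hq, show q * c₄ * q ^ N = c₄ * q ^ (N + 1) by ring, e,
    show N + 1 + 1 = N + 2 from rfl, pow_succ _ t]
  generalize (P * q ^ (N + 2))⁻¹ = y0 at *
  generalize (c₄ * q ^ (N + 1))⁻¹ = y1 at *
  generalize c₀ * c₄ * q ^ (N + 2) = y2 at *
  generalize 1 - q * c₀ = y3 at *
  generalize 1 - y0 = y4 at *
  generalize qPoch (q * (q * c₀)) q t = y5 at *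
  generalize qPoch (P * q ^ (N + 1))⁻¹ q t = y6 at *
  field_simp

section
variable {q c₀ c₁ c₂ c₃ c₄ : ℂ} {N : ℕ}

/-- The factor of `twoHypConst` which does not depend on `b` and `x`. -/
def twoHypConst₁ (q c₀ P c₃ c₄ : ℂ) (N : ℕ) : ℂ :=
  qPoch (P * q ^ 2) q N * qPoch (q * c₀) q N /
      (qPoch (c₃ * q ^ N)⁻¹ q N * qPoch (c₄ * q ^ N)⁻¹ q N)

/-- The factor of `twoHypConst` which depends on `b`. -/
def twoHypConst₂ (q c₀ c₁ c₃ : ℂ) (N b x : ℕ) : ℂ :=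
  qPoch (q * c₃) q b / qPoch (q * c₁) q b *
      (qPoch ((q ^ N)⁻¹ * q ^ x) q b * qPoch (c₁ * c₃ * q ^ (N + 2)) q b *
          qPoch (c₀ * c₁ * c₃ * q ^ (N + 2) * (q ^ x)⁻¹) q b /
        (qPoch (c₁ * c₃ * q ^ (N + 2) * (q ^ x)⁻¹) q b * qPoch (q ^ N)⁻¹ q b *
          qPoch ((c₀ * q ^ N)⁻¹ * q ^ x) q b)) * ((c₀ * c₃ * q ^ (N + 1))⁻¹) ^ b

/-- The factor of `twoHypConst` which depends on `x` only. -/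
def twoHypConst₃ (q c₀ c₂ c₄ : ℂ) (N x : ℕ) : ℂ :=
  qPoch (q * c₄) q x / qPoch (q * c₂) q x *
      (qPoch (c₀ * c₂ * c₄ * q ^ (N + 2)) q x / qPoch (c₀ * q ^ N)⁻¹ q x) *
        ((c₀ * c₄ * q ^ (N + 1))⁻¹) ^ x

theorem twoHypConst_eq (b x : ℕ) : twoHypConst q c₀ c₁ c₂ c₃ c₄ N b x =
    twoHypConst₁ q c₀ (c₁ * c₂) c₃ c₄ N * twoHypConst₂ q c₀ c₁ c₃ N b x *
      twoHypConst₃ q c₀ c₂ c₄ N x := rfl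

theorem twoHypConst₁_shift (h : GenericFive q c₀ c₁ c₂ c₃ c₄ (N + 1)) :
    twoHypConst₁ q (q * c₀) (c₁ * c₂) c₃ (q * c₄) N *
        ((1 - c₁ * c₂ * q ^ (N + 2)) * (1 - q * c₀)) =
      twoHypConst₁ q c₀ (c₁ * c₂) c₃ c₄ (N + 1) *
        ((1 - (c₃ * q ^ (N + 1))⁻¹) * (1 - (q * c₄)⁻¹)) := by
  have hq0 := h.hq.ne
  have m1 := (h.g3.mul_pow hq0 (N + 1)).inv.sub_ne_zero
  have m2 := (h.g4.mul hq0).inv.sub_ne_zero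
  have m3 := (h.g3.mul_pow hq0 N).inv.qPoch N
  have m4 := (h.g4.mul_pow hq0 (N + 1)).inv.qPoch N
  have n4 := h.n4
  unfold twoHypConst₁
  rw [qPoch_succ (c₁ * c₂ * q ^ 2), qPoch_succ' (q * c₀), qPoch_succ' (c₃ * q ^ (N + 1))⁻¹,
    qPoch_succ (c₄ * q ^ (N + 1))⁻¹, mul_inv_mul_pow_succ hq0,
    show c₁ * c₂ * q ^ 2 * q ^ N = c₁ * c₂ * q ^ (N + 2) by ring,
    show q * c₄ * q ^ N = c₄ * q ^ (N + 1) by ring,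
    show (c₄ * q ^ (N + 1))⁻¹ * q ^ N = (q * c₄)⁻¹ by field_simp; ring]
  generalize 1 - (c₃ * q ^ (N + 1))⁻¹ = y0 at *
  generalize 1 - (q * c₄)⁻¹ = y1 at *
  generalize (c₄ * q ^ (N + 1))⁻¹ = y2 at *
  generalize (c₃ * q ^ N)⁻¹ = y3 at *
  field_simp

theorem twoHypConst₂_shift (h : GenericFive q c₀ c₁ c₂ c₃ c₄ (N + 1)) {b : ℕ} (hb : b ≤ N)
    (x : ℕ) :
    twoHypConst₂ q (q * c₀) c₁ c₃ N b x *
        ((1 - (q ^ (N + 1))⁻¹ * q ^ x) * (1 - c₁ * c₃ * q ^ (N + 2) * q ^ b) *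
          (1 - c₁ * c₃ * q ^ (N + 2) * (q ^ x)⁻¹) * (1 - (q ^ (N + 1))⁻¹ * q ^ b)) =
      twoHypConst₂ q c₀ c₁ c₃ (N + 1) b x *
        ((1 - (q ^ (N + 1))⁻¹ * q ^ x * q ^ b) * (1 - c₁ * c₃ * q ^ (N + 2)) *
          (1 - c₁ * c₃ * q ^ (N + 2) * (q ^ x)⁻¹ * q ^ b) * (1 - (q ^ (N + 1))⁻¹)) := by
  have hq := h.hq
  have hq0 := hq.ne
  have m1 := h.g13.sub_pow_ne_zero (N + 2)
  have m2 := ((h.g13.mul_pow hq0 (N + 2)).mul_inv_pow hq0 x).sub_ne_zero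
  have m2' := ((h.g13.mul_pow hq0 (N + 2)).mul_inv_pow hq0 x).qPoch b
  have m3 := hq.one_sub_inv_ne_zero N
  have m4 := (hq.qPoch_inv_pow (show b ≤ N + 1 by omega))
  have m5 := ((h.g13.mul_pow hq0 (N + 2)).mul_inv_pow hq0 x).sub_pow_ne_zero b
  have m6 : 1 - (q ^ (N + 1))⁻¹ * q ^ b ≠ 0 :=
    one_sub_ne_zero_of_qPoch (hq.qPoch_inv_pow (le_refl (N + 1))) (by omega)
  have e1 := qPoch_shift ((q ^ (N + 1))⁻¹ * q ^ x) q b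
  unfold twoHypConst₂
  rw [show q * ((q ^ (N + 1))⁻¹ * q ^ x) = (q ^ N)⁻¹ * q ^ x by
    rw [← mul_assoc, mul_inv_pow_succ hq0]] at e1
  rw [show q * c₀ * c₁ * c₃ * q ^ (N + 2) = c₀ * c₁ * c₃ * q ^ (N + 1 + 2) by ring,
    show q * c₀ * q ^ N = c₀ * q ^ (N + 1) by ring,
    show q * c₀ * c₃ * q ^ (N + 1) = c₀ * c₃ * q ^ (N + 1 + 1) by ring,
    show c₁ * c₃ * q ^ (N + 1 + 2) * (q ^ x)⁻¹ = q * (c₁ * c₃ * q ^ (N + 2) * (q ^ x)⁻¹) by ring,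
    show c₁ * c₃ * q ^ (N + 1 + 2) = q * (c₁ * c₃ * q ^ (N + 2)) by ring,
    qPoch_inv_pow_eq hq N (b := b), qPoch_mul_eq m1, qPoch_mul_eq m2]
  generalize 1 - c₁ * c₃ * q ^ (N + 2) * (q ^ x)⁻¹ * q ^ b = y0 at *
  generalize 1 - c₁ * c₃ * q ^ (N + 2) * (q ^ x)⁻¹ = y1 at *
  generalize 1 - c₁ * c₃ * q ^ (N + 2) * q ^ b = y2 at *
  generalize 1 - c₁ * c₃ * q ^ (N + 2) = y3 at *
  generalize 1 - (q ^ (N + 1))⁻¹ * q ^ x * q ^ b = y4 at *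
  generalize 1 - (q ^ (N + 1))⁻¹ * q ^ b = y5 at *
  generalize 1 - (q ^ (N + 1))⁻¹ * q ^ x = y6 at *
  generalize 1 - (q ^ (N + 1))⁻¹ = y7 at *
  generalize qPoch (c₁ * c₃ * q ^ (N + 2) * (q ^ x)⁻¹) q b = y8 at *
  generalize qPoch (q ^ (N + 1))⁻¹ q b = y9 at *
  generalize qPoch ((q ^ N)⁻¹ * q ^ x) q b = y10 at *
  generalize qPoch ((q ^ (N + 1))⁻¹ * q ^ x) q b = y11 at *
  generalize ((c₀ * c₃ * q ^ (N + 1 + 1))⁻¹) ^ b = y12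
  generalize qPoch ((c₀ * q ^ (N + 1))⁻¹ * q ^ x) q b = y13
  generalize qPoch (c₁ * c₃ * q ^ (N + 2)) q b = y14
  generalize qPoch (c₀ * c₁ * c₃ * q ^ (N + 1 + 2) * (q ^ x)⁻¹) q b = y15
  field_simp
  linear_combination
    (-(qPoch (q * c₃) q b * y14 * y15 * y12 * y2 / (qPoch (q * c₁) q b * y13))) * e1

theorem twoHypConst₃_shift (h : GenericFive q c₀ c₁ c₂ c₃ c₄ (N + 1)) (x : ℕ) :
    twoHypConst₃ q (q * c₀) c₂ (q * c₄) N x *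
        ((1 - q * c₄) * (1 - c₀ * c₂ * c₄ * q ^ (N + 3)) * q ^ x) =
      twoHypConst₃ q c₀ c₂ c₄ (N + 1) x *
        ((1 - q * c₄ * q ^ x) * (1 - c₀ * c₂ * c₄ * q ^ (N + 3) * q ^ x)) := by
  have hq := h.hq
  have hq0 := hq.ne
  have m1 := (h.g4.mul hq0).sub_ne_zero
  have m2 := (h.g024.mul_pow hq0 (N + 3)).sub_ne_zero
  have e : ((q * c₀ * (q * c₄) * q ^ (N + 1))⁻¹) ^ x =
      ((c₀ * c₄ * q ^ (N + 1 + 1))⁻¹) ^ x * (q ^ x)⁻¹ := by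
    rw [← inv_pow q, ← mul_pow]
    congr 1
    field_simp
    ring
  unfold twoHypConst₃
  rw [show q * c₀ * c₂ * (q * c₄) * q ^ (N + 2) = q * (c₀ * c₂ * c₄ * q ^ (N + 3)) by ring,
    show q * c₀ * q ^ N = c₀ * q ^ (N + 1) by ring, qPoch_mul_eq m1, qPoch_mul_eq m2, e,
    show N + 1 + 2 = N + 3 from rfl]
  generalize 1 - q * c₄ * q ^ x = y0 at *
  generalize 1 - q * c₄ = y1 at *
  generalize 1 - c₀ * c₂ * c₄ * q ^ (N + 3) * q ^ x = y2 at *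
  generalize 1 - c₀ * c₂ * c₄ * q ^ (N + 3) = y3 at *
  generalize qPoch (c₀ * q ^ (N + 1))⁻¹ q x = y4
  generalize ((c₀ * c₄ * q ^ (N + 1 + 1))⁻¹) ^ x = y5
  field_simp

theorem twoHypConst₂_shift_pred (h : GenericFive q c₀ c₁ c₂ c₃ c₄ (N + 1)) {b : ℕ} (hb : b ≤ N)
    (t : ℕ) :
    twoHypConst₂ q (q * c₀) c₁ c₃ N b t *
        ((1 - c₁ * c₃ * q ^ (N + 2) * q ^ b) * (1 - c₀ * c₁ * c₃ * q ^ (N + 2) * (q ^ t)⁻¹) *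
          (1 - (q ^ (N + 1))⁻¹ * q ^ b) * (1 - (c₀ * q ^ (N + 1))⁻¹ * q ^ t)) =
      twoHypConst₂ q c₀ c₁ c₃ (N + 1) b (t + 1) *
        ((1 - c₁ * c₃ * q ^ (N + 2)) * (1 - c₀ * c₁ * c₃ * q ^ (N + 2) * (q ^ t)⁻¹ * q ^ b) *
          (1 - (q ^ (N + 1))⁻¹) * (1 - (c₀ * q ^ (N + 1))⁻¹ * q ^ t * q ^ b)) := by
  have hq := h.hq
  have hq0 := hq.ne
  have m1 := h.g13.sub_pow_ne_zero (N + 2)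
  have m2 := ((h.g013.mul_pow hq0 (N + 2)).mul_inv_pow hq0 t).sub_ne_zero
  have m2' := ((h.g0.mul_pow hq0 (N + 1)).inv.mul_pow hq0 t).qPoch b
  have m2'' := ((h.g0.mul_pow hq0 (N + 1)).inv.mul_pow hq0 t).sub_ne_zero
  have m3 := hq.one_sub_inv_ne_zero N
  have m4 := (hq.qPoch_inv_pow (show b ≤ N + 1 by omega))
  have m5 := ((h.g0.mul_pow hq0 (N + 1)).inv.mul_pow hq0 t).sub_pow_ne_zero b
  have m6 : 1 - (q ^ (N + 1))⁻¹ * q ^ b ≠ 0 :=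
    one_sub_ne_zero_of_qPoch (hq.qPoch_inv_pow (le_refl (N + 1))) (by omega)
  unfold twoHypConst₂
  rw [show q * c₀ * c₁ * c₃ * q ^ (N + 2) * (q ^ t)⁻¹ =
      q * (c₀ * c₁ * c₃ * q ^ (N + 2) * (q ^ t)⁻¹) by ring,
    show c₀ * c₁ * c₃ * q ^ (N + 1 + 2) * (q ^ (t + 1))⁻¹ =
      c₀ * c₁ * c₃ * q ^ (N + 2) * (q ^ t)⁻¹ by field_simp; ring,
    show q * c₀ * q ^ N = c₀ * q ^ (N + 1) by ring,
    show q * c₀ * c₃ * q ^ (N + 1) = c₀ * c₃ * q ^ (N + 1 + 1) by ring,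
    show c₁ * c₃ * q ^ (N + 1 + 2) * (q ^ (t + 1))⁻¹ = c₁ * c₃ * q ^ (N + 2) * (q ^ t)⁻¹ by
      field_simp; ring,
    show c₁ * c₃ * q ^ (N + 1 + 2) = q * (c₁ * c₃ * q ^ (N + 2)) by ring,
    show (c₀ * q ^ (N + 1))⁻¹ * q ^ (t + 1) = q * ((c₀ * q ^ (N + 1))⁻¹ * q ^ t) by ring,
    show (q ^ (N + 1))⁻¹ * q ^ (t + 1) = (q ^ N)⁻¹ * q ^ t by field_simp; ring,
    qPoch_inv_pow_eq hq N (b := b), qPoch_mul_eq m1, qPoch_mul_eq m2, qPoch_mul_eq m2'']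
  generalize 1 - c₀ * c₁ * c₃ * q ^ (N + 2) * (q ^ t)⁻¹ * q ^ b = y0 at *
  generalize 1 - c₀ * c₁ * c₃ * q ^ (N + 2) * (q ^ t)⁻¹ = y1 at *
  generalize 1 - c₁ * c₃ * q ^ (N + 2) * q ^ b = y2 at *
  generalize 1 - c₁ * c₃ * q ^ (N + 2) = y3 at *
  generalize 1 - (c₀ * q ^ (N + 1))⁻¹ * q ^ t * q ^ b = y4 at *
  generalize 1 - (q ^ (N + 1))⁻¹ * q ^ b = y5 at *
  generalize 1 - (c₀ * q ^ (N + 1))⁻¹ * q ^ t = y6 at *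
  generalize 1 - (q ^ (N + 1))⁻¹ = y7 at *
  generalize qPoch ((c₀ * q ^ (N + 1))⁻¹ * q ^ t) q b = y8 at *
  generalize qPoch (q ^ (N + 1))⁻¹ q b = y9 at *
  generalize qPoch ((q ^ N)⁻¹ * q ^ t) q b = y10 at *
  generalize ((c₀ * c₃ * q ^ (N + 1 + 1))⁻¹) ^ b = y11
  generalize qPoch (c₁ * c₃ * q ^ (N + 2) * (q ^ t)⁻¹) q b = y12
  generalize qPoch (c₁ * c₃ * q ^ (N + 2)) q b = y13
  generalize qPoch (c₀ * c₁ * c₃ * q ^ (N + 2) * (q ^ t)⁻¹) q b = y14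
  field_simp

theorem twoHypConst₃_shift_pred (h : GenericFive q c₀ c₁ c₂ c₃ c₄ (N + 1)) (t : ℕ) :
    twoHypConst₃ q (q * c₀) c₂ (q * c₄) N t *
        ((1 - q * c₄) * (1 - c₀ * c₂ * c₄ * q ^ (N + 3)) * q ^ t) =
      twoHypConst₃ q c₀ c₂ c₄ (N + 1) (t + 1) *
        ((1 - q * c₂ * q ^ t) * (1 - (c₀ * q ^ (N + 1))⁻¹ * q ^ t) * (c₀ * c₄ * q ^ (N + 2))) := by
  have hq := h.hq
  have hq0 := hq.ne
  have n0 := h.n0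
  have n4 := h.n4
  have m1 := (h.g0.mul_pow hq0 (N + 1)).inv.sub_pow_ne_zero t
  have m2 := (h.g2.mul hq0).sub_pow_ne_zero t
  have e : ((q * c₀ * (q * c₄) * q ^ (N + 1))⁻¹) ^ t * q ^ t =
      ((c₀ * c₄ * q ^ (N + 1 + 1))⁻¹) ^ (t + 1) * (c₀ * c₄ * q ^ (N + 2)) := by
    rw [← mul_pow, pow_succ _ t, mul_assoc (_ ^ t), show N + 1 + 1 = N + 2 from rfl,
      inv_mul_cancel₀ (by positivity), mul_one]
    congr 1
    field_simp
    ring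
  unfold twoHypConst₃
  rw [show q * c₀ * c₂ * (q * c₄) * q ^ (N + 2) = q * (c₀ * c₂ * c₄ * q ^ (N + 3)) by ring,
    show q * c₀ * q ^ N = c₀ * q ^ (N + 1) by ring, qPoch_succ' (q * c₄), qPoch_succ (q * c₂),
    qPoch_succ (c₀ * q ^ (N + 1))⁻¹, qPoch_succ', show N + 1 + 2 = N + 3 from rfl]
  generalize 1 - q * c₂ * q ^ t = y0 at *
  generalize 1 - q * c₄ = y1 at *
  generalize 1 - (c₀ * q ^ (N + 1))⁻¹ * q ^ t = y2 at *
  generalize 1 - c₀ * c₂ * c₄ * q ^ (N + 3) = y3 at *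
  generalize qPoch (c₀ * q ^ (N + 1))⁻¹ q t = y4 at *
  generalize ((c₀ * c₄ * q ^ (N + 1 + 1))⁻¹) ^ (t + 1) = y5 at *
  generalize ((q * c₀ * (q * c₄) * q ^ (N + 1))⁻¹) ^ t = y6 at *
  generalize c₀ * c₄ * q ^ (N + 2) = y7 at *
  generalize q ^ t = y8 at *
  generalize qPoch (q * (q * c₄)) q t = y9 at *
  generalize qPoch (q * (c₀ * c₂ * c₄ * q ^ (N + 3))) q t = y10 at *
  field_simp
  linear_combination (y1 * y3 * y9 * y10 / (qPoch (q * c₂) q t * y4)) * e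

end

section
variable {q c₀ c₁ c₂ c₃ c₄ : ℂ} {N : ℕ}

theorem shift_coef_aux {T T' F F' P₂ f p e s v : ℂ}
    (h₁ : T' * ((1 - P₂) * (1 - f)) = T * ((1 - p) * (1 - e⁻¹)))
    (h₂ : F * ((1 - f) * (1 - s)) = F' * ((1 - e) * (1 - p) * v)) (hP : P₂ * s = 1)
    (hs : s = e * v) (he : e ≠ 0) (n₁ : 1 - s ≠ 0) (n₂ : 1 - f ≠ 0) (n₃ : 1 - e ≠ 0)
    (n₄ : 1 - p ≠ 0) : T' * F' = T * F := by
  have hs0 : s ≠ 0 := by rintro rfl; simp at hP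
  have hv0 : v ≠ 0 := by rintro rfl; simp at hs; exact hs0 hs
  have e1 : s * (1 - P₂) = -(1 - s) := by linear_combination -hP
  have e2 : e * (1 - e⁻¹) = -(1 - e) := by field_simp; ring
  refine mul_left_cancel₀ (mul_ne_zero (mul_ne_zero (mul_ne_zero (mul_ne_zero n₁ n₂) n₃) n₄)
    (mul_ne_zero he hv0)) ?_
  have e3 : T' * ((1 - s) * (1 - f)) * e = T * ((1 - p) * (1 - e)) * s := by
    linear_combination (-(e * s)) * h₁ + (T' * (1 - f) * e) * e1 - (T * (1 - p) * s) * e2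
  linear_combination (F' * (1 - e) * (1 - p) * v) * e3 - (T * (1 - p) * (1 - e) * s) * h₂ +
    T * F * (1 - s) * (1 - f) * (1 - e) * (1 - p) * hs

theorem twoHypConst₁_mul_pentFactor (h : GenericFive q c₀ c₁ c₂ c₃ c₄ (N + 1)) (m : ℕ) :
    twoHypConst₁ q (q * c₀) (c₁ * c₂) c₃ (q * c₄) N *
        pentFactor q (q * c₀) (c₁ * c₂) c₃ (q * c₄) N m =
      twoHypConst₁ q c₀ (c₁ * c₂) c₃ c₄ (N + 1) *
        pentFactor q c₀ (c₁ * c₂) c₃ c₄ (N + 1) (m + 1) := by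
  have hq0 := h.hq.ne
  have n1 := h.n1
  have n2 := h.n2
  refine shift_coef_aux (twoHypConst₁_shift h) (pentFactor_succ hq0 h.g0 h.g12)
    (mul_inv_cancel₀ (by positivity)) ?_ (mul_ne_zero hq0 h.n4)
    (h.g12.mul_pow hq0 _).inv.sub_ne_zero (h.g0.mul hq0).sub_ne_zero (h.g4.mul hq0).sub_ne_zero
    (h.g3.mul_pow hq0 _).inv.sub_ne_zero
  refine inv_eq_of_mul_eq_one_right ?_
  linear_combination h.bal

theorem shift_coef_aux₂ {T T' U U' u₁ u₂ u₃ u₄ I e X u₇ b₂ b₃ : ℂ}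
    (h₁ : T' * ((1 - u₁) * (1 - u₂ * I) * (1 - u₃) * (1 - u₄ * I)) =
      T * ((1 - u₁ * I) * (1 - u₂) * (1 - u₃ * I) * (1 - u₄)))
    (h₂ : U' * ((1 - e) * (1 - u₇) * X) = U * ((1 - e * X) * (1 - u₇ * X)))
    (hu : u₇ = b₂ * I) (hb : u₂ * I * b₂ = 1) (hx : u₃ * X = u₂) (hb₃ : b₃ = u₄ * I)
    (hu₁ : u₁ = u₄ * X) (n₁ : 1 - u₇ ≠ 0) (n₂ : 1 - u₇ * X ≠ 0) :
    T' * U' * ((1 - e) * (1 - b₂) * (1 - b₃) * X * (1 - u₁)) =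
      T * U * ((1 - e * X) * (1 - b₂ * X) * (1 - b₃ * X) * (1 - u₄)) := by
  subst hu hb₃ hu₁
  have e1 : 1 - b₂ = -(b₂ * (1 - u₂ * I)) := by linear_combination -hb
  have e2 : 1 - b₂ * I * X = -(b₂ * I * X * (1 - u₃)) := by
    linear_combination -hb - (I * b₂) * hx
  have e3 : 1 - b₂ * I = -(b₂ * I * (1 - u₂)) := by linear_combination -hb
  have e4 : 1 - b₂ * X = -(b₂ * X * (1 - u₃ * I)) := by
    linear_combination -hb - (I * b₂) * hx
  have h₁' : T' * ((1 - u₄ * X) * (1 - b₂) * (1 - b₂ * I * X) * (1 - u₄ * I)) =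
      T * ((1 - u₄ * X * I) * (1 - b₂ * I) * (1 - b₂ * X) * (1 - u₄)) := by
    rw [e1, e2, e3, e4]
    linear_combination (b₂ * (b₂ * I * X)) * h₁
  refine mul_left_cancel₀ (mul_ne_zero n₁ n₂) ?_
  linear_combination (U' * (1 - e) * (1 - b₂ * I) * X) * h₁' +
    (T * (1 - u₄ * X * I) * (1 - b₂ * I) * (1 - b₂ * X) * (1 - u₄)) * h₂

theorem twoHypConst_mul_shift {n b : ℕ} (h : GenericFive q c₀ c₁ c₂ c₃ c₄ (n + b + 1)) (x : ℕ) :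
    twoHypConst₂ q (q * c₀) c₁ c₃ (n + b) b x * twoHypConst₃ q (q * c₀) c₂ (q * c₄) (n + b) x *
        ((1 - q * c₄) * (1 - c₂ * c₄ * c₀ * q ^ (n + 1 + 2)) * (1 - (q ^ (n + 1))⁻¹) * q ^ x *
          (1 - (q ^ (n + b + 1))⁻¹ * q ^ x)) =
      twoHypConst₂ q c₀ c₁ c₃ (n + b + 1) b x * twoHypConst₃ q c₀ c₂ c₄ (n + b + 1) x *
        ((1 - q * c₄ * q ^ x) * (1 - c₂ * c₄ * c₀ * q ^ (n + 1 + 2) * q ^ x) *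
          (1 - (q ^ (n + 1))⁻¹ * q ^ x) * (1 - (q ^ (n + b + 1))⁻¹)) := by
  have hq0 := h.hq.ne
  refine shift_coef_aux₂ (twoHypConst₂_shift h (by omega) x) (twoHypConst₃_shift h x) (by ring) ?_
    (by field_simp) (pent_coef₅ hq0) rfl (h.g024.mul_pow hq0 _).sub_ne_zero
    ((h.g024.mul_pow hq0 _).sub_pow_ne_zero _)
  linear_combination h.bal

theorem shift_coef_aux₃ {T T' U U' u₂ u₄ u₅ u₆ I e Y u₇ b₂ b₃ w v nu : ℂ}
    (h₁ : T' * ((1 - u₂ * I) * (1 - u₅) * (1 - u₄ * I) * (1 - u₆)) =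
      T * ((1 - u₂) * (1 - u₅ * I) * (1 - u₄) * (1 - u₆ * I)))
    (h₂ : U' * ((1 - e) * (1 - u₇) * Y) = U * (w * (1 - u₆) * v))
    (hu : u₇ = b₂ * I) (hb : u₂ * I * b₂ = 1) (hb₃ : b₃ = u₄ * I)
    (hnu : b₂ * u₆ * I = nu) (hnu' : u₅ * I * nu = b₃) (hv : nu * v = e * b₂ * I * Y)
    (n₁ : 1 - u₇ ≠ 0) (n₂ : 1 - u₆ ≠ 0) (hI : I * Y ≠ 0) :
    T' * U' * ((1 - e) * (1 - b₂) * (1 - b₃) * (1 - u₅) * nu ^ 2) =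
      -(T * U * (e * w * (b₂ - nu) * (b₃ - nu) * (1 - u₄))) := by
  subst hu hb₃
  have e1 : 1 - b₂ = -(b₂ * (1 - u₂ * I)) := by linear_combination -hb
  have e3 : 1 - b₂ * I = -(b₂ * I * (1 - u₂)) := by linear_combination -hb
  have e4 : b₂ - nu = b₂ * (1 - u₆ * I) := by linear_combination hnu
  have e5 : u₄ * I - nu = -(nu * (1 - u₅ * I)) := by linear_combination -hnu'
  have h₁' : T' * ((1 - b₂) * (1 - u₅) * (1 - u₄ * I) * (1 - u₆) * I) =
      T * ((1 - b₂ * I) * (1 - u₅ * I) * (1 - u₄) * (1 - u₆ * I)) := by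
    rw [e1, e3]
    linear_combination (-b₂ * I) * h₁
  rw [e4, e5]
  refine mul_left_cancel₀ (mul_ne_zero (mul_ne_zero n₁ n₂) hI) ?_
  linear_combination (U' * (1 - e) * (1 - b₂ * I) * nu ^ 2 * Y) * h₁' +
    (T * (1 - u₅ * I) * (1 - u₆ * I) * (1 - b₂ * I) * (1 - u₄) * nu ^ 2) * h₂ +
    (T * U * w * (1 - u₅ * I) * (1 - u₆ * I) * (1 - b₂ * I) * (1 - u₄) * (1 - u₆) * nu) * hv

theorem twoHypConst_mul_shift_pred {n b : ℕ} (h : GenericFive q c₀ c₁ c₂ c₃ c₄ (n + b + 1))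
    (t : ℕ) :
    twoHypConst₂ q (q * c₀) c₁ c₃ (n + b) b t * twoHypConst₃ q (q * c₀) c₂ (q * c₄) (n + b) t *
        ((1 - q * c₄) * (1 - c₂ * c₄ * c₀ * q ^ (n + 1 + 2)) * (1 - (q ^ (n + 1))⁻¹) *
          (1 - c₀ * c₁ * c₃ * q ^ (n + b + 2) * (q ^ t)⁻¹) * (c₂ * c₄ * q * q ^ (t + 1)) ^ 2) =
      -(twoHypConst₂ q c₀ c₁ c₃ (n + b + 1) b (t + 1) *
        twoHypConst₃ q c₀ c₂ c₄ (n + b + 1) (t + 1) *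
        (q * c₄ * (1 - q * c₂ * q ^ t) *
          (c₂ * c₄ * c₀ * q ^ (n + 1 + 2) - c₂ * c₄ * q * q ^ (t + 1)) *
          ((q ^ (n + 1))⁻¹ - c₂ * c₄ * q * q ^ (t + 1)) * (1 - (q ^ (n + b + 1))⁻¹))) := by
  have hq0 := h.hq.ne
  have n0 := h.n0
  have n4 := h.n4
  refine shift_coef_aux₃ (twoHypConst₂_shift_pred h (by omega) t) (twoHypConst₃_shift_pred h t)
    (by ring) ?_ (pent_coef₅ hq0) ?_ ?_ ?_ (h.g024.mul_pow hq0 _).sub_ne_zero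
    ((h.g0.mul_pow hq0 _).inv.sub_pow_ne_zero _) (by positivity)
  · linear_combination h.bal
  · field_simp; ring
  · field_simp
    linear_combination q ^ t * h.bal
  · ring

end

section
variable {q c₀ c₁ c₂ c₃ c₄ : ℂ} {N : ℕ}

theorem pentFactor_coef (h : GenericFive q c₀ c₁ c₂ c₃ c₄ (N + 1)) {y M : ℕ}
    (hM : M + y = N + 1) :
    pentFactor q (q * c₀) (c₁ * c₂) (q * c₄) c₃ N y *
        ((1 - q * c₀ * q ^ y) * (1 - c₁ * c₂ * q ^ (M + 1))) =
      pentFactor q c₀ (c₁ * c₂) c₄ c₃ (N + 1) y *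
        ((1 - q * c₀) * (1 - c₁ * c₂ * q ^ (N + 2))) := by
  have hq0 := h.hq.ne
  have n1 := h.n1
  have n2 := h.n2
  have e := pentFactor_shift (c₃ := c₃) (c₄ := c₄) (N := N) (y := y) hq0 h.g0 h.g12
  have e2 : q ^ (N + 2) = q ^ (M + 1) * q ^ y := by rw [← pow_add]; congr 1; omega
  have f1 : (c₁ * c₂ * q ^ (N + 2))⁻¹ * q ^ y = (c₁ * c₂ * q ^ (M + 1))⁻¹ := by
    rw [e2]; field_simp
  have f2 : ∀ z : ℂ, z ≠ 0 → 1 - z = -(z * (1 - z⁻¹)) := fun z hz => by field_simp; ring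
  rw [f1] at e
  rw [f2 (c₁ * c₂ * q ^ (N + 2)) (by positivity), f2 (c₁ * c₂ * q ^ (M + 1)) (by positivity)]
  linear_combination (-(c₁ * c₂ * q ^ (M + 1))) * e + (pentFactor q c₀ (c₁ * c₂) c₄ c₃ (N + 1) y *
    (1 - q * c₀) * (1 - (c₁ * c₂ * q ^ (N + 2))⁻¹) * (c₁ * c₂)) * e2

theorem pentFactor_coef_pred (h : GenericFive q c₀ c₁ c₂ c₃ c₄ (N + 1)) {y M : ℕ}
    (hM : M + y = N + 1) :
    (1 - q ^ y) * (q * c₀ - c₃ * c₀ * q * q ^ y) * (1 - (c₄ * q ^ (M + 1))⁻¹) *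
        pentFactor q (q * c₀) (c₁ * c₂) (q * c₄) c₃ N (y - 1) =
      -((1 - q ^ y) * (c₃ * c₀ * q * q ^ y) * ((1 - q * c₀) * (1 - c₁ * c₂ * q ^ (N + 2))) *
        pentFactor q c₀ (c₁ * c₂) c₄ c₃ (N + 1) y) := by
  rcases y with _ | t
  · simp
  have hq0 := h.hq.ne
  have n0 := h.n0
  have n1 := h.n1
  have n2 := h.n2
  have n4 := h.n4
  have e := pentFactor_shift_pred (c₃ := c₃) (c₄ := c₄) (N := N) (t := t) hq0 h.g0 h.g12
  have e2 : q ^ (N + 1) = q ^ (M + 1) * q ^ t := by rw [← pow_add]; congr 1; omega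
  have f1 : (c₄ * q ^ (N + 1))⁻¹ * q ^ t = (c₄ * q ^ (M + 1))⁻¹ := by
    rw [e2]; field_simp
  have f2 : ∀ z : ℂ, z ≠ 0 → 1 - z = -(z * (1 - z⁻¹)) := fun z hz => by field_simp; ring
  rw [f1] at e
  rw [f2 (c₁ * c₂ * q ^ (N + 2)) (by positivity), Nat.add_sub_cancel]
  refine mul_left_cancel₀ (show c₀ * c₄ * q ^ (N + 2) ≠ 0 by positivity) ?_
  linear_combination ((1 - q ^ (t + 1)) * (q * c₀)) * e - (pentFactor q c₀ (c₁ * c₂) c₄ c₃ (N + 1) (t + 1) *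
    ((1 - q * c₀) * (1 - (c₁ * c₂ * q ^ (N + 2))⁻¹)) * c₀ * q * q ^ t * (1 - q ^ (t + 1))) * h.bal

/-- The constant in the pentagon relation `pentSum_eq`. -/
def pentConst (q c₀ c₁ c₂ c₃ c₄ : ℂ) (N b j x y : ℕ) : ℂ :=
  twoHypConst q c₀ c₁ c₂ c₃ c₄ N b x * pentFactor q c₀ (c₁ * c₂) c₃ c₄ N j *
    pentFactor q c₀ (c₁ * c₂) c₄ c₃ N y

/-- The right-hand side of the pentagon relation `pentSum_eq`. -/
def pentRhs (q c₀ c₁ c₂ c₃ c₄ : ℂ) (N b j x y : ℕ) : ℂ :=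
  pentConst q c₀ c₁ c₂ c₃ c₄ N b j x y * racahHyp q c₂ c₄ c₀ (N - b) j x *
    racahHyp q c₀ c₃ c₁ (N - x) b y

theorem twoHypConst₂_eq_zero {q : ℂ} (hq : q ≠ 0) (c₀ c₁ c₃ : ℂ) {N b x : ℕ} (hx : x ≤ N)
    (h : N < b + x) : twoHypConst₂ q c₀ c₁ c₃ N b x = 0 := by
  have : (q ^ N)⁻¹ * q ^ x = (q ^ (N - x))⁻¹ := by
    obtain ⟨k, rfl⟩ := Nat.exists_eq_add_of_le' hx
    rw [Nat.add_sub_cancel]; field_simp; ring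
  simp [twoHypConst₂, this, qPoch_inv_pow_eq_zero hq (show N - x < b by omega)]

theorem pentRhs_aux₁ {nn f P₂ u₄ K K0 G G' G0 Z Z0 Z1 mu Y fY PM gX gY zz B₄ al g f3 : ℂ}
    (hK : K0 * (nn * (1 - g)) = K * (al * (1 - u₄)))
    (hG : G' * (fY * PM) = G * ((1 - f) * (1 - P₂)))
    (hG0 : (1 - Y) * f3 * zz * G0 = -((1 - Y) * (mu * Y) * ((1 - f) * (1 - P₂)) * G))
    (hZ : (1 - g) * (1 - mu * Y ^ 2) * Z = gY * (1 - mu * Y) * Z0 + (g - mu * Y) * (Y - 1) * Z1)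
    (hB : mu * Y * B₄ = -(g - mu * Y)) (hg : gX = gY) :
    al * (1 - f) * ((1 - P₂) * (1 - u₄)) * K * G * Z * (1 - mu * Y ^ 2) =
      nn * ((1 - mu * Y) * fY * PM * gX * (K0 * G' * Z0) -
        (1 - Y) * f3 * zz * B₄ * (K0 * G0 * Z1)) := by
  subst hg
  linear_combination (-((1 - f) * (1 - P₂) * G * Z * (1 - mu * Y ^ 2))) * hK -
    (nn * (1 - mu * Y) * gX * K0 * Z0) * hG + (nn * B₄ * K0 * Z1) * hG0 +
    (nn * K0 * (1 - f) * (1 - P₂) * G) * hZ - (nn * K0 * (1 - f) * (1 - P₂) * G * Z1 * (1 - Y)) * hB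

theorem pentRhs_aux₂ {nn f P₂ u₄ K K1 G G' G0 Z Z0 Z1 mu Y fY PM gX zz B₄ be B nuX f3 n' : ℂ}
    (hK : K1 * (n' * (1 - B) * nuX ^ 2) = -(K * (be * (1 - u₄))))
    (hG : G' * (fY * PM) = G * ((1 - f) * (1 - P₂)))
    (hG0 : (1 - Y) * f3 * zz * G0 = -((1 - Y) * (mu * Y) * ((1 - f) * (1 - P₂)) * G))
    (hZ : (1 - B) * (1 - mu * Y ^ 2) * Z = (1 - B * Y) * (1 - mu * Y) * Z0 +
      (B - mu * Y) * (Y - 1) * Z1)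
    (hB : mu * Y * B₄ = nuX * (B - mu * Y)) (hg : gX = -(nuX * (1 - B * Y)))
    (hn : nn = n' * nuX) :
    be * (1 - f) * ((1 - P₂) * (1 - u₄)) * K * G * Z * (1 - mu * Y ^ 2) =
      nn * ((1 - mu * Y) * fY * PM * gX * (K1 * G' * Z0) -
        (1 - Y) * f3 * zz * B₄ * (K1 * G0 * Z1)) := by
  subst hg hn
  linear_combination ((1 - f) * (1 - P₂) * G * Z * (1 - mu * Y ^ 2)) * hK +
    (n' * nuX * (1 - mu * Y) * nuX * (1 - B * Y) * K1 * Z0) * hG + (n' * nuX * B₄ * K1 * Z1) * hG0 -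
    (n' * K1 * (1 - f) * (1 - P₂) * G * nuX ^ 2) * hZ -
    (n' * nuX * K1 * (1 - f) * (1 - P₂) * G * Z1 * (1 - Y)) * hB

end

section
variable {q c₀ c₁ c₂ c₃ c₄ : ℂ} {N : ℕ}

theorem pentConst_mul (h : GenericFive q c₀ c₁ c₂ c₃ c₄ (N + 1)) (b m x y : ℕ) :
    pentConst q (q * c₀) c₁ c₂ c₃ (q * c₄) N b m x y =
      twoHypConst₁ q c₀ (c₁ * c₂) c₃ c₄ (N + 1) *
        pentFactor q c₀ (c₁ * c₂) c₃ c₄ (N + 1) (m + 1) *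
      (twoHypConst₂ q (q * c₀) c₁ c₃ N b x * twoHypConst₃ q (q * c₀) c₂ (q * c₄) N x) *
        pentFactor q (q * c₀) (c₁ * c₂) (q * c₄) c₃ N y := by
  rw [← twoHypConst₁_mul_pentFactor h, pentConst, twoHypConst_eq]
  ring

theorem pentRhs_step_diag {n b : ℕ} (h : GenericFive q c₀ c₁ c₂ c₃ c₄ (n + b + 1)) {x y M : ℕ}
    (hM : M + y = n + b + 1) (hx : x ≤ M) :
    (1 - q * c₄ * q ^ x) * (1 - c₂ * c₄ * c₀ * q ^ (n + 1 + 2) * q ^ x) *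
          (1 - (q ^ (n + 1))⁻¹ * q ^ x) * (1 - q * c₀) *
        ((1 - c₁ * c₂ * q ^ (n + b + 2)) * (1 - (q ^ (n + b + 1))⁻¹)) *
        (twoHypConst₂ q c₀ c₁ c₃ (n + b + 1) b x * twoHypConst₃ q c₀ c₂ c₄ (n + b + 1) x) *
        pentFactor q c₀ (c₁ * c₂) c₄ c₃ (n + b + 1) y *
        racahHyp q c₀ c₃ c₁ (n + b + 1 - x) b y * (1 - c₃ * c₀ * q * (q ^ y) ^ 2) =
      (1 - q * c₄) * (1 - c₂ * c₄ * c₀ * q ^ (n + 1 + 2)) * (1 - (q ^ (n + 1))⁻¹) * q ^ x *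
      ((1 - c₃ * c₀ * q * q ^ y) * (1 - q * c₀ * q ^ y) * (1 - c₁ * c₂ * q ^ (M + 1)) *
        (1 - (q ^ M)⁻¹ * q ^ x) *
        ((twoHypConst₂ q (q * c₀) c₁ c₃ (n + b) b x *
          twoHypConst₃ q (q * c₀) c₂ (q * c₄) (n + b) x) *
          pentFactor q (q * c₀) (c₁ * c₂) (q * c₄) c₃ (n + b) y *
          racahHyp q (q * c₀) c₃ c₁ (n + b - x) b y) -
        (1 - q ^ y) * (q * c₀ - c₃ * c₀ * q * q ^ y) * (1 - (c₄ * q ^ (M + 1))⁻¹) *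
          (1 - c₄ * c₂ * c₁ * q ^ (M + 2) * q ^ x) *
        ((twoHypConst₂ q (q * c₀) c₁ c₃ (n + b) b x *
          twoHypConst₃ q (q * c₀) c₂ (q * c₄) (n + b) x) *
          pentFactor q (q * c₀) (c₁ * c₂) (q * c₄) c₃ (n + b) (y - 1) *
          racahHyp q (q * c₀) c₃ c₁ (n + b - x) b (y - 1))) := by
  have hq := h.hq
  have hq0 := hq.ne
  rcases Nat.lt_or_ge (n + b) x with hlt | hxn
  · obtain rfl : x = n + b + 1 := by omega
    obtain rfl : y = 0 := by omega
    obtain rfl : M = n + b + 1 := by omega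
    rw [inv_mul_cancel₀ (pow_ne_zero (n + b + 1) hq0)]
    rcases b with _ | b
    · simp [hq0]
    · rw [twoHypConst₂_eq_zero hq0 _ _ _ (le_refl _) (by omega)]
      simp
  rcases Nat.lt_or_ge n x with hlt | hge
  · rw [twoHypConst₂_eq_zero (b := b) hq0 _ _ _ hxn (by omega)]
    rcases Nat.eq_or_lt_of_le (show n + 1 ≤ x by omega) with rfl | hlt
    · rw [inv_mul_cancel₀ (pow_ne_zero (n + 1) hq0)]
      simp
    · rw [twoHypConst₂_eq_zero (b := b) hq0 _ _ _ (show x ≤ n + b + 1 by omega) (by omega)]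
      simp
  · have hK := twoHypConst_mul_shift h x
    have e1 : (q ^ (n + b + 1))⁻¹ * q ^ x = (q ^ (n + b - x + 1))⁻¹ := by
      rw [show n + b + 1 = n + b - x + 1 + x by omega, pow_add _ _ x]
      field_simp
    have hZ := racahHyp_shift_left hq c₃ c₁ (a := c₀) (L := n + b - x) y (show b ≤ n + b - x by omega)
    rw [e1] at hK
    rw [show n + b - x + 1 = n + b + 1 - x by omega, mul_comm c₀ c₃] at hZ
    rw [show n + b - x + 1 = n + b + 1 - x by omega] at hK
    have hN' : q ^ (n + b + 1 - x) * q ^ x = q ^ M * q ^ y := by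
      rw [← pow_add, ← pow_add]; congr 1; omega
    refine pentRhs_aux₁ (gY := 1 - (q ^ (n + b + 1 - x))⁻¹ * q ^ y) hK (pentFactor_coef h hM)
      (pentFactor_coef_pred h hM) hZ ?_ ?_
    · have := pow_ne_zero (n + b + 1 - x) hq0
      field_simp
      have e2 : q ^ (n + b + 1 - x) * q ^ y * q ^ x * q ^ (M + 2) * q =
          q ^ (2 * (n + b + 1) + 3) := by
        rw [← pow_add, ← pow_add, ← pow_add, ← pow_succ]; congr 1; omega
      linear_combination (-1) * h.bal - (c₀ * c₁ * c₂ * c₃ * c₄) * e2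
    · congr 1
      field_simp
      linear_combination hN'

theorem pentRhs_step_off {n b : ℕ} (h : GenericFive q c₀ c₁ c₂ c₃ c₄ (n + b + 1)) {x y M : ℕ}
    (hM : M + y = n + b + 1) (hx : x ≤ M) :
    (1 - q ^ x) * ((q * c₄ - c₂ * c₄ * q * q ^ x) *
          (c₂ * c₄ * c₀ * q ^ (n + 1 + 2) - c₂ * c₄ * q * q ^ x) *
          ((q ^ (n + 1))⁻¹ - c₂ * c₄ * q * q ^ x) * (1 - q * c₀) *
        ((1 - c₁ * c₂ * q ^ (n + b + 2)) * (1 - (q ^ (n + b + 1))⁻¹)) *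
        (twoHypConst₂ q c₀ c₁ c₃ (n + b + 1) b x * twoHypConst₃ q c₀ c₂ c₄ (n + b + 1) x) *
        pentFactor q c₀ (c₁ * c₂) c₄ c₃ (n + b + 1) y *
        racahHyp q c₀ c₃ c₁ (n + b + 1 - x) b y * (1 - c₃ * c₀ * q * (q ^ y) ^ 2)) =
      (1 - q ^ x) * (c₂ * c₄ * q * ((1 - q * c₄) * (1 - c₂ * c₄ * c₀ * q ^ (n + 1 + 2)) *
        (1 - (q ^ (n + 1))⁻¹) * q ^ x) *
      ((1 - c₃ * c₀ * q * q ^ y) * (1 - q * c₀ * q ^ y) * (1 - c₁ * c₂ * q ^ (M + 1)) *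
        ((q ^ M)⁻¹ - c₄ * c₂ * q * q ^ x) *
        ((twoHypConst₂ q (q * c₀) c₁ c₃ (n + b) b (x - 1) *
          twoHypConst₃ q (q * c₀) c₂ (q * c₄) (n + b) (x - 1)) *
          pentFactor q (q * c₀) (c₁ * c₂) (q * c₄) c₃ (n + b) y *
          racahHyp q (q * c₀) c₃ c₁ (n + b - (x - 1)) b y) -
        (1 - q ^ y) * (q * c₀ - c₃ * c₀ * q * q ^ y) * (1 - (c₄ * q ^ (M + 1))⁻¹) *
          (c₄ * c₂ * c₁ * q ^ (M + 2) - c₄ * c₂ * q * q ^ x) *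
        ((twoHypConst₂ q (q * c₀) c₁ c₃ (n + b) b (x - 1) *
          twoHypConst₃ q (q * c₀) c₂ (q * c₄) (n + b) (x - 1)) *
          pentFactor q (q * c₀) (c₁ * c₂) (q * c₄) c₃ (n + b) (y - 1) *
          racahHyp q (q * c₀) c₃ c₁ (n + b - (x - 1)) b (y - 1)))) := by
  have hq := h.hq
  have hq0 := hq.ne
  rcases x with _ | t
  · simp
  congr 1
  have hK := twoHypConst_mul_shift_pred h t
  have g031 : Generic q (c₀ * c₃ * c₁) := by
    rw [mul_right_comm]; exact h.g013
  have hZ := racahHyp_shift_left' hq (n + b - t) b y g031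
  have e1 : c₀ * c₁ * c₃ * q ^ (n + b + 2) * (q ^ t)⁻¹ = c₀ * c₃ * c₁ * q ^ (n + b - t + 2) := by
    rw [show n + b + 2 = n + b - t + 2 + t by omega, pow_add _ _ t]
    field_simp
  rw [e1] at hK
  have n2 := h.n2
  have n4 := h.n4
  have n1 := h.n1
  rw [mul_comm c₀ c₃] at hZ hK
  rw [Nat.add_sub_cancel, show n + b + 1 - (t + 1) = n + b - t by omega]
  have e2 : q ^ M * q ^ (n + b - t + 2) * q ^ (t + 1) * q * q ^ y =
      q ^ (2 * (n + b + 1) + 3) := by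
    rw [← pow_add, ← pow_add, ← pow_succ, ← pow_add]
    congr 1; omega
  have e3 : q ^ M * q ^ y = q ^ (n + b - t) * q ^ t * q := by
    rw [← pow_add, ← pow_add, ← pow_succ]
    congr 1; omega
  refine pentRhs_aux₂ (B := c₃ * c₀ * c₁ * q ^ (n + b - t + 2)) (nuX := c₂ * c₄ * q * q ^ (t + 1))
    (n' := (1 - q * c₄) * (1 - c₂ * c₄ * c₀ * q ^ (n + 1 + 2)) * (1 - (q ^ (n + 1))⁻¹))
    ?_ (pentFactor_coef h hM) (pentFactor_coef_pred h hM) hZ ?_ ?_ ?_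
  · linear_combination hK
  · linear_combination c₀ * c₁ * c₂ * c₃ * c₄ * q ^ 3 * e3
  · field_simp
    linear_combination (-1) * h.bal - (c₀ * c₁ * c₂ * c₃ * c₄) * e2
  · ring

end

section
variable {q c₀ c₁ c₂ c₃ c₄ : ℂ} {N : ℕ}

theorem pentRhs_step_aux {nu A f muY2 nuX2 D KG H Z nX al be H0 H1 mu n R₁ R₂ W₀ W₁ V₀ V₁ X a₀ a₁ b₀ b₁ PM Y3 : ℂ}
    (h₁ : nu * n * nuX2 * H = nu * nX * al * H0 - (1 - X) * be * H1)
    (h₂ : al * f * D * KG * Z * muY2 = n * R₁)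
    (h₃ : (1 - X) * (be * f * D * KG * Z * muY2) = (1 - X) * (nu * n * R₂))
    (hR₁ : A * H0 * R₁ = PM * a₀ * W₀ - Y3 * b₀ * V₀) (hR₂ : A * H1 * R₂ = PM * a₁ * W₁ - Y3 * b₁ * V₁)
    (hn : nu * n ≠ 0) :
    mu * f * muY2 * nuX2 * D * (A * KG * H * Z) =
      mu * PM * (a₀ * nX * W₀ + a₁ * (X - 1) * W₁) - Y3 * mu * (b₀ * nX * V₀ + b₁ * (X - 1) * V₁) := by
  refine mul_left_cancel₀ hn ?_
  linear_combination (mu * f * muY2 * D * A * KG * Z) * h₁ + (mu * nu * nX * H0 * A) * h₂ -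
    (mu * H1 * A) * h₃ + mu * nu * n * nX * hR₁ - mu * nu * n * (1 - X) * hR₂

theorem pentRhs_step (h : GenericFive q c₀ c₁ c₂ c₃ c₄ (N + 1)) {b m x y M : ℕ}
    (hb : b + m ≤ N) (hM : M + y = N + 1) (hx : x ≤ M) :
    c₃ * c₀ * q * (1 - q * c₀) * (1 - c₃ * c₀ * q * (q ^ y) ^ 2) *
      (1 - c₄ * c₂ * q * (q ^ x) ^ 2) *
      ((1 - c₁ * c₂ * q ^ (N + 2)) * (1 - (q ^ (N + 1))⁻¹)) *
      pentRhs q c₀ c₁ c₂ c₃ c₄ (N + 1) b (m + 1) x y =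
    c₃ * c₀ * q * (1 - c₃ * c₀ * q * q ^ y) * (1 - q * c₀ * q ^ y) *
      (1 - c₁ * c₂ * q ^ (M + 1)) *
      ((1 - (q ^ M)⁻¹ * q ^ x) * (1 - c₄ * c₂ * q * q ^ x) *
        pentRhs q (q * c₀) c₁ c₂ c₃ (q * c₄) N b m x y +
      ((q ^ M)⁻¹ - c₄ * c₂ * q * q ^ x) * (q ^ x - 1) *
        pentRhs q (q * c₀) c₁ c₂ c₃ (q * c₄) N b m (x - 1) y) -
    (1 - q ^ y) * (q * c₀ - c₃ * c₀ * q * q ^ y) * (c₃ * c₀ * q) *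
      (1 - (c₄ * q ^ (M + 1))⁻¹) *
      ((1 - c₄ * c₂ * c₁ * q ^ (M + 2) * q ^ x) * (1 - c₄ * c₂ * q * q ^ x) *
        pentRhs q (q * c₀) c₁ c₂ c₃ (q * c₄) N b m x (y - 1) +
      (c₄ * c₂ * c₁ * q ^ (M + 2) - c₄ * c₂ * q * q ^ x) * (q ^ x - 1) *
        pentRhs q (q * c₀) c₁ c₂ c₃ (q * c₄) N b m (x - 1) (y - 1)) := by
  obtain ⟨n, rfl⟩ : ∃ n, N = n + b := ⟨N - b, by omega⟩
  have hq := h.hq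
  have hq0 := hq.ne
  have n2 := h.n2
  have n4 := h.n4
  have g240 : Generic q (c₂ * c₄ * c₀) := by
    rw [show c₂ * c₄ * c₀ = c₀ * c₂ * c₄ by ring]; exact h.g024
  have R1 := racahHyp_backward hq (L := n) (m := m) x (by omega) h.g4 g240
  have E1 := pentRhs_step_diag h hM hx
  have E2 := pentRhs_step_off h hM hx
  have hn : c₂ * c₄ * q * ((1 - q * c₄) * (1 - c₂ * c₄ * c₀ * q ^ (n + 1 + 2)) *
      (1 - (q ^ (n + 1))⁻¹) * q ^ x) ≠ 0 := by
    have m1 := (h.g4.mul hq0).sub_ne_zero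
    have m2 := (g240.mul_pow hq0 (n + 1 + 2)).sub_ne_zero
    have m3 := hq.one_sub_inv_ne_zero n
    positivity
  have key := pentRhs_step_aux
    (A := twoHypConst₁ q c₀ (c₁ * c₂) c₃ c₄ (n + b + 1) *
        pentFactor q c₀ (c₁ * c₂) c₃ c₄ (n + b + 1) (m + 1))
    (nu := c₂ * c₄ * q) (n := (1 - q * c₄) * (1 - c₂ * c₄ * c₀ * q ^ (n + 1 + 2)) *
      (1 - (q ^ (n + 1))⁻¹) * q ^ x) (f := 1 - q * c₀) (muY2 := 1 - c₃ * c₀ * q * (q ^ y) ^ 2)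
    (nuX2 := 1 - c₂ * c₄ * q * (q ^ x) ^ 2)
    (H := racahHyp q c₂ c₄ c₀ (n + 1) (m + 1) x) (nX := 1 - c₂ * c₄ * q * q ^ x)
    (D := (1 - c₁ * c₂ * q ^ (n + b + 2)) * (1 - (q ^ (n + b + 1))⁻¹))
    (KG := (twoHypConst₂ q c₀ c₁ c₃ (n + b + 1) b x * twoHypConst₃ q c₀ c₂ c₄ (n + b + 1) x) *
        pentFactor q c₀ (c₁ * c₂) c₄ c₃ (n + b + 1) y)
    (Z := racahHyp q c₀ c₃ c₁ (n + b + 1 - x) b y) (mu := c₃ * c₀ * q)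
    (H0 := racahHyp q c₂ (q * c₄) (q * c₀) n m x) (H1 := racahHyp q c₂ (q * c₄) (q * c₀) n m (x - 1))
    (PM := (1 - c₃ * c₀ * q * q ^ y) * (1 - q * c₀ * q ^ y) * (1 - c₁ * c₂ * q ^ (M + 1)))
    (Y3 := (1 - q ^ y) * (q * c₀ - c₃ * c₀ * q * q ^ y) * (1 - (c₄ * q ^ (M + 1))⁻¹))
    (a₀ := (1 - (q ^ M)⁻¹ * q ^ x)) (a₁ := (q ^ M)⁻¹ - c₄ * c₂ * q * q ^ x)
    (b₀ := 1 - c₄ * c₂ * c₁ * q ^ (M + 2) * q ^ x)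
    (b₁ := c₄ * c₂ * c₁ * q ^ (M + 2) - c₄ * c₂ * q * q ^ x)
    (W₀ := pentRhs q (q * c₀) c₁ c₂ c₃ (q * c₄) (n + b) b m x y)
    (W₁ := pentRhs q (q * c₀) c₁ c₂ c₃ (q * c₄) (n + b) b m (x - 1) y)
    (V₀ := pentRhs q (q * c₀) c₁ c₂ c₃ (q * c₄) (n + b) b m x (y - 1))
    (V₁ := pentRhs q (q * c₀) c₁ c₂ c₃ (q * c₄) (n + b) b m (x - 1) (y - 1)) (X := q ^ x)
    (al := (1 - q * c₄ * q ^ x) * (1 - c₂ * c₄ * c₀ * q ^ (n + 1 + 2) * q ^ x) *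
          (1 - (q ^ (n + 1))⁻¹ * q ^ x))
    (be := (q * c₄ - c₂ * c₄ * q * q ^ x) *
          (c₂ * c₄ * c₀ * q ^ (n + 1 + 2) - c₂ * c₄ * q * q ^ x) *
          ((q ^ (n + 1))⁻¹ - c₂ * c₄ * q * q ^ x))
    (R₁ := _) (R₂ := _) (by linear_combination R1) (by rw [← mul_assoc _ (twoHypConst₂ _ _ _ _ _ _ _ * _) (pentFactor _ _ _ _ _ _ _)]; exact E1)
      (by rw [← mul_assoc _ (twoHypConst₂ _ _ _ _ _ _ _ * _) (pentFactor _ _ _ _ _ _ _)]; exact E2) ?_ ?_ hn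
  · have e : pentRhs q c₀ c₁ c₂ c₃ c₄ (n + b + 1) b (m + 1) x y =
        twoHypConst₁ q c₀ (c₁ * c₂) c₃ c₄ (n + b + 1) *
          pentFactor q c₀ (c₁ * c₂) c₃ c₄ (n + b + 1) (m + 1) *
        (twoHypConst₂ q c₀ c₁ c₃ (n + b + 1) b x * twoHypConst₃ q c₀ c₂ c₄ (n + b + 1) x *
          pentFactor q c₀ (c₁ * c₂) c₄ c₃ (n + b + 1) y) *
        racahHyp q c₂ c₄ c₀ (n + 1) (m + 1) x * racahHyp q c₀ c₃ c₁ (n + b + 1 - x) b y := by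
      rw [pentRhs, pentConst, twoHypConst_eq, show n + b + 1 - b = n + 1 by omega]
      ring
    rw [e]
    linear_combination key
  · rw [pentRhs, pentRhs, pentConst_mul h, pentConst_mul h, Nat.add_sub_cancel]
    ring
  · rw [pentRhs, pentRhs, pentConst_mul h, pentConst_mul h, Nat.add_sub_cancel]
    ring

end

section
variable {q c₀ c₁ c₂ c₃ c₄ : ℂ} {N : ℕ}

theorem racahHyp_comm {q : ℂ} (hq : q ≠ 0) (a b c : ℂ) (L n x : ℕ) :
    racahHyp q a b c L n x = racahHyp q c b a L x n := by
  unfold racahHyp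
  rw [hyp_comm hq]
  congr 1 <;> ring

theorem racahHyp_zero_left (q a b c : ℂ) (L x : ℕ) : racahHyp q a b c L 0 x = 1 :=
  hyp_zero_left _ _ _ _ _ _ _

theorem racahHyp_zero_right {q : ℂ} (hq : q ≠ 0) (a b c : ℂ) (L n : ℕ) :
    racahHyp q a b c L n 0 = 1 :=
  hyp_zero_right hq _ _ _ _ _ _

theorem twoHypConst_mirror (h : GenericFive q c₀ c₁ c₂ c₃ c₄ N) {b x : ℕ} (hb : b ≤ N)
    (hx : x ≤ N) :
    twoHypConst q c₀ c₁ c₂ c₃ c₄ N b x = twoHypConst q c₀ c₂ c₁ c₄ c₃ N x b := by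
  rw [← twoHypSum_eq N h b x hb hx, ← twoHypSum_eq N h.mirror x b hx hb]
  unfold twoHypSum
  refine Finset.sum_congr rfl fun a _ => ?_
  have e : twoHypWeight q c₁ c₂ c₃ c₄ N a = twoHypWeight q c₂ c₁ c₄ c₃ N a := by
    simp only [twoHypWeight, vwpTerm, mul_comm c₂ c₁]
    ring_nf
  rw [e, racahHyp_comm h.hq.ne c₂ c₁ c₃, racahHyp_comm h.hq.ne c₄ c₂ c₁]
  ring

theorem pentSum_mirror (hq : q ≠ 0) (b j x y : ℕ) :
    pentSum q c₀ c₁ c₂ c₃ c₄ N b j x y = pentSum q c₀ c₂ c₁ c₄ c₃ N x y b j := by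
  unfold pentSum
  refine Finset.sum_congr rfl fun a _ => ?_
  have e : pentWeight q c₀ c₁ c₂ c₃ c₄ N (N - j) (N - y) a =
      pentWeight q c₀ c₂ c₁ c₄ c₃ N (N - y) (N - j) a := by
    simp only [pentWeight, mul_comm c₂ c₁]
    ring
  rw [e, racahHyp_comm hq c₂ c₁ c₃, racahHyp_comm hq c₄ c₂ c₁, racahHyp_comm hq c₃ c₀ c₄]
  ring

theorem pentRhs_mirror (h : GenericFive q c₀ c₁ c₂ c₃ c₄ N) {b x : ℕ} (hb : b ≤ N)
    (hx : x ≤ N) (j y : ℕ) :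
    pentRhs q c₀ c₁ c₂ c₃ c₄ N b j x y = pentRhs q c₀ c₂ c₁ c₄ c₃ N x y b j := by
  have hq0 := h.hq.ne
  unfold pentRhs pentConst
  rw [twoHypConst_mirror h hb hx, racahHyp_comm hq0 c₂ c₄ c₀, racahHyp_comm hq0 c₀ c₃ c₁,
    mul_comm c₂ c₁]
  ring

theorem pentSum_eq_of_eq_zero (h : GenericFive q c₀ c₁ c₂ c₃ c₄ N) {b x : ℕ} (hb : b ≤ N)
    (hx : x ≤ N) :
    pentSum q c₀ c₁ c₂ c₃ c₄ N b 0 x 0 = pentRhs q c₀ c₁ c₂ c₃ c₄ N b 0 x 0 := by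
  have hq := h.hq
  have hq0 := hq.ne
  have n0 := h.n0
  have n1 := h.n1
  have n2 := h.n2
  have n3 := h.n3
  have n4 := h.n4
  have e : pentSum q c₀ c₁ c₂ c₃ c₄ N b 0 x 0 = twoHypSum q c₁ c₂ c₃ c₄ N b x := by
    unfold pentSum twoHypSum
    refine Finset.sum_congr rfl fun a ha => ?_
    have ha : a ≤ N := by simpa [Nat.lt_succ_iff] using ha
    rw [racahHyp_zero_left, mul_one, Nat.sub_zero]
    congr 2
    unfold pentWeight twoHypWeight vwpTerm
    have m1 := (h.g12.mul_pow hq0 (N + 2)).qPoch a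
    have m2 := hq.qPoch_inv_pow ha
    rw [show c₁ * c₂ * q * q / (c₁ * c₂ * c₃ * q ^ (N + 2)) = (c₃ * q ^ N)⁻¹ by field_simp; ring,
      show c₁ * c₂ * q * q / (c₁ * c₂ * c₄ * q ^ (N + 2)) = (c₄ * q ^ N)⁻¹ by field_simp; ring,
      show c₁ * c₂ * q * q ^ (N + 1) / (c₁ * c₂ * c₃ * q ^ (N + 2) * (c₁ * c₂ * c₄ * q ^ (N + 2))) =
        c₀ * q ^ (N + 1) by field_simp; linear_combination (-q) * h.bal,
      show c₁ * c₂ * q * q ^ (N + 1) = c₁ * c₂ * q ^ (N + 2) by ring]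
    generalize qPoch (c₁ * c₂ * q ^ (N + 2)) q a = y0 at *
    generalize qPoch (q ^ N)⁻¹ q a = y1 at *
    generalize (c₃ * q ^ N)⁻¹ = y2 at *
    generalize (c₄ * q ^ N)⁻¹ = y3 at *
    field_simp
  rw [e, twoHypSum_eq N h b x hb hx, pentRhs, pentConst, racahHyp_zero_left,
    racahHyp_zero_right hq0]
  simp [pentFactor, qPoch_zero]

theorem pentSum_eq_succ (h : GenericFive q c₀ c₁ c₂ c₃ c₄ (N + 1))
    (ih : ∀ b j x y, b + j ≤ N → x + y ≤ N → pentSum q (q * c₀) c₁ c₂ c₃ (q * c₄) N b j x y =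
      pentRhs q (q * c₀) c₁ c₂ c₃ (q * c₄) N b j x y) {b m x y : ℕ} (hb : b + m ≤ N)
    (hx : x + y ≤ N + 1) :
    pentSum q c₀ c₁ c₂ c₃ c₄ (N + 1) b (m + 1) x y =
      pentRhs q c₀ c₁ c₂ c₃ c₄ (N + 1) b (m + 1) x y := by
  have hq := h.hq
  have hq0 := hq.ne
  obtain ⟨M, hM⟩ : ∃ M, M + y = N + 1 := ⟨N + 1 - y, by omega⟩
  have e1 := pentSum_step h b (m := m) (x := x) (by omega) hM (by omega)
  have e2 := pentRhs_step h (x := x) hb hM (by omega)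
  have n0 := h.n0
  have n3 := h.n3
  have m1 := (h.g0.mul hq0).sub_ne_zero
  have m2 : 1 - c₃ * c₀ * q * (q ^ y) ^ 2 ≠ 0 := by
    have := h.g03.comm.sub_pow_ne_zero (2 * y + 1)
    rwa [show c₃ * c₀ * q * (q ^ y) ^ 2 = c₃ * c₀ * q ^ (2 * y + 1) by ring]
  have m3 : 1 - c₄ * c₂ * q * (q ^ x) ^ 2 ≠ 0 := by
    have := h.g24.comm.sub_pow_ne_zero (2 * x + 1)
    rwa [show c₄ * c₂ * q * (q ^ x) ^ 2 = c₄ * c₂ * q ^ (2 * x + 1) by ring]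
  have m4 := h.g12.sub_pow_ne_zero (N + 2)
  have m5 := hq.one_sub_inv_ne_zero N
  refine mul_left_cancel₀ ?_ (e1.trans (Eq.trans ?_ e2.symm))
  · positivity
  have s1 : (1 - (q ^ M)⁻¹ * q ^ x) * pentSum q (q * c₀) c₁ c₂ c₃ (q * c₄) N b m x y =
      (1 - (q ^ M)⁻¹ * q ^ x) * pentRhs q (q * c₀) c₁ c₂ c₃ (q * c₄) N b m x y := by
    rcases Nat.lt_or_ge N (x + y) with hlt | hle
    · obtain rfl : M = x := by omega
      rw [inv_mul_cancel₀ (pow_ne_zero _ hq0)]; ring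
    · rw [ih b m x y hb hle]
  have s2 : (q ^ x - 1) * pentSum q (q * c₀) c₁ c₂ c₃ (q * c₄) N b m (x - 1) y =
      (q ^ x - 1) * pentRhs q (q * c₀) c₁ c₂ c₃ (q * c₄) N b m (x - 1) y := by
    rcases x with _ | x
    · simp
    · rw [ih b m _ y hb (by omega)]
  have s3 : (1 - q ^ y) * pentSum q (q * c₀) c₁ c₂ c₃ (q * c₄) N b m x (y - 1) =
      (1 - q ^ y) * pentRhs q (q * c₀) c₁ c₂ c₃ (q * c₄) N b m x (y - 1) := by
    rcases y with _ | y
    · simp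
    · rw [ih b m x _ hb (by omega)]
  have s4 : (1 - q ^ y) * (q ^ x - 1) *
        pentSum q (q * c₀) c₁ c₂ c₃ (q * c₄) N b m (x - 1) (y - 1) =
      (1 - q ^ y) * (q ^ x - 1) *
        pentRhs q (q * c₀) c₁ c₂ c₃ (q * c₄) N b m (x - 1) (y - 1) := by
    rcases y with _ | y
    · simp
    · rw [ih b m _ _ hb (by omega)]
  linear_combination
    (c₃ * c₀ * q * (1 - c₃ * c₀ * q * q ^ y) * (1 - q * c₀ * q ^ y) *
      (1 - c₁ * c₂ * q ^ (M + 1)) * (1 - c₄ * c₂ * q * q ^ x)) * s1 +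
    (c₃ * c₀ * q * (1 - c₃ * c₀ * q * q ^ y) * (1 - q * c₀ * q ^ y) *
      (1 - c₁ * c₂ * q ^ (M + 1)) * ((q ^ M)⁻¹ - c₄ * c₂ * q * q ^ x)) * s2 -
    ((q * c₀ - c₃ * c₀ * q * q ^ y) * (c₃ * c₀ * q) * (1 - (c₄ * q ^ (M + 1))⁻¹) *
      (1 - c₄ * c₂ * c₁ * q ^ (M + 2) * q ^ x) * (1 - c₄ * c₂ * q * q ^ x)) * s3 -
    ((q * c₀ - c₃ * c₀ * q * q ^ y) * (c₃ * c₀ * q) * (1 - (c₄ * q ^ (M + 1))⁻¹) *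
      (c₄ * c₂ * c₁ * q ^ (M + 2) - c₄ * c₂ * q * q ^ x)) * s4

end

/-- The pentagon relation. -/
theorem pentSum_eq {q : ℂ} (N : ℕ) : ∀ {c₀ c₁ c₂ c₃ c₄ : ℂ}, GenericFive q c₀ c₁ c₂ c₃ c₄ N →
    ∀ b j x y, b + j ≤ N → x + y ≤ N →
    pentSum q c₀ c₁ c₂ c₃ c₄ N b j x y = pentRhs q c₀ c₁ c₂ c₃ c₄ N b j x y := by
  induction N with
  | zero =>
    intro c₀ c₁ c₂ c₃ c₄ h b j x y hb hx
    obtain rfl : j = 0 := by omega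
    obtain rfl : y = 0 := by omega
    exact pentSum_eq_of_eq_zero h (by omega) (by omega)
  | succ N ih =>
    intro c₀ c₁ c₂ c₃ c₄ h b j x y hb hx
    rcases j with _ | m
    · rcases y with _ | m
      · exact pentSum_eq_of_eq_zero h (by omega) (by omega)
      · rw [pentSum_mirror h.hq.ne, pentRhs_mirror h (by omega) (by omega)]
        exact pentSum_eq_succ h.mirror (ih h.mirror.shift₀₄) (by omega) (by omega)
    · exact pentSum_eq_succ h (ih h.shift₀₄) (by omega) hx

theorem Generic.inv_inv {q c : ℂ} (h : Generic q c) : Generic q⁻¹ c⁻¹ := by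
  intro m hm
  apply h m
  rwa [inv_zpow, ← mul_inv, inv_eq_one] at hm

theorem NonRoot.inv {q : ℂ} (h : NonRoot q) : NonRoot q⁻¹ where
  ne := inv_ne_zero h.ne
  pow n hn := by
    rw [inv_pow, Ne, inv_eq_one]
    exact h.pow n hn

theorem GenericTriple.inv {q a b c : ℂ} (h : GenericTriple q a b c) :
    GenericTriple q⁻¹ a⁻¹ b⁻¹ c⁻¹ where
  ne_a := inv_ne_zero h.ne_a
  ne_b := inv_ne_zero h.ne_b
  ne_c := inv_ne_zero h.ne_c
  ga := h.ga.inv_inv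
  gb := h.gb.inv_inv
  gc := h.gc.inv_inv
  gab := by rw [← mul_inv]; exact h.gab.inv_inv
  gac := by rw [← mul_inv]; exact h.gac.inv_inv
  gbc := by rw [← mul_inv]; exact h.gbc.inv_inv
  gabc := by rw [← mul_inv, ← mul_inv]; exact h.gabc.inv_inv

theorem GenericTriple.swap₂₃ {q a b c : ℂ} (h : GenericTriple q a b c) : GenericTriple q a c b where
  ne_a := h.ne_a
  ne_b := h.ne_c
  ne_c := h.ne_b
  ga := h.ga
  gb := h.gc
  gc := h.gb
  gab := h.gac
  gac := h.gab
  gbc := h.gbc.comm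
  gabc := by rw [mul_right_comm]; exact h.gabc

theorem GenericTriple.swap₁₂ {q a b c : ℂ} (h : GenericTriple q a b c) : GenericTriple q b a c where
  ne_a := h.ne_b
  ne_b := h.ne_a
  ne_c := h.ne_c
  ga := h.gb
  gb := h.ga
  gc := h.gc
  gab := h.gab.comm
  gac := h.gbc
  gbc := h.gac
  gabc := by rw [mul_comm b a]; exact h.gabc

section
variable {q r a b c A B C : ℂ}

theorem qBinom_eq {n k : ℕ} : qBinom q (n + k) n = qPoch q q (n + k) / (qPoch q q n * qPoch q q k) := by
  rw [qBinom, if_pos (by omega), Nat.add_sub_cancel_left]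

/-- `Omega` in terms of `q = r ^ 2`, `A = a ^ 2`, `B = b ^ 2`, `C = c ^ 2`. -/
theorem Omega_eq_of_generic (h : GenericTriple q A B C) (hr : r ^ 2 = q) (ha : a ^ 2 = A)
    (hb : b ^ 2 = B) (hc : c ^ 2 = C) (n k : ℕ) :
    Omega r a b c (n + k) n =
      qPoch q q (n + k) / (qPoch q q n * qPoch q q k) *
        ((1 - B * C * q ^ (2 * n + 1)) * qPoch (q * B) q n *
          qPoch (A * B * C * q ^ (n + k + 2)) q n * qPoch (q * A) q k) /
        ((r * b) ^ ((n : ℤ) - k) * qPoch (B * C * q ^ (n + 1)) q (n + k + 1) *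
          qPoch (q * C) q n) := by
  rw [Omega_eq _ _ _ _ (Nat.le_add_right n k), hr, ha, hb, hc, qBinom_eq, Nat.add_sub_cancel_left,
    show 2 * (n : ℤ) - ((n + k : ℕ) : ℤ) = (n : ℤ) - k by push_cast; ring]
  rw [hr, hb, hc]
  exact h.gbc.sub_pow_ne_zero _

theorem Omega_succ_left (hq : NonRoot q) (h : GenericTriple q A B C) (hr : r ^ 2 = q)
    (ha : a ^ 2 = A) (hb : b ^ 2 = B) (hc : c ^ 2 = C) (n k : ℕ) :
    Omega r a b c (n + k + 1) n * ((1 - q ^ (k + 1)) * (1 - A * B * C * q ^ (n + k + 2)) *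
        (1 - B * C * q ^ (2 * n + k + 2))) =
      Omega r a b c (n + k) n * ((1 - q ^ (n + k + 1)) * (1 - A * B * C * q ^ (2 * n + k + 2)) *
        (1 - A * q ^ (k + 1)) * (r * b)) := by
  have hq0 := hq.ne
  have hr0 : r ≠ 0 := by rintro rfl; simp at hr; exact hq0 hr.symm
  have hb0 : b ≠ 0 := by rintro rfl; simp at hb; exact h.ne_b hb.symm
  rw [Omega_eq_of_generic h hr ha hb hc, add_assoc n k 1, Omega_eq_of_generic h hr ha hb hc,
    show n + (k + 1) = n + k + 1 from rfl, qPoch_succ q q (n + k), qPoch_succ q q k,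
    qPoch_succ (q * A), qPoch_succ _ _ (n + k + 1),
    show n + k + 1 + 2 = (n + k + 2) + 1 from rfl]
  have e1 := qPoch_shift (A * B * C * q ^ (n + k + 2)) q n
  have hz : (r * b) ^ ((n : ℤ) - (k + 1 : ℕ)) = (r * b) ^ ((n : ℤ) - k) / (r * b) := by
    rw [div_eq_mul_inv, ← zpow_sub_one₀ (mul_ne_zero hr0 hb0)]; congr 1; push_cast; ring
  rw [hz, show A * B * C * q ^ (n + k + 2 + 1) = q * (A * B * C * q ^ (n + k + 2)) by ring,
    show q * q ^ (n + k) = q ^ (n + k + 1) by ring, show q * q ^ k = q ^ (k + 1) by ring,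
    show q * A * q ^ k = A * q ^ (k + 1) by ring,
    show B * C * q ^ (n + 1) * q ^ (n + k + 1) = B * C * q ^ (2 * n + k + 2) by ring]
  rw [show A * B * C * q ^ (n + k + 2) * q ^ n = A * B * C * q ^ (2 * n + k + 2) by ring] at e1
  have m1 := hq.sub (Nat.le_add_left 1 k)
  have m2 := (h.gabc.mul_pow hq0 (n + k + 2)).sub_ne_zero
  have m3 := h.gbc.sub_pow_ne_zero (2 * n + k + 2)
  have m4 : (r * b) ^ ((n : ℤ) - k) ≠ 0 := zpow_ne_zero _ (mul_ne_zero hr0 hb0)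
  have m5 := hq.qPoch n
  have m6 := hq.qPoch k
  have m7 := (h.gc.mul hq0).qPoch n
  have m8 := (h.gbc.mul_pow hq0 (n + 1)).qPoch (n + k + 1)
  clear hz
  generalize (r * b) ^ ((n : ℤ) - k) = y0 at *
  generalize 1 - A * B * C * q ^ (2 * n + k + 2) = y1 at *
  generalize 1 - A * B * C * q ^ (n + k + 2) = y2 at *
  generalize 1 - B * C * q ^ (2 * n + k + 2) = y3 at *
  generalize 1 - q ^ (k + 1) = y4 at *
  generalize qPoch q q n = y5 at *
  generalize qPoch q q k = y6 at *
  generalize qPoch (q * C) q n = y7 at *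
  generalize qPoch (B * C * q ^ (n + 1)) q (n + k + 1) = y8 at *
  generalize 1 - A * q ^ (k + 1) = y9 at *
  generalize 1 - q ^ (n + k + 1) = y10 at *
  generalize qPoch (q * (A * B * C * q ^ (n + k + 2))) q n = y11 at *
  generalize qPoch (A * B * C * q ^ (n + k + 2)) q n = y12 at *
  generalize 1 - B * C * q ^ (2 * n + 1) = y13 at *
  field_simp
  linear_combination
    (-(qPoch q q (n + k) * y10 * y13 * qPoch (q * B) q n * qPoch (q * A) q k * y9)) * e1

theorem Omega_succ (hq : NonRoot q) (h : GenericTriple q A B C) (hr : r ^ 2 = q)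
    (ha : a ^ 2 = A) (hb : b ^ 2 = B) (hc : c ^ 2 = C) (n k : ℕ) :
    Omega r a b c (n + k + 1) (n + 1) * ((1 - q ^ (n + 1)) * (1 - B * C * q ^ (2 * n + 1)) *
        (1 - A * q ^ (k + 1)) * (1 - B * C * q ^ (2 * n + k + 3)) * (1 - C * q ^ (n + 1)) *
        (q * B)) =
      Omega r a b c (n + k + 1) n * ((1 - q ^ (k + 1)) * (1 - B * C * q ^ (2 * n + 3)) *
        (1 - B * q ^ (n + 1)) * (1 - A * B * C * q ^ (2 * n + k + 3)) *
        (1 - B * C * q ^ (n + 1))) := by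
  have hq0 := hq.ne
  have hr0 : r ≠ 0 := by rintro rfl; simp at hr; exact hq0 hr.symm
  have hb0 : b ≠ 0 := by rintro rfl; simp at hb; exact h.ne_b hb.symm
  have e0 := qPoch_shift (B * C * q ^ (n + 1)) q (n + k + 2)
  have hz : (r * b) ^ (((n + 1 : ℕ) : ℤ) - k) = (r * b) ^ ((n : ℤ) - (k + 1 : ℕ)) * (q * B) := by
    rw [← hr, ← hb, ← mul_pow, ← zpow_natCast (r * b) 2, ← zpow_add₀ (mul_ne_zero hr0 hb0)]
    congr 1; push_cast; ring
  rw [show n + k + 1 = n + 1 + k by omega, Omega_eq_of_generic h hr ha hb hc,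
    show n + 1 + k = n + (k + 1) by omega, Omega_eq_of_generic h hr ha hb hc,
    qPoch_succ q q n, qPoch_succ q q k, qPoch_succ _ _ k, qPoch_succ (A * B * C * _),
    qPoch_succ (q * B), qPoch_succ (q * C), hz,
    show n + (k + 1) + 1 = n + k + 2 by omega, show n + (k + 1) + 2 = n + k + 3 by omega,
    show q * q ^ n = q ^ (n + 1) by ring, show q * q ^ k = q ^ (k + 1) by ring,
    show q * A * q ^ k = A * q ^ (k + 1) by ring, show q * B * q ^ n = B * q ^ (n + 1) by ring,
    show q * C * q ^ n = C * q ^ (n + 1) by ring, show 2 * (n + 1) + 1 = 2 * n + 3 by ring,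
    show A * B * C * q ^ (n + k + 3) * q ^ n = A * B * C * q ^ (2 * n + k + 3) by ring]
  rw [show q * (B * C * q ^ (n + 1)) = B * C * q ^ (n + 1 + 1) by ring,
    show B * C * q ^ (n + 1) * q ^ (n + k + 2) = B * C * q ^ (2 * n + k + 3) by ring] at e0
  have m1 := hq.sub (Nat.le_add_left 1 k)
  have m1' := hq.sub (Nat.le_add_left 1 n)
  have m2 := h.ga.sub_pow_ne_zero (k + 1)
  have m3 := h.gbc.sub_pow_ne_zero (2 * n + k + 3)
  have m3' := h.gbc.sub_pow_ne_zero (n + 1)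
  have m4 : (r * b) ^ ((n : ℤ) - (k + 1 : ℕ)) ≠ 0 := zpow_ne_zero _ (mul_ne_zero hr0 hb0)
  have m5 := hq.qPoch n
  have m6 := hq.qPoch k
  have m7 := (h.gc.mul hq0).qPoch n
  have m7' := h.gc.sub_pow_ne_zero (n + 1)
  have m8 := (h.gbc.mul_pow hq0 (n + 1)).qPoch (n + k + 2)
  have m9 := (h.gbc.mul_pow hq0 (n + 1 + 1)).qPoch (n + k + 2)
  have hB := h.ne_b
  clear hz
  generalize (r * b) ^ ((n : ℤ) - (k + 1 : ℕ)) = y0 at *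
  generalize 1 - A * B * C * q ^ (2 * n + k + 3) = y1 at *
  generalize 1 - B * C * q ^ (2 * n + k + 3) = y2 at *
  generalize 1 - q ^ (k + 1) = y3 at *
  generalize 1 - q ^ (n + 1) = y4 at *
  generalize qPoch q q n = y5 at *
  generalize qPoch q q k = y6 at *
  generalize qPoch (q * C) q n = y7 at *
  generalize qPoch (B * C * q ^ (n + 1 + 1)) q (n + k + 2) = y8 at *
  generalize qPoch (B * C * q ^ (n + 1)) q (n + k + 2) = y9 at *
  generalize 1 - A * q ^ (k + 1) = y10 at *
  generalize qPoch (A * B * C * q ^ (n + k + 3)) q n = y11 at *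
  generalize qPoch (q * B) q n = y12 at *
  generalize qPoch (q * A) q k = y13 at *
  generalize qPoch q q (n + (k + 1)) = y14 at *
  generalize 1 - B * C * q ^ (2 * n + 1) = y15 at *
  generalize 1 - B * C * q ^ (2 * n + 3) = y16 at *
  generalize 1 - C * q ^ (n + 1) = y17 at *
  generalize 1 - B * C * q ^ (n + 1) = y18 at *
  generalize 1 - B * q ^ (n + 1) = y19 at *
  field_simp
  linear_combination (y14 * y16 * y12 * y19 * y11 * y1 * y13 * y15) * e0

end

section
variable {q r a b c A B C : ℂ}

theorem one_sub_inv_eq {z : ℂ} (hz : z ≠ 0) : 1 - z⁻¹ = -(z⁻¹ * (1 - z)) := by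
  field_simp; ring

theorem omega_succ (hr : r ^ 2 = q) (t : ℂ) (n : ℕ) :
    omega r t (n + 1) = omega r t n * (-(t * q ^ (n + 1))) := by
  unfold omega
  rw [hr, Nat.choose_succ_succ' (n + 1) 1, Nat.choose_one_right]
  ring

theorem omega_zero (r t : ℂ) : omega r t 0 = 1 := by simp [omega]

theorem qPoch_eq_omega_mul (hq : q ≠ 0) (hr : r ^ 2 = q) (hC : C ≠ 0) (L : ℕ) :
    qPoch (q * C) q L = omega r C L * qPoch (C * q ^ L)⁻¹ q L := by
  induction L with
  | zero => simp [omega_zero, qPoch_zero]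
  | succ L ih =>
    rw [qPoch_succ, qPoch_succ', mul_inv_mul_pow_succ hq, ih, omega_succ hr,
      one_sub_inv_eq (z := C * q ^ (L + 1)) (by positivity)]
    field_simp
    ring

theorem xi_succ (hr : r ^ 2 = q) (hb : b ^ 2 = B) (hc : c ^ 2 = C) (n : ℕ) :
    xi r b c (n + 1) =
      xi r b c n * ((1 - B * q ^ (n + 1)) / (1 - C * q ^ (n + 1)) * (c / b)) := by
  unfold xi
  rw [hr, hb, hc, qPoch_succ, qPoch_succ, show q * B * q ^ n = B * q ^ (n + 1) by ring,
    show q * C * q ^ n = C * q ^ (n + 1) by ring, mul_div_mul_comm, pow_succ _ n]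
  ring

theorem xi_zero (r b c : ℂ) : xi r b c 0 = 1 := by simp [xi, qPoch_zero]

theorem xi_ne_zero (hq : q ≠ 0) (hr : r ^ 2 = q) (hb : b ^ 2 = B) (hc : c ^ 2 = C)
    (hb0 : b ≠ 0) (hc0 : c ≠ 0) (gb : Generic q B) (gc : Generic q C) (n : ℕ) :
    xi r b c n ≠ 0 := by
  unfold xi
  rw [hr, hb, hc]
  have m1 := (gb.mul hq).qPoch n
  have m2 := (gc.mul hq).qPoch n
  positivity

theorem omega_ne_zero {t : ℂ} (hr : r ≠ 0) (ht : t ≠ 0) (n : ℕ) : omega r t n ≠ 0 := by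
  unfold omega
  have : (-1 : ℂ) ≠ 0 := by norm_num
  positivity

theorem ratioProd_mul_xi_mul_omega (hq : q ≠ 0) (hr : r ^ 2 = q) (hb : b ^ 2 = B) (hc : c ^ 2 = C)
    (hb0 : b ≠ 0) (hc0 : c ≠ 0) (gb : Generic q B) (gc : Generic q C) (t : ℂ) (n : ℕ) :
    ratioProd q C B n * xi r b c n * omega r t n = (t / (b * c)) ^ n := by
  induction n with
  | zero => simp [ratioProd_zero, xi_zero, omega_zero]
  | succ n ih =>
    have hC : C ≠ 0 := by rw [← hc]; positivity
    have m1 := gb.sub_pow_ne_zero (n + 1)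
    have m2 := gc.sub_pow_ne_zero (n + 1)
    rw [ratioProd_succ, xi_succ hr hb hc, omega_succ hr, pow_succ (t / (b * c)) n, ← ih,
      one_sub_inv_eq (z := C * q ^ (n + 1)) (by positivity)]
    generalize 1 - B * q ^ (n + 1) = y0 at *
    generalize 1 - C * q ^ (n + 1) = y1 at *
    field_simp
    rw [← hc]
    field_simp

/-- The effect on `Omega` of exchanging the last two parameters and replacing the first. -/
theorem Omega_exchange {a' A' : ℂ} (hq : NonRoot q) (h : GenericTriple q A B C)
    (h' : GenericTriple q A' C B) (hr : r ^ 2 = q)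
    (ha : a ^ 2 = A) (ha' : a' ^ 2 = A') (hb : b ^ 2 = B) (hc : c ^ 2 = C) (n k : ℕ) :
    Omega r a b c (n + k) n * (qPoch (A' * C * B * q ^ (n + k + 2)) q n * qPoch (q * A') q k) =
      Omega r a' c b (n + k) n * (xi r b c n ^ 2 * (b / c) ^ (n + k) *
        (qPoch (A * B * C * q ^ (n + k + 2)) q n * qPoch (q * A) q k)) := by
  have hq0 := hq.ne
  have hr0 : r ≠ 0 := by rintro rfl; simp at hr; exact hq0 hr.symm
  have hb0 : b ≠ 0 := by rintro rfl; simp at hb; exact h.ne_b hb.symm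
  have hc0 : c ≠ 0 := by rintro rfl; simp at hc; exact h.ne_c hc.symm
  rw [Omega_eq_of_generic h hr ha hb hc, Omega_eq_of_generic h' hr ha' hc hb, mul_comm C B, xi, hr,
    hb, hc]
  have z : ∀ z : ℂ, z ≠ 0 → (r * z) ^ ((n : ℤ) - k) = r ^ ((n : ℤ) - k) * (z ^ n / z ^ k) := by
    intro z hz
    rw [mul_zpow, zpow_sub₀ hz, zpow_natCast, zpow_natCast]
  rw [z b hb0, z c hc0]
  have m4 : r ^ ((n : ℤ) - k) ≠ 0 := zpow_ne_zero _ hr0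
  have m5 := hq.qPoch n
  have m6 := hq.qPoch k
  have m7 := (h.gc.mul hq0).qPoch n
  have m7' := (h.gb.mul hq0).qPoch n
  have m8 := (h.gbc.mul_pow hq0 (n + 1)).qPoch (n + k + 1)
  generalize r ^ ((n : ℤ) - k) = y0 at *
  generalize qPoch q q n = y1 at *
  generalize qPoch q q k = y2 at *
  generalize qPoch (q * C) q n = y3 at *
  generalize qPoch (q * B) q n = y4 at *
  generalize qPoch (B * C * q ^ (n + 1)) q (n + k + 1) = y5 at *
  generalize 1 - B * C * q ^ (2 * n + 1) = y6 at *
  generalize qPoch q q (n + k) = y7 at *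
  generalize qPoch (q * A) q k = y8 at *
  generalize qPoch (q * A') q k = y9 at *
  rw [show A' * C * B = A' * (B * C) by ring]
  generalize qPoch (A * B * C * q ^ (n + k + 2)) q n = y10 at *
  generalize qPoch (A' * (B * C) * q ^ (n + k + 2)) q n = y11 at *
  rw [div_pow, div_pow]
  field_simp
  ring

theorem Omega_inv_zero (hq : NonRoot q) (h : GenericTriple q A B C) (hr : r ^ 2 = q)
    (ha : a ^ 2 = A) (hb : b ^ 2 = B) (hc : c ^ 2 = C) (L : ℕ) :
    Omega r⁻¹ a⁻¹ b⁻¹ c⁻¹ L 0 = (C / A) ^ L * Omega r a b c L 0 := by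
  have hq0 := hq.ne
  have hr0 : r ≠ 0 := by rintro rfl; simp at hr; exact hq0 hr.symm
  have hb0 : b ≠ 0 := by rintro rfl; simp at hb; exact h.ne_b hb.symm
  have hA := h.ne_a
  have hB := h.ne_b
  have hC := h.ne_c
  induction L with
  | zero => simp [Omega, qPochOmit, qBinom, qPoch_zero]
  | succ L ih =>
    have e1 := Omega_succ_left hq h hr ha hb hc 0 L
    have e2 := Omega_succ_left hq.inv h.inv (r := r⁻¹) (a := a⁻¹) (b := b⁻¹) (c := c⁻¹)
      (by rw [inv_pow, hr]) (by rw [inv_pow, ha]) (by rw [inv_pow, hb]) (by rw [inv_pow, hc]) 0 L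
    have m1 := hq.sub (Nat.le_add_left 1 L)
    have m2 := h.gabc.sub_pow_ne_zero (L + 2)
    have m3 := h.gbc.sub_pow_ne_zero (L + 2)
    simp only [Nat.zero_add, Nat.mul_zero, ← mul_inv, inv_pow, ih] at e1 e2
    rw [one_sub_inv_eq (z := q ^ (L + 1)) (by positivity),
      one_sub_inv_eq (z := A * B * C * q ^ (L + 2)) (by positivity),
      one_sub_inv_eq (z := B * C * q ^ (L + 2)) (by positivity),
      one_sub_inv_eq (z := A * q ^ (L + 1)) (by positivity)] at e2
    generalize 1 - q ^ (L + 1) = y0 at *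
    generalize 1 - A * B * C * q ^ (L + 2) = y1 at *
    generalize 1 - B * C * q ^ (L + 2) = y2 at *
    generalize 1 - A * q ^ (L + 1) = y3 at *
    generalize Omega r⁻¹ a⁻¹ b⁻¹ c⁻¹ (L + 1) 0 = y4 at *
    generalize Omega r a b c (L + 1) 0 = y5 at *
    generalize Omega r a b c L 0 = y6 at *
    rw [show q ^ (L + 2) = q * q ^ (L + 1) by ring] at e2
    have hZ : q ^ (L + 1) ≠ 0 := by positivity
    generalize q ^ (L + 1) = Z at *
    have hm : y0 * y1 * y2 ≠ 0 := by positivity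
    refine mul_left_cancel₀ hm ?_
    have e3 : y4 * (y0 * y1 * y2) = (C / A) ^ L * y6 * (y0 * y1 * y3 * (r * b)) *
        (q * C * B / (A * (r ^ 2 * b ^ 2))) := by
      field_simp at e2 ⊢
      linear_combination (-1) * e2
    rw [hr, hb, show q * C * B / (A * (q * B)) = C / A by field_simp] at e3
    rw [pow_succ]
    linear_combination e3 - (C / A) ^ L * (C / A) * e1

/-- The effect on `Omega` of inverting all parameters. -/
theorem Omega_inv (hq : NonRoot q) (h : GenericTriple q A B C) (hr : r ^ 2 = q)
    (ha : a ^ 2 = A) (hb : b ^ 2 = B) (hc : c ^ 2 = C) {L n : ℕ} (hn : n ≤ L) :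
    Omega r⁻¹ a⁻¹ b⁻¹ c⁻¹ L n = (C / A) ^ L * Omega r a b c L n := by
  have hq0 := hq.ne
  have hr0 : r ≠ 0 := by rintro rfl; simp at hr; exact hq0 hr.symm
  have hA := h.ne_a
  have hB := h.ne_b
  have hC := h.ne_c
  induction n with
  | zero => exact Omega_inv_zero hq h hr ha hb hc L
  | succ n ih =>
    obtain ⟨k, rfl⟩ : ∃ k, L = n + k + 1 := ⟨L - n - 1, by omega⟩
    have e1 := Omega_succ hq h hr ha hb hc n k
    have e2 := Omega_succ hq.inv h.inv (r := r⁻¹) (a := a⁻¹) (b := b⁻¹) (c := c⁻¹)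
      (by rw [inv_pow, hr]) (by rw [inv_pow, ha]) (by rw [inv_pow, hb]) (by rw [inv_pow, hc]) n k
    rw [ih (by omega)] at e2
    have m1 := hq.sub (Nat.le_add_left 1 n)
    have m2 := h.gbc.sub_pow_ne_zero (2 * n + 1)
    have m3 := h.ga.sub_pow_ne_zero (k + 1)
    have m4 := h.gbc.sub_pow_ne_zero (2 * n + k + 3)
    have m5 := h.gc.sub_pow_ne_zero (n + 1)
    simp only [← mul_inv, inv_pow] at e2
    rw [one_sub_inv_eq (z := q ^ (n + 1)) (by positivity),
      one_sub_inv_eq (z := B * C * q ^ (2 * n + 1)) (by positivity),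
      one_sub_inv_eq (z := A * q ^ (k + 1)) (by positivity),
      one_sub_inv_eq (z := B * C * q ^ (2 * n + k + 3)) (by positivity),
      one_sub_inv_eq (z := C * q ^ (n + 1)) (by positivity),
      one_sub_inv_eq (z := q ^ (k + 1)) (by positivity),
      one_sub_inv_eq (z := B * C * q ^ (2 * n + 3)) (by positivity),
      one_sub_inv_eq (z := B * q ^ (n + 1)) (by positivity),
      one_sub_inv_eq (z := A * B * C * q ^ (2 * n + k + 3)) (by positivity),
      one_sub_inv_eq (z := B * C * q ^ (n + 1)) (by positivity)] at e2
    generalize 1 - q ^ (n + 1) = y0 at *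
    generalize 1 - B * C * q ^ (2 * n + 1) = y1 at *
    generalize 1 - A * q ^ (k + 1) = y2 at *
    generalize 1 - B * C * q ^ (2 * n + k + 3) = y3 at *
    generalize 1 - C * q ^ (n + 1) = y4 at *
    generalize 1 - q ^ (k + 1) = y5 at *
    generalize 1 - B * C * q ^ (2 * n + 3) = y6 at *
    generalize 1 - B * q ^ (n + 1) = y7 at *
    generalize 1 - A * B * C * q ^ (2 * n + k + 3) = y8 at *
    generalize 1 - B * C * q ^ (n + 1) = y9 at *
    generalize Omega r⁻¹ a⁻¹ b⁻¹ c⁻¹ (n + k + 1) (n + 1) = y10 at *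
    generalize Omega r a b c (n + k + 1) (n + 1) = y11 at *
    generalize Omega r a b c (n + k + 1) n = y12 at *
    generalize (C / A) ^ (n + k + 1) = y13 at *
    have hm : y0 * y1 * y2 * y3 * y4 * (q * B) ≠ 0 := by positivity
    refine mul_left_cancel₀ hm ?_
    have e3 : y10 * (y0 * y1 * y2 * y3 * y4 * (q * B)) =
        y13 * y12 * (y5 * y6 * y7 * y8 * y9) := by
      rw [show q ^ (2 * n + 1) = q * (q ^ n) ^ 2 by ring, show q ^ (2 * n + 3) = q ^ 3 * (q ^ n) ^ 2 by ring,
        show q ^ (2 * n + k + 3) = q ^ 3 * (q ^ n) ^ 2 * q ^ k by ring, pow_succ q n, pow_succ q k] at e2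
      have hU : q ^ n ≠ 0 := by positivity
      have hV : q ^ k ≠ 0 := by positivity
      generalize q ^ n = U at *
      generalize q ^ k = V at *
      field_simp at e2
      linear_combination (-1) * e2
    linear_combination e3 - y13 * e1

end

/-- Square roots `r`, `sᵢ` of a base `q` and of parameters `cᵢ` in general position, chosen
coherently. -/
structure RootFive (r s₀ s₁ s₂ s₃ s₄ q c₀ c₁ c₂ c₃ c₄ : ℂ) (N : ℕ) : Prop
    extends GenericFive q c₀ c₁ c₂ c₃ c₄ N where
  hr : r ^ 2 = q
  h0 : s₀ ^ 2 = c₀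
  h1 : s₁ ^ 2 = c₁
  h2 : s₂ ^ 2 = c₂
  h3 : s₃ ^ 2 = c₃
  h4 : s₄ ^ 2 = c₄
  root : r ^ (2 * N + 3) * (s₀ * s₁ * s₂ * s₃ * s₄) = 1

theorem vwp_succ_self {q al : ℂ} (hq : NonRoot q) (h : Generic q al) (a : ℕ) :
    vwp q al (a + 1) * ((1 - al * q ^ (2 * a)) * (1 - q ^ (a + 1))) =
      vwp q al a * ((1 - al * q ^ (2 * a + 2)) * (1 - al * q ^ a)) := by
  unfold vwp
  have m1 := hq.qPoch a
  have m2 := hq.sub (Nat.le_add_left 1 a)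
  have m3 := h.sub_ne_zero
  rw [qPoch_succ, qPoch_succ, show q * q ^ a = q ^ (a + 1) by ring,
    show (q ^ (a + 1)) ^ 2 = q ^ (2 * a + 2) by ring, show (q ^ a) ^ 2 = q ^ (2 * a) by ring]
  generalize 1 - q ^ (a + 1) = y0 at *
  generalize qPoch q q a = y1 at *
  generalize 1 - al * q ^ (2 * a) = y2 at *
  generalize 1 - al * q ^ (2 * a + 2) = y3 at *
  generalize 1 - al * q ^ a = y4 at *
  generalize 1 - al = y5 at *
  field_simp

theorem sumWeight_succ_self {q a b c : ℂ} (hq : NonRoot q) (h : GenericTriple q a b c) (L m : ℕ) :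
    sumWeight q a b c L (m + 1) * ((1 - a * b * q ^ (2 * m + 1)) * (1 - q ^ (m + 1)) *
        (1 - (c * q ^ L)⁻¹ * q ^ m) * (1 - a * b * q ^ (L + m + 2))) =
      sumWeight q a b c L m * ((1 - a * b * q ^ (2 * m + 3)) * (1 - a * b * q ^ (m + 1)) *
        (1 - a * b * c * q ^ (L + m + 2)) * (1 - (q ^ L)⁻¹ * q ^ m) * (-(c⁻¹ * q ^ m))) := by
  have hq0 := hq.ne
  have na := h.ne_a
  have nb := h.ne_b
  have nc := h.ne_c
  unfold sumWeight vwpTermLim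
  have e := vwp_succ_self hq (h.gab.mul hq0) m
  rw [show a * b * q * q / (a * b * c * q ^ (L + 2)) = (c * q ^ L)⁻¹ by field_simp; ring,
    show a * b * q * q ^ (L + 1) / (a * b * c * q ^ (L + 2)) = c⁻¹ by field_simp; ring,
    show a * b * q = q * (a * b) by ring]
  rw [show q * (a * b) * q ^ (2 * m) = a * b * q ^ (2 * m + 1) by ring,
    show q * (a * b) * q ^ (2 * m + 2) = a * b * q ^ (2 * m + 3) by ring,
    show q * (a * b) * q ^ m = a * b * q ^ (m + 1) by ring] at e
  rw [qPoch_succ, qPoch_succ, qPoch_succ, qPoch_succ,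
    show a * b * c * q ^ (L + 2) * q ^ m = a * b * c * q ^ (L + m + 2) by ring,
    show q * (a * b) * q ^ (L + 1) * q ^ m = a * b * q ^ (L + m + 2) by ring,
    Nat.choose_succ_succ' m 1, Nat.choose_one_right, pow_add q m, pow_succ (-c⁻¹) m]
  have m1 : qPoch (c * q ^ L)⁻¹ q m ≠ 0 := (h.gc.mul_pow hq0 L).inv.qPoch m
  have m2 : 1 - (c * q ^ L)⁻¹ * q ^ m ≠ 0 := (h.gc.mul_pow hq0 L).inv.sub_pow_ne_zero m
  have m3 : qPoch (q * (a * b) * q ^ (L + 1)) q m ≠ 0 := ((h.gab.mul hq0).mul_pow hq0 _).qPoch m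
  have m4 : 1 - a * b * q ^ (L + m + 2) ≠ 0 := h.gab.sub_pow_ne_zero _
  generalize qPoch (c * q ^ L)⁻¹ q m = y0 at *
  generalize 1 - (c * q ^ L)⁻¹ * q ^ m = y1 at *
  generalize qPoch (q * (a * b) * q ^ (L + 1)) q m = y2 at *
  generalize 1 - a * b * q ^ (L + m + 2) = y3 at *
  generalize vwp q (q * (a * b)) (m + 1) = y4 at *
  generalize vwp q (q * (a * b)) m = y5 at *
  generalize qPoch (a * b * c * q ^ (L + 2)) q m = y6 at *
  generalize qPoch (q ^ L)⁻¹ q m = y7 at *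
  generalize 1 - a * b * c * q ^ (L + m + 2) = y8 at *
  generalize 1 - (q ^ L)⁻¹ * q ^ m = y9 at *
  generalize 1 - a * b * q ^ (2 * m + 1) = y10 at *
  generalize 1 - a * b * q ^ (2 * m + 3) = y11 at *
  generalize 1 - a * b * q ^ (m + 1) = y12 at *
  generalize 1 - q ^ (m + 1) = y13 at *
  generalize c⁻¹ = y14 at *
  generalize q ^ m.choose 2 = y15 at *
  field_simp
  linear_combination (-y14 * (-y14) ^ m * y15 * y6 * y7 * y8 * y9) * e

namespace RootFive
variable {r s₀ s₁ s₂ s₃ s₄ q c₀ c₁ c₂ c₃ c₄ : ℂ} {N : ℕ}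

section basics
variable (h : RootFive r s₀ s₁ s₂ s₃ s₄ q c₀ c₁ c₂ c₃ c₄ N)
include h

theorem r_ne : r ≠ 0 := by
  rintro rfl; have := h.hr; simp at this; exact h.hq.ne this.symm
theorem s₀_ne : s₀ ≠ 0 := by
  rintro rfl; have := h.h0; simp at this; exact h.n0 this.symm
theorem s₁_ne : s₁ ≠ 0 := by
  rintro rfl; have := h.h1; simp at this; exact h.n1 this.symm
theorem s₂_ne : s₂ ≠ 0 := by
  rintro rfl; have := h.h2; simp at this; exact h.n2 this.symm
theorem s₃_ne : s₃ ≠ 0 := by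
  rintro rfl; have := h.h3; simp at this; exact h.n3 this.symm
theorem s₄_ne : s₄ ≠ 0 := by
  rintro rfl; have := h.h4; simp at this; exact h.n4 this.symm
theorem triple₀₁₃ : GenericTriple q c₀ c₁ c₃ :=
  ⟨h.n0, h.n1, h.n3, h.g0, h.g1, h.g3, h.g01, h.g03, h.g13,
    GenericFive.triple_aux (N := N) h.hq.ne h.g24 (by rw [← h.bal]; ring)⟩
theorem triple₀₁₄ : GenericTriple q c₀ c₁ c₄ :=
  ⟨h.n0, h.n1, h.n4, h.g0, h.g1, h.g4, h.g01, h.g04, h.g14,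
    GenericFive.triple_aux (N := N) h.hq.ne h.g23 (by rw [← h.bal]; ring)⟩
theorem triple₀₂₃ : GenericTriple q c₀ c₂ c₃ :=
  ⟨h.n0, h.n2, h.n3, h.g0, h.g2, h.g3, h.g02, h.g03, h.g23,
    GenericFive.triple_aux (N := N) h.hq.ne h.g14 (by rw [← h.bal]; ring)⟩
theorem triple₀₂₄ : GenericTriple q c₀ c₂ c₄ :=
  ⟨h.n0, h.n2, h.n4, h.g0, h.g2, h.g4, h.g02, h.g04, h.g24,
    GenericFive.triple_aux (N := N) h.hq.ne h.g13 (by rw [← h.bal]; ring)⟩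
theorem triple₀₃₄ : GenericTriple q c₀ c₃ c₄ :=
  ⟨h.n0, h.n3, h.n4, h.g0, h.g3, h.g4, h.g03, h.g04, h.g34,
    GenericFive.triple_aux (N := N) h.hq.ne h.g12 (by rw [← h.bal]; ring)⟩
theorem triple₁₂₃ : GenericTriple q c₁ c₂ c₃ :=
  ⟨h.n1, h.n2, h.n3, h.g1, h.g2, h.g3, h.g12, h.g13, h.g23,
    GenericFive.triple_aux (N := N) h.hq.ne h.g04 (by rw [← h.bal]; ring)⟩
theorem triple₁₂₄ : GenericTriple q c₁ c₂ c₄ :=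
  ⟨h.n1, h.n2, h.n4, h.g1, h.g2, h.g4, h.g12, h.g14, h.g24,
    GenericFive.triple_aux (N := N) h.hq.ne h.g03 (by rw [← h.bal]; ring)⟩
end basics
end RootFive

/-- The part of the summand of a Griffiths polynomial that is independent of `i` and `x`. -/
def griffithsWeight (r s₀ s₁ s₂ s₃ s₄ : ℂ) (N j y a : ℕ) : ℂ :=
  omega r (s₁ * s₂ * s₃ / s₄) a * Omega r s₃ s₀ s₄ (N - a) j * Omega r s₄ s₂ s₁ (N - y) a

namespace RootFive
variable {r s₀ s₁ s₂ s₃ s₄ q c₀ c₁ c₂ c₃ c₄ : ℂ} {N : ℕ}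

/-- Exchange of `c₃` and `c₄`. -/
theorem swap₃₄ (h : RootFive r s₀ s₁ s₂ s₃ s₄ q c₀ c₁ c₂ c₃ c₄ N) :
    RootFive r s₀ s₁ s₂ s₄ s₃ q c₀ c₁ c₂ c₄ c₃ N where
  hq := h.hq
  bal := by rw [← h.bal]; ring
  n0 := h.n0
  n1 := h.n1
  n2 := h.n2
  n3 := h.n4
  n4 := h.n3
  g0 := h.g0
  g1 := h.g1
  g2 := h.g2
  g3 := h.g4
  g4 := h.g3
  g01 := h.g01
  g02 := h.g02
  g03 := h.g04
  g04 := h.g03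
  g12 := h.g12
  g13 := h.g14
  g14 := h.g13
  g23 := h.g24
  g24 := h.g23
  g34 := h.g34.comm
  hr := h.hr
  h0 := h.h0
  h1 := h.h1
  h2 := h.h2
  h3 := h.h4
  h4 := h.h3
  root := by rw [← h.root]; ring

/-- Inversion of the base and of all parameters. -/
theorem inv (h : RootFive r s₀ s₁ s₂ s₃ s₄ q c₀ c₁ c₂ c₃ c₄ N) :
    RootFive r⁻¹ s₀⁻¹ s₁⁻¹ s₂⁻¹ s₃⁻¹ s₄⁻¹ q⁻¹ c₀⁻¹ c₁⁻¹ c₂⁻¹ c₃⁻¹ c₄⁻¹ N where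
  hq := h.hq.inv
  bal := by simp only [inv_pow, ← mul_inv, h.bal, inv_one]
  n0 := inv_ne_zero h.n0
  n1 := inv_ne_zero h.n1
  n2 := inv_ne_zero h.n2
  n3 := inv_ne_zero h.n3
  n4 := inv_ne_zero h.n4
  g0 := h.g0.inv_inv
  g1 := h.g1.inv_inv
  g2 := h.g2.inv_inv
  g3 := h.g3.inv_inv
  g4 := h.g4.inv_inv
  g01 := by rw [← mul_inv]; exact h.g01.inv_inv
  g02 := by rw [← mul_inv]; exact h.g02.inv_inv
  g03 := by rw [← mul_inv]; exact h.g03.inv_inv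
  g04 := by rw [← mul_inv]; exact h.g04.inv_inv
  g12 := by rw [← mul_inv]; exact h.g12.inv_inv
  g13 := by rw [← mul_inv]; exact h.g13.inv_inv
  g14 := by rw [← mul_inv]; exact h.g14.inv_inv
  g23 := by rw [← mul_inv]; exact h.g23.inv_inv
  g24 := by rw [← mul_inv]; exact h.g24.inv_inv
  g34 := by rw [← mul_inv]; exact h.g34.inv_inv
  hr := by rw [inv_pow, h.hr]
  h0 := by rw [inv_pow, h.h0]
  h1 := by rw [inv_pow, h.h1]
  h2 := by rw [inv_pow, h.h2]
  h3 := by rw [inv_pow, h.h3]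
  h4 := by rw [inv_pow, h.h4]
  root := by simp only [inv_pow, ← mul_inv, h.root, inv_one]

/-- Exchange of `c₂` with `c₃` and of `c₀` with `c₄`. -/
theorem exchange' (h : RootFive r s₀ s₁ s₂ s₃ s₄ q c₀ c₁ c₂ c₃ c₄ N) :
    RootFive r s₄ s₁ s₃ s₂ s₀ q c₄ c₁ c₃ c₂ c₀ N :=
  { h.toGenericFive.exchange with
    hr := h.hr
    h0 := h.h4
    h1 := h.h1
    h2 := h.h3
    h3 := h.h2
    h4 := h.h0
    root := by rw [← h.root]; ring }

theorem div_eq (h : RootFive r s₀ s₁ s₂ s₃ s₄ q c₀ c₁ c₂ c₃ c₄ N) :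
    s₁ * s₂ * s₃ / s₄ = r * s₀ * (q ^ (N + 1) * (c₁ * c₂ * c₃)) := by
  have := h.s₄_ne
  rw [div_eq_iff this, ← h.hr, ← h.h1, ← h.h2, ← h.h3]
  have e := h.root
  linear_combination (-s₁ * s₂ * s₃) * e

/-- The numerator in the ratio of two successive values of `griffithsWeight`. -/
def weightNum (q c₁ c₂ c₃ c₄ : ℂ) (N k m a : ℕ) : ℂ :=
  (1 - q ^ (k + 1)) * (1 - q ^ (m + 1)) * (1 - c₁ * c₂ * q ^ (a + N + 2)) *
    (1 - c₁ * c₂ * c₃ * q ^ (2 * a + k + 3)) * (1 - c₁ * c₂ * c₄ * q ^ (2 * a + m + 3)) *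
    (1 - c₁ * c₂ * q ^ (2 * a + 3)) * (1 - c₂ * q ^ (a + 1)) * (1 - c₁ * c₂ * q ^ (a + 1))

/-- The denominator in the ratio of two successive values of `griffithsWeight`. -/
def weightDen (q c₁ c₂ c₃ c₄ : ℂ) (N k m a : ℕ) : ℂ :=
  q * c₂ * ((1 - q ^ (N - a)) * (1 - c₁ * c₂ * q ^ (2 * a + k + 3)) *
    (1 - c₁ * c₂ * q ^ (2 * a + m + 3)) * (1 - c₃ * q ^ (k + 1)) * (1 - c₄ * q ^ (m + 1)) *
    (1 - c₁ * c₂ * q ^ (2 * a + 1)) * (1 - c₁ * q ^ (a + 1)) * (1 - q ^ (a + 1)))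

theorem weightDen_ne_zero (h : RootFive r s₀ s₁ s₂ s₃ s₄ q c₀ c₁ c₂ c₃ c₄ N) (k m : ℕ) {a : ℕ}
    (ha : a < N) : weightDen q c₁ c₂ c₃ c₄ N k m a ≠ 0 := by
  have := h.hq.ne
  have := h.n2
  have := h.hq.sub (show 1 ≤ N - a by omega)
  have := h.g12.sub_pow_ne_zero (2 * a + k + 3)
  have := h.g12.sub_pow_ne_zero (2 * a + m + 3)
  have := h.g12.sub_pow_ne_zero (2 * a + 1)
  have := h.g3.sub_pow_ne_zero (k + 1)
  have := h.g4.sub_pow_ne_zero (m + 1)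
  have := h.g1.sub_pow_ne_zero (a + 1)
  have := h.hq.sub (Nat.le_add_left 1 a)
  unfold weightDen
  positivity

theorem griffithsWeight_succ (h : RootFive r s₀ s₁ s₂ s₃ s₄ q c₀ c₁ c₂ c₃ c₄ N) {j y a k m : ℕ}
    (hk : N = a + k + 1 + j) (hm : N = a + m + 1 + y) :
    griffithsWeight r s₀ s₁ s₂ s₃ s₄ N j y (a + 1) * weightDen q c₁ c₂ c₃ c₄ N k m a =
      griffithsWeight r s₀ s₁ s₂ s₃ s₄ N j y a * weightNum q c₁ c₂ c₃ c₄ N k m a := by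
  have hq := h.hq
  have hq0 := hq.ne
  have hr0 := h.r_ne
  have hs0 := h.s₀_ne
  have n1 := h.n1
  have n2 := h.n2
  have n3 := h.n3
  have e1 := Omega_succ_left hq h.triple₀₃₄.swap₁₂ h.hr h.h3 h.h0 h.h4 j k
  have e2 := Omega_succ hq h.triple₁₂₄.swap₁₂.swap₂₃.swap₁₂ h.hr h.h4 h.h2 h.h1 a m
  have b1 : c₃ * c₀ * c₄ * q ^ (j + k + 2) = (c₁ * c₂ * q ^ (a + N + 2))⁻¹ :=
    eq_inv_of_mul_eq_one_left (by rw [← h.bal, hk]; ring)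
  have b2 : c₀ * c₄ * q ^ (2 * j + k + 2) = (c₁ * c₂ * c₃ * q ^ (2 * a + k + 3))⁻¹ :=
    eq_inv_of_mul_eq_one_left (by rw [← h.bal, hk]; ring)
  have b3 : c₃ * c₀ * c₄ * q ^ (2 * j + k + 2) = (c₁ * c₂ * q ^ (2 * a + k + 3))⁻¹ :=
    eq_inv_of_mul_eq_one_left (by rw [← h.bal, hk]; ring)
  rw [b1, b2, b3, one_sub_inv_eq (z := c₁ * c₂ * q ^ (a + N + 2)) (by positivity),
    one_sub_inv_eq (z := c₁ * c₂ * c₃ * q ^ (2 * a + k + 3)) (by positivity),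
    one_sub_inv_eq (z := c₁ * c₂ * q ^ (2 * a + k + 3)) (by positivity)] at e1
  unfold griffithsWeight weightNum weightDen
  rw [omega_succ h.hr, h.div_eq, show N - (a + 1) = j + k by omega, show N - a = j + k + 1 by omega,
    show N - y = a + m + 1 by omega]
  rw [mul_comm c₂ c₁, show c₄ * c₂ * c₁ = c₁ * c₂ * c₄ by ring] at e2
  generalize Omega r s₃ s₀ s₄ (j + k + 1) j = y0 at *
  generalize Omega r s₃ s₀ s₄ (j + k) j = y1 at *
  generalize Omega r s₄ s₂ s₁ (a + m + 1) (a + 1) = y2 at *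
  generalize Omega r s₄ s₂ s₁ (a + m + 1) a = y3 at *
  generalize omega r (r * s₀ * (q ^ (N + 1) * (c₁ * c₂ * c₃))) a = om
  generalize 1 - q ^ (k + 1) = y4 at *
  generalize 1 - c₁ * c₂ * q ^ (a + N + 2) = y5 at *
  generalize 1 - c₁ * c₂ * c₃ * q ^ (2 * a + k + 3) = y6 at *
  generalize 1 - q ^ (j + k + 1) = y7 at *
  generalize 1 - c₁ * c₂ * q ^ (2 * a + k + 3) = y8 at *
  generalize 1 - c₃ * q ^ (k + 1) = y9 at *
  generalize 1 - q ^ (a + 1) = y10 at *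
  generalize 1 - c₁ * c₂ * q ^ (2 * a + 1) = y11 at *
  generalize 1 - c₄ * q ^ (m + 1) = y12 at *
  generalize 1 - c₁ * c₂ * q ^ (2 * a + m + 3) = y13 at *
  generalize 1 - c₁ * q ^ (a + 1) = y14 at *
  generalize 1 - q ^ (m + 1) = y15 at *
  generalize 1 - c₁ * c₂ * q ^ (2 * a + 3) = y16 at *
  generalize 1 - c₂ * q ^ (a + 1) = y17 at *
  generalize 1 - c₁ * c₂ * c₄ * q ^ (2 * a + m + 3) = y18 at *
  generalize 1 - c₁ * c₂ * q ^ (a + 1) = y19 at *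
  have e3 : y0 * (y4 * y5 * y6) = -(y1 * (y7 * y8 * y9 * (r * s₀ * (q ^ (N + 1) * (c₁ * c₂ * c₃)) * q ^ (a + 1)))) := by
    rw [show q ^ (a + N + 2) = q ^ (N + 1) * q ^ (a + 1) by ring] at e1
    field_simp at e1
    linear_combination e1
  linear_combination (-om * y1 * y7 * y8 * y9 * (r * s₀ * (q ^ (N + 1) * (c₁ * c₂ * c₃)) * q ^ (a + 1))) * e2 - om * y3 * y15 * y16 * y17 * y18 * y19 * e3

end RootFive

namespace RootFive
variable {r s₀ s₁ s₂ s₃ s₄ q c₀ c₁ c₂ c₃ c₄ : ℂ} {N : ℕ}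

theorem sumWeight_mul_twoHypConst_succ (h : RootFive r s₀ s₁ s₂ s₃ s₄ q c₀ c₁ c₂ c₃ c₄ N)
    {j y a k m : ℕ} (hk : N = a + k + 1 + j) (hm : N = a + m + 1 + y) :
    sumWeight q c₁ c₂ c₃ (N - j) (a + 1) * twoHypConst q c₄ c₁ c₃ c₂ c₀ N (a + 1) y *
        weightDen q c₁ c₂ c₃ c₄ N k m a =
      sumWeight q c₁ c₂ c₃ (N - j) a * twoHypConst q c₄ c₁ c₃ c₂ c₀ N a y *
        weightNum q c₁ c₂ c₃ c₄ N k m a := by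
  have hq := h.hq
  have hq0 := hq.ne
  have n1 := h.n1
  have n2 := h.n2
  have n3 := h.n3
  have n4 := h.n4
  have e1 := sumWeight_succ_self hq h.triple₁₂₃ (N - j) a
  have e2 : (q ^ N)⁻¹ * q ^ y * q ^ a = (q ^ (m + 1))⁻¹ := by
    rw [hm]; field_simp; ring
  have e3 : c₁ * c₂ * q ^ (N + 2) * (q ^ y)⁻¹ * q ^ a = c₁ * c₂ * q ^ (2 * a + m + 3) := by
    rw [hm]; field_simp; ring
  have e4 : c₄ * c₁ * c₂ * q ^ (N + 2) * (q ^ y)⁻¹ * q ^ a = c₁ * c₂ * c₄ * q ^ (2 * a + m + 3) := by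
    rw [hm]; field_simp; ring
  have e5 : (c₄ * q ^ N)⁻¹ * q ^ y * q ^ a = (c₄ * q ^ (m + 1))⁻¹ := by
    rw [hm]; field_simp; ring
  have e6 : (q ^ N)⁻¹ * q ^ a = (q ^ (N - a))⁻¹ := by
    rw [show N - a = m + 1 + y by omega, hm]; field_simp; ring
  have e7 : (c₃ * q ^ (N - j))⁻¹ * q ^ a = (c₃ * q ^ (k + 1))⁻¹ := by
    rw [show N - j = a + k + 1 by omega]; field_simp; ring
  have e8 : (q ^ (N - j))⁻¹ * q ^ a = (q ^ (k + 1))⁻¹ := by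
    rw [show N - j = a + k + 1 by omega]; field_simp; ring
  rw [e7, e8, show N - j + a + 2 = 2 * a + k + 3 by omega,
    one_sub_inv_eq (z := c₃ * q ^ (k + 1)) (by positivity),
    one_sub_inv_eq (z := q ^ (k + 1)) (by positivity)] at e1
  rw [twoHypConst_succ_left, e2, e3, e4, e5, e6, one_sub_inv_eq (z := q ^ (m + 1)) (by positivity),
    one_sub_inv_eq (z := c₄ * q ^ (m + 1)) (by positivity),
    one_sub_inv_eq (z := q ^ (N - a)) (by positivity), show q * c₂ * q ^ a = c₂ * q ^ (a + 1) by ring,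
    show q * c₁ * q ^ a = c₁ * q ^ (a + 1) by ring,
    show c₁ * c₂ * q ^ (N + 2) * q ^ a = c₁ * c₂ * q ^ (a + N + 2) by ring]
  have m1 := hq.sub (show 1 ≤ N - a by omega)
  have m2 := h.g12.sub_pow_ne_zero (2 * a + m + 3)
  have m3 := h.g4.sub_pow_ne_zero (m + 1)
  have m4 := h.g1.sub_pow_ne_zero (a + 1)
  unfold weightNum weightDen
  have p1 : q ^ (N + 1) = q ^ (N - a) * q ^ (a + 1) := by
    rw [← pow_add]; congr 1; omega
  rw [p1]
  have p2 : q ^ (N - a) ≠ 0 := by positivity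
  generalize sumWeight q c₁ c₂ c₃ (N - j) (a + 1) = y0 at *
  generalize sumWeight q c₁ c₂ c₃ (N - j) a = y1 at *
  generalize twoHypConst q c₄ c₁ c₃ c₂ c₀ N a y = y2 at *
  generalize 1 - q ^ (k + 1) = y3 at *
  generalize 1 - c₁ * c₂ * q ^ (a + N + 2) = y4 at *
  generalize 1 - c₁ * c₂ * c₃ * q ^ (2 * a + k + 3) = y5 at *
  generalize 1 - q ^ (N - a) = y6 at *
  generalize 1 - c₁ * c₂ * q ^ (2 * a + k + 3) = y7 at *
  generalize 1 - c₃ * q ^ (k + 1) = y8 at *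
  generalize 1 - q ^ (a + 1) = y9 at *
  generalize 1 - c₁ * c₂ * q ^ (2 * a + 1) = y10 at *
  generalize 1 - c₄ * q ^ (m + 1) = y11 at *
  generalize 1 - c₁ * c₂ * q ^ (2 * a + m + 3) = y12 at *
  generalize 1 - c₁ * q ^ (a + 1) = y13 at *
  generalize 1 - q ^ (m + 1) = y14 at *
  generalize 1 - c₁ * c₂ * q ^ (2 * a + 3) = y15 at *
  generalize 1 - c₂ * q ^ (a + 1) = y16 at *
  generalize 1 - c₁ * c₂ * c₄ * q ^ (2 * a + m + 3) = y17 at *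
  generalize 1 - c₁ * c₂ * q ^ (a + 1) = y18 at *
  generalize q ^ (N - a) = Z at *
  rw [pow_succ q a, pow_succ q k, pow_succ q m] at *
  have hU : q ^ a ≠ 0 := by positivity
  have hV : q ^ k ≠ 0 := by positivity
  have hW : q ^ m ≠ 0 := by positivity
  generalize q ^ a = U at *
  generalize q ^ k = V at *
  generalize q ^ m = W at *
  field_simp at e1 ⊢
  linear_combination (y2 * y16 * y14 * y4 * y17) * e1

theorem pentWeight_succ_aux {v v' t f p p' T z A₁ A₂ A₃ A₄ A₅ a₁ a₂ a₃ a₄ a₅ D₁ D₂ D₃ D₄ D₅ d₁ d₂ d₃ d₄ d₅ : ℂ}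
    (e : v' * (t * f) = v * (p * p')) (u₁ : D₁ ≠ 0) (u₂ : D₂ ≠ 0) (u₃ : D₃ ≠ 0) (u₄ : D₄ ≠ 0)
    (u₅ : D₅ ≠ 0) (n₁ : d₁ ≠ 0) (n₂ : d₂ ≠ 0) (n₃ : d₃ ≠ 0) (n₄ : d₄ ≠ 0) (n₅ : d₅ ≠ 0) :
    v' * (T * z) * (A₁ * a₁ * (A₂ * a₂) * (A₃ * a₃) * (A₄ * a₄) * (A₅ * a₅) /
        (D₁ * d₁ * (D₂ * d₂) * (D₃ * d₃) * (D₄ * d₄) * (D₅ * d₅))) *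
        (t * f * d₁ * d₂ * d₃ * d₄ * d₅) =
      v * T * (A₁ * A₂ * A₃ * A₄ * A₅ / (D₁ * D₂ * D₃ * D₄ * D₅)) *
        (p * p' * z * a₁ * a₂ * a₃ * a₄ * a₅) := by
  have hD : D₁ * d₁ * (D₂ * d₂) * (D₃ * d₃) * (D₄ * d₄) * (D₅ * d₅) ≠ 0 := by positivity
  have hD' : D₁ * D₂ * D₃ * D₄ * D₅ ≠ 0 := by positivity
  rw [← mul_div_assoc, ← mul_div_assoc, div_mul_eq_mul_div, div_mul_eq_mul_div,
    div_eq_div_iff hD hD']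
  linear_combination (T * z * (A₁ * a₁ * (A₂ * a₂) * (A₃ * a₃) * (A₄ * a₄) * (A₅ * a₅)) *
    (d₁ * d₂ * d₃ * d₄ * d₅) * (D₁ * D₂ * D₃ * D₄ * D₅)) * e

theorem pentWeight_succ {L M b k m : ℕ} (h : GenericFive q c₀ c₁ c₂ c₃ c₄ N) (hL : L = b + k + 1)
    (hM : M = b + m + 1) (hb : b < N) :
    pentWeight q c₀ c₁ c₂ c₃ c₄ N L M (b + 1) * ((1 - c₁ * c₂ * q ^ (2 * b + 1)) *
        (1 - q ^ (b + 1)) * (1 - c₁ * c₂ * q ^ (2 * b + k + 3)) *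
        (1 - c₁ * c₂ * q ^ (2 * b + m + 3)) * (1 - (q ^ (N - b))⁻¹) * (1 - (c₃ * q ^ (k + 1))⁻¹) *
        (1 - (c₄ * q ^ (m + 1))⁻¹)) =
      pentWeight q c₀ c₁ c₂ c₃ c₄ N L M b * ((1 - c₁ * c₂ * q ^ (2 * b + 3)) *
        (1 - c₁ * c₂ * q ^ (b + 1)) * (c₀ * q ^ (N + 1)) * (1 - (q ^ (k + 1))⁻¹) *
        (1 - (q ^ (m + 1))⁻¹) * (1 - c₁ * c₂ * q ^ (b + N + 2)) *
        (1 - c₁ * c₂ * c₃ * q ^ (2 * b + k + 3)) * (1 - c₁ * c₂ * c₄ * q ^ (2 * b + m + 3))) := by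
  have hq := h.hq
  have hq0 := hq.ne
  have n3 := h.n3
  have n4 := h.n4
  have e1 := vwp_succ_self hq (h.g12.mul hq0) b
  rw [show q * (c₁ * c₂) * q ^ (2 * b) = c₁ * c₂ * q ^ (2 * b + 1) by ring,
    show q * (c₁ * c₂) * q ^ (2 * b + 2) = c₁ * c₂ * q ^ (2 * b + 3) by ring,
    show q * (c₁ * c₂) * q ^ b = c₁ * c₂ * q ^ (b + 1) by ring] at e1
  have f1 : (q ^ L)⁻¹ * q ^ b = (q ^ (k + 1))⁻¹ := by
    rw [hL]; field_simp; ring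
  have f2 : (q ^ M)⁻¹ * q ^ b = (q ^ (m + 1))⁻¹ := by
    rw [hM]; field_simp; ring
  have f3 : (q ^ N)⁻¹ * q ^ b = (q ^ (N - b))⁻¹ := by
    rw [show q ^ N = q ^ (N - b) * q ^ b by rw [← pow_add]; congr 1; omega]; field_simp
  have f4 : (c₃ * q ^ L)⁻¹ * q ^ b = (c₃ * q ^ (k + 1))⁻¹ := by
    rw [hL]; field_simp; ring
  have f5 : (c₄ * q ^ M)⁻¹ * q ^ b = (c₄ * q ^ (m + 1))⁻¹ := by
    rw [hM]; field_simp; ring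
  have f6 : c₁ * c₂ * q ^ (L + 2) * q ^ b = c₁ * c₂ * q ^ (2 * b + k + 3) := by
    rw [hL]; ring
  have f7 : c₁ * c₂ * q ^ (M + 2) * q ^ b = c₁ * c₂ * q ^ (2 * b + m + 3) := by
    rw [hM]; ring
  have f8 : c₁ * c₂ * c₃ * q ^ (L + 2) * q ^ b = c₁ * c₂ * c₃ * q ^ (2 * b + k + 3) := by
    rw [hL]; ring
  have f9 : c₁ * c₂ * c₄ * q ^ (M + 2) * q ^ b = c₁ * c₂ * c₄ * q ^ (2 * b + m + 3) := by
    rw [hM]; ring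
  have f10 : c₁ * c₂ * q ^ (N + 2) * q ^ b = c₁ * c₂ * q ^ (b + N + 2) := by ring
  unfold pentWeight
  simp only [qPoch_succ _ _ b]
  rw [f1, f2, f3, f4, f5, f6, f7, f8, f9, f10, show c₁ * c₂ * q = q * (c₁ * c₂) by ring,
    pow_succ _ b]
  have m2 := h.g12.sub_pow_ne_zero (2 * b + m + 3)
  have m3 := h.g12.sub_pow_ne_zero (2 * b + k + 3)
  have m1 : 1 - (q ^ (N - b))⁻¹ ≠ 0 := by
    rw [show N - b = N - b - 1 + 1 by omega]; exact hq.one_sub_inv_ne_zero _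
  have m5 : 1 - (c₃ * q ^ (k + 1))⁻¹ ≠ 0 := (h.g3.mul_pow hq0 (k + 1)).inv.sub_ne_zero
  have m6 : 1 - (c₄ * q ^ (m + 1))⁻¹ ≠ 0 := (h.g4.mul_pow hq0 (m + 1)).inv.sub_ne_zero
  have u1 := (h.g12.mul_pow hq0 (L + 2)).qPoch b
  have u2 := (h.g12.mul_pow hq0 (M + 2)).qPoch b
  have u3 := hq.qPoch_inv_pow hb.le
  have u4 := (h.g3.mul_pow hq0 L).inv.qPoch b
  have u5 := (h.g4.mul_pow hq0 M).inv.qPoch b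
  exact pentWeight_succ_aux e1 u1 u2 u3 u4 u5 m3 m2 m1 m5 m6

theorem pentWeight_mul_ratioProd_succ (h : RootFive r s₀ s₁ s₂ s₃ s₄ q c₀ c₁ c₂ c₃ c₄ N)
    {j x b k m : ℕ} (hk : N = b + k + 1 + j) (hm : N = b + m + 1 + x) :
    pentWeight q c₄ c₁ c₃ c₂ c₀ N (N - j) (N - x) (b + 1) * ratioProd q c₃ c₁ (b + 1) *
        weightDen q⁻¹ c₁⁻¹ c₃⁻¹ c₂⁻¹ c₀⁻¹ N k m b =
      pentWeight q c₄ c₁ c₃ c₂ c₀ N (N - j) (N - x) b * ratioProd q c₃ c₁ b *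
        weightNum q⁻¹ c₁⁻¹ c₃⁻¹ c₂⁻¹ c₀⁻¹ N k m b := by
  have hq := h.hq
  have hq0 := hq.ne
  have n0 := h.n0
  have n1 := h.n1
  have n2 := h.n2
  have n3 := h.n3
  have n4 := h.n4
  have e1 := pentWeight_succ h.toGenericFive.exchange (L := N - j) (M := N - x) (b := b) (k := k)
    (m := m) (by omega) (by omega) (by omega)
  have e2 : c₄ * q ^ (N + 1) = (c₀ * c₁ * c₂ * c₃ * q ^ (N + 2))⁻¹ :=
    eq_inv_of_mul_eq_one_left (by rw [← h.bal]; ring)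
  rw [e2] at e1
  clear e2
  unfold weightNum weightDen
  simp only [inv_pow, ← mul_inv]
  rw [one_sub_inv_eq (z := c₁ * c₃ * q ^ (b + N + 2)) (by positivity),
    one_sub_inv_eq (z := c₁ * c₃ * c₂ * q ^ (2 * b + k + 3)) (by positivity),
    one_sub_inv_eq (z := c₁ * c₃ * c₀ * q ^ (2 * b + m + 3)) (by positivity),
    one_sub_inv_eq (z := c₁ * c₃ * q ^ (2 * b + 3)) (by positivity),
    one_sub_inv_eq (z := c₁ * c₃ * q ^ (b + 1)) (by positivity),
    one_sub_inv_eq (z := c₁ * c₃ * q ^ (2 * b + k + 3)) (by positivity),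
    one_sub_inv_eq (z := c₁ * c₃ * q ^ (2 * b + m + 3)) (by positivity),
    one_sub_inv_eq (z := c₁ * c₃ * q ^ (2 * b + 1)) (by positivity),
    one_sub_inv_eq (z := c₁ * q ^ (b + 1)) (by positivity),
    one_sub_inv_eq (z := q ^ (b + 1)) (by positivity), ratioProd_succ]
  have m4 := h.g1.sub_pow_ne_zero (b + 1)
  generalize 1 - c₁ * c₃ * q ^ (2 * b + m + 3) = y0 at *
  generalize 1 - c₁ * c₃ * q ^ (2 * b + k + 3) = y1 at *
  generalize 1 - (q ^ (N - b))⁻¹ = y2 at *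
  generalize 1 - (c₂ * q ^ (k + 1))⁻¹ = y3 at *
  generalize 1 - (c₀ * q ^ (m + 1))⁻¹ = y4 at *
  generalize 1 - q ^ (b + 1) = y5 at *
  generalize 1 - c₁ * c₃ * q ^ (2 * b + 1) = y6 at *
  generalize 1 - c₁ * c₃ * q ^ (2 * b + 3) = y7 at *
  generalize 1 - c₁ * c₃ * q ^ (b + 1) = y8 at *
  generalize 1 - c₁ * c₃ * q ^ (b + N + 2) = y9 at *
  generalize 1 - c₁ * c₃ * c₂ * q ^ (2 * b + k + 3) = y10 at *
  generalize 1 - c₁ * c₃ * c₀ * q ^ (2 * b + m + 3) = y11 at *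
  generalize 1 - (q ^ (k + 1))⁻¹ = y12 at *
  generalize 1 - (q ^ (m + 1))⁻¹ = y13 at *
  generalize 1 - c₁ * q ^ (b + 1) = y14 at *
  generalize 1 - (c₃ * q ^ (b + 1))⁻¹ = y15 at *
  generalize pentWeight q c₄ c₁ c₃ c₂ c₀ N (N - j) (N - x) (b + 1) = y16 at *
  generalize pentWeight q c₄ c₁ c₃ c₂ c₀ N (N - j) (N - x) b = y17 at *
  generalize ratioProd q c₃ c₁ b = y18 at *
  rw [show q ^ (2 * b + k + 3) = (q ^ b) ^ 2 * q ^ k * q ^ 3 by ring,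
    show q ^ (2 * b + m + 3) = (q ^ b) ^ 2 * q ^ m * q ^ 3 by ring,
    show q ^ (2 * b + 3) = (q ^ b) ^ 2 * q ^ 3 by ring, show q ^ (b + N + 2) = q ^ b * q ^ N * q ^ 2 by ring,
    show q ^ (2 * b + 1) = (q ^ b) ^ 2 * q by ring, show q ^ (b + 1) = q ^ b * q by ring]
  rw [show q ^ (N + 2) = q ^ N * q ^ 2 by ring] at e1
  have hU : q ^ b ≠ 0 := by positivity
  have hV : q ^ k ≠ 0 := by positivity
  have hW : q ^ m ≠ 0 := by positivity
  have hZ : q ^ N ≠ 0 := by positivity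
  generalize q ^ b = U at *
  generalize q ^ k = V at *
  generalize q ^ m = W at *
  generalize q ^ N = Z at *
  field_simp at e1 ⊢
  linear_combination (-y18 * y15) * e1

theorem _root_.QRacah.mul_eq_mul_of_ratio {f g num den : ℕ → ℂ} {n : ℕ} (hd : ∀ a < n, den a ≠ 0)
    (hf : ∀ a < n, f (a + 1) * den a = f a * num a) (hg : ∀ a < n, g (a + 1) * den a = g a * num a)
    {a : ℕ} (ha : a ≤ n) : f a * g 0 = f 0 * g a := by
  induction a with
  | zero => rfl
  | succ a ih =>
    refine mul_right_cancel₀ (hd a (by omega)) ?_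
    linear_combination g 0 * hf a (by omega) - f 0 * hg a (by omega) +
      num a * ih (by omega)

theorem griffithsWeight_mul (h : RootFive r s₀ s₁ s₂ s₃ s₄ q c₀ c₁ c₂ c₃ c₄ N) {j y a : ℕ}
    (hj : a + j ≤ N) (hy : a + y ≤ N) :
    griffithsWeight r s₀ s₁ s₂ s₃ s₄ N j y a * twoHypConst q c₄ c₁ c₃ c₂ c₀ N 0 y =
      griffithsWeight r s₀ s₁ s₂ s₃ s₄ N j y 0 *
        (sumWeight q c₁ c₂ c₃ (N - j) a * twoHypConst q c₄ c₁ c₃ c₂ c₀ N a y) := by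
  have e := QRacah.mul_eq_mul_of_ratio (n := a)
    (f := griffithsWeight r s₀ s₁ s₂ s₃ s₄ N j y)
    (g := fun a => sumWeight q c₁ c₂ c₃ (N - j) a * twoHypConst q c₄ c₁ c₃ c₂ c₀ N a y)
    (num := fun a => weightNum q c₁ c₂ c₃ c₄ N (N - j - a - 1) (N - y - a - 1) a)
    (den := fun a => weightDen q c₁ c₂ c₃ c₄ N (N - j - a - 1) (N - y - a - 1) a)
    (fun b hb => h.weightDen_ne_zero _ _ (by omega))
    (fun b hb => h.griffithsWeight_succ (by omega) (by omega))
    (fun b hb => h.sumWeight_mul_twoHypConst_succ (by omega) (by omega)) le_rfl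
  rw [← e]
  have h1 : 1 - c₁ * c₂ * q ≠ 0 := by simpa using h.g12.sub_pow_ne_zero 1
  simp [sumWeight, vwpTermLim, vwp, qPoch_zero, h1]

theorem pentWeight_mul_ratioProd (h : RootFive r s₀ s₁ s₂ s₃ s₄ q c₀ c₁ c₂ c₃ c₄ N) {j x b : ℕ}
    (hj : b + j ≤ N) (hx : b + x ≤ N) :
    pentWeight q c₄ c₁ c₃ c₂ c₀ N (N - j) (N - x) b * ratioProd q c₃ c₁ b *
        griffithsWeight r⁻¹ s₄⁻¹ s₁⁻¹ s₃⁻¹ s₂⁻¹ s₀⁻¹ N j x 0 =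
      griffithsWeight r⁻¹ s₄⁻¹ s₁⁻¹ s₃⁻¹ s₂⁻¹ s₀⁻¹ N j x b := by
  have h' := h.exchange'.inv
  have e := QRacah.mul_eq_mul_of_ratio (n := b)
    (f := fun b => pentWeight q c₄ c₁ c₃ c₂ c₀ N (N - j) (N - x) b * ratioProd q c₃ c₁ b)
    (g := griffithsWeight r⁻¹ s₄⁻¹ s₁⁻¹ s₃⁻¹ s₂⁻¹ s₀⁻¹ N j x)
    (num := fun b => weightNum q⁻¹ c₁⁻¹ c₃⁻¹ c₂⁻¹ c₀⁻¹ N (N - j - b - 1) (N - x - b - 1) b)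
    (den := fun b => weightDen q⁻¹ c₁⁻¹ c₃⁻¹ c₂⁻¹ c₀⁻¹ N (N - j - b - 1) (N - x - b - 1) b)
    (fun b hb => h'.weightDen_ne_zero _ _ (by omega))
    (fun b hb => h.pentWeight_mul_ratioProd_succ (by omega) (by omega))
    (fun b hb => h'.griffithsWeight_succ (by omega) (by omega)) le_rfl
  rw [pentWeight_zero _ _ _ _ _ _ h.g13, ratioProd_zero, one_mul, one_mul] at e
  exact e

theorem griffithsWeight_swap (h : RootFive r s₀ s₁ s₂ s₃ s₄ q c₀ c₁ c₂ c₃ c₄ N) {j y a : ℕ}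
    (hj : a + j ≤ N) (hy : a + y ≤ N) :
    griffithsWeight r s₀ s₁ s₂ s₃ s₄ N j y a * griffithsWeight r s₀ s₁ s₂ s₄ s₃ N y j 0 =
      griffithsWeight r s₀ s₁ s₂ s₃ s₄ N j y 0 * griffithsWeight r s₀ s₁ s₂ s₄ s₃ N y j a := by
  refine QRacah.mul_eq_mul_of_ratio (n := a)
    (f := griffithsWeight r s₀ s₁ s₂ s₃ s₄ N j y)
    (g := griffithsWeight r s₀ s₁ s₂ s₄ s₃ N y j)
    (num := fun a => weightNum q c₁ c₂ c₃ c₄ N (N - j - a - 1) (N - y - a - 1) a)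
    (den := fun a => weightDen q c₁ c₂ c₃ c₄ N (N - j - a - 1) (N - y - a - 1) a)
    (fun b hb => h.weightDen_ne_zero _ _ (by omega))
    (fun b hb => h.griffithsWeight_succ (by omega) (by omega))
    (fun b hb => ?_) le_rfl
  have e := h.swap₃₄.griffithsWeight_succ (j := y) (y := j) (a := b) (k := N - y - b - 1)
    (m := N - j - b - 1) (by omega) (by omega)
  unfold weightNum weightDen at *
  linear_combination e

end RootFive

theorem pentFactor_zero (q c₀ P c₃ c₄ : ℂ) (N : ℕ) : pentFactor q c₀ P c₃ c₄ N 0 = 1 := by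
  simp [pentFactor, qPoch_zero]

theorem twoHypConst₂_zero (q c₀ c₁ c₃ : ℂ) (N x : ℕ) : twoHypConst₂ q c₀ c₁ c₃ N 0 x = 1 := by
  simp [twoHypConst₂, qPoch_zero]

theorem twoHypConst₃_zero (q c₀ c₂ c₄ : ℂ) (N : ℕ) : twoHypConst₃ q c₀ c₂ c₄ N 0 = 1 := by
  simp [twoHypConst₃, qPoch_zero]

theorem pentFactor_succ_right {q c₀ P c₃ c₄ : ℂ} (hq : q ≠ 0) {N j k : ℕ} (hN : N = j + k + 1) :
    pentFactor q c₀ P c₃ c₄ N (j + 1) = pentFactor q c₀ P c₃ c₄ N j *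
      ((1 - c₄ * q ^ (j + 1)) / (1 - c₀ * q ^ (j + 1)) *
        ((1 - (c₃ * q ^ (k + 1))⁻¹) / (1 - (P * q ^ (k + 2))⁻¹)) * (c₀ * c₃ * q ^ (N + 1))) := by
  have e1 : (c₃ * q ^ N)⁻¹ * q ^ j = (c₃ * q ^ (k + 1))⁻¹ := by
    rw [hN, mul_inv, mul_inv, mul_assoc]; congr 1; field_simp; ring
  have e2 : (P * q ^ (N + 1))⁻¹ * q ^ j = (P * q ^ (k + 2))⁻¹ := by
    rw [hN, mul_inv, mul_inv, mul_assoc]; congr 1; field_simp; ring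
  unfold pentFactor
  rw [qPoch_succ, qPoch_succ, qPoch_succ, qPoch_succ, e1, e2, pow_succ _ j,
    show q * c₄ * q ^ j = c₄ * q ^ (j + 1) by ring, show q * c₀ * q ^ j = c₀ * q ^ (j + 1) by ring]
  simp only [div_eq_mul_inv, mul_inv]
  ring

theorem twoHypConst₃_succ {q c₀ c₂ c₄ : ℂ} (hq : q ≠ 0) {N x k : ℕ} (hN : N = x + k + 1) :
    twoHypConst₃ q c₀ c₂ c₄ N (x + 1) = twoHypConst₃ q c₀ c₂ c₄ N x *
      ((1 - c₄ * q ^ (x + 1)) / (1 - c₂ * q ^ (x + 1)) *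
        ((1 - c₀ * c₂ * c₄ * q ^ (x + N + 2)) / (1 - (c₀ * q ^ (k + 1))⁻¹)) *
        (c₀ * c₄ * q ^ (N + 1))⁻¹) := by
  have e1 : (c₀ * q ^ N)⁻¹ * q ^ x = (c₀ * q ^ (k + 1))⁻¹ := by
    rw [hN, mul_inv, mul_inv, mul_assoc]; congr 1; field_simp; ring
  unfold twoHypConst₃
  rw [qPoch_succ, qPoch_succ, qPoch_succ, qPoch_succ, e1, pow_succ _ x,
    show q * c₄ * q ^ x = c₄ * q ^ (x + 1) by ring, show q * c₂ * q ^ x = c₂ * q ^ (x + 1) by ring,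
    show c₀ * c₂ * c₄ * q ^ (N + 2) * q ^ x = c₀ * c₂ * c₄ * q ^ (x + N + 2) by ring]
  simp only [div_eq_mul_inv, mul_inv]
  ring

theorem sumConst_succ_right {q : ℂ} (hq : q ≠ 0) (a b c : ℂ) (L : ℕ) :
    sumConst q a b c (L + 1) =
      sumConst q a b c L * ((1 - a * b * q ^ (L + 2)) / (1 - (c * q ^ (L + 1))⁻¹)) := by
  unfold sumConst
  rw [qPoch_succ, qPoch_succ', mul_inv_mul_pow_succ hq,
    show a * b * q ^ 2 * q ^ L = a * b * q ^ (L + 2) by ring]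
  simp only [div_eq_mul_inv, mul_inv]
  ring

section
variable {q r a b c A B C : ℂ}

theorem Omega_zero_succ (hq : NonRoot q) (h : GenericTriple q A B C) (hr : r ^ 2 = q)
    (ha : a ^ 2 = A) (hb : b ^ 2 = B) (hc : c ^ 2 = C) (k : ℕ) :
    Omega r a b c (k + 1) 0 * (1 - B * C * q ^ (k + 2)) =
      Omega r a b c k 0 * ((1 - A * q ^ (k + 1)) * (r * b)) := by
  have e := Omega_succ_left hq h hr ha hb hc 0 k
  have m1 := hq.sub (Nat.le_add_left 1 k)
  have m2 := h.gabc.sub_pow_ne_zero (k + 2)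
  simp only [Nat.zero_add, Nat.mul_zero] at e
  refine mul_right_cancel₀ (mul_ne_zero m1 m2) ?_
  linear_combination e

theorem Omega_zero_eq (hq : NonRoot q) (h : GenericTriple q A B C) (hr : r ^ 2 = q)
    (ha : a ^ 2 = A) (hb : b ^ 2 = B) (hc : c ^ 2 = C) (k : ℕ) :
    Omega r a b c k 0 * qPoch (B * C * q ^ 2) q k = qPoch (q * A) q k * (r * b) ^ k := by
  induction k with
  | zero => simp [Omega, qPochOmit, qBinom, qPoch_zero]
  | succ k ih =>
    have e := Omega_zero_succ hq h hr ha hb hc k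
    rw [qPoch_succ, qPoch_succ, pow_succ _ k,
      show B * C * q ^ 2 * q ^ k = B * C * q ^ (k + 2) by ring,
      show q * A * q ^ k = A * q ^ (k + 1) by ring]
    linear_combination qPoch (B * C * q ^ 2) q k * e + (1 - A * q ^ (k + 1)) * (r * b) * ih

theorem Omega_ne_zero (hq : NonRoot q) (h : GenericTriple q A B C) (hr : r ^ 2 = q)
    (ha : a ^ 2 = A) (hb : b ^ 2 = B) (hc : c ^ 2 = C) {L n : ℕ} (hn : n ≤ L) :
    Omega r a b c L n ≠ 0 := by
  obtain ⟨k, rfl⟩ := Nat.exists_eq_add_of_le hn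
  have hq0 := hq.ne
  have hr0 : r ≠ 0 := by rintro rfl; simp at hr; exact hq0 hr.symm
  have hb0 : b ≠ 0 := by rintro rfl; simp at hb; exact h.ne_b hb.symm
  rw [Omega_eq_of_generic h hr ha hb hc]
  have := hq.qPoch n
  have := hq.qPoch k
  have := hq.qPoch (n + k)
  have := h.gbc.sub_pow_ne_zero (2 * n + 1)
  have := (h.gb.mul hq0).qPoch n
  have := (h.gc.mul hq0).qPoch n
  have := (h.ga.mul hq0).qPoch k
  have := (h.gabc.mul_pow hq0 (n + k + 2)).qPoch n
  have := (h.gbc.mul_pow hq0 (n + 1)).qPoch (n + k + 1)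
  positivity

end

namespace RootFive
variable {r s₀ s₁ s₂ s₃ s₄ q c₀ c₁ c₂ c₃ c₄ : ℂ} {N : ℕ}

theorem pentFactor_mul_Omega (h : RootFive r s₀ s₁ s₂ s₃ s₄ q c₀ c₁ c₂ c₃ c₄ N) {x : ℕ}
    (hx : x ≤ N) :
    (s₁ / s₀) ^ x * pentFactor q c₄ (c₁ * c₃) c₀ c₂ N x *
        ((c₁ / c₀) ^ (N - x) * Omega r s₀ s₃ s₁ (N - x) 0) =
      (c₁ / c₀) ^ N * Omega r s₀ s₃ s₁ N 0 * xi r s₂ s₄ x := by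
  have hq0 := h.hq.ne
  have hr0 := h.r_ne
  have hs0 := h.s₀_ne
  have hs1 := h.s₁_ne
  have hs2 := h.s₂_ne
  have hs3 := h.s₃_ne
  have hs4 := h.s₄_ne
  have n0 := h.n0
  have n1 := h.n1
  have n3 := h.n3
  induction x with
  | zero => simp [pentFactor_zero, xi_zero]
  | succ x ih =>
    obtain ⟨k, hk⟩ : ∃ k, N = x + k + 1 := ⟨N - x - 1, by omega⟩
    have ih := ih (by omega)
    have e := Omega_zero_succ h.hq h.triple₀₁₃.swap₂₃ h.hr h.h0 h.h3 h.h1 k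
    rw [show N - x = k + 1 by omega, pow_succ _ k] at ih
    have m1 := h.g4.sub_pow_ne_zero (x + 1)
    have m2 := h.g13.sub_pow_ne_zero (k + 2)
    have m3 := h.g0.sub_pow_ne_zero (k + 1)
    rw [mul_comm c₃ c₁] at e
    rw [pentFactor_succ_right hq0 hk, xi_succ h.hr h.h2 h.h4, show N - (x + 1) = k by omega,
      one_sub_inv_eq (z := c₀ * q ^ (k + 1)) (by positivity),
      one_sub_inv_eq (z := c₁ * c₃ * q ^ (k + 2)) (by positivity), pow_succ _ x, ← mul_assoc _ _ (_ * (s₄ / s₂)), ← ih]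
    have key : s₁ / s₀ * (c₁ * c₃ * q ^ (k + 2)) * (c₄ * c₀ * q ^ (N + 1)) =
        (c₁ / c₀) * (r * s₃) * (s₄ / s₂) * (c₀ * q ^ (k + 1)) := by
      rw [← h.hr, ← h.h0, ← h.h1, ← h.h3, ← h.h4]
      field_simp
      linear_combination r ^ (2 * k + 3) * h.root
    have u : c₀ * q ^ (k + 1) ≠ 0 := by positivity
    have v : c₁ * c₃ * q ^ (k + 2) ≠ 0 := by positivity
    clear ih
    generalize 1 - c₄ * q ^ (x + 1) = y0 at *
    generalize 1 - c₀ * q ^ (k + 1) = y1 at *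
    generalize 1 - c₁ * c₃ * q ^ (k + 2) = y2 at *
    generalize 1 - c₂ * q ^ (x + 1) = y3 at *
    generalize pentFactor q c₄ (c₁ * c₃) c₀ c₂ N x = y4 at *
    generalize Omega r s₀ s₃ s₁ k 0 = y5 at *
    generalize Omega r s₀ s₃ s₁ (k + 1) 0 = y6 at *
    generalize (c₁ / c₀) ^ k = y7 at *
    generalize (s₁ / s₀) ^ x = y8 at *
    generalize s₁ / s₀ = y9 at *
    generalize c₁ / c₀ = y10 at *
    generalize c₀ * q ^ (k + 1) = y11 at *
    generalize c₁ * c₃ * q ^ (k + 2) = y12 at *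
    generalize c₄ * c₀ * q ^ (N + 1) = y13 at *
    generalize r * s₃ = y14 at *
    generalize s₄ / s₂ = y15 at *
    field_simp
    linear_combination y8 * y4 * y3 * y7 * y1 * y5 * key - y8 * y4 * y3 * y7 * y11 * y10 * y15 * e

theorem Omega_mul_xi (h : RootFive r s₀ s₁ s₂ s₃ s₄ q c₀ c₁ c₂ c₃ c₄ N) {y : ℕ} (hy : y ≤ N) :
    Omega r s₄ s₂ s₁ (N - y) 0 * xi r s₀ s₃ y =
      Omega r s₄ s₂ s₁ N 0 * ((s₁ / s₄) ^ y * twoHypConst₃ q c₄ c₃ c₀ N y) := by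
  have hq0 := h.hq.ne
  have hr0 := h.r_ne
  have hs0 := h.s₀_ne
  have hs1 := h.s₁_ne
  have hs2 := h.s₂_ne
  have hs3 := h.s₃_ne
  have hs4 := h.s₄_ne
  have n0 := h.n0
  have n1 := h.n1
  have n2 := h.n2
  have n4 := h.n4
  induction y with
  | zero => simp [twoHypConst₃_zero, xi_zero]
  | succ y ih =>
    obtain ⟨k, hk⟩ : ∃ k, N = y + k + 1 := ⟨N - y - 1, by omega⟩
    have ih := ih (by omega)
    have e := Omega_zero_succ h.hq h.triple₁₂₄.swap₁₂.swap₂₃.swap₁₂ h.hr h.h4 h.h2 h.h1 k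
    rw [show N - y = k + 1 by omega] at ih
    have m1 := h.g3.sub_pow_ne_zero (y + 1)
    have m2 := h.g12.sub_pow_ne_zero (k + 2)
    have m3 := h.g4.sub_pow_ne_zero (k + 1)
    rw [mul_comm c₂ c₁] at e
    have b : c₄ * c₃ * c₀ * q ^ (y + N + 2) = (c₁ * c₂ * q ^ (k + 2))⁻¹ :=
      eq_inv_of_mul_eq_one_left (by rw [← h.bal, hk]; ring)
    rw [twoHypConst₃_succ hq0 hk, xi_succ h.hr h.h0 h.h3, show N - (y + 1) = k by omega, b,
      one_sub_inv_eq (z := c₄ * q ^ (k + 1)) (by positivity),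
      one_sub_inv_eq (z := c₁ * c₂ * q ^ (k + 2)) (by positivity), pow_succ (s₁ / s₄) y,
      mul_mul_mul_comm (_ ^ y), ← mul_assoc (Omega r s₄ s₂ s₁ N 0), ← ih]
    have key : s₃ / s₀ * (c₁ * c₂ * q ^ (k + 2)) * (c₄ * c₀ * q ^ (N + 1)) =
        (s₁ / s₄) * (r * s₂) * (c₄ * q ^ (k + 1)) := by
      rw [← h.hr, ← h.h0, ← h.h1, ← h.h2, ← h.h4]
      field_simp
      linear_combination r ^ (2 * k + 3) * h.root
    have u : c₄ * q ^ (k + 1) ≠ 0 := by positivity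
    have v : c₁ * c₂ * q ^ (k + 2) ≠ 0 := by positivity
    have w : c₄ * c₀ * q ^ (N + 1) ≠ 0 := by positivity
    clear ih
    generalize 1 - c₃ * q ^ (y + 1) = y0 at *
    generalize 1 - c₄ * q ^ (k + 1) = y1 at *
    generalize 1 - c₁ * c₂ * q ^ (k + 2) = y2 at *
    generalize 1 - c₀ * q ^ (y + 1) = y3 at *
    generalize xi r s₀ s₃ y = y4 at *
    generalize Omega r s₄ s₂ s₁ k 0 = y5 at *
    generalize Omega r s₄ s₂ s₁ (k + 1) 0 = y6 at *
    generalize s₁ / s₄ = y7 at *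
    generalize s₃ / s₀ = y8 at *
    generalize c₄ * q ^ (k + 1) = y9 at *
    generalize c₁ * c₂ * q ^ (k + 2) = y10 at *
    generalize c₄ * c₀ * q ^ (N + 1) = y11 at *
    generalize r * s₂ = y12 at *
    field_simp
    linear_combination y5 * y4 * y3 * y1 * key - y4 * y3 * y7 * y9 * e

theorem sumConst_mul_Omega (h : RootFive r s₀ s₁ s₂ s₃ s₄ q c₀ c₁ c₂ c₃ c₄ N) {j : ℕ}
    (hj : j ≤ N) :
    sumConst q c₁ c₂ c₃ (N - j) * (c₁ / (s₂ * s₃)) ^ (N - j) * Omega r s₃ s₀ s₄ N j *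
        Omega r s₂ s₄ s₀ N 0 =
      sumConst q c₁ c₂ c₃ N * (c₁ / (s₂ * s₃)) ^ N * Omega r s₃ s₀ s₄ N 0 *
        ((s₃ / s₁) ^ j * xi r s₀ s₄ j * omega r (s₀ * s₂ * s₄ / s₁) j *
          pentFactor q c₄ (c₁ * c₃) c₂ c₀ N j * Omega r s₂ s₄ s₀ N j) := by
  have hq0 := h.hq.ne
  have hr0 := h.r_ne
  have hs0 := h.s₀_ne
  have hs1 := h.s₁_ne
  have hs2 := h.s₂_ne
  have hs3 := h.s₃_ne
  have hs4 := h.s₄_ne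
  have n0 := h.n0
  have n1 := h.n1
  have n2 := h.n2
  have n3 := h.n3
  have n4 := h.n4
  induction j with
  | zero => simp [pentFactor_zero, xi_zero, omega_zero]
  | succ j ih =>
    obtain ⟨k, hk⟩ : ∃ k, N = j + k + 1 := ⟨N - j - 1, by omega⟩
    have ih := ih (by omega)
    have e1 := Omega_succ h.hq h.triple₀₃₄.swap₁₂ h.hr h.h3 h.h0 h.h4 j k
    have e2 := Omega_succ h.hq h.triple₀₂₄.swap₁₂.swap₂₃ h.hr h.h2 h.h4 h.h0 j k
    rw [show N - j = k + 1 by omega, sumConst_succ_right hq0,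
      one_sub_inv_eq (z := c₃ * q ^ (k + 1)) (by positivity), pow_succ (c₁ / (s₂ * s₃)) k] at ih
    have b1 : c₃ * c₀ * c₄ * q ^ (2 * j + k + 3) = (c₁ * c₂ * q ^ (k + 2))⁻¹ :=
      eq_inv_of_mul_eq_one_left (by rw [← h.bal, hk]; ring)
    have b2 : c₂ * c₄ * c₀ * q ^ (2 * j + k + 3) = (c₁ * c₃ * q ^ (k + 2))⁻¹ :=
      eq_inv_of_mul_eq_one_left (by rw [← h.bal, hk]; ring)
    rw [← hk, b1, one_sub_inv_eq (z := c₁ * c₂ * q ^ (k + 2)) (by positivity)] at e1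
    rw [← hk, b2, mul_comm c₄ c₀] at e2
    rw [pentFactor_succ_right hq0 hk, xi_succ h.hr h.h0 h.h4, omega_succ h.hr,
      show N - (j + 1) = k by omega, one_sub_inv_eq (z := c₂ * q ^ (k + 1)) (by positivity),
      pow_succ (s₃ / s₁) j]
    have m1 := h.hq.sub (Nat.le_add_left 1 j)
    have m2 := h.g04.sub_pow_ne_zero (2 * j + 1)
    have m3 := h.g3.sub_pow_ne_zero (k + 1)
    have m4 := h.g04.sub_pow_ne_zero (2 * j + k + 3)
    have m5 := h.g4.sub_pow_ne_zero (j + 1)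
    have m6 := h.g2.sub_pow_ne_zero (k + 1)
    have m7 := h.g0.sub_pow_ne_zero (j + 1)
    have m8 := h.g12.sub_pow_ne_zero (k + 2)
    have m9 : 1 - (c₁ * c₃ * q ^ (k + 2))⁻¹ ≠ 0 := (h.g13.mul_pow hq0 _).inv.sub_ne_zero
    have key : c₂ * q ^ (k + 1) * c₄ = (s₃ / s₁) * (s₄ / s₀) * (s₀ * s₂ * s₄ / s₁ * q ^ (j + 1)) * (c₄ * c₂ * q ^ (N + 1)) * (c₁ / (s₂ * s₃)) * c₀ *
      (c₁ * c₂ * q ^ (k + 2)) * (c₃ * q ^ (k + 1)) := by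
      have k1 : (s₃ / s₁) * (s₄ / s₀) * (s₀ * s₂ * s₄ / s₁) * (c₁ / (s₂ * s₃)) = c₄ := by
        rw [← h.h1, ← h.h4]; field_simp
      have k2 : q ^ (N + 1) = q ^ (j + k + 2) := by rw [hk]
      have hb := h.bal
      rw [hk] at hb
      rw [k2]
      linear_combination (-(q ^ (j + 1) * (c₄ * c₂ * q ^ (j + k + 2)) * c₀ *
        (c₁ * c₂ * q ^ (k + 2)) * (c₃ * q ^ (k + 1)))) * k1 - c₂ * q ^ (k + 1) * c₄ * hb
    clear b1 b2
    generalize 1 - q ^ (j + 1) = y0 at *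
    generalize 1 - c₀ * c₄ * q ^ (2 * j + 1) = y1 at *
    generalize 1 - c₃ * q ^ (k + 1) = y2 at *
    generalize 1 - c₀ * c₄ * q ^ (2 * j + k + 3) = y3 at *
    generalize 1 - c₄ * q ^ (j + 1) = y4 at *
    generalize 1 - c₂ * q ^ (k + 1) = y5 at *
    generalize 1 - c₀ * q ^ (j + 1) = y6 at *
    generalize 1 - c₁ * c₂ * q ^ (k + 2) = y7 at *
    generalize 1 - (c₁ * c₃ * q ^ (k + 2))⁻¹ = y8 at *
    generalize 1 - q ^ (k + 1) = y9 at *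
    generalize 1 - c₀ * c₄ * q ^ (2 * j + 3) = y10 at *
    generalize 1 - c₀ * c₄ * q ^ (j + 1) = y11 at *
    rw [← eq_div_iff (by positivity)] at e1 e2
    rw [e1, e2]
    have u2 : c₂ * q ^ (k + 1) ≠ 0 := by positivity
    have u3 : c₃ * q ^ (k + 1) ≠ 0 := by positivity
    have v : c₁ * c₂ * q ^ (k + 2) ≠ 0 := by positivity
    generalize sumConst q c₁ c₂ c₃ k = y12 at *
    generalize sumConst q c₁ c₂ c₃ N = y13 at *
    generalize Omega r s₃ s₀ s₄ N j = y14 at *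
    generalize Omega r s₃ s₀ s₄ N 0 = y15 at *
    generalize Omega r s₂ s₄ s₀ N j = y16 at *
    generalize Omega r s₂ s₄ s₀ N 0 = y17 at *
    generalize pentFactor q c₄ (c₁ * c₃) c₂ c₀ N j = y18 at *
    generalize omega r (s₀ * s₂ * s₄ / s₁) j = y19 at *
    generalize xi r s₀ s₄ j = y20 at *
    generalize (s₃ / s₁) ^ j = y21 at *
    generalize (c₁ / (s₂ * s₃)) ^ k = y22 at *
    generalize (c₁ / (s₂ * s₃)) ^ N = y23 at *
    generalize s₀ * s₂ * s₄ / s₁ * q ^ (j + 1) = y24 at *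
    generalize s₃ / s₁ = y25 at *
    generalize s₄ / s₀ = y26 at *
    generalize c₄ * c₂ * q ^ (N + 1) = y27 at *
    generalize c₁ / (s₂ * s₃) = y28 at *
    generalize c₁ * c₂ * q ^ (k + 2) = y29 at *
    generalize c₂ * q ^ (k + 1) = y30 at *
    generalize c₃ * q ^ (k + 1) = y31 at *
    clear e1 e2
    field_simp at ih ⊢
    linear_combination (y9 * y10 * y11 * y29 * c₀ * y25 * y26 * y24 * y27) * ih -
      y12 * y7 * y22 * y14 * y17 * y9 * y10 * y11 * key

theorem choose_two_mul_two (n : ℕ) : (n + 1).choose 2 * 2 = (n + 1) * n := by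
  induction n with
  | zero => rfl
  | succ n ih =>
    rw [Nat.choose_succ_succ' (n + 1) 1, Nat.choose_one_right, add_mul, ih]
    ring

theorem omega_eq (hr : r ^ 2 = q) (t : ℂ) (n : ℕ) :
    omega r t n = (-t) ^ n * q ^ (n + 1).choose 2 := by
  rw [omega, hr, neg_pow t]

theorem sumConst_mul_Omega_mul_Omega (h : RootFive r s₀ s₁ s₂ s₃ s₄ q c₀ c₁ c₂ c₃ c₄ N) :
    sumConst q c₁ c₂ c₃ N * (c₁ / (s₂ * s₃)) ^ N * Omega r s₃ s₀ s₄ N 0 * Omega r s₄ s₂ s₁ N 0 =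
      omega r (r * s₁ * s₂ * s₃) N * twoHypConst₁ q c₄ (c₁ * c₃) c₂ c₀ N * (c₀ / c₂) ^ N *
        (c₁ / c₀) ^ N * Omega r s₂ s₄ s₀ N 0 * Omega r s₀ s₃ s₁ N 0 := by
  have hq0 := h.hq.ne
  have hr0 := h.r_ne
  have hs0 := h.s₀_ne
  have hs1 := h.s₁_ne
  have hs2 := h.s₂_ne
  have hs3 := h.s₃_ne
  have hs4 := h.s₄_ne
  have n0 := h.n0
  have n1 := h.n1
  have n2 := h.n2
  have n3 := h.n3
  have n4 := h.n4
  have z1 := Omega_zero_eq h.hq h.triple₀₃₄.swap₁₂ h.hr h.h3 h.h0 h.h4 N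
  have z2 := Omega_zero_eq h.hq h.triple₁₂₄.swap₁₂.swap₂₃.swap₁₂ h.hr h.h4 h.h2 h.h1 N
  have z3 := Omega_zero_eq h.hq h.triple₀₂₄.swap₁₂.swap₂₃ h.hr h.h2 h.h4 h.h0 N
  have z4 := Omega_zero_eq h.hq h.triple₀₁₃.swap₂₃ h.hr h.h0 h.h3 h.h1 N
  have m1 := (h.g04.mul_pow hq0 2).qPoch N
  have m2 := (h.g12.mul_pow hq0 2).qPoch N
  have m4 := (h.g13.mul_pow hq0 2).qPoch N
  rw [mul_comm c₄ c₀] at z3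
  rw [mul_comm c₂ c₁] at z2
  rw [mul_comm c₃ c₁] at z4
  rw [← eq_div_iff m1] at z1 z3
  rw [← eq_div_iff m2] at z2
  rw [← eq_div_iff m4] at z4
  rw [z1, z2, z3, z4, qPoch_eq_omega_mul hq0 h.hr n3, qPoch_eq_omega_mul hq0 h.hr n2,
    qPoch_eq_omega_mul hq0 h.hr n0]
  unfold sumConst twoHypConst₁
  have u3 := (h.g3.mul_pow hq0 N).inv.qPoch N
  have u2 := (h.g2.mul_pow hq0 N).inv.qPoch N
  have u0 := (h.g0.mul_pow hq0 N).inv.qPoch N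
  have key : omega r c₃ N * ((c₁ / (s₂ * s₃)) ^ N * (r * s₀) ^ N * (r * s₂) ^ N) =
      omega r (r * s₁ * s₂ * s₃) N * omega r c₂ N * omega r c₀ N *
        ((c₀ / c₂) ^ N * (c₁ / c₀) ^ N * (r * s₄) ^ N * (r * s₃) ^ N) := by
    have e : (q ^ (N + 1).choose 2) ^ 2 = (q ^ (N + 1)) ^ N := by
      rw [← pow_mul, ← pow_mul, choose_two_mul_two]
    have e' : -c₃ * (c₁ / (s₂ * s₃) * (r * s₀) * (r * s₂)) =
        -(r * s₁ * s₂ * s₃) * -c₂ * -c₀ * (c₀ / c₂ * (c₁ / c₀) * (r * s₄) * (r * s₃)) *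
          q ^ (N + 1) := by
      field_simp
      rw [← h.hr, ← h.h0, ← h.h3]
      linear_combination s₀ * s₃ ^ 2 * h.root
    simp only [omega_eq h.hr, ← mul_pow]
    have e'' := congrArg (fun z => z ^ N * q ^ (N + 1).choose 2) e'
    simp only [mul_pow _ (q ^ (N + 1)) N, ← e] at e''
    rw [mul_pow (-c₃)] at e''
    rw [mul_pow (_ * _ * _) (_ * _ * _ * _) N, mul_pow (_ * _) (-c₀), mul_pow _ (-c₂)] at e''
    linear_combination e''
  generalize qPoch (c₀ * c₄ * q ^ 2) q N = y0 at *
  generalize qPoch (c₁ * c₂ * q ^ 2) q N = y1 at *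
  generalize qPoch (c₁ * c₃ * q ^ 2) q N = y2 at *
  generalize qPoch (c₃ * q ^ N)⁻¹ q N = y3 at *
  generalize qPoch (c₂ * q ^ N)⁻¹ q N = y4 at *
  generalize qPoch (c₀ * q ^ N)⁻¹ q N = y5 at *
  generalize (c₁ / (s₂ * s₃)) ^ N = y6 at *
  generalize (r * s₀) ^ N = y7 at *
  generalize (r * s₂) ^ N = y8 at *
  generalize (c₀ / c₂) ^ N = y9 at *
  generalize (c₁ / c₀) ^ N = y10 at *
  generalize (r * s₄) ^ N = y11 at *
  generalize (r * s₃) ^ N = y12 at *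
  generalize omega r c₃ N = y13 at *
  generalize omega r c₂ N = y14 at *
  generalize omega r c₀ N = y15 at *
  generalize omega r (r * s₁ * s₂ * s₃) N = y16 at *
  generalize qPoch (q * c₄) q N = y17 at *
  field_simp
  linear_combination y17 * key

end RootFive

theorem exchangeConst_aux {A A' X k p w e S B O S₀ B₀ e₂ xj wj pj Oj D xy D₀ ey t₃ W t₁ g G Q₀ ex px Gx Qx xx : ℂ}
    (hI : A = A' * (X ^ 2 * k)) (hi : p * X * w = e)
    (hJ : S * k * B * O = S₀ * B₀ * (e₂ * xj * wj * pj * Oj)) (hY : D * xy = D₀ * (ey * t₃))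
    (hN : S₀ * B₀ * D₀ = W * t₁ * g * G * O * Q₀) (hX : ex * px * (Gx * Qx) = G * Q₀ * xx)
    (hw : w ≠ 0) (hxx : xx ≠ 0) (hxy : xy ≠ 0) (hO : O ≠ 0) :
    A * (B * D) * (S * p) =
      e * e₂ * ex * ey * (X * xj / (xx * xy)) * (wj / w) * W *
        (t₁ * t₃ * pj * px * (g * Oj * (Gx * Qx)) * A') := by
  have h1 : A * (B * D) * (S * p) * (w * (xx * xy)) = e * e₂ * ex * ey * (X * xj) * wj * W *
        (t₁ * t₃ * pj * px * (g * Oj * (Gx * Qx)) * A') := by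
    refine mul_right_cancel₀ hO ?_
    calc A * (B * D) * (S * p) * (w * (xx * xy)) * O
        = A' * X * (p * X * w) * (S * k * B * O) * (D * xy) * xx := by rw [hI]; ring
      _ = A' * X * e * (e₂ * xj * wj * pj * Oj) * (ey * t₃) * xx * (S₀ * B₀ * D₀) := by
          rw [hi, hJ, hY]; ring
      _ = A' * X * e * (e₂ * xj * wj * pj * Oj) * (ey * t₃) * (W * t₁ * g * O) *
            (G * Q₀ * xx) := by rw [hN]; ring
      _ = _ := by rw [← hX]; ring
  field_simp
  linear_combination h1

/-- The factor relating the two sides of the exchange of the two variables. -/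
def exchangeConst (r s₀ s₁ s₂ s₃ s₄ : ℂ) (N i j x y : ℕ) : ℂ :=
  (s₀ / s₁) ^ i * (s₃ / s₁) ^ j * (s₁ / s₀) ^ x * (s₁ / s₄) ^ y *
    (xi r s₂ s₃ i * xi r s₀ s₄ j / (xi r s₂ s₄ x * xi r s₀ s₃ y)) *
    (omega r (s₀ * s₂ * s₄ / s₁) j / omega r (s₃ * s₀ * s₂ / s₁) i) *
    omega r (r * s₁ * s₂ * s₃) N

namespace RootFive
variable {r s₀ s₁ s₂ s₃ s₄ q c₀ c₁ c₂ c₃ c₄ : ℂ} {N : ℕ}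

theorem Omega_eq_mul_xi_sq (h : RootFive r s₀ s₁ s₂ s₃ s₄ q c₀ c₁ c₂ c₃ c₄ N) {L i : ℕ}
    (hi : i ≤ L) : Omega r s₁ s₂ s₃ L i =
      Omega r⁻¹ s₁⁻¹ s₃⁻¹ s₂⁻¹ L i * (xi r s₂ s₃ i ^ 2 * (c₁ / (s₂ * s₃)) ^ L) := by
  obtain ⟨k, rfl⟩ := Nat.exists_eq_add_of_le hi
  have hq0 := h.hq.ne
  have hs2 := h.s₂_ne
  have hs3 := h.s₃_ne
  have n1 := h.n1
  rw [Omega_inv h.hq h.triple₁₂₃.swap₂₃ h.hr h.h1 h.h3 h.h2 (Nat.le_add_right i k)]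
  have e := Omega_exchange h.hq h.triple₁₂₃ h.triple₁₂₃.swap₂₃ h.hr h.h1 h.h1 h.h2 h.h3 i k
  have m1 := (h.triple₁₂₃.gabc.mul_pow hq0 (i + k + 2)).qPoch i
  have m2 := (h.g1.mul hq0).qPoch k
  rw [show c₁ * c₃ * c₂ = c₁ * c₂ * c₃ by ring] at e
  refine mul_right_cancel₀ (mul_ne_zero m1 m2) ?_
  rw [e, show s₂ / s₃ = c₂ / c₁ * (c₁ / (s₂ * s₃)) by rw [← h.h2]; field_simp, mul_pow]
  ring

theorem mul_exchangeConst (h : RootFive r s₀ s₁ s₂ s₃ s₄ q c₀ c₁ c₂ c₃ c₄ N) {i j x y : ℕ}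
    (hij : i + j ≤ N) (hxy : x + y ≤ N) :
    Omega r s₁ s₂ s₃ (N - j) i * griffithsWeight r s₀ s₁ s₂ s₃ s₄ N j y 0 *
        (sumConst q c₁ c₂ c₃ (N - j) * ratioProd q c₃ c₂ i) =
      exchangeConst r s₀ s₁ s₂ s₃ s₄ N i j x y *
        (pentConst q c₄ c₁ c₃ c₂ c₀ N 0 j y x *
          griffithsWeight r⁻¹ s₄⁻¹ s₁⁻¹ s₃⁻¹ s₂⁻¹ s₀⁻¹ N j x 0 *
          Omega r⁻¹ s₁⁻¹ s₃⁻¹ s₂⁻¹ (N - j) i) := by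
  have hr0 := h.r_ne
  have hs0 := h.s₀_ne
  have hs1 := h.s₁_ne
  have hs2 := h.s₂_ne
  have hs3 := h.s₃_ne
  have hs4 := h.s₄_ne
  have hi := ratioProd_mul_xi_mul_omega h.hq.ne h.hr h.h2 h.h3 hs2 hs3 h.g2 h.g3
    (s₃ * s₀ * s₂ / s₁) i
  rw [show s₃ * s₀ * s₂ / s₁ / (s₂ * s₃) = s₀ / s₁ by field_simp] at hi
  unfold griffithsWeight pentConst
  rw [omega_zero, omega_zero, one_mul, one_mul, Nat.sub_zero, twoHypConst_eq, twoHypConst₂_zero,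
    mul_one, Omega_inv h.hq h.triple₀₂₄.swap₁₂.swap₂₃ h.hr h.h2 h.h4 h.h0 (show j ≤ N by omega),
    Omega_inv h.hq h.triple₀₁₃.swap₂₃ h.hr h.h0 h.h3 h.h1 (Nat.zero_le _)]
  exact exchangeConst_aux (h.Omega_eq_mul_xi_sq (by omega)) hi (h.sumConst_mul_Omega (by omega))
    (h.Omega_mul_xi (by omega)) h.sumConst_mul_Omega_mul_Omega (h.pentFactor_mul_Omega (by omega))
    (omega_ne_zero hr0 (by positivity) i) (xi_ne_zero h.hq.ne h.hr h.h2 h.h4 hs2 hs4 h.g2 h.g4 x)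
    (xi_ne_zero h.hq.ne h.hr h.h0 h.h3 hs0 hs3 h.g0 h.g3 y)
    (Omega_ne_zero h.hq h.triple₀₂₄.swap₁₂.swap₂₃ h.hr h.h2 h.h4 h.h0 (Nat.zero_le _))

end RootFive

theorem qPoch_inv_inv {a q : ℂ} (ha : a ≠ 0) (hq : q ≠ 0) (k : ℕ) :
    qPoch a⁻¹ q⁻¹ k = (-1) ^ k * (q ^ k.choose 2)⁻¹ * (a ^ k)⁻¹ * qPoch a q k := by
  induction k with
  | zero => simp [qPoch_zero]
  | succ k ih =>
    rw [qPoch_succ, qPoch_succ, ih, Nat.choose_succ_succ' k 1, Nat.choose_one_right, inv_pow,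
      ← mul_inv, one_sub_inv_eq (z := a * q ^ k) (by positivity)]
    field_simp
    ring

theorem hypTerm_inv {q lam mu b₁ b₂ b₃ : ℂ} (hq : q ≠ 0) (hl : lam ≠ 0) (hm : mu ≠ 0)
    (h₁ : b₁ ≠ 0) (h₂ : b₂ ≠ 0) (h₃ : b₃ ≠ 0) (hb : b₁ * b₂ * b₃ = q * (lam * mu)) (n x k : ℕ) :
    hypTerm q⁻¹ lam⁻¹ mu⁻¹ b₁⁻¹ b₂⁻¹ b₃⁻¹ n x k = hypTerm q lam mu b₁ b₂ b₃ n x k := by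
  unfold hypTerm
  simp only [inv_pow, inv_inv, ← mul_inv]
  rw [show q ^ n = (q ^ n)⁻¹⁻¹ by rw [inv_inv], show q ^ x = (q ^ x)⁻¹⁻¹ by rw [inv_inv]]
  simp only [qPoch_inv_inv (inv_ne_zero (pow_ne_zero n hq)) hq,
    qPoch_inv_inv (inv_ne_zero (pow_ne_zero x hq)) hq,
    qPoch_inv_inv h₁ hq, qPoch_inv_inv h₂ hq, qPoch_inv_inv h₃ hq, qPoch_inv_inv hq hq]
  rw [inv_inv, inv_inv, qPoch_inv_inv (mul_ne_zero hl (pow_ne_zero n hq)) hq,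
    qPoch_inv_inv (mul_ne_zero hm (pow_ne_zero x hq)) hq]
  have hb' : b₁ ^ k * b₂ ^ k * b₃ ^ k = q ^ k * (lam ^ k * mu ^ k) := by
    simp only [← mul_pow, hb]
  simp only [mul_pow, inv_pow, mul_inv, inv_inv]
  rw [div_eq_mul_inv, div_eq_mul_inv]
  simp only [mul_inv, inv_inv]
  generalize (qPoch b₁ q k)⁻¹ = y0 at *
  generalize (qPoch b₂ q k)⁻¹ = y1 at *
  generalize (qPoch b₃ q k)⁻¹ = y2 at *
  generalize (qPoch q q k)⁻¹ = y3 at *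
  generalize qPoch (q ^ n)⁻¹ q k = y4 at *
  generalize qPoch (q ^ x)⁻¹ q k = y5 at *
  generalize qPoch (lam * q ^ n) q k = y6 at *
  generalize qPoch (mu * q ^ x) q k = y7 at *
  have hs : ((-1 : ℂ) ^ k) ≠ 0 := pow_ne_zero _ (by norm_num)
  have z0 : q ^ k.choose 2 ≠ 0 := by positivity
  have z1 : b₁ ^ k ≠ 0 := by positivity
  have z2 : b₂ ^ k ≠ 0 := by positivity
  have z3 : b₃ ^ k ≠ 0 := by positivity
  have z4 : lam ^ k ≠ 0 := by positivity
  have z5 : mu ^ k ≠ 0 := by positivity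
  have z6 : q ^ k ≠ 0 := by positivity
  have z7 : (q ^ n) ^ k ≠ 0 := by positivity
  have z8 : (q ^ x) ^ k ≠ 0 := by positivity
  generalize (-1 : ℂ) ^ k = s at *
  generalize q ^ k.choose 2 = y8 at *
  generalize b₁ ^ k = y9 at *
  generalize b₂ ^ k = y10 at *
  generalize b₃ ^ k = y11 at *
  generalize lam ^ k = y12 at *
  generalize mu ^ k = y13 at *
  generalize (q ^ n) ^ k = y14 at *
  generalize (q ^ x) ^ k = y15 at *
  generalize q ^ k = y16 at *
  field_simp
  linear_combination (y4 * y6 * y5 * y7 * y0 * y1 * y2 * y3) * hb'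

theorem racahHyp_inv {q a b c : ℂ} (hq : q ≠ 0) (ha : a ≠ 0) (hb : b ≠ 0) (hc : c ≠ 0)
    (L n x : ℕ) : racahHyp q⁻¹ a⁻¹ b⁻¹ c⁻¹ L n x = racahHyp q a b c L n x := by
  unfold racahHyp hyp
  refine Finset.sum_congr rfl fun k _ => ?_
  rw [← hypTerm_inv hq (lam := b * c * q) (mu := a * b * q) (b₁ := q * b)
    (b₂ := a * b * c * q ^ (L + 2)) (b₃ := (q ^ L)⁻¹) (by positivity) (by positivity)
    (by positivity) (by positivity) (by positivity) (by field_simp; ring)]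
  simp only [mul_inv, inv_pow]

theorem racah_eq {r a b c q A B C : ℂ} (hr : r ^ 2 = q) (ha : a ^ 2 = A) (hb : b ^ 2 = B)
    (hc : c ^ 2 = C) {L n x : ℕ} (hn : n ≤ L) (hx : x ≤ L) :
    racah r a b c L n x = Omega r a b c L n * racahHyp q A B C L n x := by
  rw [racah, if_pos ⟨hn, hx⟩, hr, ha, hb, hc]
  congr 1
  unfold phi43 racahHyp hyp hypTerm
  refine Finset.sum_congr rfl fun k _ => ?_
  simp only [zpow_neg, zpow_natCast]
  rw [show B * C * q * q ^ n = B * C * q ^ (n + 1) by ring,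
    show A * B * q * q ^ x = A * B * q ^ (x + 1) by ring]
  simp only [div_eq_mul_inv, mul_inv]
  ring

theorem griffiths_eq_zero (r s₁ s₂ s₃ s₄ : ℂ) {N i j x y : ℕ} (h : N < x + y) :
    griffiths r s₁ s₂ s₃ s₄ N i j x y = 0 := by
  refine Finset.sum_eq_zero fun a _ => ?_
  by_cases hy : y ≤ N
  · rw [racah.eq_def r s₄, if_neg (by omega), mul_zero]
  · rw [racah.eq_def r s₃, if_neg (by omega), mul_zero, zero_mul]

namespace RootFive
variable {r s₀ s₁ s₂ s₃ s₄ q c₀ c₁ c₂ c₃ c₄ : ℂ} {N : ℕ}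

theorem rootC0_eq (h : RootFive r s₀ s₁ s₂ s₃ s₄ q c₀ c₁ c₂ c₃ c₄ N) :
    rootC0 r s₁ s₂ s₃ s₄ N = s₀ := by
  rw [rootC0, eq_comm]
  exact eq_inv_of_mul_eq_one_left (by rw [← h.root]; ring)

theorem griffiths_eq (h : RootFive r s₀ s₁ s₂ s₃ s₄ q c₀ c₁ c₂ c₃ c₄ N) {i j x y : ℕ}
    (hij : i + j ≤ N) (hxy : x + y ≤ N) :
    griffiths r s₁ s₂ s₃ s₄ N i j x y =
      Omega r s₁ s₂ s₃ (N - j) i * ∑ a ∈ Finset.range (min (N - j) (N - y) + 1),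
        griffithsWeight r s₀ s₁ s₂ s₃ s₄ N j y a * (racahHyp q c₁ c₂ c₃ (N - j) i a *
          racahHyp q c₃ c₀ c₄ (N - a) j y * racahHyp q c₄ c₂ c₁ (N - y) a x) := by
  unfold griffiths griffithsWeight
  rw [Finset.mul_sum, h.rootC0_eq]
  refine Finset.sum_congr rfl fun a ha => ?_
  have ha' : a ≤ N - j ∧ a ≤ N - y := by
    rw [Finset.mem_range] at ha; omega
  rw [racah_eq h.hr h.h1 h.h2 h.h3 (by omega) ha'.1, racah_eq h.hr h.h3 h.h0 h.h4 (by omega)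
    (by omega), racah_eq h.hr h.h4 h.h2 h.h1 ha'.2 (by omega)]
  ring

end RootFive

namespace RootFive
variable {r s₀ s₁ s₂ s₃ s₄ q c₀ c₁ c₂ c₃ c₄ : ℂ} {N : ℕ}

theorem twoHypConst₁_ne_zero (h : RootFive r s₀ s₁ s₂ s₃ s₄ q c₀ c₁ c₂ c₃ c₄ N) :
    twoHypConst₁ q c₄ (c₁ * c₃) c₂ c₀ N ≠ 0 := by
  have hq0 := h.hq.ne
  have := (h.g13.mul_pow hq0 2).qPoch N
  have := (h.g4.mul hq0).qPoch N
  have := (h.g2.mul_pow hq0 N).inv.qPoch N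
  have := (h.g0.mul_pow hq0 N).inv.qPoch N
  unfold twoHypConst₁
  positivity

theorem twoHypConst₃_ne_zero (h : RootFive r s₀ s₁ s₂ s₃ s₄ q c₀ c₁ c₂ c₃ c₄ N) (y : ℕ) :
    twoHypConst₃ q c₄ c₃ c₀ N y ≠ 0 := by
  have hq0 := h.hq.ne
  have := h.n0
  have := h.n4
  have := (h.g0.mul hq0).qPoch y
  have := (h.g3.mul hq0).qPoch y
  have := (h.triple₀₃₄.swap₁₂.swap₂₃.swap₁₂.gabc.mul_pow hq0 (N + 2)).qPoch y
  have := (h.g4.mul_pow hq0 N).inv.qPoch y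
  unfold twoHypConst₃
  positivity

theorem pentFactor_ne_zero {q c₀ P c₃ c₄ : ℂ} (hq : q ≠ 0) (n0 : c₀ ≠ 0) (n3 : c₃ ≠ 0)
    (g0 : Generic q c₀) (g3 : Generic q c₃) (g4 : Generic q c₄) (gP : Generic q P) (N j : ℕ) :
    pentFactor q c₀ P c₃ c₄ N j ≠ 0 := by
  have := (g4.mul hq).qPoch j
  have := (g0.mul hq).qPoch j
  have := (g3.mul_pow hq N).inv.qPoch j
  have := (gP.mul_pow hq (N + 1)).inv.qPoch j
  unfold pentFactor
  positivity

theorem pentConst_ne_zero (h : RootFive r s₀ s₁ s₂ s₃ s₄ q c₀ c₁ c₂ c₃ c₄ N) (j x y : ℕ) :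
    pentConst q c₄ c₁ c₃ c₂ c₀ N 0 j y x ≠ 0 := by
  have hq0 := h.hq.ne
  have u₁ := h.twoHypConst₁_ne_zero
  have u₂ := h.twoHypConst₃_ne_zero y
  have u₃ := pentFactor_ne_zero hq0 h.n4 h.n2 h.g4 h.g2 h.g0 h.g13 N j
  have u₄ := pentFactor_ne_zero hq0 h.n4 h.n0 h.g4 h.g0 h.g2 h.g13 N x
  rw [pentConst, twoHypConst_eq, twoHypConst₂_zero, mul_one]
  exact mul_ne_zero (mul_ne_zero (mul_ne_zero u₁ u₂) u₃) u₄

theorem griffithsWeight_zero_ne_zero (h : RootFive r s₀ s₁ s₂ s₃ s₄ q c₀ c₁ c₂ c₃ c₄ N) {j y : ℕ}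
    (hj : j ≤ N) : griffithsWeight r s₀ s₁ s₂ s₃ s₄ N j y 0 ≠ 0 := by
  unfold griffithsWeight
  rw [omega_zero, one_mul]
  exact mul_ne_zero (Omega_ne_zero h.hq h.triple₀₃₄.swap₁₂ h.hr h.h3 h.h0 h.h4 hj)
    (Omega_ne_zero h.hq h.triple₁₂₄.swap₁₂.swap₂₃.swap₁₂ h.hr h.h4 h.h2 h.h1 (Nat.zero_le _))

/-- The double sum behind the exchange of the two variables. -/
theorem sum_griffithsWeight_mul (h : RootFive r s₀ s₁ s₂ s₃ s₄ q c₀ c₁ c₂ c₃ c₄ N) {i j x y : ℕ}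
    (hij : i + j ≤ N) (hxy : x + y ≤ N) :
    pentConst q c₄ c₁ c₃ c₂ c₀ N 0 j y x * griffithsWeight r⁻¹ s₄⁻¹ s₁⁻¹ s₃⁻¹ s₂⁻¹ s₀⁻¹ N j x 0 *
        ∑ a ∈ Finset.range (min (N - j) (N - y) + 1),
        griffithsWeight r s₀ s₁ s₂ s₃ s₄ N j y a * (racahHyp q c₁ c₂ c₃ (N - j) i a *
          racahHyp q c₃ c₀ c₄ (N - a) j y * racahHyp q c₄ c₂ c₁ (N - y) a x) =
      griffithsWeight r s₀ s₁ s₂ s₃ s₄ N j y 0 *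
        (sumConst q c₁ c₂ c₃ (N - j) * ratioProd q c₃ c₂ i) *
        ∑ b ∈ Finset.range (min (N - j) (N - x) + 1),
        griffithsWeight r⁻¹ s₄⁻¹ s₁⁻¹ s₃⁻¹ s₂⁻¹ s₀⁻¹ N j x b * (racahHyp q c₁ c₃ c₂ (N - j) i b *
          racahHyp q c₂ c₄ c₀ (N - b) j x * racahHyp q c₀ c₃ c₁ (N - x) b y) := by
  have hq0 := h.hq.ne
  have h1 : pentConst q c₄ c₁ c₃ c₂ c₀ N 0 j y x *
        ∑ a ∈ Finset.range (min (N - j) (N - y) + 1),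
        griffithsWeight r s₀ s₁ s₂ s₃ s₄ N j y a * (racahHyp q c₁ c₂ c₃ (N - j) i a *
          racahHyp q c₃ c₀ c₄ (N - a) j y * racahHyp q c₄ c₂ c₁ (N - y) a x) =
      griffithsWeight r s₀ s₁ s₂ s₃ s₄ N j y 0 * ∑ a ∈ Finset.range (N - j + 1),
        sumWeight q c₁ c₂ c₃ (N - j) a * racahHyp q c₁ c₂ c₃ (N - j) i a *
          pentSum q c₄ c₁ c₃ c₂ c₀ N a j y x := by
    rw [← Finset.sum_subset (Finset.range_mono
      (show min (N - j) (N - y) + 1 ≤ N - j + 1 by omega)), Finset.mul_sum, Finset.mul_sum]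
    · refine Finset.sum_congr rfl fun a ha => ?_
      rw [Finset.mem_range] at ha
      rw [pentSum_eq N h.toGenericFive.exchange a j y x (by omega) (by omega)]
      unfold pentRhs pentConst
      have e := h.griffithsWeight_mul (a := a) (j := j) (y := y) (by omega) (by omega)
      linear_combination (pentFactor q c₄ (c₁ * c₃) c₂ c₀ N j *
        pentFactor q c₄ (c₁ * c₃) c₀ c₂ N x * (racahHyp q c₁ c₂ c₃ (N - j) i a *
          racahHyp q c₃ c₀ c₄ (N - a) j y * racahHyp q c₄ c₂ c₁ (N - y) a x)) * e
    · intro a ha ha'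
      rw [Finset.mem_range] at ha ha'
      rw [pentSum_eq N h.toGenericFive.exchange a j y x (by omega) (by omega), pentRhs, pentConst,
        twoHypConst_eq, twoHypConst₂_eq_zero hq0 _ _ _ (by omega) (by omega)]
      ring
  have h2 : ∑ a ∈ Finset.range (N - j + 1),
        sumWeight q c₁ c₂ c₃ (N - j) a * racahHyp q c₁ c₂ c₃ (N - j) i a *
          pentSum q c₄ c₁ c₃ c₂ c₀ N a j y x =
      ∑ b ∈ Finset.range (N + 1), pentWeight q c₄ c₁ c₃ c₂ c₀ N (N - j) (N - x) b *
        racahHyp q c₀ c₃ c₁ (N - x) b y * racahHyp q c₂ c₄ c₀ (N - b) j x *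
          racahSum q c₁ c₂ c₃ (N - j) i b := by
    unfold pentSum racahSum
    simp only [Finset.mul_sum]
    rw [Finset.sum_comm]
    refine Finset.sum_congr rfl fun b _ => Finset.sum_congr rfl fun a _ => ?_
    ring
  have h3 : griffithsWeight r⁻¹ s₄⁻¹ s₁⁻¹ s₃⁻¹ s₂⁻¹ s₀⁻¹ N j x 0 *
      ∑ b ∈ Finset.range (N + 1), pentWeight q c₄ c₁ c₃ c₂ c₀ N (N - j) (N - x) b *
        racahHyp q c₀ c₃ c₁ (N - x) b y * racahHyp q c₂ c₄ c₀ (N - b) j x *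
          racahSum q c₁ c₂ c₃ (N - j) i b =
      sumConst q c₁ c₂ c₃ (N - j) * ratioProd q c₃ c₂ i *
        ∑ b ∈ Finset.range (min (N - j) (N - x) + 1),
        griffithsWeight r⁻¹ s₄⁻¹ s₁⁻¹ s₃⁻¹ s₂⁻¹ s₀⁻¹ N j x b * (racahHyp q c₁ c₃ c₂ (N - j) i b *
          racahHyp q c₂ c₄ c₀ (N - b) j x * racahHyp q c₀ c₃ c₁ (N - x) b y) := by
    rw [← Finset.sum_subset (Finset.range_mono
      (show min (N - j) (N - x) + 1 ≤ N + 1 by omega)), Finset.mul_sum, Finset.mul_sum]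
    · refine Finset.sum_congr rfl fun b hb => ?_
      rw [Finset.mem_range] at hb
      rw [racahSum_eq h.hq (N - j) h.triple₁₂₃ i b (by omega) (by omega), racahSumFactor]
      have e := h.pentWeight_mul_ratioProd (b := b) (j := j) (x := x) (by omega) (by omega)
      linear_combination (sumConst q c₁ c₂ c₃ (N - j) * ratioProd q c₃ c₂ i *
        (racahHyp q c₁ c₃ c₂ (N - j) i b *
          racahHyp q c₂ c₄ c₀ (N - b) j x * racahHyp q c₀ c₃ c₁ (N - x) b y)) * e
    · intro b hb hb'
      rw [Finset.mem_range] at hb hb'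
      rw [pentWeight_eq_zero hq0 _ _ _ _ _ _ (by omega)]
      ring
  rw [h2] at h1
  rw [mul_right_comm, h1]
  linear_combination griffithsWeight r s₀ s₁ s₂ s₃ s₄ N j y 0 * h3

theorem griffiths_exchange (h : RootFive r s₀ s₁ s₂ s₃ s₄ q c₀ c₁ c₂ c₃ c₄ N) {i j x y : ℕ}
    (hij : i + j ≤ N) :
    griffiths r s₁ s₂ s₃ s₄ N i j x y = exchangeConst r s₀ s₁ s₂ s₃ s₄ N i j x y *
      griffiths r⁻¹ s₁⁻¹ s₃⁻¹ s₂⁻¹ s₀⁻¹ N i j y x := by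
  rcases lt_or_ge N (x + y) with hxy | hxy
  · rw [griffiths_eq_zero _ _ _ _ _ hxy, griffiths_eq_zero _ _ _ _ _ (by omega), mul_zero]
  · rw [h.griffiths_eq hij hxy, h.exchange'.inv.griffiths_eq hij (by omega)]
    simp only [racahHyp_inv h.hq.ne h.n1 h.n3 h.n2, racahHyp_inv h.hq.ne h.n2 h.n4 h.n0,
      racahHyp_inv h.hq.ne h.n0 h.n3 h.n1]
    have e1 := h.sum_griffithsWeight_mul hij hxy
    have e2 := h.mul_exchangeConst hij hxy
    have m1 := h.pentConst_ne_zero j x y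
    have m2 := h.exchange'.inv.griffithsWeight_zero_ne_zero (j := j) (y := x) (by omega)
    refine mul_left_cancel₀ (mul_ne_zero m1 m2) ?_
    rw [mul_left_comm, e1]
    linear_combination (∑ b ∈ Finset.range (min (N - j) (N - x) + 1),
        griffithsWeight r⁻¹ s₄⁻¹ s₁⁻¹ s₃⁻¹ s₂⁻¹ s₀⁻¹ N j x b * (racahHyp q c₁ c₃ c₂ (N - j) i b *
          racahHyp q c₂ c₄ c₀ (N - b) j x * racahHyp q c₀ c₃ c₁ (N - x) b y)) * e2

end RootFive

theorem qPoch_add (a q : ℂ) (m n : ℕ) : qPoch a q (m + n) = qPoch a q m * qPoch (a * q ^ m) q n := by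
  unfold qPoch
  rw [Finset.prod_range_add]
  congr 1
  exact Finset.prod_congr rfl fun l _ => by rw [pow_add, mul_assoc]

theorem qPoch_eq_omega_mul_of_mul_eq_one {q r u v : ℂ} (hq : q ≠ 0) (hr : r ^ 2 = q) {n : ℕ}
    (h : u * v * q ^ n = q) : qPoch u q n = omega r (u / q) n * qPoch v q n := by
  have hu : u ≠ 0 := by rintro rfl; simp at h; exact hq h.symm
  have e := qPoch_eq_omega_mul hq hr (div_ne_zero hu hq) n
  rw [mul_div_cancel₀ _ hq] at e
  rw [e]
  congr 2
  field_simp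
  linear_combination -h

/-- Reversal of the last `n` factors of a `q`-Pochhammer symbol. -/
theorem qPoch_mul_omega {q r X v : ℂ} (hq : q ≠ 0) (hr : r ^ 2 = q) {m n : ℕ}
    (h : X * v * q ^ (m + n + 1) = 1) :
    qPoch (X * q ^ 2) q (m + n) =
      qPoch (X * q ^ 2) q m * (omega r (X * q ^ (m + 1)) n * qPoch v q n) := by
  rw [qPoch_add, qPoch_eq_omega_mul_of_mul_eq_one hq hr (u := X * q ^ 2 * q ^ m) (v := v)
    (by linear_combination q * h),
    show X * q ^ 2 * q ^ m / q = X * q ^ (m + 1) by field_simp; ring]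

theorem omega_mul_left (r s t : ℂ) (n : ℕ) : omega r (s * t) n = s ^ n * omega r t n := by
  unfold omega; ring

namespace RootFive
variable {r s₀ s₁ s₂ s₃ s₄ q c₀ c₁ c₂ c₃ c₄ : ℂ} {N : ℕ}

theorem griffiths_dual (h : RootFive r s₀ s₁ s₂ s₃ s₄ q c₀ c₁ c₂ c₃ c₄ N) {i j x y : ℕ}
    (hij : i + j ≤ N) (hxy : x + y ≤ N) :
    griffiths r s₁ s₂ s₃ s₄ N i j x y *
        (Omega r s₁ s₂ s₄ (N - y) x * griffithsWeight r s₀ s₁ s₂ s₄ s₃ N y j 0) =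
      Omega r s₁ s₂ s₃ (N - j) i * griffithsWeight r s₀ s₁ s₂ s₃ s₄ N j y 0 *
        griffiths r s₁ s₂ s₄ s₃ N x y i j := by
  have hq0 := h.hq.ne
  rw [h.griffiths_eq hij hxy, h.swap₃₄.griffiths_eq hxy hij, min_comm (N - y) (N - j)]
  simp only [Finset.mul_sum, Finset.sum_mul]
  refine Finset.sum_congr rfl fun a ha => ?_
  rw [Finset.mem_range] at ha
  have e := h.griffithsWeight_swap (j := j) (y := y) (a := a) (by omega) (by omega)
  rw [racahHyp_comm hq0 c₁ c₂ c₃, racahHyp_comm hq0 c₃ c₀ c₄, racahHyp_comm hq0 c₄ c₂ c₁]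
  linear_combination (Omega r s₁ s₂ s₃ (N - j) i * Omega r s₁ s₂ s₄ (N - y) x *
    (racahHyp q c₃ c₂ c₁ (N - j) a i * racahHyp q c₄ c₀ c₃ (N - a) y j *
      racahHyp q c₁ c₂ c₄ (N - y) x a)) * e

theorem Omega_mul_Omega_mul_xi_sq (h : RootFive r s₀ s₁ s₂ s₃ s₄ q c₀ c₁ c₂ c₃ c₄ N) {y k : ℕ}
    (hy : N = y + k) :
    Omega r s₄ s₂ s₁ k 0 * Omega r s₂ s₃ s₀ N y * xi r s₀ s₃ y ^ 2 * qPoch (c₁ * c₂ * q ^ 2) q N =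
      Omega r s₂ s₄ s₁ k 0 * Omega r s₄ s₀ s₃ N y * qPoch (c₁ * c₄ * q ^ 2) q N *
        ((c₂ / c₄) ^ y * (s₃ / s₀) ^ N * (s₂ / s₄) ^ k) := by
  have hq0 := h.hq.ne
  have hr0 := h.r_ne
  have hs0 := h.s₀_ne
  have hs2 := h.s₂_ne
  have hs3 := h.s₃_ne
  have hs4 := h.s₄_ne
  have n1 := h.n1
  have n2 := h.n2
  have n4 := h.n4
  have e1 := Omega_exchange h.hq h.triple₀₃₄.swap₁₂.swap₂₃.swap₁₂.swap₂₃ h.triple₀₂₃.swap₁₂.swap₂₃ h.hr h.h4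
    h.h2 h.h0 h.h3 y k
  have z1 := Omega_zero_eq h.hq h.triple₁₂₄.swap₁₂.swap₂₃.swap₁₂ h.hr h.h4 h.h2 h.h1 k
  have z2 := Omega_zero_eq h.hq h.triple₁₂₄.swap₂₃.swap₁₂.swap₂₃.swap₁₂ h.hr h.h2 h.h4 h.h1 k
  rw [mul_comm c₂ c₁] at z1
  rw [mul_comm c₄ c₁] at z2
  have p1 := qPoch_mul_omega hq0 h.hr (m := k) (n := y) (X := c₁ * c₂)
    (v := c₄ * c₀ * c₃ * q ^ (y + k + 2)) (by rw [← h.bal, hy]; ring)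
  have p2 := qPoch_mul_omega hq0 h.hr (m := k) (n := y) (X := c₁ * c₄)
    (v := c₂ * c₃ * c₀ * q ^ (y + k + 2)) (by rw [← h.bal, hy]; ring)
  rw [← hy] at e1
  rw [add_comm k y, ← hy] at p1 p2
  have o : omega r (c₁ * c₂ * q ^ (k + 1)) y = (c₂ / c₄) ^ y * omega r (c₁ * c₄ * q ^ (k + 1)) y := by
    rw [← omega_mul_left]; congr 1; field_simp
  have ρ : (r * s₂) ^ k = (s₂ / s₄) ^ k * (r * s₄) ^ k := by
    rw [← mul_pow]; congr 1; field_simp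
  have σ : (s₃ / s₀) ^ N * (s₀ / s₃) ^ N = 1 := by
    rw [← mul_pow, div_mul_div_cancel₀ hs0, div_self hs3, one_pow]
  rw [p1, p2, o]
  rw [ρ] at z1
  generalize Omega r s₄ s₂ s₁ k 0 = y0 at *
  generalize Omega r s₂ s₄ s₁ k 0 = y1 at *
  generalize Omega r s₂ s₃ s₀ N y = y2 at *
  generalize Omega r s₄ s₀ s₃ N y = y3 at *
  generalize qPoch (c₁ * c₂ * q ^ 2) q k = y4 at *
  generalize qPoch (c₁ * c₄ * q ^ 2) q k = y5 at *
  generalize qPoch (c₄ * c₀ * c₃ * q ^ (N + 2)) q y = y6 at *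
  generalize qPoch (c₂ * c₃ * c₀ * q ^ (N + 2)) q y = y7 at *
  generalize xi r s₀ s₃ y = y8 at *
  generalize (s₀ / s₃) ^ N = y9 at *
  generalize (s₃ / s₀) ^ N = y10 at *
  generalize (c₂ / c₄) ^ y = y11 at *
  generalize (s₂ / s₄) ^ k = y12 at *
  generalize (r * s₄) ^ k = y13 at *
  generalize omega r (c₁ * c₄ * q ^ (k + 1)) y = y14 at *
  generalize qPoch (q * c₂) q k = y15 at *
  generalize qPoch (q * c₄) q k = y16 at *
  linear_combination (y2 * y8 ^ 2 * y11 * y14 * y6) * z1 - y11 * y14 * y12 * y13 * y10 * e1 - y3 * y14 * y7 * y11 * y10 * y12 * z2 - y11 * y14 * y12 * y13 * y2 * y8 ^ 2 * y6 * y16 * σ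

end RootFive

section
variable {q r a b c A B C : ℂ}

theorem Omega_add_left (hq : NonRoot q) (h : GenericTriple q A B C) (hr : r ^ 2 = q)
    (ha : a ^ 2 = A) (hb : b ^ 2 = B) (hc : c ^ 2 = C) (n k j : ℕ) :
    Omega r a b c (n + (k + j)) n * (qPoch q q (n + k) * qPoch q q (k + j) *
        qPoch (A * B * C * q ^ (n + k + 2)) q n * qPoch (q * A) q k *
        qPoch (B * C * q ^ (2 * n + k + 2)) q j) =
      Omega r a b c (n + k) n * (qPoch q q (n + (k + j)) * qPoch q q k *
        qPoch (A * B * C * q ^ (n + (k + j) + 2)) q n * qPoch (q * A) q (k + j) * (r * b) ^ j) := by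
  have hq0 := hq.ne
  have hr0 : r ≠ 0 := by rintro rfl; simp at hr; exact hq0 hr.symm
  have hb0 : b ≠ 0 := by rintro rfl; simp at hb; exact h.ne_b hb.symm
  rw [Omega_eq_of_generic h hr ha hb hc, Omega_eq_of_generic h hr ha hb hc,
    show n + (k + j) + 1 = n + k + 1 + j by omega, qPoch_add (B * C * q ^ (n + 1)),
    show B * C * q ^ (n + 1) * q ^ (n + k + 1) = B * C * q ^ (2 * n + k + 2) by ring]
  have z : (r * b) ^ ((n : ℤ) - k) = (r * b) ^ ((n : ℤ) - (k + j : ℕ)) * (r * b) ^ j := by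
    rw [← zpow_natCast (r * b) j, ← zpow_add₀ (mul_ne_zero hr0 hb0)]
    congr 1; push_cast; ring
  rw [z]
  have m1 : (r * b) ^ ((n : ℤ) - (k + j : ℕ)) ≠ 0 := zpow_ne_zero _ (mul_ne_zero hr0 hb0)
  have m2 : (r * b) ^ j ≠ 0 := by positivity
  have m3 := hq.qPoch n
  have m4 := hq.qPoch k
  have m5 := hq.qPoch (k + j)
  have m6 := (h.gbc.mul_pow hq0 (2 * n + k + 2)).qPoch j
  have m7 := (h.gbc.mul_pow hq0 (n + 1)).qPoch (n + k + 1)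
  have m8 := (h.gc.mul hq0).qPoch n
  generalize (r * b) ^ ((n : ℤ) - (k + j : ℕ)) = y0 at *
  generalize (r * b) ^ j = y1 at *
  generalize qPoch q q n = y2 at *
  generalize qPoch q q k = y3 at *
  generalize qPoch q q (k + j) = y4 at *
  generalize qPoch (B * C * q ^ (2 * n + k + 2)) q j = y5 at *
  generalize qPoch (B * C * q ^ (n + 1)) q (n + k + 1) = y6 at *
  generalize qPoch (q * C) q n = y7 at *
  generalize qPoch q q (n + (k + j)) = y8 at *
  generalize qPoch q q (n + k) = y9 at *
  generalize 1 - B * C * q ^ (2 * n + 1) = y10 at *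
  generalize qPoch (q * B) q n = y11 at *
  generalize qPoch (A * B * C * q ^ (n + k + 2)) q n = y12 at *
  generalize qPoch (A * B * C * q ^ (n + (k + j) + 2)) q n = y13 at *
  generalize qPoch (q * A) q (k + j) = y14 at *
  generalize qPoch (q * A) q k = y15 at *
  field_simp

theorem Omega_exchange_add {a' A' : ℂ} (hq : NonRoot q) (h : GenericTriple q A B C)
    (h' : GenericTriple q A' C B) (hr : r ^ 2 = q) (ha : a ^ 2 = A) (ha' : a' ^ 2 = A')
    (hb : b ^ 2 = B) (hc : c ^ 2 = C) (n k j : ℕ) :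
    Omega r a b c (n + k) n * (qPoch q q (n + (k + j)) * qPoch q q k *
        qPoch (A' * C * B * q ^ (n + (k + j) + 2)) q n * qPoch (q * A') q (k + j) * (r * c) ^ j) =
      Omega r a' c b (n + (k + j)) n * (qPoch q q (n + k) * qPoch q q (k + j) *
        qPoch (C * B * q ^ (2 * n + k + 2)) q j * (xi r b c n ^ 2 * (b / c) ^ (n + k)) *
        qPoch (A * B * C * q ^ (n + k + 2)) q n * qPoch (q * A) q k) := by
  have hq0 := hq.ne
  have e1 := Omega_exchange hq h h' hr ha ha' hb hc n k
  have e2 := Omega_add_left hq h' hr ha' hc hb n k j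
  have m1 := (h'.gabc.mul_pow hq0 (n + k + 2)).qPoch n
  have m2 := (h'.ga.mul hq0).qPoch k
  refine mul_right_cancel₀ (mul_ne_zero m1 m2) ?_
  linear_combination (qPoch q q (n + (k + j)) * qPoch q q k *
        qPoch (A' * C * B * q ^ (n + (k + j) + 2)) q n * qPoch (q * A') q (k + j) *
        (r * c) ^ j) * e1 - (xi r b c n ^ 2 * (b / c) ^ (n + k)) *
        qPoch (A * B * C * q ^ (n + k + 2)) q n * qPoch (q * A) q k * e2

theorem xi_mul_xi_symm (hq : q ≠ 0) (hr : r ^ 2 = q) (hb : b ^ 2 = B) (hc : c ^ 2 = C)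
    (hb0 : b ≠ 0) (hc0 : c ≠ 0) (gb : Generic q B) (gc : Generic q C) (n : ℕ) :
    xi r b c n * xi r c b n = 1 := by
  unfold xi
  rw [hr, hb, hc, div_pow, div_pow]
  have := (gb.mul hq).qPoch n
  have := (gc.mul hq).qPoch n
  field_simp

end

namespace RootFive
variable {r s₀ s₁ s₂ s₃ s₄ q c₀ c₁ c₂ c₃ c₄ : ℂ} {N : ℕ}

theorem omega_mul_omega_mul_omega {S T V V' f g : ℂ} {i j : ℕ} (hr : r ^ 2 = q)
    (e₁ : S * T * q ^ (i + 1) * q ^ j = f) (e₂ : V = V' * g * q ^ i) :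
    omega r S i * omega r T i * omega r V j = omega r V' j * (f ^ i * g ^ j) := by
  have e3 : (q ^ (i + 1).choose 2) ^ 2 = (q ^ (i + 1)) ^ i := by
    rw [← pow_mul, ← pow_mul, choose_two_mul_two]
  have e4 : ((-1 : ℂ) ^ i) ^ 2 = 1 := by rw [← pow_mul, mul_comm, pow_mul]; simp
  have e5 : (q ^ j) ^ i = (q ^ i) ^ j := by rw [← pow_mul, ← pow_mul, mul_comm]
  subst e₁ e₂
  simp only [omega_eq hr]
  rw [neg_pow S, neg_pow T, neg_pow (V' * g * q ^ i), neg_pow V', mul_pow _ (q ^ i), mul_pow V' g,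
    mul_pow _ (q ^ j), mul_pow _ (q ^ (i + 1)), mul_pow S T, ← e3, e5]
  linear_combination (S ^ i * T ^ i * (q ^ (i + 1).choose 2) ^ 2 * (-1) ^ j * V' ^ j * g ^ j *
    (q ^ i) ^ j * q ^ (j + 1).choose 2) * e4

theorem Omega_mul_Omega_mul_Omega_aux {F Ni Nj K a304 a023 g0 g3 ρ3 ρ0 a23 X σ a123 g1 a04 X' σ' a140 O123 O032 O140 O304
    O041 O321 p14 p12 P14 P12 oi oi' oj oj' ρ4 ρ2 f t : ℂ}
    (eA : O123 * (F * K * a023 * g0 * ρ3) = O032 * (Ni * Nj * a23 * (X ^ 2 * σ) * a123 * g1))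
    (eB : O140 * (F * K * a304 * g3 * ρ0) = O304 * (Nj * Ni * a04 * (X' ^ 2 * σ') * a140 * g1))
    (z1 : O041 * p14 = g0 * ρ4) (z2 : O321 * p12 = g3 * ρ2)
    (p1 : P12 = p12 * (oj' * a304)) (p2 : P14 = p14 * (oi' * a023))
    (v1 : a123 = oi * a04) (v2 : a23 = oj * a140) (ho : oi * oi' * oj = oj' * f)
    (hX : t * X' = 1)
    (n : F * K * a023 * g0 * ρ3 ≠ 0) (n' : Ni * Nj * a04 * a140 * g1 * σ' * ρ2 * oj ≠ 0) :
    O123 * O304 * O041 * P14 * (ρ3 * ρ2 * σ') =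
      O140 * O032 * O321 * P12 * (X ^ 2 * t ^ 2 * (f * (σ * ρ4 * ρ0))) := by
  have n1 : F * K * a023 * g0 ≠ 0 := left_ne_zero_of_mul n
  have n2 : Ni * Nj * a04 * a140 * g1 ≠ 0 :=
    left_ne_zero_of_mul (left_ne_zero_of_mul (left_ne_zero_of_mul n'))
  refine mul_left_cancel₀ (mul_ne_zero n1 n2) ?_
  subst p1 p2 v1 v2
  have hX2 : t ^ 2 * X' ^ 2 = 1 := by rw [← mul_pow, hX, one_pow]
  calc _ = (O123 * (F * K * a023 * g0 * ρ3)) * (O304 * (Nj * Ni * a04 * (X' ^ 2 * σ') * a140 * g1)) * (O041 * p14) * (oi' * a023) * ρ2 * t ^ 2 +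
          (1 - t ^ 2 * X' ^ 2) * ((O123 * (F * K * a023 * g0 * ρ3)) * (O304 * (Nj * Ni * a04 * σ' * a140 * g1)) * (O041 * p14) * (oi' * a023) * ρ2) := by ring
    _ = (O032 * (Ni * Nj * (oj * a140) * (X ^ 2 * σ) * (oi * a04) * g1)) * (O140 * (F * K * a304 * g3 * ρ0)) * (g0 * ρ4) * (oi' * a023) * ρ2 * t ^ 2 := by
      rw [hX2, eA, eB, z1]; ring
    _ = O032 * Ni * Nj * a140 * X ^ 2 * σ * a04 * g1 * O140 * F * K * a304 * ρ0 * g0 * ρ4 * a023 * t ^ 2 * (oi * oi' * oj) * (g3 * ρ2) := by ring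
    _ = _ := by rw [ho, ← z2]; ring

theorem Omega_mul_Omega_mul_Omega (h : RootFive r s₀ s₁ s₂ s₃ s₄ q c₀ c₁ c₂ c₃ c₄ N) {i j k : ℕ}
    (hN : N = i + (k + j)) :
    Omega r s₁ s₂ s₃ (i + k) i * Omega r s₃ s₀ s₄ N j * Omega r s₀ s₄ s₁ (j + k) 0 *
        qPoch (c₁ * c₄ * q ^ 2) q N =
      Omega r s₁ s₄ s₀ (j + k) j * Omega r s₀ s₃ s₂ N i * Omega r s₃ s₂ s₁ (i + k) 0 *
        qPoch (c₁ * c₂ * q ^ 2) q N * (xi r s₂ s₃ i ^ 2 * xi r s₀ s₄ j ^ 2 *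
          ((c₁ / c₀) ^ i * (c₃ / c₁) ^ j * (s₀ / s₃) ^ N)) := by
  have hq0 := h.hq.ne
  have hr0 := h.r_ne
  have hs0 := h.s₀_ne
  have hs2 := h.s₂_ne
  have hs3 := h.s₃_ne
  have hs4 := h.s₄_ne
  have n0 := h.n0
  have n1 := h.n1
  have n2 := h.n2
  have n3 := h.n3
  have n4 := h.n4
  have hN' : N = j + (k + i) := by omega
  have eA := Omega_exchange_add h.hq h.triple₁₂₃ h.triple₀₂₃.swap₂₃ h.hr h.h1 h.h0 h.h2 h.h3 i k j
  have eB := Omega_exchange_add h.hq h.triple₀₁₄.swap₁₂.swap₂₃ h.triple₀₃₄.swap₁₂ h.hr h.h1 h.h3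
    h.h4 h.h0 j k i
  have z1 := Omega_zero_eq h.hq h.triple₀₁₄.swap₂₃ h.hr h.h0 h.h4 h.h1 (j + k)
  have z2 := Omega_zero_eq h.hq h.triple₁₂₃.swap₁₂.swap₂₃.swap₁₂ h.hr h.h3 h.h2 h.h1 (i + k)
  rw [mul_comm c₄ c₁] at z1
  rw [mul_comm c₂ c₁] at z2
  have p1 := qPoch_mul_omega hq0 h.hr (m := i + k) (n := j) (X := c₁ * c₂)
    (v := c₃ * c₀ * c₄ * q ^ (N + 2)) (by rw [← h.bal, hN]; ring)
  have p2 := qPoch_mul_omega hq0 h.hr (m := j + k) (n := i) (X := c₁ * c₄)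
    (v := c₀ * c₃ * c₂ * q ^ (N + 2)) (by rw [← h.bal, hN]; ring)
  have v1 := qPoch_eq_omega_mul_of_mul_eq_one hq0 h.hr (u := c₁ * c₂ * c₃ * q ^ (i + k + 2))
    (v := c₀ * c₄ * q ^ (2 * j + k + 2)) (n := i)
    (by have := h.bal; rw [hN] at this; linear_combination q * this)
  have v2 := qPoch_eq_omega_mul_of_mul_eq_one hq0 h.hr (u := c₃ * c₂ * q ^ (2 * i + k + 2))
    (v := c₁ * c₄ * c₀ * q ^ (j + k + 2)) (n := j)
    (by have := h.bal; rw [hN] at this; linear_combination q * this)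
  rw [← hN, add_comm k j] at eA
  rw [← hN', add_comm k i] at eB
  rw [show i + k + j = N by omega] at p1
  rw [show j + k + i = N by omega] at p2
  have ho : omega r (c₁ * c₂ * c₃ * q ^ (i + k + 2) / q) i * omega r (c₁ * c₄ * q ^ (j + k + 1)) i *
      omega r (c₃ * c₂ * q ^ (2 * i + k + 2) / q) j =
      omega r (c₁ * c₂ * q ^ (i + k + 1)) j * ((c₁ / c₀) ^ i * (c₃ / c₁) ^ j) := by
    have e1 : c₁ * c₂ * c₃ * q ^ (i + k + 2) / q * (c₁ * c₄ * q ^ (j + k + 1)) * q ^ (i + 1) * q ^ j =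
        c₁ / c₀ := by
      have hb := h.bal
      rw [hN] at hb
      field_simp
      linear_combination q * hb
    have e2 : c₃ * c₂ * q ^ (2 * i + k + 2) / q = c₁ * c₂ * q ^ (i + k + 1) * (c₃ / c₁) * q ^ i := by
      field_simp
      ring
    exact omega_mul_omega_mul_omega h.hr e1 e2
  have hN0 := (h.hq.qPoch N)
  have hNk := (h.hq.qPoch k)
  have key := Omega_mul_Omega_mul_Omega_aux eA eB z1 z2 p1 p2 v1 v2 ho
    (xi_mul_xi_symm hq0 h.hr h.h0 h.h4 hs0 hs4 h.g0 h.g4 j)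
    (by
      have := (h.triple₀₂₃.swap₂₃.gabc.mul_pow hq0 (N + 2)).qPoch i
      have := (h.g0.mul hq0).qPoch (j + k)
      positivity)
    (by
      have := h.hq.qPoch (i + k)
      have := h.hq.qPoch (j + k)
      have := (h.g04.mul_pow hq0 (2 * j + k + 2)).qPoch i
      have := (h.triple₀₁₄.swap₁₂.swap₂₃.gabc.mul_pow hq0 (j + k + 2)).qPoch j
      have := (h.g1.mul hq0).qPoch k
      have : omega r (c₃ * c₂ * q ^ (2 * i + k + 2) / q) j ≠ 0 := omega_ne_zero hr0 (by positivity) j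
      positivity)
  refine mul_right_cancel₀ (b := (r * s₃) ^ j * (r * s₂) ^ (i + k) * (s₄ / s₀) ^ (j + k))
    (by positivity) (key.trans ?_)
  have e : (s₂ / s₃) ^ (i + k) * (r * s₄) ^ (j + k) * (r * s₀) ^ i =
      (s₀ / s₃) ^ N * ((r * s₃) ^ j * (r * s₂) ^ (i + k) * (s₄ / s₀) ^ (j + k)) := by
    rw [hN]
    simp only [div_pow, mul_pow, pow_add]
    field_simp
  rw [e]
  ring

end RootFive

/-- The factor relating the two sides of the exchange of the two indices. -/
def exchangeConst' (r s₀ s₁ s₂ s₃ s₄ : ℂ) (N i j x y : ℕ) : ℂ :=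
  (s₀ / s₁) ^ i * (s₃ / s₁) ^ j * (s₁ / s₀) ^ x * (s₁ / s₄) ^ y *
    (xi r s₂ s₃ i * xi r s₀ s₄ j / (xi r s₂ s₄ x * xi r s₀ s₃ y)) *
    (omega r (s₁ * s₃ * s₀ / s₂) y / omega r (s₂ * s₄ * s₁ / s₀) x) *
    omega r (r * s₁ * s₂ * s₄) N

theorem exchangeConst'_aux {O123 O304 O421 P142 P230 P041 O124 O403 O321 P140 P032 P241 X Xi Xj Y kx g14 g12 U V
    e1x e1y e1i e1j w1y w1x W e2i e2j e2x e2y w2y w2x : ℂ}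
    (h1 : O124 = P142 * (X ^ 2 * kx))
    (h2 : O123 * O304 * P041 * g14 = P140 * P032 * O321 * g12 * (Xi ^ 2 * Xj ^ 2 * U))
    (h3 : O421 * P230 * Y ^ 2 * g12 = P241 * O403 * g14 * V)
    (hx : e1x * w2x = e2x * w1x)
    (hy : e1y * e1i * e1j * w1y * U * V = kx * e2i * e2j * e2y * w2y)
    (n1 : Xi ≠ 0) (n2 : Xj ≠ 0) (n3 : X ≠ 0) (n4 : Y ≠ 0) (n5 : w1x ≠ 0) (n6 : w2x ≠ 0)
    (n7 : g12 ≠ 0) (n8 : g14 ≠ 0) :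
    O123 * (O304 * O421) * (e1x * e1y * e1i * e1j * (X * Y / (Xi * Xj)) * (w1y / w1x) * W) *
        (P142 * (P230 * P041)) =
      e2i * e2j * e2x * e2y * (Xi * Xj / (X * Y)) * (w2y / w2x) * W *
        (O124 * (O403 * O321)) * (P140 * (P032 * P241)) := by
  have h23 : O123 * O304 * O421 * P230 * P041 * Y ^ 2 =
      P140 * P032 * O321 * P241 * O403 * (Xi ^ 2 * Xj ^ 2 * U * V) := by
    refine mul_right_cancel₀ (mul_ne_zero n7 n8) ?_
    linear_combination O421 * P230 * Y ^ 2 * g12 * h2 +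
      (P140 * P032 * O321 * g12 * (Xi ^ 2 * Xj ^ 2 * U)) * h3
  rw [h1]
  field_simp
  have e : O123 * O304 * O421 * P230 * P041 * Y ^ 2 * (e1y * e1i * e1j * w1y) =
      P140 * P032 * O321 * P241 * O403 * (Xi ^ 2 * Xj ^ 2) * (kx * e2i * e2j * e2y * w2y) := by
    rw [h23, ← hy]; ring
  linear_combination (e1x * W * P142 * w2x) * e + (P140 * P032 * O321 * P241 * O403 * (Xi ^ 2 * Xj ^ 2) * (kx * e2i * e2j * e2y * w2y)) * W * P142 * hx

namespace RootFive
variable {r s₀ s₁ s₂ s₃ s₄ q c₀ c₁ c₂ c₃ c₄ : ℂ} {N : ℕ}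

theorem exchangeConst'_eq (h : RootFive r s₀ s₁ s₂ s₃ s₄ q c₀ c₁ c₂ c₃ c₄ N) {i j x y : ℕ}
    (hij : i + j ≤ N) (hxy : x + y ≤ N) :
    Omega r s₁ s₂ s₃ (N - j) i * griffithsWeight r s₀ s₁ s₂ s₃ s₄ N j y 0 *
        exchangeConst r s₀ s₁ s₂ s₄ s₃ N x y i j *
        (Omega r⁻¹ s₁⁻¹ s₄⁻¹ s₂⁻¹ (N - y) x *
          griffithsWeight r⁻¹ s₃⁻¹ s₁⁻¹ s₄⁻¹ s₂⁻¹ s₀⁻¹ N y i 0) =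
      exchangeConst' r s₀ s₁ s₂ s₃ s₄ N i j x y *
        (Omega r s₁ s₂ s₄ (N - y) x * griffithsWeight r s₀ s₁ s₂ s₄ s₃ N y j 0) *
        (Omega r⁻¹ s₁⁻¹ s₄⁻¹ s₀⁻¹ (N - i) j *
          griffithsWeight r⁻¹ s₃⁻¹ s₁⁻¹ s₄⁻¹ s₀⁻¹ s₂⁻¹ N i y 0) := by
  have hq := h.hq
  have hq0 := hq.ne
  have hr0 := h.r_ne
  have hs0 := h.s₀_ne
  have hs1 := h.s₁_ne
  have hs2 := h.s₂_ne
  have hs3 := h.s₃_ne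
  have hs4 := h.s₄_ne
  have n0 := h.n0
  have n1 := h.n1
  have n2 := h.n2
  have n3 := h.n3
  have n4 := h.n4
  obtain ⟨k, hk⟩ : ∃ k, N = i + (k + j) := ⟨N - i - j, by omega⟩
  obtain ⟨m, hm⟩ : ∃ m, N = y + m := ⟨N - y, by omega⟩
  have h1 := h.swap₃₄.Omega_eq_mul_xi_sq (L := N - y) (i := x) (by omega)
  have h2 := h.Omega_mul_Omega_mul_Omega hk
  have h3 := h.Omega_mul_Omega_mul_xi_sq hm
  have i1 := Omega_inv_zero hq h.triple₀₁₄.swap₂₃ h.hr h.h0 h.h4 h.h1 (j + k)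
  have i2 := Omega_inv hq h.triple₀₁₄.swap₁₂.swap₂₃ h.hr h.h1 h.h4 h.h0 (Nat.le_add_right j k)
  have i3 := Omega_inv hq h.triple₀₂₃.swap₂₃ h.hr h.h0 h.h3 h.h2 (show i ≤ N by omega)
  have i4 := Omega_inv hq h.triple₀₂₃.swap₁₂.swap₂₃ h.hr h.h2 h.h3 h.h0 (show y ≤ N by omega)
  have i5 := Omega_inv_zero hq h.triple₁₂₄.swap₂₃.swap₁₂.swap₂₃.swap₁₂ h.hr h.h2 h.h4 h.h1 m
  unfold griffithsWeight exchangeConst exchangeConst'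
  simp only [omega_zero, one_mul, Nat.sub_zero]
  rw [show N - j = i + k by omega, show N - i = j + k by omega]
  rw [show N - y = m by omega] at *
  have g1 := (h.g12.mul_pow hq0 2).qPoch N
  have g2 := (h.g14.mul_pow hq0 2).qPoch N
  refine exchangeConst'_aux
    (U := (c₁ / c₀) ^ (j + k) * (c₁ / c₀) ^ (j + k) / (c₂ / c₀) ^ N * ((c₁ / c₀) ^ i * (c₃ / c₁) ^ j * (s₀ / s₃) ^ N))
    (V := (c₀ / c₂) ^ N / (c₁ / c₂) ^ m * ((c₂ / c₄) ^ y * (s₃ / s₀) ^ N * (s₂ / s₄) ^ m))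
    h1 ?_ ?_ ?_ ?_ (xi_ne_zero h.hq.ne h.hr h.h2 h.h3 hs2 hs3 h.g2 h.g3 i)
    (xi_ne_zero h.hq.ne h.hr h.h0 h.h4 hs0 hs4 h.g0 h.g4 j)
    (xi_ne_zero h.hq.ne h.hr h.h2 h.h4 hs2 hs4 h.g2 h.g4 x)
    (xi_ne_zero h.hq.ne h.hr h.h0 h.h3 hs0 hs3 h.g0 h.g3 y)
    (omega_ne_zero hr0 (by positivity) x) (omega_ne_zero hr0 (by positivity) x) g1 g2
  · rw [i1, i2, i3]
    have e : (c₀ / c₁) ^ (j + k) * (c₁ / c₀) ^ (j + k) = 1 := by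
      rw [← mul_pow, div_mul_div_cancel₀ n1, div_self n0, one_pow]
    have m1 : (c₂ / c₀) ^ N ≠ 0 := by positivity
    generalize (c₀ / c₁) ^ (j + k) = u at *
    generalize (c₁ / c₀) ^ (j + k) = v at *
    generalize (c₂ / c₀) ^ N = w at *
    have ht := div_mul_cancel₀ (v * v) m1
    generalize v * v / w = t at *
    linear_combination v * h2 - (Omega r s₁ s₄ s₀ (j + k) j * Omega r s₀ s₃ s₂ N i *
      Omega r s₃ s₂ s₁ (i + k) 0 * qPoch (c₁ * c₂ * q ^ 2) q N *
      (xi r s₂ s₃ i ^ 2 * xi r s₀ s₄ j ^ 2 *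
        ((c₁ / c₀) ^ i * (c₃ / c₁) ^ j * (s₀ / s₃) ^ N))) * (v * e + u * ht)
  · rw [i4, i5]
    have m1 : (c₁ / c₂) ^ m ≠ 0 := by positivity
    generalize (c₁ / c₂) ^ m = w at *
    generalize (c₀ / c₂) ^ N = u at *
    have ht := div_mul_cancel₀ u m1
    generalize u / w = t at *
    linear_combination u * h3 - (Omega r s₂ s₄ s₁ m 0 * Omega r s₄ s₀ s₃ N y *
      qPoch (c₁ * c₄ * q ^ 2) q N * ((c₂ / c₄) ^ y * (s₃ / s₀) ^ N * (s₂ / s₄) ^ m)) * ht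
  · have e : omega r (s₄ * s₀ * s₂ / s₁) x = (c₀ / c₁) ^ x * omega r (s₂ * s₄ * s₁ / s₀) x := by
      rw [← omega_mul_left, ← h.h0, ← h.h1]; congr 1; field_simp
    rw [e, ← h.h0, ← h.h1]
    simp only [div_pow]
    field_simp
    ring
  · have e : omega r (s₀ * s₂ * s₃ / s₁) y = (c₂ / c₁) ^ y * omega r (s₁ * s₃ * s₀ / s₂) y := by
      rw [← omega_mul_left, ← h.h2, ← h.h1]; congr 1; field_simp
    rw [e]
    have e' : (c₁ / c₀) ^ (j + k) = (c₁ / c₀) ^ N / (c₁ / c₀) ^ i := by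
      rw [eq_div_iff (by positivity), ← pow_add, hk]; congr 1; omega
    rw [e', hm, ← h.h0, ← h.h1, ← h.h2, ← h.h3, ← h.h4]
    simp only [div_pow, pow_add]
    generalize omega r (s₁ * s₃ * s₀ / s₂) y = w
    field_simp
    ring

theorem griffiths_exchange' (h : RootFive r s₀ s₁ s₂ s₃ s₄ q c₀ c₁ c₂ c₃ c₄ N) {i j x y : ℕ}
    (hij : i + j ≤ N) :
    griffiths r s₁ s₂ s₃ s₄ N i j x y = exchangeConst' r s₀ s₁ s₂ s₃ s₄ N i j x y *
      griffiths r⁻¹ s₁⁻¹ s₄⁻¹ s₀⁻¹ s₂⁻¹ N j i x y := by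
  rcases lt_or_ge N (x + y) with hxy | hxy
  · rw [griffiths_eq_zero _ _ _ _ _ hxy, griffiths_eq_zero _ _ _ _ _ hxy, mul_zero]
  · have d1 := h.griffiths_dual hij hxy
    have e := h.swap₃₄.griffiths_exchange (x := i) (y := j) hxy
    have d2 := h.swap₃₄.exchange'.inv.griffiths_dual (i := x) (j := y) (x := j) (y := i) hxy
      (by omega)
    have c := h.exchangeConst'_eq hij hxy
    have m1 := h.swap₃₄.griffithsWeight_zero_ne_zero (j := y) (y := j) (by omega)
    have m2 := h.swap₃₄.exchange'.inv.swap₃₄.griffithsWeight_zero_ne_zero (j := i) (y := y) (by omega)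
    have m3 := Omega_ne_zero h.hq h.triple₁₂₄ h.hr h.h1 h.h2 h.h4 (show x ≤ N - y by omega)
    have m4 := Omega_ne_zero h.inv.hq h.inv.triple₀₁₄.swap₁₂.swap₂₃ h.inv.hr h.inv.h1 h.inv.h4
      h.inv.h0 (show j ≤ N - i by omega)
    refine mul_right_cancel₀ (mul_ne_zero (mul_ne_zero m3 m1) (mul_ne_zero m4 m2)) ?_
    rw [← mul_assoc (griffiths r s₁ s₂ s₃ s₄ N i j x y), d1, e]
    linear_combination (Omega r s₁ s₂ s₃ (N - j) i * griffithsWeight r s₀ s₁ s₂ s₃ s₄ N j y 0 *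
      exchangeConst r s₀ s₁ s₂ s₄ s₃ N x y i j) * d2 +
      griffiths r⁻¹ s₁⁻¹ s₄⁻¹ s₀⁻¹ s₂⁻¹ N j i x y * c

end RootFive

section continuity
open Filter Topology
variable {X : Type*} [TopologicalSpace X] {p : X}

theorem qPoch_ne_zero {a q : ℂ} {n : ℕ} (h : ∀ l < n, a * q ^ l ≠ 1) : qPoch a q n ≠ 0 :=
  Finset.prod_ne_zero_iff.mpr fun l hl => sub_ne_zero.mpr (h l (Finset.mem_range.mp hl)).symm

theorem continuousAt_qPoch {a q : X → ℂ} (ha : ContinuousAt a p) (hq : ContinuousAt q p) (n : ℕ) :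
    ContinuousAt (fun u => qPoch (a u) (q u) n) p :=
  tendsto_finsetProd _ fun l _ => (continuousAt_const.sub (ha.mul (hq.pow l)))

theorem continuousAt_qPochOmit {c q : X → ℂ} (hc : ContinuousAt c p) (hq : ContinuousAt q p)
    (N n : ℕ) : ContinuousAt (fun u => qPochOmit (c u) (q u) N n) p :=
  tendsto_finsetProd _ fun _ _ => (continuousAt_const.sub (hc.mul (hq.pow _)))

theorem continuousAt_omega {r t : X → ℂ} (hr : ContinuousAt r p) (ht : ContinuousAt t p) (n : ℕ) :
    ContinuousAt (fun u => omega (r u) (t u) n) p := by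
  unfold omega
  fun_prop

theorem continuousAt_xi {r s t : X → ℂ} (hr : ContinuousAt r p) (hs : ContinuousAt s p)
    (ht : ContinuousAt t p) {n : ℕ} (hs0 : s p ≠ 0)
    (h : ∀ m, 1 ≤ m → m ≤ n → t p ^ 2 * (r p ^ 2) ^ m ≠ 1) :
    ContinuousAt (fun u => xi (r u) (s u) (t u) n) p := by
  unfold xi
  refine ((continuousAt_qPoch (by fun_prop) (by fun_prop) n).div
    (continuousAt_qPoch (by fun_prop) (by fun_prop) n) (qPoch_ne_zero fun l hl => ?_)).mul
    ((ht.div hs hs0).pow n)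
  have := h (l + 1) (by omega) (by omega)
  convert this using 1
  ring

/-- Conditions under which the normalized `q`-Racah polynomials with parameters `a`, `b`, `c` and
degree parameter at most `N` have no poles. -/
structure RacahRegular (q a b c : ℂ) (N : ℕ) : Prop where
  q_ne : q ≠ 0
  b_ne : b ≠ 0
  pow : ∀ m, 1 ≤ m → m ≤ N → q ^ m ≠ 1
  b_pow : ∀ m, 1 ≤ m → m ≤ N → b * q ^ m ≠ 1
  c_pow : ∀ m, 1 ≤ m → m ≤ N → c * q ^ m ≠ 1
  bc_pow : ∀ m, 2 ≤ m → m ≤ 2 * N → b * c * q ^ m ≠ 1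
  abc_pow : ∀ m, 2 ≤ m → m ≤ 2 * N → a * b * c * q ^ (m + 1) ≠ 1

theorem continuousAt_racah {r a b c : X → ℂ} (hr : ContinuousAt r p) (ha : ContinuousAt a p)
    (hb : ContinuousAt b p) (hc : ContinuousAt c p) {N : ℕ}
    (h : RacahRegular (r p ^ 2) (a p ^ 2) (b p ^ 2) (c p ^ 2) N) {L : ℕ} (hL : L ≤ N) (n x : ℕ) :
    ContinuousAt (fun u => racah (r u) (a u) (b u) (c u) L n x) p := by
  unfold racah
  split_ifs with hnx
  swap
  · exact continuousAt_const
  obtain ⟨hn, hx⟩ := hnx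
  have hq0 := h.q_ne
  have hr0 : r p ≠ 0 := by intro h0; simp [h0] at hq0
  have hb0 : b p ≠ 0 := by intro h0; have := h.b_ne; simp [h0] at this
  have hqq : ∀ k ≤ L, qPoch (r p ^ 2) (r p ^ 2) k ≠ 0 := fun k hk =>
    qPoch_ne_zero fun l hl => by
      rw [← pow_succ']; exact h.pow (l + 1) (by omega) (by omega)
  have hqb : ∀ k ≤ L, qPoch (r p ^ 2 * b p ^ 2) (r p ^ 2) k ≠ 0 := fun k hk =>
    qPoch_ne_zero fun l hl => by
      convert h.b_pow (l + 1) (by omega) (by omega) using 1; ring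
  refine ContinuousAt.mul ?_ ?_
  · unfold Omega
    refine ContinuousAt.div (ContinuousAt.mul ?_ (((continuousAt_qPoch (by fun_prop)
      (by fun_prop) n).mul (continuousAt_qPoch (by fun_prop) (by fun_prop) n)).mul
      (continuousAt_qPoch (by fun_prop) (by fun_prop) _)))
      ((ContinuousAt.mul ?_ (continuousAt_qPochOmit (by fun_prop) (by fun_prop) L n)).mul
        (continuousAt_qPoch (by fun_prop) (by fun_prop) n)) ?_
    · simp only [qBinom, if_pos hn]
      exact (continuousAt_qPoch (by fun_prop) (by fun_prop) L).div
        ((continuousAt_qPoch (by fun_prop) (by fun_prop) n).mul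
          (continuousAt_qPoch (by fun_prop) (by fun_prop) _))
        (mul_ne_zero (hqq n hn) (hqq _ (by omega)))
    · exact (hr.mul hb).zpow₀ _ (Or.inl (mul_ne_zero hr0 hb0))
    · refine mul_ne_zero (mul_ne_zero (zpow_ne_zero _ (mul_ne_zero hr0 hb0)) ?_) ?_
      · refine Finset.prod_ne_zero_iff.mpr fun l hl => sub_ne_zero.mpr (Ne.symm ?_)
        rw [Finset.mem_erase, Finset.mem_range] at hl
        exact h.bc_pow _ (by omega) (by omega)
      · refine qPoch_ne_zero fun l hl => ?_
        convert h.c_pow (l + 1) (by omega) (by omega) using 1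
        ring
  · unfold phi43
    have hz : ∀ k : ℕ, ContinuousAt (fun u => (r u ^ 2) ^ (-(k : ℤ))) p := fun k =>
      (hr.pow 2).zpow₀ _ (Or.inl hq0)
    refine tendsto_finsetSum _ fun k hk => ?_
    have hk' : k ≤ n := by rw [Finset.mem_range] at hk; omega
    refine ContinuousAt.mul (ContinuousAt.div ((((continuousAt_qPoch (hz n) (by fun_prop) k).mul
      (continuousAt_qPoch (by fun_prop) (by fun_prop) k)).mul
      (continuousAt_qPoch (hz x) (by fun_prop) k)).mul
      (continuousAt_qPoch (by fun_prop) (by fun_prop) k))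
      (((continuousAt_qPoch (by fun_prop) (by fun_prop) k).mul
      (continuousAt_qPoch (by fun_prop) (by fun_prop) k)).mul
      (continuousAt_qPoch (hz L) (by fun_prop) k)) ?_)
      (ContinuousAt.div (by fun_prop) (continuousAt_qPoch (by fun_prop) (by fun_prop) k)
        (hqq k (by omega)))
    refine mul_ne_zero (mul_ne_zero (hqb k (by omega)) ?_) ?_
    · refine qPoch_ne_zero fun l hl => ?_
      convert h.abc_pow (L + 1 + l) (by omega) (by omega) using 1
      ring
    · refine qPoch_ne_zero fun l hl => ?_
      have := h.pow (L - l) (by omega) (by omega)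
      intro h1
      apply this
      rw [zpow_neg, zpow_natCast] at h1
      have e : (r p ^ 2) ^ L = (r p ^ 2) ^ (L - l) * (r p ^ 2) ^ l := by
        rw [← pow_add]; congr 1; omega
      rw [e] at h1
      have h2 := pow_ne_zero l hq0
      have h3 := pow_ne_zero (L - l) hq0
      field_simp at h1
      exact h1.symm

theorem AvoidsOne.mul_pow_ne_one {q c : ℂ} {N : ℕ} (h : AvoidsOne q N c) (m : ℕ)
    (h1 : 1 ≤ m) (hm : m ≤ N) : c * q ^ m ≠ 1 := by
  intro e
  refine h m h1 hm ?_
  rw [zpow_neg, zpow_natCast]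
  exact eq_inv_of_mul_eq_one_left e

theorem AvoidsTwo.mul_pow_ne_one {q c : ℂ} {N : ℕ} (h : AvoidsTwo q N c) (m : ℕ)
    (h1 : 2 ≤ m) (hm : m ≤ 2 * N) : c * q ^ m ≠ 1 := by
  intro e
  refine h m h1 hm ?_
  rw [zpow_neg, zpow_natCast]
  exact eq_inv_of_mul_eq_one_left e

theorem continuousAt_griffiths {r s₀ s₁ s₂ s₃ s₄ : X → ℂ} {N : ℕ} (hr : ContinuousAt r p)
    (h₁ : ContinuousAt s₁ p) (h₂ : ContinuousAt s₂ p) (h₃ : ContinuousAt s₃ p)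
    (h₄ : ContinuousAt s₄ p) (hroot : r p ^ (2 * N + 3) * (s₀ p * s₁ p * s₂ p * s₃ p * s₄ p) = 1)
    (hadm : Admissible (r p ^ 2) (s₀ p ^ 2) (s₁ p ^ 2) (s₂ p ^ 2) (s₃ p ^ 2) (s₄ p ^ 2) N)
    (i j x y : ℕ) :
    ContinuousAt (fun u => griffiths (r u) (s₁ u) (s₂ u) (s₃ u) (s₄ u) N i j x y) p := by
  obtain ⟨-, hq0, ⟨n0, n1, n2, n3, n4⟩, hpow, ⟨p12, p23, p03, p04, p24⟩, ⟨t123, t034, t124⟩,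
    ⟨a0, a1, a2, a3, a4⟩⟩ := hadm
  have e0 : rootC0 (r p) (s₁ p) (s₂ p) (s₃ p) (s₄ p) N = s₀ p := by
    rw [rootC0, eq_comm]
    exact eq_inv_of_mul_eq_one_left (by rw [← hroot]; ring)
  have hr0 : r p ≠ 0 := by intro h0; simp [h0] at hq0
  have m1 : s₁ p ≠ 0 := by intro h0; simp [h0] at n1
  have m2 : s₂ p ≠ 0 := by intro h0; simp [h0] at n2
  have m3 : s₃ p ≠ 0 := by intro h0; simp [h0] at n3
  have m4 : s₄ p ≠ 0 := by intro h0; simp [h0] at n4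
  have hc0 : ContinuousAt (fun u => rootC0 (r u) (s₁ u) (s₂ u) (s₃ u) (s₄ u) N) p := by
    unfold rootC0
    exact ContinuousAt.inv₀ (by fun_prop) (by positivity)
  unfold griffiths
  refine tendsto_finsetSum _ fun a _ => ?_
  refine ContinuousAt.mul (ContinuousAt.mul (ContinuousAt.mul (continuousAt_omega hr
    (((h₁.mul h₂).mul h₃).div h₄ m4) a) (continuousAt_racah hr h₁ h₂ h₃ (N := N) ?_ (by omega) _ _))
    (continuousAt_racah hr h₃ hc0 h₄ (N := N) ?_ (by omega) _ _))
    (continuousAt_racah hr h₄ h₂ h₁ (N := N) ?_ (by omega) _ _)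
  · refine ⟨hq0, n2, hpow, a2.mul_pow_ne_one, a3.mul_pow_ne_one, p23.mul_pow_ne_one,
      fun m h hm => ?_⟩
    convert t123.mul_pow_ne_one m h hm using 1; ring
  · simp only [e0]
    refine ⟨hq0, n0, hpow, a0.mul_pow_ne_one, a4.mul_pow_ne_one, p04.mul_pow_ne_one,
      fun m h hm => ?_⟩
    convert t034.mul_pow_ne_one m h hm using 1; ring
  · refine ⟨hq0, n2, hpow, a2.mul_pow_ne_one, a1.mul_pow_ne_one, fun m h hm => ?_,
      fun m h hm => ?_⟩
    · convert p12.mul_pow_ne_one m h hm using 1; ring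
    · convert t124.mul_pow_ne_one m h hm using 1; ring

end continuity

section deformation
open Filter Topology

instance : CountableInterFilter (cocountable : Filter ℂ) :=
  CardinalInterFilter.toCountableInterFilter _ Cardinal.aleph0_lt_aleph_one

theorem eventually_cocountable_mul_zpow_ne_one (z : ℂ) {k : ℤ} (hk : k ≠ 0) :
    ∀ᶠ u in cocountable, z * u ^ k ≠ 1 := by
  have hn : 0 < k.natAbs := Int.natAbs_pos.mpr hk
  have hfin : ∀ a : ℂ, {u : ℂ | u ^ k.natAbs = a}.Countable := fun a => by
    refine ((Polynomial.nthRoots k.natAbs a).toFinset.finite_toSet.countable).mono fun u hu => ?_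
    simpa [Polynomial.mem_nthRoots hn] using hu
  rw [Filter.Eventually, mem_cocountable]
  refine ((hfin z).union (hfin z⁻¹)).mono fun u hu => ?_
  have hu' : z * u ^ k = 1 := by simpa using hu
  have h1 : u ^ k = z⁻¹ := eq_inv_of_mul_eq_one_right hu'
  rcases Int.natAbs_eq k with h | h
  · right
    rw [h, zpow_natCast] at h1
    exact h1
  · left
    rw [h, zpow_neg, zpow_natCast] at h1
    exact inv_injective h1

theorem frequently_nhds_of_eventually_cocountable {P : ℂ → Prop}
    (h : ∀ᶠ u in cocountable, P u) (a : ℂ) : ∃ᶠ u in 𝓝 a, P u := by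
  have hd : Dense {u | P u}ᶜᶜ := Set.Countable.dense_compl ℝ (mem_cocountable.mp h)
  rw [compl_compl] at hd
  exact mem_closure_iff_frequently.mp (hd a)

theorem eventually_cocountable_generic (z w : ℂ) {e : ℤ} (he : ∀ m : ℤ, e + 10 * m ≠ 0) :
    ∀ᶠ u in cocountable, Generic (w * u ^ (10 : ℤ)) (z * u ^ e) := by
  have h0 : ∀ᶠ u in cocountable, u ≠ (0 : ℂ) := by
    rw [Filter.Eventually, mem_cocountable]
    refine (Set.countable_singleton (0 : ℂ)).mono fun u hu => ?_
    simpa using hu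
  have h1 : ∀ᶠ u in cocountable, ∀ m : ℤ, (z * w ^ m) * u ^ (e + 10 * m) ≠ 1 :=
    eventually_countable_forall.mpr fun m => eventually_cocountable_mul_zpow_ne_one _ (he m)
  filter_upwards [h0, h1] with u hu hm m
  convert hm m using 1
  rw [mul_zpow, ← zpow_mul, zpow_add₀ hu]
  ring

/-- A deformation of the parameters which preserves the relation between the roots and is generic
for all but countably many values of `u`. -/
theorem eventually_cocountable_rootFive {r s₀ s₁ s₂ s₃ s₄ : ℂ} {N : ℕ}
    (hr : r ≠ 0) (h0 : s₀ ≠ 0) (h1 : s₁ ≠ 0) (h2 : s₂ ≠ 0) (h3 : s₃ ≠ 0) (h4 : s₄ ≠ 0)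
    (hroot : r ^ (2 * N + 3) * (s₀ * s₁ * s₂ * s₃ * s₄) = 1) :
    ∀ᶠ u in cocountable, RootFive (r * u ^ 5) (s₀ * (u ^ (10 * N + 19))⁻¹) (s₁ * u) (s₂ * u)
      (s₃ * u) (s₄ * u) ((r * u ^ 5) ^ 2) ((s₀ * (u ^ (10 * N + 19))⁻¹) ^ 2) ((s₁ * u) ^ 2)
      ((s₂ * u) ^ 2) ((s₃ * u) ^ 2) ((s₄ * u) ^ 2) N := by
  have hne : ∀ᶠ u in cocountable, u ≠ (0 : ℂ) := by
    rw [Filter.Eventually, mem_cocountable]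
    refine (Set.countable_singleton (0 : ℂ)).mono fun u hu => ?_
    simpa using hu
  have hq : ∀ᶠ u in cocountable, ∀ m : ℕ, 1 ≤ m → (r ^ 2) ^ m * u ^ (10 * (m : ℤ)) ≠ 1 := by
    refine eventually_countable_forall.mpr fun m => ?_
    rcases Nat.eq_zero_or_pos m with rfl | hm
    · simp
    · filter_upwards [eventually_cocountable_mul_zpow_ne_one ((r ^ 2) ^ m)
        (k := 10 * (m : ℤ)) (by omega)] with u hu _ using hu
  have hs : ∀ z : ℂ, ∀ᶠ u in cocountable, Generic (r ^ 2 * u ^ (10 : ℤ)) (z * u ^ (2 : ℤ)) :=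
    fun z => eventually_cocountable_generic z _ fun m => by omega
  have hp : ∀ z : ℂ, ∀ᶠ u in cocountable, Generic (r ^ 2 * u ^ (10 : ℤ)) (z * u ^ (4 : ℤ)) :=
    fun z => eventually_cocountable_generic z _ fun m => by omega
  have hs0 : ∀ z : ℂ, ∀ᶠ u in cocountable,
      Generic (r ^ 2 * u ^ (10 : ℤ)) (z * u ^ (-(20 * N + 38) : ℤ)) :=
    fun z => eventually_cocountable_generic z _ fun m => by omega
  have hp0 : ∀ z : ℂ, ∀ᶠ u in cocountable,
      Generic (r ^ 2 * u ^ (10 : ℤ)) (z * u ^ (-(20 * N + 36) : ℤ)) :=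
    fun z => eventually_cocountable_generic z _ fun m => by omega
  filter_upwards [hne, hq, hs0 (s₀ ^ 2), hs (s₁ ^ 2), hs (s₂ ^ 2), hs (s₃ ^ 2), hs (s₄ ^ 2),
    hp0 (s₀ ^ 2 * s₁ ^ 2), hp0 (s₀ ^ 2 * s₂ ^ 2), hp0 (s₀ ^ 2 * s₃ ^ 2), hp0 (s₀ ^ 2 * s₄ ^ 2),
    hp (s₁ ^ 2 * s₂ ^ 2), hp (s₁ ^ 2 * s₃ ^ 2), hp (s₁ ^ 2 * s₄ ^ 2), hp (s₂ ^ 2 * s₃ ^ 2),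
    hp (s₂ ^ 2 * s₄ ^ 2), hp (s₃ ^ 2 * s₄ ^ 2)]
    with u hu hqu g0 g1 g2 g3 g4 g01 g02 g03 g04 g12 g13 g14 g23 g24 g34
  have eq : r ^ 2 * u ^ (10 : ℤ) = (r * u ^ 5) ^ 2 := by norm_cast; ring
  have e2 : ∀ s : ℂ, s ^ 2 * u ^ (2 : ℤ) = (s * u) ^ 2 := fun s => by norm_cast; ring
  have e4 : ∀ s t : ℂ, s ^ 2 * t ^ 2 * u ^ (4 : ℤ) = (s * u) ^ 2 * (t * u) ^ 2 := fun s t => by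
    norm_cast; ring
  have e0 : s₀ ^ 2 * u ^ (-(20 * N + 38) : ℤ) = (s₀ * (u ^ (10 * N + 19))⁻¹) ^ 2 := by
    rw [show (20 * (N : ℤ) + 38) = (((10 * N + 19) * 2 : ℕ) : ℤ) by push_cast; ring, zpow_neg,
      zpow_natCast, pow_mul, mul_pow, inv_pow]
  have e0' : ∀ t : ℂ, s₀ ^ 2 * t ^ 2 * u ^ (-(20 * N + 36) : ℤ) =
      (s₀ * (u ^ (10 * N + 19))⁻¹) ^ 2 * (t * u) ^ 2 := fun t => by
    rw [← e0, show (-(20 * N + 36) : ℤ) = -(20 * N + 38) + 2 by ring, zpow_add₀ hu, ← e2]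
    generalize u ^ (-(20 * (N : ℤ) + 38)) = U
    ring
  simp only [eq] at g0 g1 g2 g3 g4 g01 g02 g03 g04 g12 g13 g14 g23 g24 g34
  simp only [e2] at g1 g2 g3 g4
  simp only [e4] at g12 g13 g14 g23 g24 g34
  simp only [e0'] at g01 g02 g03 g04
  rw [e0] at g0
  have hrt : (r * u ^ 5) ^ (2 * N + 3) * (s₀ * (u ^ (10 * N + 19))⁻¹ * (s₁ * u) * (s₂ * u) *
      (s₃ * u) * (s₄ * u)) = 1 := by
    rw [← hroot, mul_pow, ← pow_mul,
      show 10 * N + 19 = 5 * (2 * N + 3) + 4 by ring, pow_add u]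
    have hU : u ^ (5 * (2 * N + 3)) ≠ 0 := pow_ne_zero _ hu
    generalize u ^ (5 * (2 * N + 3)) = U at hU ⊢
    field_simp
  exact
    { hq := ⟨by positivity, fun m hm => by
        have := hqu m hm
        convert this using 1
        rw [show (10 * (m : ℤ)) = ((10 * m : ℕ) : ℤ) by push_cast; ring, zpow_natCast]
        ring⟩
      bal := by
        have := congrArg (· ^ 2) hrt
        simp only [one_pow] at this
        rw [← this]
        ring
      n0 := by positivity
      n1 := by positivity
      n2 := by positivity
      n3 := by positivity
      n4 := by positivity
      g0 := g0
      g1 := g1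
      g2 := g2
      g3 := g3
      g4 := g4
      g01 := g01
      g02 := g02
      g03 := g03
      g04 := g04
      g12 := g12
      g13 := g13
      g14 := g14
      g23 := g23
      g24 := g24
      g34 := g34
      hr := rfl
      h0 := rfl
      h1 := rfl
      h2 := rfl
      h3 := rfl
      h4 := rfl
      root := hrt }

end deformation

section limit
open Filter Topology

section
variable {X : Type*} [TopologicalSpace X] {p : X}

theorem xi_ne_zero_of_mul_pow_ne_one {r s t : ℂ} {n : ℕ} (hs0 : s ≠ 0) (ht0 : t ≠ 0)
    (hs : ∀ m, 1 ≤ m → m ≤ n → s ^ 2 * (r ^ 2) ^ m ≠ 1)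
    (ht : ∀ m, 1 ≤ m → m ≤ n → t ^ 2 * (r ^ 2) ^ m ≠ 1) : xi r s t n ≠ 0 := by
  unfold xi
  refine mul_ne_zero (div_ne_zero (qPoch_ne_zero fun l hl => ?_) (qPoch_ne_zero fun l hl => ?_))
    (pow_ne_zero _ (div_ne_zero ht0 hs0))
  · convert hs (l + 1) (by omega) (by omega) using 1
    ring
  · convert ht (l + 1) (by omega) (by omega) using 1
    ring

theorem continuousAt_exchangeConst_xi {r s₀ s₁ s₂ s₃ s₄ : X → ℂ} {N : ℕ} (hr : ContinuousAt r p)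
    (h₀ : ContinuousAt s₀ p) (h₁ : ContinuousAt s₁ p) (h₂ : ContinuousAt s₂ p)
    (h₃ : ContinuousAt s₃ p) (h₄ : ContinuousAt s₄ p)
    (hadm : Admissible (r p ^ 2) (s₀ p ^ 2) (s₁ p ^ 2) (s₂ p ^ 2) (s₃ p ^ 2) (s₄ p ^ 2) N)
    {i j x y : ℕ} (hi : i ≤ N) (hj : j ≤ N) (hx : x ≤ N) (hy : y ≤ N) :
    ContinuousAt (fun u => (s₀ u / s₁ u) ^ i * (s₃ u / s₁ u) ^ j * (s₁ u / s₀ u) ^ x *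
      (s₁ u / s₄ u) ^ y * (xi (r u) (s₂ u) (s₃ u) i * xi (r u) (s₀ u) (s₄ u) j /
        (xi (r u) (s₂ u) (s₄ u) x * xi (r u) (s₀ u) (s₃ u) y))) p := by
  obtain ⟨-, hq0, ⟨n0, n1, n2, n3, n4⟩, -, -, -, ⟨a0, a1, a2, a3, a4⟩⟩ := hadm
  have m0 : s₀ p ≠ 0 := by intro h0; simp [h0] at n0
  have m1 : s₁ p ≠ 0 := by intro h0; simp [h0] at n1
  have m2 : s₂ p ≠ 0 := by intro h0; simp [h0] at n2
  have m3 : s₃ p ≠ 0 := by intro h0; simp [h0] at n3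
  have m4 : s₄ p ≠ 0 := by intro h0; simp [h0] at n4
  have le : ∀ {c : ℂ} {n : ℕ}, AvoidsOne (r p ^ 2) N c → n ≤ N →
      ∀ m, 1 ≤ m → m ≤ n → c * (r p ^ 2) ^ m ≠ 1 :=
    fun ha hn m h1 hm => ha.mul_pow_ne_one m h1 (hm.trans hn)
  refine ContinuousAt.mul (((((h₀.div h₁ m1).pow i).mul ((h₃.div h₁ m1).pow j)).mul
    ((h₁.div h₀ m0).pow x)).mul ((h₁.div h₄ m4).pow y)) (ContinuousAt.div
    ((continuousAt_xi hr h₂ h₃ m2 (le a3 hi)).mul (continuousAt_xi hr h₀ h₄ m0 (le a4 hj)))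
    ((continuousAt_xi hr h₂ h₄ m2 (le a4 hx)).mul (continuousAt_xi hr h₀ h₃ m0 (le a3 hy)))
    (mul_ne_zero (xi_ne_zero_of_mul_pow_ne_one m2 m4 (le a2 hx) (le a4 hx))
      (xi_ne_zero_of_mul_pow_ne_one m0 m3 (le a0 hy) (le a3 hy))))

end

theorem continuousAt_deformation {s : ℂ} (k : ℕ) :
    ContinuousAt (fun u : ℂ => s * (u ^ k)⁻¹) 1 :=
  continuousAt_const.mul ((continuousAt_id.pow k).inv₀ (by simp))

theorem griffiths_exchange_of_admissible {r s₀ s₁ s₂ s₃ s₄ : ℂ} {N : ℕ}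
    (hroot : r ^ (2 * N + 3) * (s₀ * s₁ * s₂ * s₃ * s₄) = 1)
    (hadm : Admissible (r ^ 2) (s₀ ^ 2) (s₁ ^ 2) (s₂ ^ 2) (s₃ ^ 2) (s₄ ^ 2) N)
    (hadm' : Admissible (r⁻¹ ^ 2) (s₄⁻¹ ^ 2) (s₁⁻¹ ^ 2) (s₃⁻¹ ^ 2) (s₂⁻¹ ^ 2) (s₀⁻¹ ^ 2) N)
    {i j x y : ℕ} (hij : i + j ≤ N) :
    griffiths r s₁ s₂ s₃ s₄ N i j x y =
      exchangeConst r s₀ s₁ s₂ s₃ s₄ N i j x y *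
        griffiths r⁻¹ s₁⁻¹ s₃⁻¹ s₂⁻¹ s₀⁻¹ N i j y x := by
  rcases lt_or_ge N (x + y) with hxy | hxy
  · rw [griffiths_eq_zero _ _ _ _ _ hxy, griffiths_eq_zero _ _ _ _ _ (by omega), mul_zero]
  obtain ⟨hr0, m0, m1, m2, m3, m4⟩ :
      r ≠ 0 ∧ s₀ ≠ 0 ∧ s₁ ≠ 0 ∧ s₂ ≠ 0 ∧ s₃ ≠ 0 ∧ s₄ ≠ 0 := by
    refine ⟨?_, ?_, ?_, ?_, ?_, ?_⟩ <;> rintro rfl <;> simp at hroot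
  have hfreq := frequently_nhds_of_eventually_cocountable
    (eventually_cocountable_rootFive hr0 m0 m1 m2 m3 m4 hroot) 1
  have cr : ContinuousAt (fun u : ℂ => r * u ^ 5) 1 := by fun_prop
  have c0 := continuousAt_deformation (s := s₀) (10 * N + 19)
  have c1 : ContinuousAt (fun u : ℂ => s₁ * u) 1 := by fun_prop
  have c2 : ContinuousAt (fun u : ℂ => s₂ * u) 1 := by fun_prop
  have c3 : ContinuousAt (fun u : ℂ => s₃ * u) 1 := by fun_prop
  have c4 : ContinuousAt (fun u : ℂ => s₄ * u) 1 := by fun_prop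
  have cr' : ContinuousAt (fun u : ℂ => (r * u ^ 5)⁻¹) 1 := cr.inv₀ (by simpa using hr0)
  have c0' : ContinuousAt (fun u : ℂ => (s₀ * (u ^ (10 * N + 19))⁻¹)⁻¹) 1 :=
    c0.inv₀ (by simpa using m0)
  have c1' : ContinuousAt (fun u : ℂ => (s₁ * u)⁻¹) 1 := c1.inv₀ (by simpa using m1)
  have c2' : ContinuousAt (fun u : ℂ => (s₂ * u)⁻¹) 1 := c2.inv₀ (by simpa using m2)
  have c3' : ContinuousAt (fun u : ℂ => (s₃ * u)⁻¹) 1 := c3.inv₀ (by simpa using m3)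
  have hL := continuousAt_griffiths (s₀ := fun u => s₀ * (u ^ (10 * N + 19))⁻¹) cr c1 c2 c3 c4
    (by simpa using hroot) (by simpa using hadm) i j x y
  have hR := continuousAt_griffiths (s₀ := fun u => (s₄ * u)⁻¹) cr' c1' c3' c2' c0' (N := N) (by
      have := congrArg (·⁻¹) hroot
      simp only [mul_one, one_pow, inv_one] at this ⊢
      rw [← this]
      simp only [mul_inv, inv_pow]
      ring) (by simpa using hadm') i j y x
  have hC := continuousAt_exchangeConst_xi (s₀ := fun u => s₀ * (u ^ (10 * N + 19))⁻¹)
    cr c0 c1 c2 c3 c4 (N := N) (by simpa using hadm) (i := i) (j := j) (x := x) (y := y)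
    (by omega) (by omega) (by omega) (by omega)
  have hE : ContinuousAt (fun u => exchangeConst (r * u ^ 5) (s₀ * (u ^ (10 * N + 19))⁻¹) (s₁ * u)
      (s₂ * u) (s₃ * u) (s₄ * u) N i j x y) 1 := by
    unfold exchangeConst
    refine (hC.mul (ContinuousAt.div
      (continuousAt_omega cr (((c0.mul c2).mul c4).div c1 (by simpa using m1)) j)
      (continuousAt_omega cr (((c3.mul c0).mul c2).div c1 (by simpa using m1)) i)
      (omega_ne_zero (by simpa using hr0) ?_ i))).mul
      (continuousAt_omega cr (((cr.mul c1).mul c2).mul c3) N)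
    simp [m0, m1, m2, m3]
  have key := tendsto_nhds_unique_of_frequently_eq hL (hE.mul hR)
    (hfreq.mono fun u hu => hu.griffiths_exchange hij)
  simpa using key

theorem griffiths_exchange'_of_admissible {r s₀ s₁ s₂ s₃ s₄ : ℂ} {N : ℕ}
    (hroot : r ^ (2 * N + 3) * (s₀ * s₁ * s₂ * s₃ * s₄) = 1)
    (hadm : Admissible (r ^ 2) (s₀ ^ 2) (s₁ ^ 2) (s₂ ^ 2) (s₃ ^ 2) (s₄ ^ 2) N)
    (hadm' : Admissible (r⁻¹ ^ 2) (s₃⁻¹ ^ 2) (s₁⁻¹ ^ 2) (s₄⁻¹ ^ 2) (s₀⁻¹ ^ 2) (s₂⁻¹ ^ 2) N)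
    {i j x y : ℕ} (hij : i + j ≤ N) :
    griffiths r s₁ s₂ s₃ s₄ N i j x y =
      exchangeConst' r s₀ s₁ s₂ s₃ s₄ N i j x y *
        griffiths r⁻¹ s₁⁻¹ s₄⁻¹ s₀⁻¹ s₂⁻¹ N j i x y := by
  rcases lt_or_ge N (x + y) with hxy | hxy
  · rw [griffiths_eq_zero _ _ _ _ _ hxy, griffiths_eq_zero _ _ _ _ _ hxy, mul_zero]
  obtain ⟨hr0, m0, m1, m2, m3, m4⟩ :
      r ≠ 0 ∧ s₀ ≠ 0 ∧ s₁ ≠ 0 ∧ s₂ ≠ 0 ∧ s₃ ≠ 0 ∧ s₄ ≠ 0 := by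
    refine ⟨?_, ?_, ?_, ?_, ?_, ?_⟩ <;> rintro rfl <;> simp at hroot
  have hfreq := frequently_nhds_of_eventually_cocountable
    (eventually_cocountable_rootFive hr0 m0 m1 m2 m3 m4 hroot) 1
  have cr : ContinuousAt (fun u : ℂ => r * u ^ 5) 1 := by fun_prop
  have c0 := continuousAt_deformation (s := s₀) (10 * N + 19)
  have c1 : ContinuousAt (fun u : ℂ => s₁ * u) 1 := by fun_prop
  have c2 : ContinuousAt (fun u : ℂ => s₂ * u) 1 := by fun_prop
  have c3 : ContinuousAt (fun u : ℂ => s₃ * u) 1 := by fun_prop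
  have c4 : ContinuousAt (fun u : ℂ => s₄ * u) 1 := by fun_prop
  have cr' : ContinuousAt (fun u : ℂ => (r * u ^ 5)⁻¹) 1 := cr.inv₀ (by simpa using hr0)
  have c0' : ContinuousAt (fun u : ℂ => (s₀ * (u ^ (10 * N + 19))⁻¹)⁻¹) 1 :=
    c0.inv₀ (by simpa using m0)
  have c1' : ContinuousAt (fun u : ℂ => (s₁ * u)⁻¹) 1 := c1.inv₀ (by simpa using m1)
  have c2' : ContinuousAt (fun u : ℂ => (s₂ * u)⁻¹) 1 := c2.inv₀ (by simpa using m2)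
  have c4' : ContinuousAt (fun u : ℂ => (s₄ * u)⁻¹) 1 := c4.inv₀ (by simpa using m4)
  have hL := continuousAt_griffiths (s₀ := fun u => s₀ * (u ^ (10 * N + 19))⁻¹) cr c1 c2 c3 c4
    (by simpa using hroot) (by simpa using hadm) i j x y
  have hR := continuousAt_griffiths (s₀ := fun u => (s₃ * u)⁻¹) cr' c1' c4' c0' c2' (N := N) (by
      have := congrArg (·⁻¹) hroot
      simp only [mul_one, one_pow, inv_one] at this ⊢
      rw [← this]
      simp only [mul_inv, inv_pow]
      ring) (by simpa using hadm') j i x y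
  have hC := continuousAt_exchangeConst_xi (s₀ := fun u => s₀ * (u ^ (10 * N + 19))⁻¹)
    cr c0 c1 c2 c3 c4 (N := N) (by simpa using hadm) (i := i) (j := j) (x := x) (y := y)
    (by omega) (by omega) (by omega) (by omega)
  have hE : ContinuousAt (fun u => exchangeConst' (r * u ^ 5) (s₀ * (u ^ (10 * N + 19))⁻¹)
      (s₁ * u) (s₂ * u) (s₃ * u) (s₄ * u) N i j x y) 1 := by
    unfold exchangeConst'
    refine (hC.mul (ContinuousAt.div
      (continuousAt_omega cr (((c1.mul c3).mul c0).div c2 (by simpa using m2)) y)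
      (continuousAt_omega cr (((c2.mul c4).mul c1).div c0 (by simpa using m0)) x)
      (omega_ne_zero (by simpa using hr0) ?_ x))).mul
      (continuousAt_omega cr (((cr.mul c1).mul c2).mul c4) N)
    simp [m0, m1, m2, m4]
  have key := tendsto_nhds_unique_of_frequently_eq hL (hE.mul hR)
    (hfreq.mono fun u hu => hu.griffiths_exchange' hij)
  simpa using key

end limit

end QRacah

end

theorem mainTheorem2 (N : ℕ) (r s₀ s₁ s₂ s₃ s₄ : ℂ)
    (hroot : r ^ (2 * N + 3) * (s₀ * s₁ * s₂ * s₃ * s₄) = 1)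
    (hadm : QRacah.Admissible (r ^ 2) (s₀ ^ 2) (s₁ ^ 2) (s₂ ^ 2) (s₃ ^ 2) (s₄ ^ 2) N)
    (i j x y : ℕ) (hij : i + j ≤ N) :
    -- exchange of the two variables
    (QRacah.Admissible (r⁻¹ ^ 2) (s₄⁻¹ ^ 2) (s₁⁻¹ ^ 2) (s₃⁻¹ ^ 2) (s₂⁻¹ ^ 2) (s₀⁻¹ ^ 2) N →
      QRacah.griffiths r s₁ s₂ s₃ s₄ N i j x y =
        (s₀ / s₁) ^ i * (s₃ / s₁) ^ j * (s₁ / s₀) ^ x * (s₁ / s₄) ^ y *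
          (QRacah.xi r s₂ s₃ i * QRacah.xi r s₀ s₄ j /
            (QRacah.xi r s₂ s₄ x * QRacah.xi r s₀ s₃ y)) *
          (QRacah.omega r (s₀ * s₂ * s₄ / s₁) j / QRacah.omega r (s₃ * s₀ * s₂ / s₁) i) *
          QRacah.omega r (r * s₁ * s₂ * s₃) N *
          QRacah.griffiths r⁻¹ s₁⁻¹ s₃⁻¹ s₂⁻¹ s₀⁻¹ N i j y x) ∧
    -- exchange of the two indices
    (QRacah.Admissible (r⁻¹ ^ 2) (s₃⁻¹ ^ 2) (s₁⁻¹ ^ 2) (s₄⁻¹ ^ 2) (s₀⁻¹ ^ 2) (s₂⁻¹ ^ 2) N →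
      QRacah.griffiths r s₁ s₂ s₃ s₄ N i j x y =
        (s₀ / s₁) ^ i * (s₃ / s₁) ^ j * (s₁ / s₀) ^ x * (s₁ / s₄) ^ y *
          (QRacah.xi r s₂ s₃ i * QRacah.xi r s₀ s₄ j /
            (QRacah.xi r s₂ s₄ x * QRacah.xi r s₀ s₃ y)) *
          (QRacah.omega r (s₁ * s₃ * s₀ / s₂) y / QRacah.omega r (s₂ * s₄ * s₁ / s₀) x) *
          QRacah.omega r (r * s₁ * s₂ * s₄) N *
          QRacah.griffiths r⁻¹ s₁⁻¹ s₄⁻¹ s₀⁻¹ s₂⁻¹ N j i x y) := ⟨fun h => QRacah.griffiths_exchange_of_admissible hroot hadm h hij,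
    fun h => QRacah.griffiths_exchange'_of_admissible hroot hadm h hij⟩
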